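/- **Setting.** Let $G$ be a locally compact second countable Hausdorff group, $H$ a closed subgroup, $\Gamma$ a lattice in $G$ (a discrete subgroup such that $G/\Gamma$ carries a nonzero finite $G$-invariant measure), $X=H\backslash G$, $Y=G/\Gamma$, $\mathsf p_X(g)=Hg$. Let $\rho$ be a left Haar measure on $H$, and $m$ the left Haar measure on $G$ normalised so that the induced measure $\mu(A)=m(\mathsf p_Y^{-1}(A)\cap\mathcal F)$ on $Y$ ($\mathsf p_Y:G\to Y$ the projection, $\mathcal F$ a fundamental domain for the right action of $\Gamma$) has total mass $1$. Let $\mathsf s:X\to G$ be a measurable section of $\mathsf p_X$, bounded on compact sets, and $\xi$ the measure on $X$ with $\int_G f\,dm=\int_X\int_H f(h\,\mathsf s(x))\,d\rho(h)\,d\xi(x)$. Let $\{G_t\}_{t\ge t_0}$ be an increasing family of compact subsets of $G$, and put $H_t=H\cap G_t$, $H_t[g_1,g_2]=H\cap g_1G_tg_2^{-1}$, $$\pi_X(\lambda_t)\phi(x)=\frac1{\rho(H_t)}\sum_{\gamma\in\Gamma\cap G_t}\phi(x\gamma),\qquad \pi_X(\lambda^G_t)\phi(x)=\frac1{\rho(H_t)}\int_{G_t}\phi(xg)\,dm(g),$$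 $$\pi_Y(\beta_t^{g_1,g_2})F(y)=\frac1{\rho(H_t[g_1,g_2])}\int_{H_t[g_1,g_2]}F(h^{-1}y)\,d\rho(h).$$ For $l\in\mathbb Z_{\ge0}$, $L^q_l(D)$ denotes the Sobolev space of functions supported in the compact set $D$ whose distributional derivatives of order at most $l$ are in $L^q$, normed through a finite system of charts covering $D$ and a partition of unity (all choices give equivalent norms); $L^q_0(D)=L^q(D)$; $L^q_l(D)^+$ is the cone of its nonnegative elements. When $l>0$ we assume that $G$ is a connected Lie group and $H$ a closed Lie subgroup; $X$ and $Y$ carry their quotient smooth structures. **Conditions.** Let $1\le p<q\le\infty$, $r=pq/(q-p)$ ($r=p$ if $q=\infty$), $d,\kappa\in\mathbb R$. * (CA1) For every compact $\Omega\subset G$ there is $c>0$ with $\Omega G_t\Omega\subset G_{t+c}$ for all $t\ge t_0$. * (CA2) $\rho(H_t)>0$ for $t\ge t_0$, and $\sup_{t\ge t_0}\rho(H_{t+c})/\rho(H_t)<\infty$ for every $c>0$. * (HA1) There are a basis $\{O_\varepsilon\}_{\varepsilon\in(0,1]}$ of symmetric neighbourhoods of the identity in $G$, shrinking to the identity as $\varepsilon\to0$,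 and $c>0$ with $O_\varepsilon G_tO_\varepsilon\subset G_{t+c\varepsilon}$ for all $\varepsilon\in(0,1)$, $t\ge t_0$; for all small $\varepsilon$ there is a nonnegative $\chi_\varepsilon\in C^l_c(H)$, supported in $O_\varepsilon$ and in a compact subset of $H$ independent of $\varepsilon$, with $\int_H\chi_\varepsilon\,d\rho=1$ and $\|\chi_\varepsilon\|_{L^q_l(H)}\ll\varepsilon^{-\kappa}$; and every compact $\Omega\subset G$ is, for every $\varepsilon\in(0,1)$, covered by $n_\varepsilon\ll_\Omega\varepsilon^{-d}$ translates $v_iO_\varepsilon$. When $l>0$, $O_\varepsilon$ is the symmetric $\varepsilon$-neighbourhood of the identity for a fixed Riemannian metric on $G$. * (HA2$'$) with exponent $\theta>0$ on the compact set $\Omega\subset G$: there is $c>0$ such that for all $t\ge t_0$, $\varepsilon\in(0,1)$, $$\Big(\int_{\Omega\times\Omega}\big(\rho(H_{t+\varepsilon}[u,v])-\rho(H_t[u,v])\big)^r\,dm(u)\,dm(v)\Big)^{1/r}\le c\,\varepsilon^\theta\rho(H_t).$$ * (HS) Every $x\in X$ has a neighbourhood $U$ with a section $\sigma:U\to G$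 of $\mathsf p_X$ that is Lipschitz with respect to the $O_\varepsilon$: there is $L>0$ with $\sigma(yO_\varepsilon\cap U)\subset\sigma(y)O_{L\varepsilon}$ for all $y\in U$ and $\varepsilon\in(0,1]$ with $L\varepsilon\le1$. A function $E:\mathbb R\to[0,\infty)$ is called coarsely admissible if there is $c>0$ with $E(s)\le c\,E(t)$ for all $s,t\ge t_0$ with $|s-t|\le1$. **Theorem.** Assume (CA1), (CA2), (HA1) and (HS). Let $E$ be coarsely admissible with $E(t)\to0$ as $t\to\infty$, and assume the quantitative mean ergodic theorem for $\beta_t^{g_1,g_2}$ with error term $E$: for all compact $B\subset Y$ and $K\subset G$, all sufficiently large $t$, all $g_1,g_2\in K$ and all $F\in L^q_l(B)^+$, $$\Big\|\pi_Y(\beta_t^{g_1,g_2})F-\int_YF\,d\mu\Big\|_{L^p(B)}\ll_{p,q,l,B,K}E(t)\,\|F\|_{L^q_l(B)}.$$ If (HA2$'$) holds on every compact $\Omega\subset G$ with one exponent $\theta$ (the constant $c$ may depend on $\Omega$), then $\delta=\theta/(\theta+2d+l+\kappa)$ is positive and, for every compact $D\subset X$, all sufficiently large $t$ (depending on $D$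 but not on $\phi$) and all $\phi\in L^q_l(D)^+$, $$\big\|\pi_X(\lambda_t)\phi-\pi_X(\lambda^G_t)\phi\big\|_{L^p(D)}\ll_{p,q,l,D}E(t)^\delta\,\|\phi\|_{L^q_l(D)}.$$ In particular $\delta$ does not depend on $\phi$ and $D$. If $\theta$ in (HA2$'$) is allowed to depend on $\Omega$, then for every compact $D$ the same bound holds with some $\delta=\delta(D)>0$. -/

import Mathlib

open MeasureTheory Set Filter Topology
open scoped Pointwise ENNReal NNReal ContDiff Manifold Bundle

noncomputable section

/-! ### Sobolev spaces on `ℝᵏ` and on manifolds -/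

/-- The partial derivative `∂ᵢ ψ` of a function on `ℝᵏ`. -/
def partialDeriv {k : ℕ} (i : Fin k) (ψ : EuclideanSpace ℝ (Fin k) → ℝ) :
    EuclideanSpace ℝ (Fin k) → ℝ :=
  fun x => fderiv ℝ ψ x (EuclideanSpace.single i 1)

/-- The iterated partial derivative `𝒟ˢ ψ = ∂₁^{s₁} ⋯ ∂ₖ^{sₖ} ψ` for a multi-index `s`. -/
def multiDeriv {k : ℕ} (s : Fin k → ℕ) (ψ : EuclideanSpace ℝ (Fin k) → ℝ) :
    EuclideanSpace ℝ (Fin k) → ℝ :=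
  (List.finRange k).foldr (fun i g => (partialDeriv i)^[s i] g) ψ

/-- `v` is the distributional derivative `𝒟ˢ u`. -/
def HasWeakDeriv {k : ℕ} (s : Fin k → ℕ) (u v : EuclideanSpace ℝ (Fin k) → ℝ) : Prop :=
  LocallyIntegrable u ∧ LocallyIntegrable v ∧
    ∀ ψ : EuclideanSpace ℝ (Fin k) → ℝ, ContDiff ℝ ∞ ψ → HasCompactSupport ψ →
      ∫ x, u x * multiDeriv s ψ x = (-1) ^ (∑ i, s i) * ∫ x, v x * ψ x

/-- `‖𝒟ˢ u‖_{Lᵖ(ℝᵏ)}`; it is `∞` if `u` has no distributional derivative `𝒟ˢ u` in `Lᵖ`. The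
infimum is over the representatives of `𝒟ˢ u`, which all have the same norm. -/
def weakDerivENorm {k : ℕ} (p : ℝ≥0∞) (s : Fin k → ℕ) (u : EuclideanSpace ℝ (Fin k) → ℝ) :
    ℝ≥0∞ :=
  ⨅ (v : EuclideanSpace ℝ (Fin k) → ℝ) (_ : HasWeakDeriv s u v), eLpNorm v p volume

/-- The Sobolev norm `∑_{|s| ≤ l} ‖𝒟ˢ u‖_{Lᵖ(ℝᵏ)}`, with value `∞` outside the Sobolev space. -/
def sobolevENorm {k : ℕ} (p : ℝ≥0∞) (l : ℕ) (u : EuclideanSpace ℝ (Fin k) → ℝ) : ℝ≥0∞ :=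
  ∑ s ∈ (Fintype.piFinset fun _ : Fin k => Finset.range (l + 1)).filter (fun s => ∑ i, s i ≤ l),
    weakDerivENorm p s u

/-- A finite system of smooth coordinate charts of a manifold `M` of dimension `k` covering `D`,
together with a smooth partition of unity on `D` subordinate to it. -/
structure ChartSystem (k : ℕ) {M : Type*} [TopologicalSpace M]
    [ChartedSpace (EuclideanSpace ℝ (Fin k)) M] (D : Set M) where
  N : ℕ
  chart : Fin N → OpenPartialHomeomorph M (EuclideanSpace ℝ (Fin k))
  chart_mem : ∀ i, chart i ∈ IsManifold.maximalAtlas (𝓡 k) ∞ M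
  ψ : Fin N → M → ℝ
  smooth : ∀ i, ContMDiff (𝓡 k) 𝓘(ℝ, ℝ) ∞ (ψ i)
  nonneg : ∀ i x, 0 ≤ ψ i x
  compact_support : ∀ i, HasCompactSupport (ψ i)
  support_subset : ∀ i, tsupport (ψ i) ⊆ (chart i).source
  sum_eq_one : ∀ x ∈ D, ∑ i, ψ i x = 1

/-- The function `φ · ψᵢ` read in the `i`-th chart, extended by zero. -/
def ChartSystem.localPiece {k : ℕ} {M : Type*} [TopologicalSpace M]
    [ChartedSpace (EuclideanSpace ℝ (Fin k)) M] {D : Set M} (A : ChartSystem k D)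
    (φ : M → ℝ) (i : Fin A.N) : EuclideanSpace ℝ (Fin k) → ℝ :=
  (A.chart i).target.indicator
    (fun z => φ ((A.chart i).symm z) * A.ψ i ((A.chart i).symm z))

/-- The Sobolev norm `‖φ‖_{Lᵖ_l(D)} = ∑ᵢ ‖(φ · ψᵢ) ∘ ωᵢ‖_{Lᵖ_l}` of a function supported in `D`. -/
def ChartSystem.sobolevNorm {k : ℕ} {M : Type*} [TopologicalSpace M]
    [ChartedSpace (EuclideanSpace ℝ (Fin k)) M] {D : Set M} (A : ChartSystem k D)
    (p : ℝ≥0∞) (l : ℕ) (φ : M → ℝ) : ℝ≥0∞ :=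
  ∑ i, sobolevENorm p l (A.localPiece φ i)

/-- The `Lᵖ(μ)`-norm, with value `∞` outside `Lᵖ(μ)`. -/
def lebesgueENorm {M : Type*} [MeasurableSpace M] (p : ℝ≥0∞) (μ : Measure M) (φ : M → ℝ) :
    ℝ≥0∞ :=
  open Classical in if AEStronglyMeasurable φ μ then eLpNorm φ p μ else ⊤

/-- The (only) norm of `Lᵖ(D)`, as a function of the set `D`. -/
def lebesgueNorms {M : Type*} [MeasurableSpace M] (p : ℝ≥0∞) (μ : Measure M) :
    Set M → Set ((M → ℝ) → ℝ≥0∞) :=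
  fun _ => {lebesgueENorm p μ}

/-- The (mutually equivalent) norms of `Lᵖ_l(D)` for all choices of charts and of a partition of
unity, as a function of the set `D`. -/
def sobolevNorms (k : ℕ) {M : Type*} [TopologicalSpace M]
    [ChartedSpace (EuclideanSpace ℝ (Fin k)) M] (p : ℝ≥0∞) (l : ℕ) :
    Set M → Set ((M → ℝ) → ℝ≥0∞) :=
  fun D => Set.range fun A : ChartSystem k D => A.sobolevNorm p l

/-- The space of right cosets `H \ G`. -/
abbrev RightCosets {G : Type*} [Group G] (H : Subgroup G) : Type _ :=
  Quotient (QuotientGroup.rightRel H)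

/-- The projection `G → H \ G`, `g ↦ H g`. -/
abbrev toRightCosets {G : Type*} [Group G] (H : Subgroup G) (g : G) : RightCosets H :=
  Quotient.mk (QuotientGroup.rightRel H) g

/-- The right action `(H a, g) ↦ H a g` of `G` on `H \ G`. -/
def RightCosets.act {G : Type*} [Group G] {H : Subgroup G} (x : RightCosets H) (g : G) :
    RightCosets H :=
  Quotient.map (fun a => a * g) (fun a b hab => by
    change QuotientGroup.rightRel H (a * g) (b * g)
    have h : QuotientGroup.rightRel H a b := hab
    rw [QuotientGroup.rightRel_apply] at h ⊢
    simpa [mul_assoc] using h) x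

/-- A lattice: a discrete subgroup `Γ` such that `G / Γ` has a nonzero finite invariant measure. -/
def IsLattice {G : Type*} [Group G] [TopologicalSpace G] [MeasurableSpace G]
    (Γ : Subgroup G) : Prop :=
  DiscreteTopology Γ ∧
    ∃ μ : Measure (G ⧸ Γ), IsFiniteMeasure μ ∧ μ ≠ 0 ∧ SMulInvariantMeasure G (G ⧸ Γ) μ

/-- A closed subgroup `H` and a lattice `Γ` of `G`, Haar measures on `G` and `H`, a section of
`G → X = H \ G`, the resulting measure `ξ` on `X`, and the increasing family of compact sets `G_t`,
`t ≥ t₀`. -/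
structure DualitySetting (G : Type*) [Group G] [TopologicalSpace G] [MeasurableSpace G] where
  H : Subgroup G
  isClosed_H : IsClosed (H : Set G)
  Γ : Subgroup G
  isLattice : IsLattice Γ
  /-- left Haar measure on `G` -/
  m : Measure G
  isHaar_m : m.IsHaarMeasure
  /-- left Haar measure on `H` -/
  ρ : Measure H
  isHaar_ρ : ρ.IsHaarMeasure
  /-- a fundamental domain for the right action of `Γ` on `G` -/
  𝓕 : Set G
  isFundamentalDomain : IsFundamentalDomain Γ.op 𝓕 m
  /-- the normalisation `μ(G / Γ) = 1` -/
  measure_𝓕 : m 𝓕 = 1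
  /-- a measurable section, bounded on compact sets -/
  s : RightCosets H → G
  measurable_s : Measurable s
  section_s : ∀ x, toRightCosets H (s x) = x
  bounded_s : ∀ D : Set (RightCosets H), IsCompact D → ∃ K : Set G, IsCompact K ∧ s '' D ⊆ K
  /-- the measure on `X` in the disintegration `dm(h s(x)) = dρ(h) dξ(x)` -/
  ξ : Measure (RightCosets H)
  disintegration : ∀ f : G → ℝ≥0∞, Measurable f →
    ∫⁻ g, f g ∂m = ∫⁻ x, ∫⁻ h : H, f ((h : G) * s x) ∂ρ ∂ξ
  Gt : ℝ → Set G
  t₀ : ℝ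
  isCompact_Gt : ∀ t, t₀ ≤ t → IsCompact (Gt t)
  monotone_Gt : ∀ t t', t₀ ≤ t → t ≤ t' → Gt t ⊆ Gt t'

namespace DualitySetting

variable {G : Type*} [Group G] [TopologicalSpace G] [MeasurableSpace G] (S : DualitySetting G)

/-- `X = H \ G` -/
abbrev X : Type _ := RightCosets S.H

/-- `Y = G / Γ` -/
abbrev Y : Type _ := G ⧸ S.Γ

/-- The probability measure on `Y` induced by `m`: `μ(A) = m(p_Y⁻¹(A) ∩ 𝓕)`. -/
def μ : Measure S.Y := (S.m.restrict S.𝓕).map (QuotientGroup.mk : G → G ⧸ S.Γ)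

/-- `H_t = H ∩ G_t` -/
def Ht (t : ℝ) : Set S.H := {h | (h : G) ∈ S.Gt t}

/-- `H_t[g₁, g₂] = H ∩ g₁ G_t g₂⁻¹` -/
def skewBall (t : ℝ) (g₁ g₂ : G) : Set S.H := {h | g₁⁻¹ * (h : G) * g₂ ∈ S.Gt t}

/-- `π_X(λ_t)φ(x) = ρ(H_t)⁻¹ ∑_{γ ∈ Γ ∩ G_t} φ(xγ)` -/
def sampling (t : ℝ) (φ : S.X → ℝ) (x : S.X) : ℝ :=
  (S.ρ.real (S.Ht t))⁻¹ * ∑ᶠ γ ∈ (S.Γ : Set G) ∩ S.Gt t, φ (x.act γ)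

/-- `π_X(λ_t^G)φ(x) = ρ(H_t)⁻¹ ∫_{G_t} φ(xg) dm(g)` -/
def haarSampling (t : ℝ) (φ : S.X → ℝ) (x : S.X) : ℝ :=
  (S.ρ.real (S.Ht t))⁻¹ * ∫ g in S.Gt t, φ (x.act g) ∂S.m

/-- `π_Y(β_t^{g₁,g₂})F(y) = ρ(H_t[g₁,g₂])⁻¹ ∫_{H_t[g₁,g₂]} F(h⁻¹y) dρ(h)` -/
def averaging (t : ℝ) (g₁ g₂ : G) (F : S.Y → ℝ) (y : S.Y) : ℝ :=
  (S.ρ.real (S.skewBall t g₁ g₂))⁻¹ *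
    ∫ h in S.skewBall t g₁ g₂, F ((h : G)⁻¹ • y) ∂S.ρ

/-- (CA1): for every compact `Ω` there is `c > 0` with `Ω G_t Ω ⊆ G_{t+c}` for all `t ≥ t₀`. -/
def CA1 : Prop :=
  ∀ Ω : Set G, IsCompact Ω → ∃ c : ℝ, 0 < c ∧ ∀ t, S.t₀ ≤ t → Ω * S.Gt t * Ω ⊆ S.Gt (t + c)

/-- (CA2): the measures `ρ(H_t)` are positive and `sup_{t ≥ t₀} ρ(H_{t+c}) / ρ(H_t) < ∞`. -/
def CA2 : Prop :=
  (∀ t, S.t₀ ≤ t → 0 < S.ρ.real (S.Ht t)) ∧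
    ∀ c : ℝ, 0 < c → ∃ C : ℝ, ∀ t, S.t₀ ≤ t →
      S.ρ.real (S.Ht (t + c)) / S.ρ.real (S.Ht t) ≤ C

/-- A basis `O_ε`, `0 < ε ≤ 1`, of symmetric neighbourhoods of the identity, shrinking to the
identity as `ε → 0`. -/
def IsSymmetricBasis (O : ℝ → Set G) : Prop :=
  (∀ ε, 0 < ε → ε ≤ 1 → O ε ∈ 𝓝 (1 : G) ∧ (O ε)⁻¹ = O ε) ∧
    ∀ U ∈ 𝓝 (1 : G), ∀ᶠ ε in 𝓝[>] (0 : ℝ), O ε ⊆ U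

/-- (HA1) for the neighbourhoods `O_ε`, with exponents `d` (covering) and `κ` (bump functions).
Here `NH K` is the set of norms of the function space on the compact subset `K` of `H`, and
`CH` is the class of functions on `H` from which the bump functions are taken. -/
structure HA1 (O : ℝ → Set G) (CH : (S.H → ℝ) → Prop)
    (NH : Set S.H → Set ((S.H → ℝ) → ℝ≥0∞)) (d κ : ℝ) : Prop where
  basis : IsSymmetricBasis O
  perturb : ∃ c : ℝ, 0 < c ∧ ∀ ε, 0 < ε → ε < 1 → ∀ t, S.t₀ ≤ t →
    O ε * S.Gt t * O ε ⊆ S.Gt (t + c * ε)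
  bump : ∃ K : Set S.H, IsCompact K ∧ ∃ N ∈ NH K, ∃ C : ℝ, ∀ᶠ ε in 𝓝[>] (0 : ℝ),
    ∃ χ : S.H → ℝ, CH χ ∧ (∀ h, 0 ≤ χ h) ∧ tsupport χ ⊆ K ∧
      (∀ h ∈ tsupport χ, (h : G) ∈ O ε) ∧ ∫ h, χ h ∂S.ρ = 1 ∧
      N χ ≤ ENNReal.ofReal (C * ε ^ (-κ))
  cover : ∀ Ω : Set G, IsCompact Ω → ∃ C : ℝ, ∀ ε, 0 < ε → ε < 1 →
    ∃ V : Finset G, Ω ⊆ ⋃ v ∈ V, v • O ε ∧ (V.card : ℝ) ≤ C * ε ^ (-d)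

/-- The inequality of (HA2′) on the compact set `Ω`, with exponents `r` and `θ`: the `L^r`-norm of
`ρ(H_{t+ε}[u,v]) - ρ(H_t[u,v])` over `Ω × Ω` is at most `c ε^θ ρ(H_t)`. -/
def HA2' (r : ℝ≥0∞) (θ : ℝ) (Ω : Set G) : Prop :=
  ∃ c : ℝ, 0 < c ∧ ∀ t, S.t₀ ≤ t → ∀ ε, 0 < ε → ε < 1 →
    eLpNorm (fun w : G × G => S.ρ.real (S.skewBall (t + ε) w.1 w.2) -
        S.ρ.real (S.skewBall t w.1 w.2)) r ((S.m.restrict Ω).prod (S.m.restrict Ω)) ≤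
      ENNReal.ofReal (c * ε ^ θ * S.ρ.real (S.Ht t))

/-- (HS): local sections `σ` of `G → X` that are Lipschitz with respect to the neighbourhoods
`O_ε`, that is, `σ(y O_ε ∩ U) ⊆ σ(y) O_{Lε}`. -/
def HS (O : ℝ → Set G) : Prop :=
  ∀ x : S.X, ∃ U ∈ 𝓝 x, ∃ σ : S.X → G, (∀ y ∈ U, toRightCosets S.H (σ y) = y) ∧
    ∃ L : ℝ, 0 < L ∧ ∀ ε, 0 < ε → ε ≤ 1 → L * ε ≤ 1 →
      ∀ y ∈ U, ∀ o ∈ O ε, y.act o ∈ U → σ (y.act o) ∈ σ y • O (L * ε)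

/-- The quantitative mean ergodic theorem, with error term `E`, for the averages `β_t^{g₁,g₂}` on
nonnegative functions supported in compact subsets `B` of `Y`, in the norm of `L^p(B)`, uniformly
for `g₁, g₂` in compact sets. Here `NY B` is the set of norms of the function space on `B`. -/
def MeanErgodic (p : ℝ≥0∞) (NY : Set S.Y → Set ((S.Y → ℝ) → ℝ≥0∞)) (E : ℝ → ℝ≥0) : Prop :=
  ∀ B : Set S.Y, IsCompact B → ∀ K : Set G, IsCompact K → ∃ N ∈ NY B, ∃ (C : ℝ≥0) (T : ℝ),
    ∀ g₁ ∈ K, ∀ g₂ ∈ K, ∀ t, T ≤ t → ∀ F : S.Y → ℝ,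
      (∀ y, 0 ≤ F y) → (∀ y, y ∉ B → F y = 0) → N F < ⊤ →
      eLpNorm (fun y => S.averaging t g₁ g₂ F y - ∫ z, F z ∂S.μ) p (S.μ.restrict B) ≤
        ((C * E t : ℝ≥0) : ℝ≥0∞) * N F

/-- `‖π_X(λ_t)φ - π_X(λ_t^G)φ‖_{L^p(D)} ≪ E(t)^δ ‖φ‖` for all sufficiently large `t` and all
nonnegative `φ` supported in `D`, for every norm in `NX D`; the implied constant and the threshold
do not depend on `φ`. -/
def DualityBound (p : ℝ≥0∞) (NX : Set S.X → Set ((S.X → ℝ) → ℝ≥0∞)) (E : ℝ → ℝ≥0) (δ : ℝ)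
    (D : Set S.X) : Prop :=
  ∀ N ∈ NX D, ∃ (C : ℝ≥0) (T : ℝ), ∀ t, T ≤ t → ∀ φ : S.X → ℝ,
    (∀ x, 0 ≤ φ x) → (∀ x, x ∉ D → φ x = 0) → N φ < ⊤ →
    eLpNorm (fun x => S.sampling t φ x - S.haarSampling t φ x) p (S.ξ.restrict D) ≤
      ((C * E t ^ δ : ℝ≥0) : ℝ≥0∞) * N φ

end DualitySetting

/-- `E` is comparable on intervals of bounded length. -/
def CoarselyAdmissible (t₀ : ℝ) (E : ℝ → ℝ≥0) : Prop :=
  ∃ c : ℝ≥0, 0 < c ∧ ∀ t s, t₀ ≤ t → t₀ ≤ s → |s - t| ≤ 1 → E s ≤ c * E t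

/-- `r = pq / (q - p)`, which is read as `p` if `q = ∞`. -/
def dualityExponent (p q : ℝ≥0∞) : ℝ≥0∞ := open Classical in if q = ⊤ then p else p * q / (q - p)

/-- The symmetric `ε`-neighbourhoods of the identity for a Riemannian metric on a Lie group. -/
def riemannianNhds (n : ℕ) (G : Type*) [Group G] [TopologicalSpace G]
    [ChartedSpace (EuclideanSpace ℝ (Fin n)) G]
    [Bundle.RiemannianBundle (fun x : G => TangentSpace (𝓡 n) x)] (ε : ℝ) : Set G :=
  {g | Manifold.riemannianEDist (𝓡 n) 1 g < ENNReal.ofReal ε ∧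
    Manifold.riemannianEDist (𝓡 n) 1 g⁻¹ < ENNReal.ofReal ε}

end

set_option linter.unusedSectionVars false

noncomputable section

/-! ### Periodization along a discrete subgroup -/

section Periodize

variable {G : Type*} [Group G]

/-- The function `gΓ ↦ ∑_{γ ∈ Γ} f(gγ)` on `G / Γ`. -/
def periodize {M : Type*} [AddCommMonoid M] [TopologicalSpace M] (Γ : Subgroup G) (f : G → M) :
    G ⧸ Γ → M :=
  Quotient.lift (fun g => ∑' γ : Γ, f (g * γ)) (fun a b hab => by
    have h : a⁻¹ * b ∈ Γ := QuotientGroup.leftRel_apply.mp hab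
    rw [← (Equiv.mulLeft (⟨a⁻¹ * b, h⟩ : Γ)).tsum_eq]
    exact tsum_congr fun γ => by simp [← mul_assoc])

@[simp] lemma periodize_mk {M : Type*} [AddCommMonoid M] [TopologicalSpace M] (Γ : Subgroup G)
    (f : G → M) (g : G) : periodize Γ f (g : G ⧸ Γ) = ∑' γ : Γ, f (g * γ) := rfl

variable [TopologicalSpace G] [IsTopologicalGroup G] [T2Space G]

lemma finite_mul_mem_of_isCompact {Γ : Subgroup G} [DiscreteTopology Γ] {K : Set G}
    (hK : IsCompact K) (g : G) : {γ : Γ | g * γ ∈ K}.Finite := by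
  have hcl : IsClosed (Γ : Set G) := Subgroup.isClosed_of_discrete
  have h1 : IsCompact ((fun x => g * x) ⁻¹' K) := by
    simpa using (Homeomorph.mulLeft g).isCompact_preimage.2 hK
  have h2 := hcl.isClosedEmbedding_subtypeVal.isCompact_preimage h1
  exact h2.finite_of_discrete

lemma exists_encard_mul_mem_le {Γ : Subgroup G} [DiscreteTopology Γ] {K : Set G}
    (hK : IsCompact K) : ∃ M : ℕ, ∀ g : G, {γ : Γ | g * γ ∈ K}.encard ≤ M := by
  have hK2 : IsCompact (K⁻¹ * K) := hK.inv.mul hK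
  have hf := finite_mul_mem_of_isCompact (Γ := Γ) hK2 1
  refine ⟨hf.toFinset.card, fun g => ?_⟩
  rcases ({γ : Γ | g * γ ∈ K}).eq_empty_or_nonempty with h | ⟨γ₀, h₀⟩
  · simp [h]
  · have : {γ : Γ | g * γ ∈ K} ⊆ (fun x => γ₀ * x) '' {γ : Γ | 1 * (γ : G) ∈ K⁻¹ * K} := by
      intro γ hγ
      refine ⟨γ₀⁻¹ * γ, ?_, by simp⟩
      refine ⟨(g * γ₀)⁻¹, by simpa using h₀, g * γ, hγ, ?_⟩
      simp [mul_assoc]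
    calc _ ≤ _ := Set.encard_le_encard this
      _ ≤ _ := Set.encard_image_le _ _
      _ = _ := by rw [← Set.Finite.encard_eq_coe_toFinset_card]

lemma tsum_indicator_one_eq_encard {ι : Type*} (s : Set ι) :
    ∑' i, s.indicator (fun _ => (1 : ℝ≥0∞)) i = (s.encard : ℝ≥0∞) := by
  rw [← tsum_subtype, ENNReal.tsum_one]; rfl

variable [MeasurableSpace G] [BorelSpace G]

lemma measurable_periodize {Γ : Subgroup G} [Countable Γ] {f : G → ℝ≥0∞} (hf : Measurable f) :
    Measurable (periodize Γ f) := by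
  apply QuotientGroup.measurable_from_quotient.2
  change Measurable fun g => ∑' γ : Γ, f (g * γ)
  exact Measurable.tsum fun γ => hf.comp (measurable_mul_const _)

end Periodize

lemma countable_of_discreteTopology_subgroup {G : Type*} [Group G] [TopologicalSpace G]
    [SecondCountableTopology G] (Γ : Subgroup G) [DiscreteTopology Γ] : Countable Γ :=
  TopologicalSpace.separableSpace_iff_countable.1 inferInstance

section Lattice

variable {G : Type*} [Group G] [TopologicalSpace G] [IsTopologicalGroup G]
  [LocallyCompactSpace G] [SecondCountableTopology G] [T2Space G]
  [MeasurableSpace G] [BorelSpace G]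

/-- The lift to `G` of an invariant measure on `G / Γ`. -/
def liftMeasure {Γ : Subgroup G} [Countable Γ] (μ : Measure (G ⧸ Γ)) : Measure G :=
  Measure.ofMeasurable (fun A _ => ∫⁻ y, periodize Γ (A.indicator 1) y ∂μ)
    (by
      have : periodize Γ ((∅ : Set G).indicator (1 : G → ℝ≥0∞)) = 0 := by
        ext y; induction y using QuotientGroup.induction_on; simp
      simp only [this, Pi.zero_apply, lintegral_zero])
    (fun A hA hd => by
      rw [← lintegral_tsum fun i =>
        (measurable_periodize (measurable_one.indicator (hA i))).aemeasurable]
      congr 1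
      ext y
      obtain ⟨x, rfl⟩ := QuotientGroup.mk_surjective y
      simp only [periodize_mk]
      rw [ENNReal.tsum_comm]
      refine tsum_congr fun γ => ?_
      have := measure_iUnion (μ := Measure.dirac (x * (γ : G))) hd hA
      simpa only [Measure.dirac_apply' _ (MeasurableSet.iUnion hA),
        Measure.dirac_apply' _ (hA _)] using this)

lemma liftMeasure_apply {Γ : Subgroup G} [Countable Γ] (μ : Measure (G ⧸ Γ)) {A : Set G}
    (hA : MeasurableSet A) : liftMeasure μ A = ∫⁻ y, periodize Γ (A.indicator 1) y ∂μ :=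
  Measure.ofMeasurable_apply A hA

lemma isMulLeftInvariant_liftMeasure {Γ : Subgroup G} [Countable Γ] (μ : Measure (G ⧸ Γ))
    [SMulInvariantMeasure G (G ⧸ Γ) μ] : (liftMeasure μ).IsMulLeftInvariant := by
  refine ⟨fun g => ?_⟩
  ext A hA
  have hmg : Measurable fun y : G ⧸ Γ => g • y := by
    apply QuotientGroup.measurable_from_quotient.2
    exact QuotientGroup.measurable_coe.comp (measurable_const_mul g)
  rw [Measure.map_apply (measurable_const_mul g) hA,
    liftMeasure_apply _ (hA.preimage (measurable_const_mul g)), liftMeasure_apply _ hA]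
  have hmp : Measure.map (fun y : G ⧸ Γ => g • y) μ = μ := by
    ext B hB
    rw [Measure.map_apply hmg hB]
    exact SMulInvariantMeasure.measure_preimage_smul g hB
  conv_rhs => rw [← hmp, lintegral_map (measurable_periodize (measurable_one.indicator hA)) hmg]
  congr 1
  ext y
  induction y using QuotientGroup.induction_on with
  | H x =>
    change _ = periodize Γ (A.indicator 1) ((g * x : G) : G ⧸ Γ)
    simp only [periodize_mk, mul_assoc]
    rfl

lemma isFiniteMeasureOnCompacts_liftMeasure {Γ : Subgroup G} [DiscreteTopology Γ] [Countable Γ]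
    (μ : Measure (G ⧸ Γ)) [IsFiniteMeasure μ] : IsFiniteMeasureOnCompacts (liftMeasure μ) := by
  refine ⟨fun K hK => ?_⟩
  obtain ⟨M, hM⟩ := exists_encard_mul_mem_le (Γ := Γ) hK
  rw [liftMeasure_apply _ hK.measurableSet]
  calc _ ≤ ∫⁻ _ : G ⧸ Γ, (M : ℝ≥0∞) ∂μ := by
        refine lintegral_mono fun y => ?_
        induction y using QuotientGroup.induction_on with
        | H x =>
          have h := tsum_indicator_one_eq_encard {γ : Γ | x * γ ∈ K}
          have h2 : ((({γ : Γ | x * γ ∈ K}).encard : ℕ∞) : ℝ≥0∞) ≤ M := by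
            exact_mod_cast hM x
          rw [← h] at h2
          exact h2
    _ < ⊤ := by
      rw [lintegral_const]
      exact ENNReal.mul_lt_top (by simp) (measure_lt_top _ _)

lemma liftMeasure_preimage_mul_right {Γ : Subgroup G} [Countable Γ] (μ : Measure (G ⧸ Γ))
    (γ : Γ) {A : Set G} (hA : MeasurableSet A) :
    liftMeasure μ ((fun g => g * (γ : G)) ⁻¹' A) = liftMeasure μ A := by
  rw [liftMeasure_apply _ (hA.preimage (measurable_mul_const _)), liftMeasure_apply _ hA]
  congr 1
  ext y
  induction y using QuotientGroup.induction_on with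
  | H x =>
    simp only [periodize_mk]
    conv_rhs => rw [← (Equiv.mulRight γ).tsum_eq]
    refine tsum_congr fun γ' => ?_
    exact congrArg (A.indicator (1 : G → ℝ≥0∞)) (mul_assoc x γ' γ)

lemma liftMeasure_ne_zero {Γ : Subgroup G} [Countable Γ] {μ : Measure (G ⧸ Γ)} (h : μ ≠ 0) :
    liftMeasure μ ≠ 0 := by
  intro h0
  have h1 : liftMeasure μ univ = 0 := by simp [h0]
  rw [liftMeasure_apply _ MeasurableSet.univ] at h1
  have h2 : ∫⁻ _ : G ⧸ Γ, (1 : ℝ≥0∞) ∂μ ≤ 0 := by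
    rw [← h1]
    refine lintegral_mono fun y => ?_
    induction y using QuotientGroup.induction_on with
    | H x =>
      simp only [indicator_univ, periodize_mk, Pi.one_apply]
      exact ENNReal.le_tsum (f := fun _ : Γ => (1 : ℝ≥0∞)) 1
  simp only [lintegral_const, one_mul, nonpos_iff_eq_zero, Measure.measure_univ_eq_zero] at h2
  exact h h2

/-- A left Haar measure is right invariant under a lattice. -/
lemma IsLattice.map_mul_right {Γ : Subgroup G} (hΓ : IsLattice Γ) (m : Measure G)
    [m.IsHaarMeasure] (γ : Γ) : m.map (fun g => g * (γ : G)) = m := by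
  obtain ⟨hd, μ, hfin, hne, hinv⟩ := hΓ
  have := countable_of_discreteTopology_subgroup Γ
  have := isMulLeftInvariant_liftMeasure μ
  have := isFiniteMeasureOnCompacts_liftMeasure μ
  have hsm := Measure.isMulLeftInvariant_eq_smul (liftMeasure μ) m
  set c := (liftMeasure μ).haarScalarFactor m with hc
  have hc0 : c ≠ 0 := by
    intro h
    rw [h, zero_smul] at hsm
    exact liftMeasure_ne_zero hne hsm
  ext A hA
  rw [Measure.map_apply (measurable_mul_const _) hA]
  have h := liftMeasure_preimage_mul_right μ γ hA
  rw [hsm] at h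
  simp only [Measure.smul_apply] at h
  exact (ENNReal.mul_right_inj (by simpa using hc0) ENNReal.coe_ne_top).1 h

end Lattice

namespace DualitySetting

variable {G : Type*} [Group G] [TopologicalSpace G] [IsTopologicalGroup G]
  [LocallyCompactSpace G] [SecondCountableTopology G] [T2Space G]
  [MeasurableSpace G] [BorelSpace G] (S : DualitySetting G)

instance : DiscreteTopology S.Γ := S.isLattice.1

instance : Countable S.Γ := countable_of_discreteTopology_subgroup S.Γ

instance : S.m.IsHaarMeasure := S.isHaar_m

instance : S.ρ.IsHaarMeasure := S.isHaar_ρ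

instance : LocallyCompactSpace S.H :=
  S.isClosed_H.isClosedEmbedding_subtypeVal.locallyCompactSpace

lemma measurePreserving_mul_right (γ : S.Γ) :
    MeasurePreserving (fun g => g * (γ : G)) S.m S.m :=
  ⟨measurable_mul_const _, S.isLattice.map_mul_right S.m γ⟩

instance : SMulInvariantMeasure S.Γ.op G S.m :=
  ⟨fun γ A hA => by
    have h := (S.measurePreserving_mul_right ((Subgroup.equivOp S.Γ).symm γ)).measure_preimage
      hA.nullMeasurableSet
    exact h⟩

instance : Countable S.Γ.op := (Subgroup.equivOp S.Γ).symm.injective.countable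

instance : MeasurableConstSMul S.Γ.op G :=
  ⟨fun γ => measurable_mul_const ((γ : Gᵐᵒᵖ).unop)⟩

lemma measurable_mk : Measurable (QuotientGroup.mk : G → S.Y) := QuotientGroup.measurable_coe

lemma lintegral_periodize_of_measurable {f : G → ℝ≥0∞} (hf : Measurable f) :
    ∫⁻ y, periodize S.Γ f y ∂S.μ = ∫⁻ g, f g ∂S.m := by
  rw [μ, lintegral_map (measurable_periodize hf) S.measurable_mk,
    S.isFundamentalDomain.lintegral_eq_tsum'']
  simp only [periodize_mk]
  rw [lintegral_tsum (f := fun (γ : S.Γ) g => f (g * γ))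
    fun γ => (hf.comp (measurable_mul_const _)).aemeasurable, ← (Subgroup.equivOp S.Γ).tsum_eq]
  rfl

lemma μ_apply {A : Set S.Y} (hA : MeasurableSet A) :
    S.μ A = S.m ((QuotientGroup.mk : G → S.Y) ⁻¹' A ∩ S.𝓕) := by
  change Measure.map (QuotientGroup.mk : G → S.Y) (S.m.restrict S.𝓕) A = _
  rw [Measure.map_apply S.measurable_mk hA, Measure.restrict_apply (hA.preimage S.measurable_mk)]

lemma ae_of_ae_comp_mk {P : S.Y → Prop} (h : ∀ᵐ g : G ∂S.m, P (g : S.Y)) :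
    ∃ N : Set S.Y, MeasurableSet N ∧ S.μ N = 0 ∧ ∀ y, y ∉ N → P y := by
  set T := toMeasurable S.m {g : G | ¬ P (g : S.Y)} with hT
  have hTm : MeasurableSet T := measurableSet_toMeasurable _ _
  have hT0 : S.m T = 0 := by rw [hT, measure_toMeasurable]; exact h
  set U : Set G := ⋃ γ : S.Γ, (fun g => g * (γ : G)) ⁻¹' T with hU
  have hUm : MeasurableSet U :=
    MeasurableSet.iUnion fun γ => hTm.preimage (measurable_mul_const _)
  have hU0 : S.m U = 0 := by
    rw [hU, measure_iUnion_null_iff]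
    intro γ
    rw [(S.measurePreserving_mul_right γ).measure_preimage hTm.nullMeasurableSet, hT0]
  have hpre : (QuotientGroup.mk : G → S.Y) ⁻¹' (QuotientGroup.mk '' U) = U := by
    refine subset_antisymm ?_ (subset_preimage_image _ _)
    rintro g ⟨g', hg', hgg⟩
    obtain ⟨γ, hγ⟩ := mem_iUnion.1 hg'
    have h1 : g'⁻¹ * g ∈ S.Γ := QuotientGroup.eq.1 hgg
    refine mem_iUnion.2 ⟨(⟨g'⁻¹ * g, h1⟩ : S.Γ)⁻¹ * γ, ?_⟩
    simpa [mul_assoc] using hγ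
  have hNm : MeasurableSet (QuotientGroup.mk '' U : Set S.Y) := by
    change MeasurableSet ((QuotientGroup.mk : G → S.Y) ⁻¹' _)
    rwa [hpre]
  refine ⟨QuotientGroup.mk '' U, hNm, ?_, ?_⟩
  · rw [S.μ_apply hNm, hpre]
    exact measure_mono_null inter_subset_left hU0
  · intro y hy
    obtain ⟨g, rfl⟩ := QuotientGroup.mk_surjective y
    by_contra hP
    refine hy ⟨g, mem_iUnion.2 ⟨1, ?_⟩, rfl⟩
    simpa using subset_toMeasurable S.m _ hP

lemma ae_iff_ae_comp_mk {P : S.Y → Prop} :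
    (∀ᵐ y ∂S.μ, P y) ↔ ∀ᵐ g : G ∂S.m, P (g : S.Y) := by
  constructor
  · intro h
    set T := toMeasurable S.μ {y | ¬ P y} with hT
    have hTm : MeasurableSet T := measurableSet_toMeasurable _ _
    have hT0 : S.μ T = 0 := by rw [hT, measure_toMeasurable]; exact h
    have h0 : S.m ((QuotientGroup.mk : G → S.Y) ⁻¹' T) = 0 := by
      refine S.isFundamentalDomain.measure_zero_of_invariant _ (fun γ => ?_) ?_
      · ext x
        rw [mem_smul_set_iff_inv_smul_mem, mem_preimage, mem_preimage]
        have : ((γ⁻¹ • x : G) : S.Y) = (x : S.Y) := by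
          rw [QuotientGroup.eq]
          change (x * ((γ⁻¹ : S.Γ.op) : Gᵐᵒᵖ).unop)⁻¹ * x ∈ S.Γ
          have h2 := (γ⁻¹).2
          rw [Subgroup.mem_op] at h2
          simpa using h2
        rw [this]
      · have h3 := hT0
        rw [S.μ_apply hTm] at h3
        exact h3
    refine measure_mono_null ?_ h0
    intro g hg
    exact subset_toMeasurable S.μ _ hg
  · intro h
    obtain ⟨N, -, h0, hN⟩ := S.ae_of_ae_comp_mk h
    exact measure_mono_null (fun y hy => by_contra fun h => hy (hN y h)) h0

lemma aemeasurable_of_comp_mk {Ψ : S.Y → ℝ}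
    (h : AEMeasurable (fun g : G => Ψ (g : S.Y)) S.m) : AEMeasurable Ψ S.μ := by
  obtain ⟨N, hNm, hN0, hN⟩ := S.ae_of_ae_comp_mk (P := fun y => ∀ g : G, (g : S.Y) = y →
    Ψ y = h.mk _ g) (by
      have h1 : ∀ᵐ g ∂S.m, ∀ γ : S.Γ, Ψ ((g * γ : G) : S.Y) = h.mk _ (g * γ) :=
        ae_all_iff.2 fun γ => (S.measurePreserving_mul_right γ).quasiMeasurePreserving.ae h.ae_eq_mk
      filter_upwards [h1] with g hg g' hg'
      have h2 : g⁻¹ * g' ∈ S.Γ := QuotientGroup.eq.1 hg'.symm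
      have h3 := hg ⟨_, h2⟩
      simp only [mul_inv_cancel_left] at h3
      rw [← hg']
      exact h3)
  refine ⟨Nᶜ.indicator Ψ, ?_, ?_⟩
  · apply QuotientGroup.measurable_from_quotient.2
    have : (fun g : G => Nᶜ.indicator Ψ (g : S.Y)) =
        ((QuotientGroup.mk : G → S.Y) ⁻¹' Nᶜ).indicator (h.mk _) := by
      ext g
      by_cases hg : (g : S.Y) ∈ N
      · rw [indicator_of_notMem (by simpa using hg), indicator_of_notMem (by simpa using hg)]
      · rw [indicator_of_mem (by simpa using hg), indicator_of_mem (by simpa using hg)]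
        exact hN _ hg g rfl
    change Measurable (fun g : G => Nᶜ.indicator Ψ (g : S.Y))
    rw [this]
    exact h.measurable_mk.indicator (hNm.compl.preimage S.measurable_mk)
  · have : ∀ᵐ y ∂S.μ, y ∉ N := by simpa [ae_iff] using hN0
    filter_upwards [this] with y hy
    rw [indicator_of_mem (by simpa using hy)]

lemma lintegral_periodize {f : G → ℝ≥0∞} (hf : AEMeasurable f S.m) :
    ∫⁻ y, periodize S.Γ f y ∂S.μ = ∫⁻ g, f g ∂S.m := by
  rw [lintegral_congr_ae hf.ae_eq_mk, ← S.lintegral_periodize_of_measurable hf.measurable_mk]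
  refine lintegral_congr_ae (S.ae_iff_ae_comp_mk.2 ?_)
  have h1 : ∀ᵐ g ∂S.m, ∀ γ : S.Γ, f (g * γ) = hf.mk _ (g * γ) :=
    ae_all_iff.2 fun γ => (S.measurePreserving_mul_right γ).quasiMeasurePreserving.ae hf.ae_eq_mk
  filter_upwards [h1] with g hg
  simp only [periodize_mk]
  exact tsum_congr hg

lemma continuous_mk : Continuous (QuotientGroup.mk : G → S.Y) := continuous_quot_mk

lemma measurableSet_of_isClosed_Y {B : Set S.Y} (hB : IsClosed B) : MeasurableSet B := by
  change MeasurableSet ((QuotientGroup.mk : G → S.Y) ⁻¹' B)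
  exact (hB.preimage S.continuous_mk).measurableSet

instance : T2Space S.Y := by
  have : IsClosed (S.Γ : Set G) := Subgroup.isClosed_of_discrete
  have : T3Space (G ⧸ S.Γ) := inferInstance
  infer_instance

/-- Restricted to a compact subset of `G`, the projection to `Y` has bounded multiplicity. -/
lemma exists_map_restrict_le_Y {K : Set G} (hK : IsCompact K) :
    ∃ M : ℝ≥0, (S.m.restrict K).map (QuotientGroup.mk : G → S.Y) ≤
      M • S.μ.restrict (QuotientGroup.mk '' K) := by
  obtain ⟨M, hM⟩ := exists_encard_mul_mem_le (Γ := S.Γ) hK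
  refine ⟨M, Measure.le_iff.2 fun A hA => ?_⟩
  have hAm := hA.preimage (S.measurable_mk)
  have hBm : MeasurableSet (QuotientGroup.mk '' K : Set S.Y) :=
    S.measurableSet_of_isClosed_Y (hK.image S.continuous_mk).isClosed
  rw [Measure.map_apply S.measurable_mk hA, Measure.restrict_apply hAm]
  set T := (QuotientGroup.mk : G → S.Y) ⁻¹' A ∩ K with hT
  have hTm : MeasurableSet T := hAm.inter hK.measurableSet
  rw [← lintegral_indicator_one hTm,
    ← S.lintegral_periodize_of_measurable (measurable_one.indicator hTm)]
  rw [Measure.smul_apply, Measure.restrict_apply hA]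
  calc _ ≤ ∫⁻ y, (M : ℝ≥0∞) * (A ∩ QuotientGroup.mk '' K).indicator 1 y ∂S.μ := by
        refine lintegral_mono fun y => ?_
        obtain ⟨x, rfl⟩ := QuotientGroup.mk_surjective y
        by_cases hx : (x : S.Y) ∈ A ∩ QuotientGroup.mk '' K
        · rw [indicator_of_mem hx, Pi.one_apply, mul_one]
          have h2 : ((({γ : S.Γ | x * γ ∈ K}).encard : ℕ∞) : ℝ≥0∞) ≤ M := by
            exact_mod_cast hM x
          rw [← tsum_indicator_one_eq_encard] at h2
          refine le_trans ?_ h2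
          refine ENNReal.tsum_le_tsum fun γ => ?_
          exact indicator_le_indicator_of_subset (s := T) (t := K) inter_subset_right
            (fun _ => zero_le_one) (x * γ)
        · rw [indicator_of_notMem hx, mul_zero, periodize_mk, nonpos_iff_eq_zero,
            ENNReal.tsum_eq_zero]
          intro γ
          refine indicator_of_notMem (fun h => hx ?_) _
          have hxg : ((x * γ : G) : S.Y) = (x : S.Y) := by simp
          exact ⟨hxg ▸ h.1, ⟨_, h.2, hxg⟩⟩
    _ = _ := by
      rw [lintegral_const_mul' _ _ (by simp), lintegral_indicator_one (hA.inter hBm)]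
      simp [ENNReal.smul_def]

end DualitySetting

namespace DualitySetting

variable {G : Type*} [Group G] [TopologicalSpace G] [IsTopologicalGroup G]
  [LocallyCompactSpace G] [SecondCountableTopology G] [T2Space G]
  [MeasurableSpace G] [BorelSpace G] (S : DualitySetting G)

/-- The projection `G → X`. -/
abbrev pX (g : G) : S.X := toRightCosets S.H g

lemma pX_eq_iff {a b : G} : S.pX a = S.pX b ↔ b * a⁻¹ ∈ S.H := by
  rw [pX, pX, toRightCosets, toRightCosets, Quotient.eq]
  exact QuotientGroup.rightRel_apply

lemma pX_surjective : Function.Surjective S.pX := Quotient.mk_surjective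

@[simp] lemma pX_mul (h : S.H) (g : G) : S.pX ((h : G) * g) = S.pX g := by
  rw [pX_eq_iff]
  simp

@[simp] lemma pX_inv_mul (h : S.H) (g : G) : S.pX ((h : G)⁻¹ * g) = S.pX g :=
  S.pX_mul h⁻¹ g

lemma pX_s (x : S.X) : S.pX (S.s x) = x := S.section_s x

lemma continuous_pX : Continuous S.pX := continuous_quot_mk

lemma measurable_pX : Measurable S.pX := measurable_quotient_mk''

lemma isOpenQuotientMap_pX : IsOpenQuotientMap S.pX := by
  refine ⟨S.pX_surjective, S.continuous_pX, fun U hU => ?_⟩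
  change IsOpen (S.pX ⁻¹' (S.pX '' U))
  have : S.pX ⁻¹' (S.pX '' U) = (S.H : Set G) * U := by
    ext g
    constructor
    · rintro ⟨a, ha, hag⟩
      exact ⟨g * a⁻¹, S.pX_eq_iff.1 hag, a, ha, by simp⟩
    · rintro ⟨h, hh, a, ha, rfl⟩
      exact ⟨a, ha, (S.pX_mul ⟨h, hh⟩ a).symm⟩
  rw [this]
  exact hU.mul_left

instance : T2Space S.X := by
  rw [t2Space_iff_of_isOpenQuotientMap S.isOpenQuotientMap_pX]
  have : {q : G × G | S.pX q.1 = S.pX q.2} = (fun q : G × G => q.2 * q.1⁻¹) ⁻¹' S.H := by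
    ext q
    exact S.pX_eq_iff
  rw [this]
  exact S.isClosed_H.preimage (by fun_prop)

instance : LocallyCompactSpace S.X := S.isOpenQuotientMap_pX.locallyCompactSpace

instance : SecondCountableTopology S.X :=
  S.isOpenQuotientMap_pX.isQuotientMap.secondCountableTopology S.isOpenQuotientMap_pX.isOpenMap

lemma measurableSet_of_isClosed_X {B : Set S.X} (hB : IsClosed B) : MeasurableSet B := by
  change MeasurableSet (S.pX ⁻¹' B)
  exact (hB.preimage S.continuous_pX).measurableSet

/-- The element `h` of `H` with `g = h s(Hg)`. -/
def fiberPart (g : G) : S.H :=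
  ⟨g * (S.s (S.pX g))⁻¹, S.pX_eq_iff.1 (S.pX_s _)⟩

lemma fiberPart_mul (g : G) : (S.fiberPart g : G) * S.s (S.pX g) = g := by
  simp [fiberPart]

lemma measure_preimage_pX_inter {A : Set S.X} (hA : MeasurableSet A) {K : Set G}
    (hK : MeasurableSet K) :
    S.m (K ∩ S.pX ⁻¹' A) = ∫⁻ x in A, S.ρ {h : S.H | (h : G) * S.s x ∈ K} ∂S.ξ := by
  have hm : MeasurableSet (K ∩ S.pX ⁻¹' A) := hK.inter (hA.preimage S.measurable_pX)
  rw [← lintegral_indicator_one hm, S.disintegration _ (measurable_one.indicator hm),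
    ← lintegral_indicator hA]
  refine lintegral_congr fun x => ?_
  have hKx : MeasurableSet {h : S.H | (h : G) * S.s x ∈ K} :=
    hK.preimage (measurable_subtype_coe.mul_const _)
  by_cases hx : x ∈ A
  · rw [indicator_of_mem hx, ← lintegral_indicator_one hKx]
    refine lintegral_congr fun h => ?_
    have : (h : G) * S.s x ∈ K ∩ S.pX ⁻¹' A ↔ (h : G) * S.s x ∈ K := by
      rw [mem_inter_iff, mem_preimage, S.pX_mul, S.pX_s, and_iff_left hx]
    by_cases hk : (h : G) * S.s x ∈ K
    · rw [indicator_of_mem (this.2 hk), indicator_of_mem (by exact hk)]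
      rfl
    · rw [indicator_of_notMem (fun h => hk (this.1 h)), indicator_of_notMem (by exact hk)]
  · rw [indicator_of_notMem hx]
    have : ∀ h : S.H, (h : G) * S.s x ∉ K ∩ S.pX ⁻¹' A := fun h => by
      rw [mem_inter_iff, mem_preimage, S.pX_mul, S.pX_s]
      exact fun h => hx h.2
    simp only [indicator_of_notMem (this _), lintegral_zero]

lemma quasiMeasurePreserving_pX : Measure.QuasiMeasurePreserving S.pX S.m S.ξ := by
  refine ⟨S.measurable_pX, ?_⟩
  refine Measure.AbsolutelyContinuous.mk fun A hA h0 => ?_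
  rw [Measure.map_apply S.measurable_pX hA, ← univ_inter (S.pX ⁻¹' A),
    S.measure_preimage_pX_inter hA MeasurableSet.univ, Measure.restrict_zero_set h0]
  simp

lemma isCompact_preimage_coe_H {K : Set G} (hK : IsCompact K) :
    IsCompact {h : S.H | (h : G) ∈ K} :=
  S.isClosed_H.isClosedEmbedding_subtypeVal.isCompact_preimage hK

lemma exists_restrict_le_map_pX {D : Set S.X} (hD : IsCompact D) :
    ∃ Ω : Set G, IsCompact Ω ∧ ∃ C : ℝ≥0,
      S.ξ.restrict D ≤ C • (S.m.restrict Ω).map S.pX := by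
  obtain ⟨K, hK, hsK⟩ := S.bounded_s D hD
  obtain ⟨K₀, hK₀, hK₀1⟩ := exists_compact_mem_nhds (1 : S.H)
  have hK₀' : IsCompact ((Subtype.val : S.H → G) '' K₀) := hK₀.image continuous_subtype_val
  refine ⟨(Subtype.val '' K₀) * K, hK₀'.mul hK, (S.ρ K₀).toNNReal⁻¹, ?_⟩
  have hpos : S.ρ K₀ ≠ 0 := (Measure.measure_pos_of_mem_nhds S.ρ hK₀1).ne'
  have hfin : S.ρ K₀ ≠ ⊤ := hK₀.measure_lt_top.ne
  refine Measure.le_iff.2 fun A hA => ?_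
  have hDm := S.measurableSet_of_isClosed_X hD.isClosed
  rw [Measure.smul_apply, Measure.map_apply S.measurable_pX hA,
    Measure.restrict_apply (hA.preimage S.measurable_pX), Measure.restrict_apply hA]
  have h1 : S.ρ K₀ * S.ξ (A ∩ D) ≤ S.m (S.pX ⁻¹' A ∩ ((Subtype.val '' K₀) * K)) := by
    rw [inter_comm (S.pX ⁻¹' A), S.measure_preimage_pX_inter hA (hK₀'.mul hK).measurableSet]
    calc _ = ∫⁻ _ in A ∩ D, S.ρ K₀ ∂S.ξ := by simp
      _ ≤ ∫⁻ x in A ∩ D, S.ρ {h : S.H | (h : G) * S.s x ∈ (Subtype.val '' K₀) * K} ∂S.ξ := by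
          refine setLIntegral_mono' (hA.inter hDm) fun x hx => measure_mono fun h hh => ?_
          exact ⟨h, ⟨h, hh, rfl⟩, S.s x, hsK ⟨x, hx.2, rfl⟩, rfl⟩
      _ ≤ _ := lintegral_mono_set inter_subset_left
  calc S.ξ (A ∩ D) = (S.ρ K₀)⁻¹ * (S.ρ K₀ * S.ξ (A ∩ D)) := by
        rw [← mul_assoc, ENNReal.inv_mul_cancel hpos hfin, one_mul]
    _ ≤ (S.ρ K₀)⁻¹ * S.m (S.pX ⁻¹' A ∩ ((Subtype.val '' K₀) * K)) := by gcongr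
    _ = _ := by
      rw [ENNReal.smul_def, ENNReal.coe_inv (by simp [ENNReal.toNNReal_eq_zero_iff, hpos, hfin]),
        ENNReal.coe_toNNReal hfin]
      rfl

lemma exists_map_pX_restrict_le {D : Set S.X} (hD : IsCompact D) {Ω : Set G} (hΩ : IsCompact Ω) :
    ∃ C : ℝ≥0, (S.m.restrict (Ω ∩ S.pX ⁻¹' D)).map S.pX ≤ C • S.ξ := by
  obtain ⟨K, hK, hsK⟩ := S.bounded_s D hD
  have hc : IsCompact {h : S.H | (h : G) ∈ Ω * K⁻¹} := S.isCompact_preimage_coe_H (hΩ.mul hK.inv)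
  refine ⟨(S.ρ {h : S.H | (h : G) ∈ Ω * K⁻¹}).toNNReal, Measure.le_iff.2 fun A hA => ?_⟩
  have hDm := S.measurableSet_of_isClosed_X hD.isClosed
  rw [Measure.smul_apply, Measure.map_apply S.measurable_pX hA,
    Measure.restrict_apply (hA.preimage S.measurable_pX), ENNReal.smul_def,
    ENNReal.coe_toNNReal hc.measure_lt_top.ne]
  have : S.pX ⁻¹' A ∩ (Ω ∩ S.pX ⁻¹' D) = Ω ∩ S.pX ⁻¹' (A ∩ D) := by
    ext; simp only [mem_inter_iff, mem_preimage]; tauto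
  rw [this, S.measure_preimage_pX_inter (hA.inter hDm) hΩ.measurableSet]
  calc _ ≤ ∫⁻ _ in A ∩ D, S.ρ {h : S.H | (h : G) ∈ Ω * K⁻¹} ∂S.ξ := by
        refine setLIntegral_mono' (hA.inter hDm) fun x hx => measure_mono fun h hh => ?_
        exact ⟨_, hh, (S.s x)⁻¹, inv_mem_inv.2 (hsK ⟨x, hx.2, rfl⟩), by simp⟩
    _ = S.ρ {h : S.H | (h : G) ∈ Ω * K⁻¹} * S.ξ (A ∩ D) := by simp
    _ ≤ _ := by
      rw [smul_eq_mul]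
      gcongr
      exact inter_subset_left

instance : SigmaFinite S.ρ := by
  have : SigmaCompactSpace S.H := S.isClosed_H.isClosedEmbedding_subtypeVal.sigmaCompactSpace
  infer_instance

/-- Left translation by `H` as a map `H × G → G` is quasi-measure-preserving. -/
lemma quasiMeasurePreserving_inv_mul (A : Set S.H) :
    Measure.QuasiMeasurePreserving (fun w : S.H × G => (w.1 : G)⁻¹ * w.2)
      ((S.ρ.restrict A).prod S.m) S.m := by
  have h1 : MeasurePreserving (fun w : S.H × G => (w.1, (w.1 : G)⁻¹ * w.2))
      ((S.ρ.restrict A).prod S.m) ((S.ρ.restrict A).prod S.m) := by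
    refine (MeasurePreserving.id _).skew_product (g := fun (h : S.H) (g : G) => (h : G)⁻¹ * g)
      (by fun_prop) ?_
    exact Eventually.of_forall fun h => map_mul_left_eq_self S.m _
  exact Measure.quasiMeasurePreserving_snd.comp h1.quasiMeasurePreserving

lemma aestronglyMeasurable_integral_inv_mul {f : G → ℝ} (hf : AEStronglyMeasurable f S.m)
    (A : Set S.H) :
    AEStronglyMeasurable (fun g => ∫ h in A, f ((h : G)⁻¹ * g) ∂S.ρ) S.m := by
  have h1 := hf.comp_quasiMeasurePreserving (S.quasiMeasurePreserving_inv_mul A)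
  exact h1.prod_swap.integral_prod_right'

end DualitySetting

namespace DualitySetting

variable {G : Type*} [Group G] [TopologicalSpace G] [IsTopologicalGroup G]
  [LocallyCompactSpace G] [SecondCountableTopology G] [T2Space G]
  [MeasurableSpace G] [BorelSpace G] (S : DualitySetting G)

section Sandwich

variable {Z : Type*} [MeasurableSpace Z] {ν : Measure Z} [SFinite ν] {ι : Z → G}

lemma sum_lintegral_lintegral_eq (hι : Measurable ι) {ψ : G → ℝ≥0∞} {n : ℕ}
    {W : Fin n → G → ℝ≥0∞} (hW : ∀ j, Measurable (W j)) (g : G)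
    (hψm : AEMeasurable (fun z => ψ (g * ι z)) ν) {B : Fin n → Set S.H} :
    ∑ j, ∫⁻ h in B j, ∫⁻ z, W j ((h : G)⁻¹ * (g * ι z)) * ψ (g * ι z) ∂ν ∂S.ρ =
      ∫⁻ z, ∑ j, (∫⁻ h in B j, W j ((h : G)⁻¹ * (g * ι z)) ∂S.ρ) * ψ (g * ι z) ∂ν := by
  have hWm : ∀ j, Measurable fun w : S.H × Z => W j ((w.1 : G)⁻¹ * (g * ι w.2)) := fun j =>
    (hW j).comp (by fun_prop)
  have hm : ∀ j ∈ Finset.univ, AEMeasurable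
      (fun z => (∫⁻ h in B j, W j ((h : G)⁻¹ * (g * ι z)) ∂S.ρ) * ψ (g * ι z)) ν := fun j _ =>
    ((hWm j).lintegral_prod_left').aemeasurable.mul hψm
  rw [lintegral_finsetSum' _ hm]
  refine Finset.sum_congr rfl fun j _ => ?_
  rw [lintegral_lintegral_swap ((hWm j).aemeasurable.mul
    (hψm.comp_quasiMeasurePreserving Measure.quasiMeasurePreserving_snd))]
  refine lintegral_congr fun z => ?_
  rw [lintegral_mul_const]
  exact (hW j).comp (by fun_prop)

lemma mul_setLIntegral_le_sum (hι : Measurable ι) {ψ : G → ℝ≥0∞} {n : ℕ}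
    {W : Fin n → G → ℝ≥0∞} (hW : ∀ j, Measurable (W j)) {v : Fin n → G} {O A A' : Set G}
    (hO : O⁻¹ = O) (hA : MeasurableSet A) (hA' : MeasurableSet A') (hAA' : O * A * O ⊆ A')
    (hsupp : ∀ j g, W j g ≠ 0 → (v j)⁻¹ * g ∈ O) {lam : ℝ≥0∞}
    (hlam : ∀ g, ψ g ≠ 0 → ∑ j, ∫⁻ h : S.H, W j ((h : G)⁻¹ * g) ∂S.ρ = lam) {g u : G}
    (hgu : u⁻¹ * g ∈ O) (hψm : AEMeasurable (fun z => ψ (g * ι z)) ν) :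
    lam * ∫⁻ z in ι ⁻¹' A, ψ (g * ι z) ∂ν ≤
      ∑ j, ∫⁻ h in {h : S.H | u⁻¹ * (h : G) * v j ∈ A'},
        ∫⁻ z, W j ((h : G)⁻¹ * (g * ι z)) * ψ (g * ι z) ∂ν ∂S.ρ := by
  rw [S.sum_lintegral_lintegral_eq hι hW g hψm, ← lintegral_indicator (hA.preimage hι)]
  refine (lintegral_const_mul_le _ _).trans (lintegral_mono fun z => ?_)
  by_cases hz : ι z ∈ A
  swap
  · simp [indicator_of_notMem (s := ι ⁻¹' A) (a := z) hz]
  rw [indicator_of_mem (by exact hz)]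
  rcases eq_or_ne (ψ (g * ι z)) 0 with h0 | h0
  · simp [h0]
  rw [← hlam _ h0, Finset.sum_mul]
  refine Finset.sum_le_sum fun j _ => mul_le_mul_left ?_ _
  have hm : MeasurableSet {h : S.H | u⁻¹ * (h : G) * v j ∈ A'} :=
    hA'.preimage (by fun_prop)
  rw [← lintegral_indicator hm]
  refine lintegral_mono fun h => ?_
  by_cases hh : h ∈ {h : S.H | u⁻¹ * (h : G) * v j ∈ A'}
  · rw [indicator_of_mem hh]
  · rw [indicator_of_notMem hh]
    by_contra hne
    refine hh (hAA' ⟨(u⁻¹ * g) * ι z, ⟨_, hgu, _, hz, rfl⟩, ((v j)⁻¹ * ((h : G)⁻¹ * (g * ι z)))⁻¹, ?_,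
      ?_⟩)
    · rw [← hO]
      exact inv_mem_inv.2 (hsupp j _ (by simpa using hne))
    · simp only [mul_inv_rev, inv_inv]
      group

lemma sum_le_mul_setLIntegral (hι : Measurable ι) {ψ : G → ℝ≥0∞} {n : ℕ}
    {W : Fin n → G → ℝ≥0∞} (hW : ∀ j, Measurable (W j)) {v : Fin n → G} {O A A' : Set G}
    (hO : O⁻¹ = O) (hA : MeasurableSet A) (hA' : MeasurableSet A') (hAA' : O * A' * O ⊆ A)
    (hsupp : ∀ j g, W j g ≠ 0 → (v j)⁻¹ * g ∈ O) {lam : ℝ≥0∞} (hlamtop : lam ≠ ⊤)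
    (hlam : ∀ g, ψ g ≠ 0 → ∑ j, ∫⁻ h : S.H, W j ((h : G)⁻¹ * g) ∂S.ρ = lam) {g u : G}
    (hgu : u⁻¹ * g ∈ O) (hψm : AEMeasurable (fun z => ψ (g * ι z)) ν) :
    ∑ j, ∫⁻ h in {h : S.H | u⁻¹ * (h : G) * v j ∈ A'},
        ∫⁻ z, W j ((h : G)⁻¹ * (g * ι z)) * ψ (g * ι z) ∂ν ∂S.ρ ≤
      lam * ∫⁻ z in ι ⁻¹' A, ψ (g * ι z) ∂ν := by
  rw [S.sum_lintegral_lintegral_eq hι hW g hψm, ← lintegral_indicator (hA.preimage hι),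
    ← lintegral_const_mul' _ _ hlamtop]
  refine lintegral_mono fun z => ?_
  rcases eq_or_ne (ψ (g * ι z)) 0 with h0 | h0
  · simp [h0]
  by_cases hz : ι z ∈ A
  · rw [indicator_of_mem (by exact hz), ← hlam _ h0, Finset.sum_mul]
    refine Finset.sum_le_sum fun j _ => mul_le_mul_left ?_ _
    exact setLIntegral_le_lintegral _ _
  · rw [indicator_of_notMem (by exact hz), mul_zero, nonpos_iff_eq_zero]
    refine Finset.sum_eq_zero fun j _ => ?_
    rw [mul_eq_zero]
    left
    have hm : MeasurableSet {h : S.H | u⁻¹ * (h : G) * v j ∈ A'} :=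
      hA'.preimage (by fun_prop)
    rw [setLIntegral_congr_fun hm (g := fun _ => 0), lintegral_zero]
    intro h hh
    by_contra hne
    refine hz (hAA' ⟨(u⁻¹ * g)⁻¹ * (u⁻¹ * (h : G) * v j), ⟨_, ?_, _, hh, rfl⟩,
      (v j)⁻¹ * ((h : G)⁻¹ * (g * ι z)), hsupp j _ hne, ?_⟩)
    · rw [← hO]
      exact inv_mem_inv.2 hgu
    · simp only [mul_inv_rev, inv_inv]
      group

end Sandwich

lemma ofReal_periodize {Γ : Subgroup G} [DiscreteTopology Γ] {f : G → ℝ} (hf : ∀ g, 0 ≤ f g)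
    {Ω : Set G} (hΩ : IsCompact Ω) (hfΩ : ∀ g, f g ≠ 0 → g ∈ Ω) (y : G ⧸ Γ) :
    ENNReal.ofReal (periodize Γ f y) = periodize Γ (fun g => ENNReal.ofReal (f g)) y := by
  obtain ⟨g, rfl⟩ := QuotientGroup.mk_surjective y
  simp only [periodize_mk]
  refine ENNReal.ofReal_tsum_of_nonneg (fun γ => hf _) ?_
  refine summable_of_hasFiniteSupport ((finite_mul_mem_of_isCompact hΩ g).subset fun γ hγ => ?_)
  exact hfΩ _ hγ

lemma periodize_nonneg {Γ : Subgroup G} {f : G → ℝ} (hf : ∀ g, 0 ≤ f g) (y : G ⧸ Γ) :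
    0 ≤ periodize Γ f y := by
  obtain ⟨g, rfl⟩ := QuotientGroup.mk_surjective y
  exact tsum_nonneg fun γ => hf _

lemma periodize_eq_zero {Γ : Subgroup G} {f : G → ℝ} {Ω : Set G}
    (hfΩ : ∀ g, f g ≠ 0 → g ∈ Ω) {y : G ⧸ Γ} (hy : y ∉ (QuotientGroup.mk '' Ω : Set (G ⧸ Γ))) :
    periodize Γ f y = 0 := by
  obtain ⟨g, rfl⟩ := QuotientGroup.mk_surjective y
  rw [periodize_mk]
  refine (tsum_congr fun γ => ?_).trans tsum_zero
  by_contra h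
  exact hy ⟨_, hfΩ _ h, by simp⟩

variable {S}

/-- A weight `Θ ≥ 0` on `G` with compact support whose integral over the fibres of `G → X` above
`D` is the constant `lam`. -/
structure IsCutoff (D : Set S.X) (Ω : Set G) (Θ : G → ℝ) (lam : ℝ) : Prop where
  measurable : Measurable Θ
  nonneg : ∀ g, 0 ≤ Θ g
  bdd : ∃ C : ℝ, ∀ g, Θ g ≤ C
  support : ∀ g, Θ g ≠ 0 → g ∈ Ω
  lam_pos : 0 < lam
  integral : ∀ g, S.pX g ∈ D →
    ∫⁻ h : S.H, ENNReal.ofReal (Θ ((h : G)⁻¹ * g)) ∂S.ρ = ENNReal.ofReal lam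

/-- A decomposition of `Θ` into nonnegative measurable functions supported in the translates
`v j • O` with `v j ∈ K`. -/
structure IsCellFamily (Θ : G → ℝ) (K O : Set G) {n : ℕ} (W : Fin n → G → ℝ) (v : Fin n → G) :
    Prop where
  measurable : ∀ j, Measurable (W j)
  nonneg : ∀ j g, 0 ≤ W j g
  sum_eq : ∀ g, ∑ j, W j g = Θ g
  support : ∀ j g, W j g ≠ 0 → (v j)⁻¹ * g ∈ O
  center : ∀ j, v j ∈ K

variable (S) in
/-- The function `g ↦ W(g) φ(Hg)`. -/
def weighted (W : G → ℝ) (φ : S.X → ℝ) (g : G) : ℝ := W g * φ (S.pX g)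

namespace IsCellFamily

variable {D : Set S.X} {Ω : Set G} {Θ : G → ℝ} {lam : ℝ} {K O : Set G} {n : ℕ}
  {W : Fin n → G → ℝ} {v : Fin n → G}

lemma le (hW : IsCellFamily Θ K O W v) (j : Fin n) (g : G) : W j g ≤ Θ g := by
  rw [← hW.sum_eq]
  exact Finset.single_le_sum (f := fun j => W j g) (fun i _ => hW.nonneg i g) (Finset.mem_univ j)

lemma mem_of_ne_zero (hW : IsCellFamily Θ K O W v) (hΘ : IsCutoff D Ω Θ lam) {j : Fin n} {g : G}
    (h : W j g ≠ 0) : g ∈ Ω := by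
  refine hΘ.support g fun h0 => h (le_antisymm ?_ (hW.nonneg j g))
  rw [← h0]
  exact hW.le j g

lemma weighted_support (hW : IsCellFamily Θ K O W v) (hΘ : IsCutoff D Ω Θ lam) (j : Fin n)
    (φ : S.X → ℝ) (g : G) (h : S.weighted (W j) φ g ≠ 0) : g ∈ Ω :=
  hW.mem_of_ne_zero hΘ (left_ne_zero_of_mul h)

lemma aestronglyMeasurable_weighted (hW : IsCellFamily Θ K O W v) {φ : S.X → ℝ}
    (hf : AEStronglyMeasurable (S.weighted Θ φ) S.m) (hΘm : Measurable Θ) (j : Fin n) :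
    AEStronglyMeasurable (S.weighted (W j) φ) S.m := by
  have : S.weighted (W j) φ = fun g => W j g / Θ g * S.weighted Θ φ g := by
    ext g
    rcases eq_or_ne (Θ g) 0 with h | h
    · have : W j g = 0 := le_antisymm (h ▸ hW.le j g) (hW.nonneg j g)
      simp [weighted, this]
    · simp only [weighted]
      field_simp
  rw [this]
  exact (((hW.measurable j).div hΘm).aestronglyMeasurable).mul hf

end IsCellFamily

end DualitySetting

namespace DualitySetting

variable {G : Type*} [Group G] [TopologicalSpace G] [IsTopologicalGroup G]
  [LocallyCompactSpace G] [SecondCountableTopology G] [T2Space G]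
  [MeasurableSpace G] [BorelSpace G] (S : DualitySetting G)

lemma isCompact_skewBall {t : ℝ} (ht : S.t₀ ≤ t) (u v : G) : IsCompact (S.skewBall t u v) := by
  have h : IsCompact ((fun g : G => u⁻¹ * g * v) ⁻¹' S.Gt t) :=
    ((Homeomorph.mulLeft u⁻¹).trans (Homeomorph.mulRight v)).isCompact_preimage.2
      (S.isCompact_Gt t ht)
  exact S.isCompact_preimage_coe_H h

lemma measure_skewBall_ne_top {t : ℝ} (ht : S.t₀ ≤ t) (u v : G) : S.ρ (S.skewBall t u v) ≠ ⊤ :=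
  (S.isCompact_skewBall ht u v).measure_lt_top.ne

lemma measurable_measureReal_skewBall {t : ℝ} (ht : S.t₀ ≤ t) :
    Measurable fun w : G × G => S.ρ.real (S.skewBall t w.1 w.2) := by
  have hm : MeasurableSet {z : (G × G) × S.H | z.1.1⁻¹ * (z.2 : G) * z.1.2 ∈ S.Gt t} :=
    (S.isCompact_Gt t ht).measurableSet.preimage (by fun_prop)
  exact (measurable_measure_prodMk_left hm).ennreal_toReal

variable {S} {D : Set S.X} {Ω : Set G} {Θ : G → ℝ} {lam : ℝ} {K O : Set G} {n : ℕ}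
  {W : Fin n → G → ℝ} {v : Fin n → G}

lemma sum_lintegral_cell (hΘ : IsCutoff D Ω Θ lam) (hW : IsCellFamily Θ K O W v) {g : G}
    (hg : S.pX g ∈ D) :
    ∑ j, ∫⁻ h : S.H, ENNReal.ofReal (W j ((h : G)⁻¹ * g)) ∂S.ρ = ENNReal.ofReal lam := by
  rw [← lintegral_finsetSum, ← hΘ.integral g hg]
  · refine lintegral_congr fun h => ?_
    rw [← ENNReal.ofReal_sum_of_nonneg fun j _ => hW.nonneg j _, hW.sum_eq]
  · intro j _
    exact ((hW.measurable j).comp (by fun_prop)).ennreal_ofReal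

lemma aemeasurable_ofReal_comp_pX (hΘ : IsCutoff D Ω Θ lam) {φ : S.X → ℝ}
    (hφD : ∀ x, x ∉ D → φ x = 0) (hf : AEStronglyMeasurable (S.weighted Θ φ) S.m) :
    AEMeasurable (fun g => ENNReal.ofReal (φ (S.pX g))) S.m := by
  have h1 : AEMeasurable (fun w : S.H × G => ENNReal.ofReal (S.weighted Θ φ ((w.1 : G)⁻¹ * w.2)))
      (S.ρ.prod S.m) := by
    have := hf.comp_quasiMeasurePreserving (S.quasiMeasurePreserving_inv_mul univ)
    rw [Measure.restrict_univ] at this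
    exact this.aemeasurable.ennreal_ofReal
  have h2 : AEMeasurable (fun g => ∫⁻ h, ENNReal.ofReal (S.weighted Θ φ ((h : G)⁻¹ * g)) ∂S.ρ)
      S.m := h1.prod_swap.lintegral_prod_right'
  have h3 : (fun g => ENNReal.ofReal (φ (S.pX g))) = fun g => (ENNReal.ofReal lam)⁻¹ *
      ∫⁻ h, ENNReal.ofReal (S.weighted Θ φ ((h : G)⁻¹ * g)) ∂S.ρ := by
    ext g
    simp only [weighted, pX_inv_mul]
    by_cases hg : S.pX g ∈ D
    · simp_rw [ENNReal.ofReal_mul (hΘ.nonneg _)]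
      rw [lintegral_mul_const _ (by
          have := hΘ.measurable
          fun_prop), hΘ.integral g hg, ← mul_assoc,
        ENNReal.inv_mul_cancel (by simpa using hΘ.lam_pos) ENNReal.ofReal_ne_top, one_mul]
    · simp [hφD _ hg]
  rw [h3]
  exact h2.const_mul _

lemma weighted_nonneg {W : G → ℝ} (hW : ∀ g, 0 ≤ W g) {φ : S.X → ℝ} (hφ : ∀ x, 0 ≤ φ x) (g : G) :
    0 ≤ S.weighted W φ g := mul_nonneg (hW g) (hφ _)

lemma periodize_weighted_smul {W : G → ℝ} (hWnn : ∀ g, 0 ≤ W g)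
    (hΩ : IsCompact Ω) (hWΩ : ∀ g, W g ≠ 0 → g ∈ Ω) {φ : S.X → ℝ} (hφ : ∀ x, 0 ≤ φ x)
    (h : S.H) (g : G) :
    ENNReal.ofReal (periodize S.Γ (S.weighted W φ) ((h : G)⁻¹ • (g : S.Y))) =
      ∑' γ : S.Γ, ENNReal.ofReal (W ((h : G)⁻¹ * (g * γ))) *
        ENNReal.ofReal (φ (S.pX (g * γ))) := by
  rw [ofReal_periodize (weighted_nonneg hWnn hφ) hΩ
    (fun g hg => hWΩ g (left_ne_zero_of_mul hg))]
  change periodize S.Γ _ (((h : G)⁻¹ * g : G) : S.Y) = _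
  rw [periodize_mk]
  refine tsum_congr fun γ => ?_
  rw [weighted, ENNReal.ofReal_mul (hWnn _), mul_assoc, S.pX_inv_mul]

lemma measurable_periodize_weighted_smul {W : G → ℝ} (hWm : Measurable W) (hWnn : ∀ g, 0 ≤ W g)
    (hΩ : IsCompact Ω) (hWΩ : ∀ g, W g ≠ 0 → g ∈ Ω) {φ : S.X → ℝ} (hφ : ∀ x, 0 ≤ φ x) (g : G) :
    Measurable fun h : S.H => periodize S.Γ (S.weighted W φ) ((h : G)⁻¹ • (g : S.Y)) := by
  have : (fun h : S.H => periodize S.Γ (S.weighted W φ) ((h : G)⁻¹ • (g : S.Y))) =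
      fun h : S.H => (∑' γ : S.Γ, ENNReal.ofReal (W ((h : G)⁻¹ * (g * γ))) *
        ENNReal.ofReal (φ (S.pX (g * γ)))).toReal := by
    ext h
    rw [← periodize_weighted_smul hWnn hΩ hWΩ hφ, ENNReal.toReal_ofReal]
    exact periodize_nonneg (weighted_nonneg hWnn hφ) _
  rw [this]
  refine Measurable.ennreal_toReal (Measurable.tsum fun γ => ?_)
  fun_prop

lemma lintegral_periodize_weighted_smul_lt_top {W : G → ℝ} (hWm : Measurable W)
    (hWnn : ∀ g, 0 ≤ W g) {C : ℝ} (hWC : ∀ g, W g ≤ C)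
    (hΩ : IsCompact Ω) (hWΩ : ∀ g, W g ≠ 0 → g ∈ Ω) {φ : S.X → ℝ} (hφ : ∀ x, 0 ≤ φ x) (g : G)
    {A : Set S.H} (hA : IsCompact A) :
    ∫⁻ h in A, ENNReal.ofReal (periodize S.Γ (S.weighted W φ) ((h : G)⁻¹ • (g : S.Y))) ∂S.ρ
      < ⊤ := by
  simp_rw [periodize_weighted_smul hWnn hΩ hWΩ hφ]
  rw [lintegral_tsum fun γ => by
    have : Measurable fun h : S.H => ENNReal.ofReal (W ((h : G)⁻¹ * (g * γ))) *
        ENNReal.ofReal (φ (S.pX (g * γ))) := by fun_prop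
    exact this.aemeasurable]
  have hfin := finite_mul_mem_of_isCompact (Γ := S.Γ)
    ((hA.image continuous_subtype_val).mul hΩ) g
  rw [tsum_eq_sum (s := hfin.toFinset)]
  · refine ENNReal.sum_lt_top.2 fun γ _ => ?_
    rw [lintegral_mul_const _ (by fun_prop)]
    refine ENNReal.mul_lt_top ?_ ENNReal.ofReal_lt_top
    calc _ ≤ ∫⁻ _ in A, ENNReal.ofReal C ∂S.ρ :=
          lintegral_mono fun h => ENNReal.ofReal_le_ofReal (hWC _)
      _ < ⊤ := by
        rw [setLIntegral_const]
        exact ENNReal.mul_lt_top ENNReal.ofReal_lt_top hA.measure_lt_top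
  · intro γ hγ
    rw [setLIntegral_congr_fun hA.measurableSet (g := fun _ => 0), lintegral_zero]
    intro h hh
    change ENNReal.ofReal (W ((h : G)⁻¹ * (g * γ))) * ENNReal.ofReal (φ (S.pX (g * γ))) = 0
    have : W ((h : G)⁻¹ * (g * γ)) = 0 := by
      by_contra hne
      refine hγ ?_
      rw [Finite.mem_toFinset]
      exact ⟨h, ⟨h, hh, rfl⟩, _, hWΩ _ hne, by simp⟩
    simp [this]

lemma setIntegral_periodize_weighted_smul {W : G → ℝ} (hWm : Measurable W)
    (hWnn : ∀ g, 0 ≤ W g) {C : ℝ} (hWC : ∀ g, W g ≤ C)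
    (hΩ : IsCompact Ω) (hWΩ : ∀ g, W g ≠ 0 → g ∈ Ω) {φ : S.X → ℝ} (hφ : ∀ x, 0 ≤ φ x) (g : G)
    {A : Set S.H} (hA : IsCompact A) :
    ENNReal.ofReal (∫ h in A, periodize S.Γ (S.weighted W φ) ((h : G)⁻¹ • (g : S.Y)) ∂S.ρ) =
      ∫⁻ h in A, ∑' γ : S.Γ, ENNReal.ofReal (W ((h : G)⁻¹ * (g * γ))) *
        ENNReal.ofReal (φ (S.pX (g * γ))) ∂S.ρ := by
  rw [integral_eq_lintegral_of_nonneg_ae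
      (Eventually.of_forall fun h => periodize_nonneg (weighted_nonneg hWnn hφ) _)
      (measurable_periodize_weighted_smul hWm hWnn hΩ hWΩ hφ g).aestronglyMeasurable,
    ENNReal.ofReal_toReal
      (lintegral_periodize_weighted_smul_lt_top hWm hWnn hWC hΩ hWΩ hφ g hA).ne]
  simp_rw [periodize_weighted_smul hWnn hΩ hWΩ hφ]

lemma aestronglyMeasurable_periodize_comp_mk {f : G → ℝ} (hfnn : ∀ g, 0 ≤ f g) (hΩ : IsCompact Ω)
    (hfΩ : ∀ g, f g ≠ 0 → g ∈ Ω) (hf : AEStronglyMeasurable f S.m) :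
    AEStronglyMeasurable (fun g : G => periodize S.Γ f (g : S.Y)) S.m := by
  have : (fun g : G => periodize S.Γ f (g : S.Y)) =
      fun g : G => (∑' γ : S.Γ, ENNReal.ofReal (f (g * γ))).toReal := by
    ext g
    have := ofReal_periodize (Γ := S.Γ) hfnn hΩ hfΩ (g : S.Y)
    rw [periodize_mk S.Γ (fun g => ENNReal.ofReal (f g))] at this
    rw [← this, ENNReal.toReal_ofReal (periodize_nonneg hfnn _)]
  rw [this]
  refine (AEMeasurable.ennreal_toReal (AEMeasurable.tsum fun γ => ?_)).aestronglyMeasurable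
  exact (hf.comp_measurePreserving (S.measurePreserving_mul_right γ)).aemeasurable.ennreal_ofReal

lemma ofReal_integral_periodize {f : G → ℝ} (hfnn : ∀ g, 0 ≤ f g) (hΩ : IsCompact Ω)
    (hfΩ : ∀ g, f g ≠ 0 → g ∈ Ω) (hf : AEStronglyMeasurable f S.m)
    (hfin : ∫⁻ g, ENNReal.ofReal (f g) ∂S.m ≠ ⊤) :
    ENNReal.ofReal (∫ y, periodize S.Γ f y ∂S.μ) = ∫⁻ g, ENNReal.ofReal (f g) ∂S.m := by
  have hm : AEMeasurable (periodize S.Γ f) S.μ :=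
    S.aemeasurable_of_comp_mk (aestronglyMeasurable_periodize_comp_mk hfnn hΩ hfΩ hf).aemeasurable
  have h1 : ∫⁻ y, ENNReal.ofReal (periodize S.Γ f y) ∂S.μ = ∫⁻ g, ENNReal.ofReal (f g) ∂S.m := by
    rw [← S.lintegral_periodize hf.aemeasurable.ennreal_ofReal]
    exact lintegral_congr fun y => ofReal_periodize hfnn hΩ hfΩ y
  rw [integral_eq_lintegral_of_nonneg_ae (Eventually.of_forall fun y => periodize_nonneg hfnn _)
    hm.aestronglyMeasurable, h1, ENNReal.ofReal_toReal hfin]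

end DualitySetting

namespace DualitySetting

variable {G : Type*} [Group G] [TopologicalSpace G] [IsTopologicalGroup G]
  [LocallyCompactSpace G] [SecondCountableTopology G] [T2Space G]
  [MeasurableSpace G] [BorelSpace G] (S : DualitySetting G)

/-- The deviation `∫_{H_t[u,v]} F(h⁻¹y) dρ(h) - ρ(H_t[u,v]) ∫_Y F dμ`. -/
def deviation (t : ℝ) (u v : G) (F : S.Y → ℝ) (y : S.Y) : ℝ :=
  ∫ h in S.skewBall t u v, F ((h : G)⁻¹ • y) ∂S.ρ -
    S.ρ.real (S.skewBall t u v) * ∫ z, F z ∂S.μ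

/-- The increment `ρ(H_{t+τ}[g,g']) - ρ(H_{t-τ}[g,g'])`. -/
def increment (t τ : ℝ) (g g' : G) : ℝ :=
  S.ρ.real (S.skewBall (t + τ) g g') - S.ρ.real (S.skewBall (t - τ) g g')

lemma measurable_increment {t τ : ℝ} (hτ : 0 ≤ τ) (ht : S.t₀ ≤ t - τ) :
    Measurable fun w : G × G => S.increment t τ w.1 w.2 := by
  have h1 := S.measurable_measureReal_skewBall (t := t + τ) (by linarith)
  have h2 := S.measurable_measureReal_skewBall ht
  exact Measurable.sub h1 h2

lemma measurable_ofReal_increment {t τ : ℝ} (hτ : 0 ≤ τ) (ht : S.t₀ ≤ t - τ) (g : G) :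
    Measurable fun g' => ENNReal.ofReal (S.increment t τ g g') := by
  have h := (S.measurable_increment hτ ht).ennreal_ofReal
  exact h.of_uncurry_left (f := fun g g' => ENNReal.ofReal (S.increment t τ g g')) (x := g)

variable {S} {D : Set S.X} {Ω : Set G} {Θ : G → ℝ} {lam : ℝ} {K O : Set G} {n : ℕ}
  {W : Fin n → G → ℝ} {v : Fin n → G}

lemma ofReal_sampling {t : ℝ} (ht : S.t₀ ≤ t) (hpos : 0 < S.ρ.real (S.Ht t)) {φ : S.X → ℝ}
    (hφ : ∀ x, 0 ≤ φ x) (g : G) :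
    ENNReal.ofReal (S.ρ.real (S.Ht t) * S.sampling t φ (S.pX g)) =
      ∫⁻ γ in (Subtype.val : S.Γ → G) ⁻¹' S.Gt t, ENNReal.ofReal (φ (S.pX (g * γ)))
        ∂Measure.count := by
  have hfin : {γ : S.Γ | (γ : G) ∈ S.Gt t}.Finite := by
    simpa using finite_mul_mem_of_isCompact (Γ := S.Γ) (S.isCompact_Gt t ht) 1
  rw [sampling, mul_inv_cancel_left₀ hpos.ne']
  have himg : (S.Γ : Set G) ∩ S.Gt t = Subtype.val '' {γ : S.Γ | (γ : G) ∈ S.Gt t} := by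
    ext g
    constructor
    · rintro ⟨h1, h2⟩
      exact ⟨⟨g, h1⟩, h2, rfl⟩
    · rintro ⟨γ, h2, rfl⟩
      exact ⟨γ.2, h2⟩
  rw [himg, finsum_mem_image Subtype.val_injective.injOn, finsum_mem_eq_finite_toFinset_sum _ hfin,
    ENNReal.ofReal_sum_of_nonneg fun _ _ => hφ _,
    ← lintegral_indicator (MeasurableSet.of_discrete), lintegral_count, tsum_eq_sum
      (s := hfin.toFinset)]
  · refine Finset.sum_congr rfl fun γ hγ => ?_
    rw [indicator_of_mem (by simpa using hγ)]
    rfl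
  · intro γ hγ
    exact indicator_of_notMem (by simpa using hγ) _

lemma haarSampling_eq {t : ℝ} (hpos : 0 < S.ρ.real (S.Ht t)) {φ : S.X → ℝ}
    (hφ : ∀ x, 0 ≤ φ x) (hφm : AEMeasurable (fun g => ENNReal.ofReal (φ (S.pX g))) S.m) (g : G) :
    S.ρ.real (S.Ht t) * S.haarSampling t φ (S.pX g) =
      (∫⁻ g' in S.Gt t, ENNReal.ofReal (φ (S.pX (g * g'))) ∂S.m).toReal := by
  rw [haarSampling, mul_inv_cancel_left₀ hpos.ne']
  change ∫ g' in S.Gt t, φ (S.pX (g * g')) ∂S.m = _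
  rw [integral_eq_lintegral_of_nonneg_ae (Eventually.of_forall fun _ => hφ _)]
  have h1 : AEMeasurable (fun g => φ (S.pX g)) S.m := by
    have := hφm.ennreal_toReal
    simpa only [ENNReal.toReal_ofReal (hφ _)] using this
  exact (h1.comp_quasiMeasurePreserving
    (measurePreserving_mul_left S.m g).quasiMeasurePreserving).aestronglyMeasurable.restrict

set_option maxHeartbeats 800000 in
theorem abs_sampling_sub_le (hO : O⁻¹ = O) (hΩ : IsCompact Ω)
    (hΘ : IsCutoff D Ω Θ lam) (hW : IsCellFamily Θ K O W v)
    {t τ : ℝ} (hτ : 0 ≤ τ) (ht : S.t₀ ≤ t - 2 * τ)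
    (hpert : ∀ s, S.t₀ ≤ s → O * S.Gt s * O ⊆ S.Gt (s + τ))
    (hpos : 0 < S.ρ.real (S.Ht t)) {φ : S.X → ℝ} (hφ : ∀ x, 0 ≤ φ x)
    (hφD : ∀ x, x ∉ D → φ x = 0) (hf : AEStronglyMeasurable (S.weighted Θ φ) S.m)
    (hfin : ∫⁻ g, ENNReal.ofReal (S.weighted Θ φ g) ∂S.m ≠ ⊤) {g u : G} (hgu : u⁻¹ * g ∈ O) :
    ENNReal.ofReal lam *
      ‖S.ρ.real (S.Ht t) * (S.sampling t φ (S.pX g) - S.haarSampling t φ (S.pX g))‖ₑ ≤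
      ∑ j, (‖S.deviation (t + τ) u (v j) (periodize S.Γ (S.weighted (W j) φ)) g‖ₑ +
        ‖S.deviation (t - τ) u (v j) (periodize S.Γ (S.weighted (W j) φ)) g‖ₑ) +
      ∫⁻ g', ENNReal.ofReal (S.weighted Θ φ g') * ENNReal.ofReal (S.increment t (2 * τ) g g')
        ∂S.m := by
  obtain ⟨C, hC⟩ := hΘ.bdd
  set ψ : G → ℝ≥0∞ := fun g => ENNReal.ofReal (φ (S.pX g)) with hψ
  have hψm : AEMeasurable ψ S.m := aemeasurable_ofReal_comp_pX hΘ hφD hf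
  set F := fun j => periodize S.Γ (S.weighted (W j) φ) with hF
  have hWnn := hW.nonneg
  have hWΩ : ∀ j g, W j g ≠ 0 → g ∈ Ω := fun j g h => hW.mem_of_ne_zero hΘ h
  have hfj : ∀ j, AEStronglyMeasurable (S.weighted (W j) φ) S.m := fun j =>
    hW.aestronglyMeasurable_weighted hf hΘ.measurable j
  have hfjnn : ∀ j g, 0 ≤ S.weighted (W j) φ g := fun j g => weighted_nonneg (hWnn j) hφ g
  have hfjΩ : ∀ j g, S.weighted (W j) φ g ≠ 0 → g ∈ Ω := fun j => hW.weighted_support hΘ j φ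
  have hfjfin : ∀ j, ∫⁻ g, ENNReal.ofReal (S.weighted (W j) φ g) ∂S.m ≠ ⊤ := fun j =>
    ne_top_of_le_ne_top hfin (lintegral_mono fun g => ENNReal.ofReal_le_ofReal
      (mul_le_mul_of_nonneg_right (hW.le j g) (hφ _)))
  have hlam : ∀ g, ψ g ≠ 0 →
      ∑ j, ∫⁻ h : S.H, ENNReal.ofReal (W j ((h : G)⁻¹ * g)) ∂S.ρ = ENNReal.ofReal lam := by
    intro g hg
    refine sum_lintegral_cell hΘ hW (by_contra fun hD => hg ?_)
    simp [hψ, hφD _ hD]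
  have hWm : ∀ j, Measurable fun g => ENNReal.ofReal (W j g) := fun j =>
    (hW.measurable j).ennreal_ofReal
  have hsupp : ∀ j g, ENNReal.ofReal (W j g) ≠ 0 → (v j)⁻¹ * g ∈ O := fun j g h =>
    hW.support j g fun h0 => h (by simp [h0])
  have hGtm : ∀ s, S.t₀ ≤ s → MeasurableSet (S.Gt s) := fun s hs =>
    (S.isCompact_Gt s hs).measurableSet
  have ht1 : S.t₀ ≤ t - τ := by linarith
  have ht2 : S.t₀ ≤ t := by linarith
  have ht3 : S.t₀ ≤ t + τ := by linarith
  have ht4 : S.t₀ ≤ t + 2 * τ := by linarith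
  have hpm : O * S.Gt (t - τ) * O ⊆ S.Gt t := by simpa using hpert (t - τ) ht1
  set I : ℝ → Fin n → ℝ := fun s j => ∫ h in S.skewBall s u (v j), F j ((h : G)⁻¹ • (g : S.Y)) ∂S.ρ
  set c : Fin n → ℝ := fun j => ∫ y, F j y ∂S.μ
  set R : ℝ → Fin n → ℝ := fun s j => S.ρ.real (S.skewBall s u (v j))
  have hInn : ∀ s j, 0 ≤ I s j := fun s j => integral_nonneg fun h => periodize_nonneg (hfjnn j) _
  have hcnn : ∀ j, 0 ≤ c j := fun j => integral_nonneg fun y => periodize_nonneg (hfjnn j) _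
  have hRnn : ∀ s j, 0 ≤ R s j := fun s j => measureReal_nonneg
  have hc : ∀ j, ENNReal.ofReal (c j) = ∫⁻ g, ENNReal.ofReal (S.weighted (W j) φ g) ∂S.m := fun j =>
    ofReal_integral_periodize (hfjnn j) hΩ (hfjΩ j) (hfj j) (hfjfin j)
  have hI : ∀ s, S.t₀ ≤ s → ∀ j, ENNReal.ofReal (I s j) =
      ∫⁻ h in {h : S.H | u⁻¹ * (h : G) * v j ∈ S.Gt s}, ∫⁻ γ : S.Γ,
        ENNReal.ofReal (W j ((h : G)⁻¹ * (g * γ))) * ψ (g * γ) ∂Measure.count ∂S.ρ := by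
    intro s hs j
    simp only [lintegral_count]
    exact setIntegral_periodize_weighted_smul (hW.measurable j) (hWnn j)
      (fun g => (hW.le j g).trans (hC g)) hΩ (hWΩ j) hφ g (S.isCompact_skewBall hs u (v j))
  have hJ : ∀ s, S.t₀ ≤ s → ∀ j, ENNReal.ofReal (R s j * c j) =
      ∫⁻ h in {h : S.H | u⁻¹ * (h : G) * v j ∈ S.Gt s}, ∫⁻ g',
        ENNReal.ofReal (W j ((h : G)⁻¹ * (g * g'))) * ψ (g * g') ∂S.m ∂S.ρ := by
    intro s hs j
    have h1 : ∀ h : S.H, ∫⁻ g', ENNReal.ofReal (W j ((h : G)⁻¹ * (g * g'))) * ψ (g * g') ∂S.m =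
        ENNReal.ofReal (c j) := by
      intro h
      rw [hc j, ← lintegral_mul_left_eq_self
        (fun x => ENNReal.ofReal (S.weighted (W j) φ x)) ((h : G)⁻¹ * g)]
      refine lintegral_congr fun g' => ?_
      rw [weighted, ENNReal.ofReal_mul (hWnn j _), mul_assoc, S.pX_inv_mul]
    simp_rw [h1]
    rw [setLIntegral_const, ENNReal.ofReal_mul (hRnn s j), mul_comm]
    congr 1
    exact ENNReal.ofReal_toReal (S.measure_skewBall_ne_top hs u (v j))
  have hSm : AEMeasurable (fun γ : S.Γ => ψ (g * (γ : G))) Measure.count :=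
    (measurable_of_countable _).aemeasurable
  have hAm : AEMeasurable (fun g' : G => ψ (g * g')) S.m :=
    hψm.comp_quasiMeasurePreserving
    (measurePreserving_mul_left S.m g).quasiMeasurePreserving
  set Sr := S.ρ.real (S.Ht t) * S.sampling t φ (S.pX g) with hSr
  set Ar := S.ρ.real (S.Ht t) * S.haarSampling t φ (S.pX g) with hAr
  have hS1 : lam * Sr ≤ ∑ j, I (t + τ) j := by
    rw [← ENNReal.ofReal_le_ofReal_iff (Finset.sum_nonneg fun j _ => hInn _ j),
      ENNReal.ofReal_mul hΘ.lam_pos.le, ENNReal.ofReal_sum_of_nonneg fun j _ => hInn _ j, hSr,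
      ofReal_sampling ht2 hpos hφ]
    simp_rw [hI _ ht3]
    exact S.mul_setLIntegral_le_sum measurable_subtype_coe hWm hO (hGtm _ ht2) (hGtm _ ht3)
      (hpert t ht2) hsupp hlam hgu hSm
  have hS2 : ∑ j, I (t - τ) j ≤ lam * Sr := by
    have hSr0 : 0 ≤ Sr := mul_nonneg hpos.le (mul_nonneg (by positivity)
      (finsum_nonneg fun _ => finsum_nonneg fun _ => hφ _))
    rw [← ENNReal.ofReal_le_ofReal_iff (mul_nonneg hΘ.lam_pos.le hSr0),
      ENNReal.ofReal_mul hΘ.lam_pos.le, ENNReal.ofReal_sum_of_nonneg fun j _ => hInn _ j, hSr,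
      ofReal_sampling ht2 hpos hφ]
    simp_rw [hI _ ht1]
    exact S.sum_le_mul_setLIntegral measurable_subtype_coe hWm hO (hGtm _ ht2) (hGtm _ ht1)
      hpm hsupp ENNReal.ofReal_ne_top hlam hgu hSm
  have hAfin : ∫⁻ g' in S.Gt t, ψ (g * g') ∂S.m ≠ ⊤ := by
    have h1 := S.mul_setLIntegral_le_sum measurable_id hWm hO (hGtm _ ht2) (hGtm _ ht3)
      (hpert t ht2) hsupp hlam hgu hAm
    simp only [id] at h1
    simp_rw [← hJ _ ht3] at h1
    intro htop
    change ENNReal.ofReal lam * ∫⁻ g' in S.Gt t, ψ (g * g') ∂S.m ≤ _ at h1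
    rw [htop, ENNReal.mul_top (by simpa using hΘ.lam_pos), top_le_iff] at h1
    exact ENNReal.sum_ne_top.2 (fun j _ => ENNReal.ofReal_ne_top) h1
  have hArof : ENNReal.ofReal Ar = ∫⁻ g' in S.Gt t, ψ (g * g') ∂S.m := by
    rw [hAr, haarSampling_eq hpos hφ hψm, ENNReal.ofReal_toReal hAfin]
  have hA1 : lam * Ar ≤ ∑ j, R (t + τ) j * c j := by
    rw [← ENNReal.ofReal_le_ofReal_iff
        (Finset.sum_nonneg fun j _ => mul_nonneg (hRnn _ j) (hcnn j)),
      ENNReal.ofReal_mul hΘ.lam_pos.le,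
      ENNReal.ofReal_sum_of_nonneg fun j _ => mul_nonneg (hRnn _ j) (hcnn j), hArof]
    simp_rw [hJ _ ht3]
    exact S.mul_setLIntegral_le_sum measurable_id hWm hO (hGtm _ ht2) (hGtm _ ht3)
      (hpert t ht2) hsupp hlam hgu hAm
  have hA2 : ∑ j, R (t - τ) j * c j ≤ lam * Ar := by
    have hAr0 : 0 ≤ Ar := by
      rw [hAr, haarSampling_eq hpos hφ hψm]
      exact ENNReal.toReal_nonneg
    rw [← ENNReal.ofReal_le_ofReal_iff (mul_nonneg hΘ.lam_pos.le hAr0),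
      ENNReal.ofReal_mul hΘ.lam_pos.le,
      ENNReal.ofReal_sum_of_nonneg fun j _ => mul_nonneg (hRnn _ j) (hcnn j), hArof]
    simp_rw [hJ _ ht1]
    exact S.sum_le_mul_setLIntegral measurable_id hWm hO (hGtm _ ht2) (hGtm _ ht1)
      hpm hsupp ENNReal.ofReal_ne_top hlam hgu hAm
  have hRmono : ∀ j, R (t - τ) j ≤ R (t + τ) j := fun j =>
    measureReal_mono (fun h hh => S.monotone_Gt _ _ ht1 (by linarith) hh)
      (S.measure_skewBall_ne_top ht3 u (v j))
  have hΔ : ENNReal.ofReal (∑ j, (R (t + τ) j - R (t - τ) j) * c j) ≤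
      ∫⁻ g', ENNReal.ofReal (S.weighted Θ φ g') * ENNReal.ofReal (S.increment t (2 * τ) g g')
        ∂S.m := by
    have hincm : Measurable fun g' => ENNReal.ofReal (S.increment t (2 * τ) g g') :=
      S.measurable_ofReal_increment (by linarith) ht g
    rw [ENNReal.ofReal_sum_of_nonneg fun j _ => mul_nonneg (sub_nonneg.2 (hRmono j)) (hcnn j)]
    have hsum : ∀ g', ENNReal.ofReal (S.weighted Θ φ g') =
        ∑ j, ENNReal.ofReal (S.weighted (W j) φ g') := by
      intro g'
      rw [← ENNReal.ofReal_sum_of_nonneg fun j _ => hfjnn j g']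
      simp only [weighted, ← Finset.sum_mul, hW.sum_eq]
    simp_rw [hsum, Finset.sum_mul]
    have hm : ∀ j ∈ Finset.univ, AEMeasurable (fun g' => ENNReal.ofReal (S.weighted (W j) φ g') *
        ENNReal.ofReal (S.increment t (2 * τ) g g')) S.m := fun j _ =>
      (hfj j).aemeasurable.ennreal_ofReal.mul hincm.aemeasurable
    rw [lintegral_finsetSum' _ hm]
    refine Finset.sum_le_sum fun j _ => ?_
    rw [ENNReal.ofReal_mul (sub_nonneg.2 (hRmono j)), hc j,
      ← lintegral_const_mul' _ _ ENNReal.ofReal_ne_top]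
    refine lintegral_mono fun g' => ?_
    rcases eq_or_ne (S.weighted (W j) φ g') 0 with h0 | h0
    · simp [h0]
    have hg' : (v j)⁻¹ * g' ∈ O := hW.support j g' (left_ne_zero_of_mul h0)
    have hginv : g⁻¹ * u ∈ O := by
      rw [← hO, Set.mem_inv]
      simpa using hgu
    have hg'inv : g'⁻¹ * v j ∈ O := by
      rw [← hO, Set.mem_inv]
      simpa using hg'
    rw [mul_comm]
    refine mul_le_mul_right (ENNReal.ofReal_le_ofReal (sub_le_sub ?_ ?_)) _
    · refine measureReal_mono (fun h hh => ?_) (S.measure_skewBall_ne_top ht4 g g')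
      have h2 := hpert _ ht3 (mul_mem_mul (mul_mem_mul hginv hh) hg')
      rw [show t + τ + τ = t + 2 * τ by ring] at h2
      change g⁻¹ * (h : G) * g' ∈ S.Gt (t + 2 * τ)
      convert h2 using 1
      group
    · refine measureReal_mono (fun h hh => ?_) (S.measure_skewBall_ne_top ht1 u (v j))
      have h2 := hpert _ ht (mul_mem_mul (mul_mem_mul hgu hh) hg'inv)
      rw [show t - 2 * τ + τ = t - τ by ring] at h2
      change u⁻¹ * (h : G) * v j ∈ S.Gt (t - τ)
      convert h2 using 1
      group
  have hdev : ∀ s j, S.deviation s u (v j) (F j) g = I s j - R s j * c j := fun s j => rfl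
  have key : lam * |Sr - Ar| ≤ ∑ j, (|I (t + τ) j - R (t + τ) j * c j| +
      |I (t - τ) j - R (t - τ) j * c j|) + ∑ j, (R (t + τ) j - R (t - τ) j) * c j := by
    have e1 : ∑ j, (I (t + τ) j - R (t + τ) j * c j) ≤ ∑ j, |I (t + τ) j - R (t + τ) j * c j| :=
      Finset.sum_le_sum fun j _ => le_abs_self _
    have e2 : ∑ j, -(I (t - τ) j - R (t - τ) j * c j) ≤ ∑ j, |I (t - τ) j - R (t - τ) j * c j| :=
      Finset.sum_le_sum fun j _ => neg_le_abs _
    have e3 : (0 : ℝ) ≤ ∑ j, |I (t + τ) j - R (t + τ) j * c j| :=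
      Finset.sum_nonneg fun j _ => abs_nonneg _
    have e4 : (0 : ℝ) ≤ ∑ j, |I (t - τ) j - R (t - τ) j * c j| :=
      Finset.sum_nonneg fun j _ => abs_nonneg _
    simp only [Finset.sum_add_distrib, Finset.sum_sub_distrib, Finset.sum_neg_distrib,
      sub_mul] at e1 e2 ⊢
    have e5 : lam * |Sr - Ar| = |lam * Sr - lam * Ar| := by
      rw [show lam * Sr - lam * Ar = lam * (Sr - Ar) by ring, abs_mul lam, abs_of_pos hΘ.lam_pos]
    rw [e5, abs_le]
    constructor <;> linarith
  calc ENNReal.ofReal lam *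
      ‖S.ρ.real (S.Ht t) * (S.sampling t φ (S.pX g) - S.haarSampling t φ (S.pX g))‖ₑ
      = ENNReal.ofReal (lam * |Sr - Ar|) := by
        rw [mul_sub, Real.enorm_eq_ofReal_abs, ENNReal.ofReal_mul hΘ.lam_pos.le]
    _ ≤ ENNReal.ofReal (∑ j, (|I (t + τ) j - R (t + τ) j * c j| +
          |I (t - τ) j - R (t - τ) j * c j|) + ∑ j, (R (t + τ) j - R (t - τ) j) * c j) :=
        ENNReal.ofReal_le_ofReal key
    _ ≤ _ := by
        refine ENNReal.ofReal_add_le.trans (add_le_add (le_of_eq ?_) hΔ)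
        rw [ENNReal.ofReal_sum_of_nonneg fun j _ => by positivity]
        refine Finset.sum_congr rfl fun j _ => ?_
        rw [ENNReal.ofReal_add (abs_nonneg _) (abs_nonneg _), hdev, hdev,
          Real.enorm_eq_ofReal_abs, Real.enorm_eq_ofReal_abs]

end DualitySetting

section LpLemmas

variable {α β : Type*} [MeasurableSpace α] [MeasurableSpace β] {μ : Measure α} {ν : Measure β}

lemma eLpNorm_smul_measure_le {ε : Type*} [TopologicalSpace ε] [ContinuousENorm ε] (f : α → ε)
    {p : ℝ≥0∞} (hp : 1 ≤ p) (c : ℝ≥0) : eLpNorm f p (c • μ) ≤ (1 + c) * eLpNorm f p μ := by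
  have h1 : (c : ℝ≥0∞) • μ ≤ (1 + c : ℝ≥0∞) • μ := by
    refine Measure.le_iff.2 fun s _ => ?_
    simp only [Measure.smul_apply, smul_eq_mul]
    gcongr
    exact le_add_self
  refine (eLpNorm_mono_measure f h1).trans ?_
  rw [eLpNorm_smul_measure_of_ne_zero (by simp), smul_eq_mul]
  gcongr
  have h2 : (1 / p).toReal ≤ 1 := by
    rw [one_div]
    refine ENNReal.toReal_le_of_le_ofReal zero_le_one ?_
    simpa using hp
  calc (1 + c : ℝ≥0∞) ^ (1 / p).toReal ≤ (1 + c : ℝ≥0∞) ^ (1 : ℝ) :=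
        ENNReal.rpow_le_rpow_of_exponent_le (by simp) h2
    _ = _ := ENNReal.rpow_one _

lemma eLpNorm_comp_le_of_map_le {ε : Type*} [TopologicalSpace ε] [ContinuousENorm ε] {f : α → β}
    (hf : AEMeasurable f μ) {c : ℝ≥0} (hmap : μ.map f ≤ c • ν) {p : ℝ≥0∞} (hp : 1 ≤ p) {g : β → ε}
    (hg : AEStronglyMeasurable g ν) :
    eLpNorm (fun x => g (f x)) p μ ≤ (1 + c) * eLpNorm g p ν := by
  have hac : μ.map f ≪ ν :=
    (Measure.absolutelyContinuous_of_le hmap).trans Measure.smul_absolutelyContinuous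
  have h1 := eLpNorm_map_measure (p := p) (hg.mono_ac hac) hf
  change eLpNorm (g ∘ f) p μ ≤ _
  rw [← h1]
  exact (eLpNorm_mono_measure g hmap).trans (eLpNorm_smul_measure_le g hp c)

lemma eLpNorm_le_of_le_map {ε : Type*} [TopologicalSpace ε] [ContinuousENorm ε] {f : α → β}
    {c : ℝ≥0} (hmap : ν ≤ c • μ.map f) {p : ℝ≥0∞} (hp : 1 ≤ p) (hptop : p ≠ ⊤) (g : β → ε) :
    eLpNorm g p ν ≤ (1 + c) * eLpNorm (fun x => g (f x)) p μ := by
  refine (eLpNorm_mono_measure g hmap).trans ((eLpNorm_smul_measure_le g hp c).trans ?_)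
  gcongr
  have hp0 : p ≠ 0 := (zero_lt_one.trans_le hp).ne'
  rw [eLpNorm_eq_lintegral_rpow_enorm_toReal hp0 hptop,
    eLpNorm_eq_lintegral_rpow_enorm_toReal hp0 hptop]
  gcongr
  exact lintegral_map_le (fun x => ‖g x‖ₑ ^ p.toReal) f

/-- Minkowski-type bound: the `L^p`-norm in `x` of `∫ |P(x,y)| dν(y)` on a finite measure space. -/
lemma eLpNorm_lintegral_prod_le [IsFiniteMeasure ν] [SFinite μ] {P : α × β → ℝ}
    (hP : AEStronglyMeasurable P (μ.prod ν)) {p : ℝ≥0∞} (hp : 1 ≤ p) (hptop : p ≠ ⊤) :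
    eLpNorm (fun x => ∫⁻ y, ‖P (x, y)‖ₑ ∂ν) p μ ≤
      (1 + ν univ) * eLpNorm P p (μ.prod ν) := by
  have hp0 : p ≠ 0 := (zero_lt_one.trans_le hp).ne'
  have hp1 : 1 ≤ p.toReal := by
    rw [← ENNReal.toReal_one]
    exact ENNReal.toReal_mono hptop hp
  have hppos : 0 < p.toReal := by linarith
  rw [eLpNorm_eq_lintegral_rpow_enorm_toReal hp0 hptop,
    eLpNorm_eq_lintegral_rpow_enorm_toReal hp0 hptop]
  have h1 : ∀ᵐ x ∂μ, (∫⁻ y, ‖P (x, y)‖ₑ ∂ν) ^ p.toReal ≤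
      (1 + ν univ) ^ p.toReal * ∫⁻ y, ‖P (x, y)‖ₑ ^ p.toReal ∂ν := by
    filter_upwards [hP.prodMk_left] with x hx
    have h2 := eLpNorm_le_eLpNorm_mul_rpow_measure_univ hp hx
    rw [eLpNorm_one_eq_lintegral_enorm, eLpNorm_eq_lintegral_rpow_enorm_toReal hp0 hptop] at h2
    calc (∫⁻ y, ‖P (x, y)‖ₑ ∂ν) ^ p.toReal
        ≤ ((∫⁻ y, ‖P (x, y)‖ₑ ^ p.toReal ∂ν) ^ (1 / p.toReal) * (1 + ν univ)) ^ p.toReal := by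
          gcongr
          refine h2.trans ?_
          gcongr
          calc ν univ ^ (1 / (1 : ℝ≥0∞).toReal - 1 / p.toReal)
              ≤ (1 + ν univ) ^ (1 / (1 : ℝ≥0∞).toReal - 1 / p.toReal) := by
                refine ENNReal.rpow_le_rpow le_add_self ?_
                rw [ENNReal.toReal_one, one_div_one, sub_nonneg]
                exact (div_le_one hppos).2 hp1
            _ ≤ (1 + ν univ) ^ (1 : ℝ) := by
                refine ENNReal.rpow_le_rpow_of_exponent_le (by simp) ?_
                have : 0 ≤ 1 / p.toReal := by positivity
                rw [ENNReal.toReal_one]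
                linarith
            _ = _ := ENNReal.rpow_one _
      _ = _ := by
        rw [ENNReal.mul_rpow_of_nonneg _ _ hppos.le, ← ENNReal.rpow_mul,
          one_div_mul_cancel hppos.ne', ENNReal.rpow_one, mul_comm]
  calc (∫⁻ x, ‖∫⁻ y, ‖P (x, y)‖ₑ ∂ν‖ₑ ^ p.toReal ∂μ) ^ (1 / p.toReal)
      ≤ ((1 + ν univ) ^ p.toReal * ∫⁻ w, ‖P w‖ₑ ^ p.toReal ∂(μ.prod ν)) ^ (1 / p.toReal) := by
        gcongr
        rw [lintegral_prod _ (hP.enorm.pow_const _),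
          ← lintegral_const_mul' _ _ (ENNReal.rpow_ne_top_of_nonneg hppos.le (by finiteness))]
        exact lintegral_mono_ae (by simpa using h1)
    _ = _ := by
        rw [ENNReal.mul_rpow_of_nonneg _ _ (by positivity), ← ENNReal.rpow_mul,
          mul_one_div_cancel hppos.ne', ENNReal.rpow_one]

lemma holderTriple_dualityExponent {p q : ℝ≥0∞} (hp : 1 ≤ p) (hpq : p < q) :
    ENNReal.HolderTriple q (dualityExponent p q) p := by
  unfold dualityExponent
  split_ifs with hq
  · subst hq
    infer_instance
  · constructor
    have hp0 : p ≠ 0 := (zero_lt_one.trans_le hp).ne'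
    have hq0 : q ≠ 0 := (zero_lt_one.trans_le (hp.trans hpq.le)).ne'
    have hptop : p ≠ ⊤ := (hpq.trans_le le_top).ne
    lift p to ℝ≥0 using hptop
    lift q to ℝ≥0 using hq
    have hpq' : p < q := by exact_mod_cast hpq
    have hp' : p ≠ 0 := by exact_mod_cast hp0
    have hq' : q ≠ 0 := by exact_mod_cast hq0
    have hsub : q - p ≠ 0 := (tsub_pos_of_lt hpq').ne'
    have h1 : p * q / (q - p) ≠ 0 := div_ne_zero (mul_ne_zero hp' hq') hsub
    have e1 : (p : ℝ≥0∞) * q / ((q : ℝ≥0∞) - p) = ((p * q / (q - p) : ℝ≥0) : ℝ≥0∞) := by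
      rw [ENNReal.coe_div hsub, ENNReal.coe_mul, ENNReal.coe_sub]
    rw [e1, ← ENNReal.coe_inv h1, ← ENNReal.coe_inv hq', ← ENNReal.coe_inv hp',
      ← ENNReal.coe_add, ENNReal.coe_inj]
    rw [← NNReal.coe_inj]
    have hps : (q : ℝ) - p ≠ 0 := by
      have : (p : ℝ) < q := by exact_mod_cast hpq'
      linarith
    have hpr : (p : ℝ) ≠ 0 := by exact_mod_cast hp'
    have hqr : (q : ℝ) ≠ 0 := by exact_mod_cast hq'
    push_cast [NNReal.coe_sub hpq'.le]
    field_simp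
    ring

end LpLemmas

namespace DualitySetting

variable {G : Type*} [Group G] [TopologicalSpace G] [IsTopologicalGroup G]
  [LocallyCompactSpace G] [SecondCountableTopology G] [T2Space G]
  [MeasurableSpace G] [BorelSpace G] {S : DualitySetting G}

lemma deviation_eq {t : ℝ} (ht : S.t₀ ≤ t) (u v : G) (F : S.Y → ℝ) (y : S.Y) :
    S.deviation t u v F y = S.ρ.real (S.skewBall t u v) *
      (S.averaging t u v F y - ∫ z, F z ∂S.μ) := by
  rw [deviation, averaging, mul_sub]
  congr 1
  rcases eq_or_ne (S.ρ.real (S.skewBall t u v)) 0 with h | h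
  · have : S.ρ (S.skewBall t u v) = 0 := by
      rwa [measureReal_eq_zero_iff (S.measure_skewBall_ne_top ht u v)] at h
    rw [Measure.restrict_zero_set this]
    simp
  · rw [mul_inv_cancel_left₀ h]

lemma aemeasurable_deviation {Ω : Set G} (hΩ : IsCompact Ω) {f : G → ℝ} (hfnn : ∀ g, 0 ≤ f g)
    (hfΩ : ∀ g, f g ≠ 0 → g ∈ Ω) (hf : AEStronglyMeasurable f S.m) (t : ℝ) (u v : G) :
    AEMeasurable (S.deviation t u v (periodize S.Γ f)) S.μ := by
  refine S.aemeasurable_of_comp_mk ?_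
  have h1 := aestronglyMeasurable_periodize_comp_mk hfnn hΩ hfΩ hf
  have h2 := S.aestronglyMeasurable_integral_inv_mul h1 (S.skewBall t u v)
  exact h2.aemeasurable.sub_const _

lemma exists_measureReal_skewBall_le (hCA1 : S.CA1) (hCA2 : S.CA2) {K : Set G}
    (hK : IsCompact K) : ∃ C : ℝ≥0, ∀ t, S.t₀ ≤ t → ∀ s, S.t₀ ≤ s → s ≤ t + 1 → ∀ u ∈ K, ∀ v ∈ K,
      S.ρ.real (S.skewBall s u v) ≤ C * S.ρ.real (S.Ht t) := by
  obtain ⟨c, hc, hcK⟩ := hCA1 (K ∪ K⁻¹) (hK.union hK.inv)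
  obtain ⟨C, hC⟩ := hCA2.2 (1 + c) (by linarith)
  refine ⟨C.toNNReal, fun t ht s hs hst u hu v hv => ?_⟩
  have hpos := hCA2.1 t ht
  have h1 : S.skewBall s u v ⊆ S.Ht (t + (1 + c)) := by
    intro h hh
    have h2 := hcK s hs (mul_mem_mul (mul_mem_mul (Or.inl hu) hh)
      (Or.inr (Set.inv_mem_inv.2 hv)))
    have h3 := S.monotone_Gt (s + c) (t + (1 + c)) (by linarith) (by linarith) h2
    change (h : G) ∈ S.Gt (t + (1 + c))
    convert h3 using 1
    group
  have hfin : S.ρ (S.Ht (t + (1 + c))) ≠ ⊤ :=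
    (S.isCompact_preimage_coe_H (S.isCompact_Gt _ (by linarith))).measure_lt_top.ne
  calc S.ρ.real (S.skewBall s u v) ≤ S.ρ.real (S.Ht (t + (1 + c))) := measureReal_mono h1 hfin
    _ ≤ C * S.ρ.real (S.Ht t) := (div_le_iff₀ hpos).1 (hC t ht)
    _ ≤ _ := by
      gcongr
      exact Real.le_coe_toNNReal C

end DualitySetting

lemma le_of_forall_rpow_bound {x y : ℝ≥0∞} {C e ε₀ b θ δ : ℝ} (hC : 0 ≤ C) (he : 0 ≤ e)
    (he1 : e ≤ 1) (hb : 0 ≤ b) (hθ : 0 < θ) (hδ0 : 0 < δ) (hδ : δ ≤ θ / (θ + b)) (hε₀ : 0 < ε₀)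
    (heε : e ^ (1 / (θ + b)) < ε₀) (hy : y ≠ ⊤)
    (h : ∀ ε, 0 < ε → ε < ε₀ → x ≤ ENNReal.ofReal (C * (ε ^ (-b) * e + ε ^ θ)) * y) :
    x ≤ ENNReal.ofReal (2 * C * e ^ δ) * y := by
  rcases he.eq_or_lt with rfl | he0
  · have h1 : Tendsto (fun ε : ℝ => ENNReal.ofReal (C * (ε ^ (-b) * 0 + ε ^ θ)) * y) (𝓝[>] 0)
        (𝓝 (ENNReal.ofReal (C * (0 ^ θ)) * y)) := by
      refine ENNReal.Tendsto.mul_const (ENNReal.tendsto_ofReal ?_) (Or.inr hy)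
      simp only [mul_zero, zero_add]
      refine Tendsto.const_mul C ?_
      exact ((Real.continuousAt_rpow_const 0 θ (Or.inr hθ.le)).tendsto).mono_left nhdsWithin_le_nhds
    refine (ge_of_tendsto h1 ?_).trans ?_
    · filter_upwards [Ioo_mem_nhdsGT hε₀] with ε hε using h ε hε.1 hε.2
    · simp [Real.zero_rpow hθ.ne']
  · have hpos : 0 < θ + b := by linarith
    refine (h (e ^ (1 / (θ + b))) (by positivity) heε).trans
      (mul_le_mul_left (ENNReal.ofReal_le_ofReal ?_) _)
    rw [← Real.rpow_mul he, ← Real.rpow_mul he]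
    have e1 : e ^ (1 / (θ + b) * -b) * e = e ^ (θ / (θ + b)) := by
      rw [← Real.rpow_add_one he0.ne']
      congr 1
      field_simp
      ring
    have e2 : e ^ (1 / (θ + b) * θ) = e ^ (θ / (θ + b)) := by
      congr 1
      field_simp
    rw [e1, e2]
    have e3 : e ^ (θ / (θ + b)) ≤ e ^ δ := Real.rpow_le_rpow_of_exponent_ge he0 he1 hδ
    nlinarith

lemma eLpNorm_mul_le_dualityExponent {α : Type*} [MeasurableSpace α] {μ : Measure α} {p q : ℝ≥0∞}
    (hp : 1 ≤ p) (hpq : p < q) {f g : α → ℝ} (hf : AEStronglyMeasurable f μ)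
    (hg : AEStronglyMeasurable g μ) :
    eLpNorm (fun x => f x * g x) p μ ≤ eLpNorm f q μ * eLpNorm g (dualityExponent p q) μ := by
  have := holderTriple_dualityExponent hp hpq
  exact eLpNorm_smul_le_mul_eLpNorm (φ := f) (f := g) hg hf

namespace DualitySetting

variable {G : Type*} [Group G] [TopologicalSpace G] [IsTopologicalGroup G]
  [LocallyCompactSpace G] [SecondCountableTopology G] [T2Space G]
  [MeasurableSpace G] [BorelSpace G] {S : DualitySetting G}

lemma aemeasurable_deviation_comp_mk {Ω : Set G} (hΩ : IsCompact Ω) {f : G → ℝ}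
    (hfnn : ∀ g, 0 ≤ f g) (hfΩ : ∀ g, f g ≠ 0 → g ∈ Ω) (hf : AEStronglyMeasurable f S.m)
    (t : ℝ) (u v : G) :
    AEMeasurable (fun g : G => S.deviation t u v (periodize S.Γ f) g) (S.m.restrict Ω) := by
  obtain ⟨M, hM⟩ := S.exists_map_restrict_le_Y hΩ
  have h1 := (aemeasurable_deviation hΩ hfnn hfΩ hf t u v).restrict
    (s := (QuotientGroup.mk : G → S.Y) '' Ω)
  exact (h1.mono_ac ((Measure.absolutelyContinuous_of_le hM).trans
    Measure.smul_absolutelyContinuous)).comp_measurable S.measurable_mk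

lemma exists_eLpNorm_deviation_le (hCA1 : S.CA1) (hCA2 : S.CA2) {Ω K : Set G} (hΩ : IsCompact Ω)
    (hK : IsCompact K) {p : ℝ≥0∞} (hp : 1 ≤ p) {E : ℝ → ℝ≥0} {NY : (S.Y → ℝ) → ℝ≥0∞}
    (hMET : ∃ (C : ℝ≥0) (T : ℝ), ∀ g₁ ∈ K, ∀ g₂ ∈ K, ∀ t, T ≤ t → ∀ F : S.Y → ℝ,
      (∀ y, 0 ≤ F y) → (∀ y, y ∉ (QuotientGroup.mk : G → S.Y) '' Ω → F y = 0) → NY F < ⊤ →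
      eLpNorm (fun y => S.averaging t g₁ g₂ F y - ∫ z, F z ∂S.μ) p
        (S.μ.restrict ((QuotientGroup.mk : G → S.Y) '' Ω)) ≤ ((C * E t : ℝ≥0) : ℝ≥0∞) * NY F) :
    ∃ (C : ℝ≥0) (T : ℝ), ∀ t, S.t₀ ≤ t → ∀ s, T ≤ s → s ≤ t + 1 → ∀ u ∈ K, ∀ v ∈ K,
      ∀ f : G → ℝ, (∀ g, 0 ≤ f g) → (∀ g, f g ≠ 0 → g ∈ Ω) → AEStronglyMeasurable f S.m →
      NY (periodize S.Γ f) < ⊤ →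
      eLpNorm (fun g : G => S.deviation s u v (periodize S.Γ f) g) p (S.m.restrict Ω) ≤
        ((C * E s : ℝ≥0) : ℝ≥0∞) * ENNReal.ofReal (S.ρ.real (S.Ht t)) *
          NY (periodize S.Γ f) := by
  obtain ⟨C, T, hC⟩ := hMET
  obtain ⟨C', hC'⟩ := exists_measureReal_skewBall_le hCA1 hCA2 hK
  obtain ⟨M, hM⟩ := S.exists_map_restrict_le_Y hΩ
  refine ⟨(1 + M) * (C' * C), max T S.t₀, fun t ht s hs hst u hu v hv f hfnn hfΩ hf hN => ?_⟩
  have hs0 : S.t₀ ≤ s := (le_max_right _ _).trans hs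
  have h1 := (aemeasurable_deviation hΩ hfnn hfΩ hf s u v).restrict
    (s := (QuotientGroup.mk : G → S.Y) '' Ω)
  refine (eLpNorm_comp_le_of_map_le S.measurable_mk.aemeasurable hM hp
    h1.aestronglyMeasurable).trans ?_
  have h2 : eLpNorm (S.deviation s u v (periodize S.Γ f)) p
      (S.μ.restrict ((QuotientGroup.mk : G → S.Y) '' Ω)) ≤
      ENNReal.ofReal (C' * S.ρ.real (S.Ht t)) *
        (((C * E s : ℝ≥0) : ℝ≥0∞) * NY (periodize S.Γ f)) := by
    rw [show S.deviation s u v (periodize S.Γ f) = S.ρ.real (S.skewBall s u v) •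
        fun y => S.averaging s u v (periodize S.Γ f) y - ∫ z, periodize S.Γ f z ∂S.μ from
      funext fun y => deviation_eq hs0 u v _ y, eLpNorm_const_smul,
      Real.enorm_of_nonneg measureReal_nonneg]
    gcongr
    · exact hC' t ht s hs0 hst u hu v hv
    · exact hC u hu v hv s ((le_max_left _ _).trans hs) _ (periodize_nonneg hfnn)
        (fun y hy => periodize_eq_zero hfΩ hy) hN
  calc (1 + (M : ℝ≥0∞)) * eLpNorm (S.deviation s u v (periodize S.Γ f)) p
        (S.μ.restrict ((QuotientGroup.mk : G → S.Y) '' Ω)) ≤ (1 + (M : ℝ≥0∞)) * (ENNReal.ofReal (C' * S.ρ.real (S.Ht t)) *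
        (((C * E s : ℝ≥0) : ℝ≥0∞) * NY (periodize S.Γ f))) := by gcongr
    _ = _ := by
      rw [ENNReal.ofReal_mul (by positivity), ENNReal.ofReal_coe_nnreal]
      push_cast
      ring

lemma aemeasurable_lintegral_weighted_increment {Ω : Set G} {f : G → ℝ}
    (hf : AEStronglyMeasurable f S.m) {t τ : ℝ} (hτ : 0 ≤ τ) (ht : S.t₀ ≤ t - τ) :
    AEMeasurable (fun g => ∫⁻ g', ENNReal.ofReal (f g') *
      ENNReal.ofReal (S.increment t τ g g') ∂S.m) (S.m.restrict Ω) := by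
  have h1 : AEMeasurable (fun w : G × G => ENNReal.ofReal (f w.2) *
      ENNReal.ofReal (S.increment t τ w.1 w.2)) ((S.m.restrict Ω).prod S.m) :=
    (hf.aemeasurable.ennreal_ofReal.comp_snd).mul
      (S.measurable_increment hτ ht).ennreal_ofReal.aemeasurable
  exact h1.lintegral_prod_right'

lemma exists_eLpNorm_increment_le {Ω : Set G} (hΩ : IsCompact Ω) {p q : ℝ≥0∞} (hp : 1 ≤ p)
    (hpq : p < q) {θ : ℝ} (hHA2 : S.HA2' (dualityExponent p q) θ Ω) :
    ∃ C : ℝ≥0, ∀ t τ, 0 < τ → 2 * τ < 1 → S.t₀ ≤ t - τ → ∀ f : G → ℝ, (∀ g, 0 ≤ f g) →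
      (∀ g, f g ≠ 0 → g ∈ Ω) → AEStronglyMeasurable f S.m →
      eLpNorm (fun g => ∫⁻ g', ENNReal.ofReal (f g') * ENNReal.ofReal (S.increment t τ g g') ∂S.m)
        p (S.m.restrict Ω) ≤
      C * ENNReal.ofReal (τ ^ θ) * ENNReal.ofReal (S.ρ.real (S.Ht t)) * eLpNorm f q S.m := by
  obtain ⟨c, hc, hcb⟩ := hHA2
  have := isFiniteMeasure_restrict.2 (hΩ.measure_lt_top (μ := S.m)).ne
  have hq : 1 ≤ q := hp.trans hpq.le
  have hpt : p ≠ ⊤ := (hpq.trans_le le_top).ne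
  set A : ℝ≥0 := (S.m Ω).toNNReal with hA
  have hAe : (A : ℝ≥0∞) = S.m Ω := ENNReal.coe_toNNReal (hΩ.measure_lt_top (μ := S.m)).ne
  refine ⟨(1 + A) * ((1 + A) * (c * 2 ^ θ).toNNReal), fun t τ hτ hτ1 ht f hfnn hfΩ hf => ?_⟩
  set ν := S.m.restrict Ω with hν
  have hincm : Measurable fun w : G × G => S.increment t τ w.1 w.2 :=
    S.measurable_increment hτ.le ht
  have hincnn : ∀ g g', 0 ≤ S.increment t τ g g' := fun g g' =>
    sub_nonneg.2 (measureReal_mono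
      (fun h hh => S.monotone_Gt (t - τ) (t + τ) ht (by linarith) hh)
      (S.measure_skewBall_ne_top (by linarith) g g'))
  have hf2 : AEStronglyMeasurable (fun w : G × G => f w.2) (ν.prod ν) := hf.restrict.comp_snd
  have hP : AEStronglyMeasurable (fun w : G × G => f w.2 * S.increment t τ w.1 w.2)
      (ν.prod ν) := hf2.mul hincm.aestronglyMeasurable
  have e1 : (fun g => ∫⁻ g', ENNReal.ofReal (f g') * ENNReal.ofReal (S.increment t τ g g') ∂S.m) =
      fun g => ∫⁻ g', ‖f g' * S.increment t τ g g'‖ₑ ∂ν := by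
    ext g
    rw [hν, ← lintegral_indicator hΩ.measurableSet]
    refine lintegral_congr fun g' => ?_
    by_cases hg' : g' ∈ Ω
    · rw [indicator_of_mem hg', Real.enorm_of_nonneg (mul_nonneg (hfnn _) (hincnn _ _)),
        ENNReal.ofReal_mul (hfnn _)]
    · have : f g' = 0 := by_contra fun h => hg' (hfΩ _ h)
      rw [indicator_of_notMem hg', this, ENNReal.ofReal_zero, zero_mul]
  rw [e1]
  refine (eLpNorm_lintegral_prod_le hP hp hpt).trans ?_
  have h3 : eLpNorm (fun w : G × G => f w.2) q (ν.prod ν) ≤ (1 + A) * eLpNorm f q S.m := by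
    have hmap : (ν.prod ν).map Prod.snd ≤ A • S.m := by
      rw [Measure.map_snd_prod, hν, Measure.restrict_apply_univ, ← hAe]
      refine Measure.le_iff.2 fun s _ => ?_
      rw [Measure.smul_apply, Measure.smul_apply, ENNReal.smul_def, smul_eq_mul, smul_eq_mul]
      exact mul_le_mul_right (Measure.restrict_apply_le _ _) _
    exact eLpNorm_comp_le_of_map_le measurable_snd.aemeasurable hmap hq hf
  have h4 : eLpNorm (fun w : G × G => S.increment t τ w.1 w.2) (dualityExponent p q) (ν.prod ν) ≤
      ENNReal.ofReal (c * (2 * τ) ^ θ * S.ρ.real (S.Ht t)) := by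
    have h5 := hcb (t - τ) ht (2 * τ) (by linarith) hτ1
    rw [show t - τ + 2 * τ = t + τ by ring] at h5
    refine h5.trans (ENNReal.ofReal_le_ofReal ?_)
    refine mul_le_mul_of_nonneg_left ?_ (by positivity)
    refine measureReal_mono (μ := S.ρ) (s₁ := S.Ht (t - τ)) (s₂ := S.Ht t)
      (fun h hh => S.monotone_Gt (t - τ) t ht (by linarith) hh) ?_
    exact (S.isCompact_preimage_coe_H (S.isCompact_Gt _ (by linarith))).measure_lt_top.ne
  have h5 : eLpNorm (fun w : G × G => f w.2 * S.increment t τ w.1 w.2) p (ν.prod ν) ≤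
      eLpNorm (fun w : G × G => f w.2) q (ν.prod ν) *
        eLpNorm (fun w : G × G => S.increment t τ w.1 w.2) (dualityExponent p q) (ν.prod ν) :=
    eLpNorm_mul_le_dualityExponent hp hpq hf2 hincm.aestronglyMeasurable
  have h6 : ν univ = A := by rw [hν, Measure.restrict_apply_univ, hAe]
  calc (1 + ν univ) * eLpNorm (fun w : G × G => f w.2 * S.increment t τ w.1 w.2) p (ν.prod ν)
      ≤ (1 + A) * (((1 + A) * eLpNorm f q S.m) *
        ENNReal.ofReal (c * (2 * τ) ^ θ * S.ρ.real (S.Ht t))) := by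
        rw [h6]
        refine mul_le_mul_right ?_ _
        exact h5.trans (mul_le_mul' h3 h4)
    _ = _ := by
      rw [show c * (2 * τ) ^ θ * S.ρ.real (S.Ht t) = c * 2 ^ θ * τ ^ θ * S.ρ.real (S.Ht t) by
          rw [Real.mul_rpow (by norm_num) hτ.le]
          ring,
        ENNReal.ofReal_mul (by positivity), ENNReal.ofReal_mul (by positivity)]
      push_cast
      change _ = (1 + (A : ℝ≥0∞)) * ((1 + A) * ENNReal.ofReal (c * 2 ^ θ)) * _ * _ * _
      ring

end DualitySetting

namespace DualitySetting

variable {G : Type*} [Group G] [TopologicalSpace G] [IsTopologicalGroup G]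
  [LocallyCompactSpace G] [SecondCountableTopology G] [T2Space G]
  [MeasurableSpace G] [BorelSpace G] {S : DualitySetting G}

lemma eLpNorm_deviation_cells_le {D : Set S.X} {Ω : Set G} {Θ : G → ℝ} {lam : ℝ} {K O : Set G}
    {n : ℕ} {W : Fin n → G → ℝ} {v : Fin n → G} (hΩ : IsCompact Ω) {p : ℝ≥0∞} (hp : 1 ≤ p)
    {V : Finset G} (hΘ : IsCutoff D Ω Θ lam) (hW : IsCellFamily Θ K O W v)
    {φ : S.X → ℝ} (hφ : ∀ x, 0 ≤ φ x) (hf : AEStronglyMeasurable (S.weighted Θ φ) S.m)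
    {t₁ t₂ : ℝ} {M : ℝ≥0∞}
    (h1 : ∀ u ∈ V, ∀ j, eLpNorm (fun g : G => S.deviation t₁ u (v j)
      (periodize S.Γ (S.weighted (W j) φ)) g) p (S.m.restrict Ω) ≤ M)
    (h2 : ∀ u ∈ V, ∀ j, eLpNorm (fun g : G => S.deviation t₂ u (v j)
      (periodize S.Γ (S.weighted (W j) φ)) g) p (S.m.restrict Ω) ≤ M)
    {k : G → ℝ≥0∞} (hk : AEMeasurable k (S.m.restrict Ω)) :
    eLpNorm (fun g : G => ∑ u ∈ V, ∑ j,
      (‖S.deviation t₁ u (v j) (periodize S.Γ (S.weighted (W j) φ)) g‖ₑ +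
        ‖S.deviation t₂ u (v j) (periodize S.Γ (S.weighted (W j) φ)) g‖ₑ) + k g) p
      (S.m.restrict Ω) ≤ V.card * n * (2 * M) + eLpNorm k p (S.m.restrict Ω) := by
  have hm : ∀ t u j, AEMeasurable (fun g : G => ‖S.deviation t u (v j)
      (periodize S.Γ (S.weighted (W j) φ)) g‖ₑ) (S.m.restrict Ω) := fun t u j =>
    (aemeasurable_deviation_comp_mk hΩ (fun g => weighted_nonneg (hW.nonneg j) hφ g)
      (hW.weighted_support hΘ j φ) (hW.aestronglyMeasurable_weighted hf hΘ.measurable j) t u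
      (v j)).enorm
  have hm2 : ∀ u j, AEMeasurable (fun g : G =>
      (‖S.deviation t₁ u (v j) (periodize S.Γ (S.weighted (W j) φ)) g‖ₑ +
        ‖S.deviation t₂ u (v j) (periodize S.Γ (S.weighted (W j) φ)) g‖ₑ)) (S.m.restrict Ω) :=
    fun u j => (hm t₁ u j).add (hm t₂ u j)
  have hm3 : ∀ u, AEMeasurable (fun g : G => ∑ j,
      (‖S.deviation t₁ u (v j) (periodize S.Γ (S.weighted (W j) φ)) g‖ₑ +
        ‖S.deviation t₂ u (v j) (periodize S.Γ (S.weighted (W j) φ)) g‖ₑ)) (S.m.restrict Ω) :=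
    fun u => Finset.aemeasurable_fun_sum _ fun j _ => hm2 u j
  have hm4 := Finset.aemeasurable_fun_sum V fun u _ => hm3 u
  refine (eLpNorm_add_le hm4.aestronglyMeasurable hk.aestronglyMeasurable hp).trans ?_
  gcongr
  have e1 : (fun g : G => ∑ u ∈ V, ∑ j,
      (‖S.deviation t₁ u (v j) (periodize S.Γ (S.weighted (W j) φ)) g‖ₑ +
        ‖S.deviation t₂ u (v j) (periodize S.Γ (S.weighted (W j) φ)) g‖ₑ)) =
      ∑ u ∈ V, ∑ j, fun g : G =>
      (‖S.deviation t₁ u (v j) (periodize S.Γ (S.weighted (W j) φ)) g‖ₑ +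
        ‖S.deviation t₂ u (v j) (periodize S.Γ (S.weighted (W j) φ)) g‖ₑ) := by
    ext g
    simp [Finset.sum_apply]
  rw [e1]
  refine (eLpNorm_sum_le (fun u _ => ?_) hp).trans ?_
  · exact Finset.aestronglyMeasurable_sum _ fun j _ => (hm2 u j).aestronglyMeasurable
  calc _ ≤ ∑ u ∈ V, ∑ j : Fin n, 2 * M := by
        refine Finset.sum_le_sum fun u hu => ?_
        refine (eLpNorm_sum_le (fun j _ => (hm2 u j).aestronglyMeasurable) hp).trans ?_
        refine Finset.sum_le_sum fun j _ => ?_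
        refine (eLpNorm_add_le (hm t₁ u j).aestronglyMeasurable
          (hm t₂ u j).aestronglyMeasurable hp).trans ?_
        rw [eLpNorm_enorm, eLpNorm_enorm, two_mul]
        exact add_le_add (h1 u hu j) (h2 u hu j)
    _ = _ := by
      simp only [Finset.sum_const, Finset.card_univ, Fintype.card_fin, nsmul_eq_mul]
      ring

lemma lintegral_ofReal_weighted_ne_top {Ω : Set G} (hΩ : IsCompact Ω) {f : G → ℝ}
    (hfnn : ∀ g, 0 ≤ f g) (hfΩ : ∀ g, f g ≠ 0 → g ∈ Ω) {q : ℝ≥0∞} (hq : 1 ≤ q)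
    (hf : AEStronglyMeasurable f S.m) (hfq : eLpNorm f q S.m < ⊤) :
    ∫⁻ g, ENNReal.ofReal (f g) ∂S.m ≠ ⊤ := by
  have := isFiniteMeasure_restrict.2 (hΩ.measure_lt_top (μ := S.m)).ne
  have h1 : MemLp f q (S.m.restrict Ω) :=
    ⟨hf.restrict, (eLpNorm_restrict_le f q S.m Ω).trans_lt hfq⟩
  have h2 := (h1.mono_exponent hq).2
  rw [eLpNorm_one_eq_lintegral_enorm] at h2
  have e : ∫⁻ g, ENNReal.ofReal (f g) ∂S.m = ∫⁻ g in Ω, ‖f g‖ₑ ∂S.m := by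
    rw [← lintegral_indicator hΩ.measurableSet]
    refine lintegral_congr fun g => ?_
    by_cases hg : g ∈ Ω
    · rw [indicator_of_mem hg, Real.enorm_of_nonneg (hfnn g)]
    · rw [indicator_of_notMem hg, by_contra fun h => hg (hfΩ g h), ENNReal.ofReal_zero]
  rw [e]
  exact h2.ne

/-- The estimate for a fixed scale `ε`, before division by `ρ(H_t)`. -/
lemma mul_eLpNorm_sampling_sub_le {D : Set S.X} {Ω : Set G} {Θ : G → ℝ} {lam : ℝ} {K O : Set G}
    {n : ℕ} {W : Fin n → G → ℝ} {v : Fin n → G} (hΩ : IsCompact Ω) {p q : ℝ≥0∞} (hp : 1 ≤ p)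
    (hpq : p < q) {Cξ : ℝ≥0} (hξ : S.ξ.restrict D ≤ Cξ • (S.m.restrict Ω).map S.pX)
    (hO : O⁻¹ = O) {V : Finset G} (hV : Ω ⊆ ⋃ u ∈ V, u • O)
    (hΘ : IsCutoff D Ω Θ lam) (hW : IsCellFamily Θ K O W v)
    {t τ : ℝ} (hτ : 0 ≤ τ) (ht : S.t₀ ≤ t - 2 * τ)
    (hpert : ∀ s, S.t₀ ≤ s → O * S.Gt s * O ⊆ S.Gt (s + τ))
    (hpos : 0 < S.ρ.real (S.Ht t)) {φ : S.X → ℝ} (hφ : ∀ x, 0 ≤ φ x)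
    (hφD : ∀ x, x ∉ D → φ x = 0) (hf : AEStronglyMeasurable (S.weighted Θ φ) S.m)
    (hfq : eLpNorm (S.weighted Θ φ) q S.m < ⊤) {M : ℝ≥0∞}
    (h1 : ∀ u ∈ V, ∀ j, eLpNorm (fun g : G => S.deviation (t + τ) u (v j)
      (periodize S.Γ (S.weighted (W j) φ)) g) p (S.m.restrict Ω) ≤ M)
    (h2 : ∀ u ∈ V, ∀ j, eLpNorm (fun g : G => S.deviation (t - τ) u (v j)
      (periodize S.Γ (S.weighted (W j) φ)) g) p (S.m.restrict Ω) ≤ M) :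
    ENNReal.ofReal (lam * S.ρ.real (S.Ht t)) *
      eLpNorm (fun x => S.sampling t φ x - S.haarSampling t φ x) p (S.ξ.restrict D) ≤
    (1 + Cξ) * (V.card * n * (2 * M) + eLpNorm (fun g => ∫⁻ g', ENNReal.ofReal
      (S.weighted Θ φ g') * ENNReal.ofReal (S.increment t (2 * τ) g g') ∂S.m) p
      (S.m.restrict Ω)) := by
  have hpt : p ≠ ⊤ := (hpq.trans_le le_top).ne
  set R := S.ρ.real (S.Ht t)
  have e1 : ENNReal.ofReal (lam * R) *
      eLpNorm (fun x => S.sampling t φ x - S.haarSampling t φ x) p (S.ξ.restrict D) =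
      eLpNorm ((lam * R) • fun x => S.sampling t φ x - S.haarSampling t φ x) p
        (S.ξ.restrict D) := by
    rw [eLpNorm_const_smul, Real.enorm_of_nonneg (mul_nonneg hΘ.lam_pos.le hpos.le)]
  rw [e1]
  refine (eLpNorm_le_of_le_map hξ hp hpt _).trans (mul_le_mul_right ?_ _)
  refine le_trans ?_ (eLpNorm_deviation_cells_le hΩ hp hΘ hW hφ hf h1 h2
    (aemeasurable_lintegral_weighted_increment hf (by linarith) ht))
  refine eLpNorm_mono_enorm_ae ?_
  filter_upwards [ae_restrict_mem hΩ.measurableSet] with g hg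
  obtain ⟨u, hu, hgu⟩ := mem_iUnion₂.1 (hV hg)
  have h3 := abs_sampling_sub_le hO hΩ hΘ hW hτ ht hpert hpos hφ hφD hf
    (lintegral_ofReal_weighted_ne_top hΩ (fun g => weighted_nonneg hΘ.nonneg hφ g)
      (fun g h => hΘ.support g (left_ne_zero_of_mul h)) (hp.trans hpq.le) hf hfq)
    (mem_smul_set_iff_inv_smul_mem.1 hgu)
  calc ‖((lam * R) • fun x => S.sampling t φ x - S.haarSampling t φ x) (S.pX g)‖ₑ
      = ENNReal.ofReal lam * ‖R * (S.sampling t φ (S.pX g) - S.haarSampling t φ (S.pX g))‖ₑ := by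
        rw [Pi.smul_apply, smul_eq_mul, mul_assoc, enorm_mul lam,
          Real.enorm_of_nonneg hΘ.lam_pos.le]
    _ ≤ _ := h3
    _ ≤ _ := by
      rw [enorm_eq_self]
      refine add_le_add_left ?_ _
      exact Finset.single_le_sum (f := fun u => ∑ j,
        (‖S.deviation (t + τ) u (v j) (periodize S.Γ (S.weighted (W j) φ)) g‖ₑ +
          ‖S.deviation (t - τ) u (v j) (periodize S.Γ (S.weighted (W j) φ)) g‖ₑ))
        (fun _ _ => zero_le) hu

end DualitySetting

lemma le_ofReal_mul_of_mul_le {x y : ℝ≥0∞} {a b R : ℝ} (ha : 0 < a) (hR : 0 < R)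
    (h : ENNReal.ofReal (a * R) * x ≤ ENNReal.ofReal (b * R) * y) :
    x ≤ ENNReal.ofReal (b / a) * y := by
  have haR : 0 < a * R := mul_pos ha hR
  have h1 : ENNReal.ofReal (a * R)⁻¹ * (ENNReal.ofReal (a * R) * x) ≤
      ENNReal.ofReal (a * R)⁻¹ * (ENNReal.ofReal (b * R) * y) := by gcongr
  rw [← mul_assoc, ← mul_assoc, ← ENNReal.ofReal_mul (by positivity),
    ← ENNReal.ofReal_mul (by positivity), inv_mul_cancel₀ haR.ne', ENNReal.ofReal_one,
    one_mul] at h1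
  convert h1 using 3
  field_simp

namespace DualitySetting

variable {G : Type*} [Group G] [TopologicalSpace G] [IsTopologicalGroup G]
  [LocallyCompactSpace G] [SecondCountableTopology G] [T2Space G]
  [MeasurableSpace G] [BorelSpace G] {S : DualitySetting G}

/-- Cell decompositions of the cutoff `Θ` at all small scales `ε`, with at most `C ε^{-d}` cells
centred in `K`, together with the control of the norm of the periodized cells. -/
def HasCells (S : DualitySetting G) (D : Set S.X) (Θ : G → ℝ) (K : Set G) (O : ℝ → Set G)
    (NX : (S.X → ℝ) → ℝ≥0∞) (NY : (S.Y → ℝ) → ℝ≥0∞) (d a : ℝ) : Prop :=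
  ∃ C ε₁ : ℝ, 0 < ε₁ ∧ ∀ ε, 0 < ε → ε < ε₁ → ∃ (n : ℕ) (W : Fin n → G → ℝ) (v : Fin n → G),
    IsCellFamily Θ K (O ε) W v ∧ (n : ℝ) ≤ C * ε ^ (-d) ∧
    ∀ φ : S.X → ℝ, (∀ x, 0 ≤ φ x) → (∀ x, x ∉ D → φ x = 0) → NX φ < ⊤ → ∀ j,
      NY (periodize S.Γ (S.weighted (W j) φ)) ≤ ENNReal.ofReal (C * ε ^ (-a)) * NX φ

/-- Covers of `Ω` by at most `C ε^{-d}` translates of `O_ε` by elements of `K`. -/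
def HasCovers (Ω K : Set G) (O : ℝ → Set G) (d : ℝ) : Prop :=
  ∃ C ε₁ : ℝ, 0 < ε₁ ∧ ∀ ε, 0 < ε → ε < ε₁ → ∃ V : Finset G, (∀ v ∈ V, v ∈ K) ∧
    Ω ⊆ ⋃ v ∈ V, v • O ε ∧ (V.card : ℝ) ≤ C * ε ^ (-d)

set_option maxHeartbeats 1000000 in
theorem dualityBound_of_cells {p q : ℝ≥0∞} (hp : 1 ≤ p) (hpq : p < q) {E : ℝ → ℝ≥0}
    (hE : Tendsto E atTop (𝓝 0)) (hEadm : CoarselyAdmissible S.t₀ E) (hCA1 : S.CA1) (hCA2 : S.CA2)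
    {O : ℝ → Set G} {D : Set S.X} {Ω K : Set G} {Θ : G → ℝ} {lam d a θ δ : ℝ}
    {NX : (S.X → ℝ) → ℝ≥0∞} {NY : (S.Y → ℝ) → ℝ≥0∞}
    (hO : ∀ ε, 0 < ε → ε < 1 → (O ε)⁻¹ = O ε)
    (hpert : ∃ c : ℝ, 0 < c ∧ ∀ ε, 0 < ε → ε < 1 → ∀ t, S.t₀ ≤ t →
      O ε * S.Gt t * O ε ⊆ S.Gt (t + c * ε))
    (hΩ : IsCompact Ω) (hK : IsCompact K) (hcov : HasCovers Ω K O d)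
    (hξ : ∃ C : ℝ≥0, S.ξ.restrict D ≤ C • (S.m.restrict Ω).map S.pX)
    (hΘ : IsCutoff D Ω Θ lam)
    (hN : ∃ C : ℝ≥0, ∀ φ : S.X → ℝ, (∀ x, 0 ≤ φ x) → (∀ x, x ∉ D → φ x = 0) → NX φ < ⊤ →
      AEStronglyMeasurable (S.weighted Θ φ) S.m ∧ eLpNorm (S.weighted Θ φ) q S.m ≤ C * NX φ)
    (hcell : S.HasCells D Θ K O NX NY d a)
    (hMET : ∃ (C : ℝ≥0) (T : ℝ), ∀ g₁ ∈ K, ∀ g₂ ∈ K, ∀ t, T ≤ t → ∀ F : S.Y → ℝ,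
      (∀ y, 0 ≤ F y) → (∀ y, y ∉ (QuotientGroup.mk : G → S.Y) '' Ω → F y = 0) → NY F < ⊤ →
      eLpNorm (fun y => S.averaging t g₁ g₂ F y - ∫ z, F z ∂S.μ) p
        (S.μ.restrict ((QuotientGroup.mk : G → S.Y) '' Ω)) ≤ ((C * E t : ℝ≥0) : ℝ≥0∞) * NY F)
    (hHA2 : S.HA2' (dualityExponent p q) θ Ω) (hθ : 0 < θ) (hb : 0 ≤ 2 * d + a) (hδ0 : 0 < δ)
    (hδ : δ ≤ θ / (θ + (2 * d + a))) :
    ∃ (C : ℝ≥0) (T : ℝ), ∀ t, T ≤ t → ∀ φ : S.X → ℝ,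
      (∀ x, 0 ≤ φ x) → (∀ x, x ∉ D → φ x = 0) → NX φ < ⊤ →
      eLpNorm (fun x => S.sampling t φ x - S.haarSampling t φ x) p (S.ξ.restrict D) ≤
        ((C * E t ^ δ : ℝ≥0) : ℝ≥0∞) * NX φ := by
  obtain ⟨c, hc, hpert⟩ := hpert
  obtain ⟨C₅, ε₅, hε₅, hcov⟩ := hcov
  obtain ⟨Cξ, hξ⟩ := hξ
  obtain ⟨C₄, hN⟩ := hN
  obtain ⟨C₂, ε₂, hε₂, hcell⟩ := hcell
  obtain ⟨C₁, T₁, hdev⟩ := exists_eLpNorm_deviation_le hCA1 hCA2 hΩ hK hp hMET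
  obtain ⟨C₃, hinc⟩ := exists_eLpNorm_increment_le hΩ hp hpq hHA2
  obtain ⟨cE, hcE, hEadm⟩ := hEadm
  have hlam := hΘ.lam_pos
  set ε₀ := min (min ε₅ ε₂) (min (1 / 2) (1 / (8 * c))) with hε₀def
  have hε₀ : 0 < ε₀ := by positivity
  set A₁ : ℝ := (1 + Cξ) * (|C₅| * |C₂| * (2 * (C₁ * cE * |C₂|))) with hA₁
  set A₂ : ℝ := (1 + Cξ) * (C₃ * (2 * c) ^ θ * C₄) with hA₂
  have hA₁0 : 0 ≤ A₁ := by positivity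
  have hA₂0 : 0 ≤ A₂ := by positivity
  have key : ∀ t, max T₁ S.t₀ + 1 ≤ t → ∀ φ : S.X → ℝ,
      (∀ x, 0 ≤ φ x) → (∀ x, x ∉ D → φ x = 0) → NX φ < ⊤ → ∀ ε, 0 < ε → ε < ε₀ →
      eLpNorm (fun x => S.sampling t φ x - S.haarSampling t φ x) p (S.ξ.restrict D) ≤
        ENNReal.ofReal ((A₁ + A₂) / lam * (ε ^ (-(2 * d + a)) * E t + ε ^ θ)) * NX φ := by
    intro t ht φ hφ hφD hφN ε hε hεε
    have hε5 : ε < ε₅ := hεε.trans_le ((min_le_left _ _).trans (min_le_left _ _))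
    have hε2 : ε < ε₂ := hεε.trans_le ((min_le_left _ _).trans (min_le_right _ _))
    have hε1 : ε < 1 / 2 := hεε.trans_le ((min_le_right _ _).trans (min_le_left _ _))
    have hεc : ε < 1 / (8 * c) := hεε.trans_le ((min_le_right _ _).trans (min_le_right _ _))
    rw [lt_div_iff₀ (by positivity)] at hεc
    have htT : T₁ + 1 ≤ t := (add_le_add_left (le_max_left _ _) 1).trans ht
    have htt : S.t₀ + 1 ≤ t := (add_le_add_left (le_max_right _ _) 1).trans ht
    set τ := c * ε with hτ
    have hτ0 : 0 < τ := mul_pos hc hε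
    have hτ8 : 8 * τ < 1 := by rw [hτ]; linarith
    have ht0 : S.t₀ ≤ t := by linarith
    have hpos := hCA2.1 t ht0
    set R := S.ρ.real (S.Ht t) with hR
    obtain ⟨V, hVK, hV, hVc⟩ := hcov ε hε hε5
    obtain ⟨n, W, v, hW, hn, hWN⟩ := hcell ε hε hε2
    obtain ⟨hf, hfq⟩ := hN φ hφ hφD hφN
    have hM : ∀ s, |s - t| ≤ 1 → T₁ ≤ s → S.t₀ ≤ s → s ≤ t + 1 → ∀ u ∈ V, ∀ j,
        eLpNorm (fun g : G => S.deviation s u (v j)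
          (periodize S.Γ (S.weighted (W j) φ)) g) p (S.m.restrict Ω) ≤
        ENNReal.ofReal (C₁ * (cE * E t) * R * (|C₂| * ε ^ (-a))) * NX φ := by
      intro s hs1 hs2 hs3 hs4 u hu j
      have hfin : NY (periodize S.Γ (S.weighted (W j) φ)) < ⊤ :=
        (hWN φ hφ hφD hφN j).trans_lt (ENNReal.mul_lt_top ENNReal.ofReal_lt_top hφN)
      refine (hdev t ht0 s hs2 hs4 u (hVK u hu) (v j) (hW.center j) _
        (fun g => weighted_nonneg (hW.nonneg j) hφ g) (hW.weighted_support hΘ j φ)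
        (hW.aestronglyMeasurable_weighted hf hΘ.measurable j) hfin).trans ?_
      have e1 : ((C₁ * E s : ℝ≥0) : ℝ≥0∞) ≤ ENNReal.ofReal (C₁ * (cE * E t)) := by
        rw [← ENNReal.ofReal_coe_nnreal]
        refine ENNReal.ofReal_le_ofReal ?_
        have := hEadm t s ht0 hs3 hs1
        push_cast
        gcongr
        exact_mod_cast this
      have e2 : NY (periodize S.Γ (S.weighted (W j) φ)) ≤
          ENNReal.ofReal (|C₂| * ε ^ (-a)) * NX φ := by
        refine (hWN φ hφ hφD hφN j).trans ?_
        gcongr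
        exact le_abs_self _
      refine (mul_le_mul' (mul_le_mul' e1 le_rfl) e2).trans (le_of_eq ?_)
      rw [ENNReal.ofReal_mul (p := C₁ * (cE * E t) * R) (by positivity),
        ENNReal.ofReal_mul (p := C₁ * (cE * E t)) (by positivity)]
      ring
    have hmain := mul_eLpNorm_sampling_sub_le hΩ hp hpq hξ (hO ε hε (by linarith)) hV hΘ hW
      hτ0.le (by linarith) (fun s hs => hpert ε hε (by linarith) s hs) hpos hφ hφD hf
      (hfq.trans_lt (ENNReal.mul_lt_top ENNReal.coe_lt_top hφN))
      (hM (t + τ) (by rw [abs_le]; constructor <;> linarith) (by linarith) (by linarith)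
        (by linarith))
      (hM (t - τ) (by rw [abs_le]; constructor <;> linarith) (by linarith) (by linarith)
        (by linarith))
    have hinc' := hinc t (2 * τ) (by linarith) (by linarith) (by linarith) (S.weighted Θ φ)
      (fun g => weighted_nonneg hΘ.nonneg hφ g) (fun g h => hΘ.support g (left_ne_zero_of_mul h)) hf
    have hx : ENNReal.ofReal (lam * R) *
        eLpNorm (fun x => S.sampling t φ x - S.haarSampling t φ x) p (S.ξ.restrict D) ≤
        ENNReal.ofReal ((A₁ * (ε ^ (-(2 * d + a)) * E t) + A₂ * ε ^ θ) * R) * NX φ := by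
      refine hmain.trans ?_
      have e1 : (V.card : ℝ≥0∞) ≤ ENNReal.ofReal (|C₅| * ε ^ (-d)) := by
        rw [← ENNReal.ofReal_natCast]
        refine ENNReal.ofReal_le_ofReal (hVc.trans ?_)
        gcongr
        exact le_abs_self _
      have e2 : (n : ℝ≥0∞) ≤ ENNReal.ofReal (|C₂| * ε ^ (-d)) := by
        rw [← ENNReal.ofReal_natCast]
        refine ENNReal.ofReal_le_ofReal (hn.trans ?_)
        gcongr
        exact le_abs_self _
      have e3 : (1 + Cξ : ℝ≥0∞) = ENNReal.ofReal (1 + Cξ) := by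
        rw [ENNReal.ofReal_add zero_le_one (by positivity)]
        simp
      have e4 : (2 : ℝ≥0∞) = ENNReal.ofReal 2 := by simp
      have e5 : (C₃ : ℝ≥0∞) = ENNReal.ofReal C₃ := by simp
      have e6 : (C₄ : ℝ≥0∞) = ENNReal.ofReal C₄ := by simp
      have e7 : ε ^ (-(2 * d + a)) = ε ^ (-d) * ε ^ (-d) * ε ^ (-a) := by
        rw [← Real.rpow_add hε, ← Real.rpow_add hε]
        congr 1
        ring
      have e8 : (2 * τ) ^ θ = (2 * c) ^ θ * ε ^ θ := by
        rw [← Real.mul_rpow (by positivity) hε.le, hτ, mul_assoc]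
      calc _ ≤ ENNReal.ofReal (1 + Cξ) * (ENNReal.ofReal (|C₅| * ε ^ (-d)) *
            ENNReal.ofReal (|C₂| * ε ^ (-d)) * (ENNReal.ofReal 2 *
            (ENNReal.ofReal (C₁ * (cE * E t) * R * (|C₂| * ε ^ (-a))) * NX φ)) +
            ENNReal.ofReal C₃ * ENNReal.ofReal ((2 * τ) ^ θ) * ENNReal.ofReal R *
            (ENNReal.ofReal C₄ * NX φ)) := by
            rw [e3, ← e4, ← e5, ← e6]
            refine mul_le_mul_right (add_le_add (mul_le_mul_left (mul_le_mul' e1 e2) _) ?_) _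
            exact hinc'.trans (mul_le_mul_right hfq _)
        _ = _ := by
            rw [e8, e7]
            rw [show (A₁ * (ε ^ (-d) * ε ^ (-d) * ε ^ (-a) * E t) + A₂ * ε ^ θ) * R =
              (1 + Cξ) * (|C₅| * ε ^ (-d) * (|C₂| * ε ^ (-d)) *
                (2 * (C₁ * (cE * E t) * R * (|C₂| * ε ^ (-a)))) +
                C₃ * ((2 * c) ^ θ * ε ^ θ) * R * C₄) by rw [hA₁, hA₂]; ring]
            rw [ENNReal.ofReal_mul (p := 1 + (Cξ : ℝ)) (by positivity),
              ENNReal.ofReal_add (q := C₃ * ((2 * c) ^ θ * ε ^ θ) * R * C₄) (by positivity)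
                (by positivity),
              ENNReal.ofReal_mul (p := |C₅| * ε ^ (-d) * (|C₂| * ε ^ (-d))) (by positivity),
              ENNReal.ofReal_mul (p := |C₅| * ε ^ (-d)) (by positivity),
              ENNReal.ofReal_mul (p := 2) (by positivity),
              ENNReal.ofReal_mul (p := C₃ * ((2 * c) ^ θ * ε ^ θ) * R) (by positivity),
              ENNReal.ofReal_mul (p := C₃ * ((2 * c) ^ θ * ε ^ θ)) (by positivity),
              ENNReal.ofReal_mul (p := (C₃ : ℝ)) (by positivity)]
            ring
    refine (le_ofReal_mul_of_mul_le hlam hpos hx).trans ?_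
    gcongr ENNReal.ofReal ?_ * _
    rw [div_mul_eq_mul_div]
    gcongr
    have : 0 ≤ ε ^ (-(2 * d + a)) * E t := by positivity
    have : 0 ≤ ε ^ θ := by positivity
    nlinarith
  have hsmall : ∀ᶠ t in atTop, (E t : ℝ) ≤ 1 ∧ (E t : ℝ) ^ (1 / (θ + (2 * d + a))) < ε₀ := by
    have h1 : Tendsto (fun t => (E t : ℝ)) atTop (𝓝 0) := by
      simpa using NNReal.tendsto_coe.2 hE
    have hexp : 0 < 1 / (θ + (2 * d + a)) := by positivity
    have h2 := h1.rpow_const (p := 1 / (θ + (2 * d + a))) (Or.inr hexp.le)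
    rw [Real.zero_rpow hexp.ne'] at h2
    filter_upwards [h1.eventually (gt_mem_nhds zero_lt_one), h2.eventually (gt_mem_nhds hε₀)]
      with t h3 h4 using ⟨h3.le, h4⟩
  obtain ⟨T₂, hT₂⟩ := eventually_atTop.1 hsmall
  refine ⟨(2 * ((A₁ + A₂) / lam)).toNNReal, max T₂ (max T₁ S.t₀ + 1), fun t ht φ hφ hφD hφN => ?_⟩
  obtain ⟨h1, h2⟩ := hT₂ t ((le_max_left _ _).trans ht)
  refine (le_of_forall_rpow_bound (C := (A₁ + A₂) / lam) (by positivity) (E t).2 h1 hb hθ hδ0 hδ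
    hε₀ h2 hφN.ne (key t ((le_max_right _ _).trans ht) φ hφ hφD hφN)).trans (le_of_eq ?_)
  congr 1
  rw [ENNReal.ofReal_mul (by positivity), ENNReal.coe_mul]
  congr 1
  rw [← ENNReal.ofReal_coe_nnreal, NNReal.coe_rpow]
  rfl

end DualitySetting

/-- A positive constant cannot be bounded by `C ε ^ (-κ)` as `ε → 0` unless `κ ≥ 0`. -/
lemma nonneg_of_eventually_le_rpow {c C κ : ℝ} (hc : 0 < c)
    (h : ∃ᶠ ε in 𝓝[>] (0 : ℝ), c ≤ C * ε ^ (-κ)) : 0 ≤ κ := by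
  by_contra hκ
  push Not at hκ
  have h1 : Tendsto (fun ε : ℝ => C * ε ^ (-κ)) (𝓝[>] 0) (𝓝 (C * 0 ^ (-κ))) :=
    (((Real.continuousAt_rpow_const 0 (-κ) (Or.inr (by linarith))).tendsto).mono_left
      nhdsWithin_le_nhds).const_mul C
  rw [Real.zero_rpow (by linarith), mul_zero] at h1
  obtain ⟨ε, h2, h3⟩ := (h.and_eventually (h1.eventually (gt_mem_nhds hc))).exists
  linarith

namespace DualitySetting

variable {G : Type*} [Group G] [TopologicalSpace G] [IsTopologicalGroup G]
  [LocallyCompactSpace G] [SecondCountableTopology G] [T2Space G]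
  [MeasurableSpace G] [BorelSpace G] {S : DualitySetting G}

lemma hasCovers_of_cover {O O' : ℝ → Set G} {d : ℝ} (hbasis : IsSymmetricBasis O)
    (hcov : ∀ Ω : Set G, IsCompact Ω → ∃ C : ℝ, ∀ ε, 0 < ε → ε < 1 →
      ∃ V : Finset G, Ω ⊆ ⋃ v ∈ V, v • O ε ∧ (V.card : ℝ) ≤ C * ε ^ (-d))
    (hOO' : ∀ ε, O ε ⊆ O' ε) {Ω : Set G} (hΩ : IsCompact Ω) :
    ∃ K : Set G, IsCompact K ∧ Ω ⊆ K ∧ HasCovers Ω K O' d := by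
  obtain ⟨K₁, hK₁, hK₁n⟩ := exists_compact_mem_nhds (1 : G)
  obtain ⟨C, hC⟩ := hcov Ω hΩ
  have h1 := hbasis.2 K₁ hK₁n
  obtain ⟨ε₁, hε₁, h1⟩ := mem_nhdsGT_iff_exists_Ioo_subset.1 h1
  refine ⟨Ω * K₁⁻¹, hΩ.mul hK₁.inv, fun g hg => ⟨g, hg, 1, by simpa using mem_of_mem_nhds hK₁n, by simp⟩,
    C, min ε₁ 1, lt_min hε₁ one_pos, fun ε hε hεε => ?_⟩
  classical
  obtain ⟨V, hV, hVc⟩ := hC ε hε (hεε.trans_le (min_le_right _ _))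
  refine ⟨V.filter fun v => ∃ g ∈ Ω, v⁻¹ * g ∈ O ε, ?_, ?_, ?_⟩
  · intro v hv
    obtain ⟨g, hg, hgv⟩ := (Finset.mem_filter.1 hv).2
    refine ⟨g, hg, (v⁻¹ * g)⁻¹, inv_mem_inv.2 (h1 ⟨hε, hεε.trans_le (min_le_left _ _)⟩ hgv), ?_⟩
    simp
  · intro g hg
    obtain ⟨v, hv, hgv⟩ := mem_iUnion₂.1 (hV hg)
    rw [mem_smul_set_iff_inv_smul_mem] at hgv
    refine mem_iUnion₂.2 ⟨v, Finset.mem_filter.2 ⟨hv, g, hg, hgv⟩, ?_⟩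
    rw [mem_smul_set_iff_inv_smul_mem]
    exact hOO' ε hgv
  · refine le_trans ?_ hVc
    exact_mod_cast Finset.card_filter_le _ _

lemma covering_exponent_nonneg {O : ℝ → Set G} {d : ℝ}
    (hcov : ∀ Ω : Set G, IsCompact Ω → ∃ C : ℝ, ∀ ε, 0 < ε → ε < 1 →
      ∃ V : Finset G, Ω ⊆ ⋃ v ∈ V, v • O ε ∧ (V.card : ℝ) ≤ C * ε ^ (-d)) : 0 ≤ d := by
  obtain ⟨C, hC⟩ := hcov {1} isCompact_singleton
  refine nonneg_of_eventually_le_rpow (C := C) one_pos (Eventually.frequently ?_)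
  filter_upwards [Ioo_mem_nhdsGT one_pos] with ε hε
  obtain ⟨V, hV, hVc⟩ := hC ε hε.1 hε.2
  refine le_trans ?_ hVc
  obtain ⟨v, hv, -⟩ := mem_iUnion₂.1 (hV (mem_singleton 1))
  exact_mod_cast Finset.card_pos.2 ⟨v, hv⟩

lemma closure_perturb {O : ℝ → Set G}
    (hpert : ∃ c : ℝ, 0 < c ∧ ∀ ε, 0 < ε → ε < 1 → ∀ t, S.t₀ ≤ t →
      O ε * S.Gt t * O ε ⊆ S.Gt (t + c * ε)) :
    ∃ c : ℝ, 0 < c ∧ ∀ ε, 0 < ε → ε < 1 → ∀ t, S.t₀ ≤ t →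
      closure (O ε) * S.Gt t * closure (O ε) ⊆ S.Gt (t + c * ε) := by
  obtain ⟨c, hc, h⟩ := hpert
  refine ⟨c, hc, fun ε hε hε1 t ht => ?_⟩
  rintro _ ⟨_, ⟨a, ha, b, hb, rfl⟩, a', ha', rfl⟩
  have hcl : IsClosed (S.Gt (t + c * ε)) :=
    (S.isCompact_Gt _ (by have := mul_pos hc hε; linarith)).isClosed
  have h1 : ∀ a ∈ closure (O ε), ∀ a' ∈ O ε, a * b * a' ∈ S.Gt (t + c * ε) := by
    intro a ha a' ha'
    have := map_mem_closure (f := fun a => a * b * a') (by fun_prop) ha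
      (fun x hx => h ε hε hε1 t ht (mul_mem_mul (mul_mem_mul hx hb) ha'))
    rwa [hcl.closure_eq] at this
  have := map_mem_closure (f := fun a' => a * b * a') (by fun_prop) ha' (fun x hx => h1 a ha x hx)
  rwa [hcl.closure_eq] at this

lemma eLpNorm_periodize_le {Ω : Set G} (hΩ : IsCompact Ω) {q : ℝ≥0∞} (hq : 1 ≤ q) :
    ∃ M : ℝ≥0, ∀ f : G → ℝ, (∀ g, 0 ≤ f g) → (∀ g, f g ≠ 0 → g ∈ Ω) → AEStronglyMeasurable f S.m →
      eLpNorm (periodize S.Γ f) q S.μ ≤ M * eLpNorm f q S.m := by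
  obtain ⟨M, hM⟩ := exists_encard_mul_mem_le (Γ := S.Γ) hΩ
  refine ⟨M, fun f hfnn hfΩ hf => ?_⟩
  have hb : ∀ (g : G) (B : ℝ≥0∞), (∀ γ : S.Γ, ‖f (g * γ)‖ₑ ≤ B) →
      ‖periodize S.Γ f (g : S.Y)‖ₑ ≤ M * B := by
    intro g B hB
    rw [Real.enorm_of_nonneg (periodize_nonneg hfnn _), ofReal_periodize hfnn hΩ hfΩ, periodize_mk]
    have hfin := finite_mul_mem_of_isCompact (Γ := S.Γ) hΩ g
    rw [tsum_eq_sum (s := hfin.toFinset)]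
    · refine (Finset.sum_le_card_nsmul _ _ B fun γ _ => ?_).trans ?_
      · rw [← Real.enorm_of_nonneg (hfnn _)]
        exact hB γ
      · rw [nsmul_eq_mul]
        gcongr
        have := hM g
        rw [hfin.encard_eq_coe_toFinset_card] at this
        exact_mod_cast this
    · intro γ hγ
      have : f (g * γ) = 0 := by_contra fun h => hγ (by simpa using hfΩ _ h)
      simp [this]
  have hq0 : q ≠ 0 := (zero_lt_one.trans_le hq).ne'
  rcases eq_or_ne q ⊤ with rfl | hqt
  · simp only [eLpNorm_exponent_top]
    refine eLpNormEssSup_le_of_ae_enorm_bound ?_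
    rw [S.ae_iff_ae_comp_mk]
    have h1 : ∀ᵐ g : G ∂S.m, ∀ γ : S.Γ, ‖f (g * γ)‖ₑ ≤ eLpNormEssSup f S.m :=
      ae_all_iff.2 fun γ => (S.measurePreserving_mul_right γ).quasiMeasurePreserving.ae
        (ae_le_eLpNormEssSup (f := f))
    filter_upwards [h1] with g hg
    exact hb g _ hg
  · have hqp : 0 < q.toReal := ENNReal.toReal_pos hq0 hqt
    rw [eLpNorm_eq_lintegral_rpow_enorm_toReal hq0 hqt,
      eLpNorm_eq_lintegral_rpow_enorm_toReal hq0 hqt,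
      ← S.lintegral_periodize (f := fun g => ‖f g‖ₑ ^ q.toReal) (hf.enorm.pow_const _)]
    have h2 : ∀ y, ‖periodize S.Γ f y‖ₑ ^ q.toReal ≤
        (M : ℝ≥0∞) ^ q.toReal * periodize S.Γ (fun g => ‖f g‖ₑ ^ q.toReal) y := by
      intro y
      obtain ⟨g, rfl⟩ := QuotientGroup.mk_surjective y
      have h3 := hb g ((periodize S.Γ (fun g => ‖f g‖ₑ ^ q.toReal) (g : S.Y)) ^ (1 / q.toReal)) ?_
      · calc _ ≤ (M * (periodize S.Γ (fun g => ‖f g‖ₑ ^ q.toReal) (g : S.Y)) ^ (1 / q.toReal)) ^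
              q.toReal := ENNReal.rpow_le_rpow h3 hqp.le
          _ = _ := by
            rw [ENNReal.mul_rpow_of_nonneg _ _ hqp.le, ← ENNReal.rpow_mul,
              one_div_mul_cancel hqp.ne', ENNReal.rpow_one]
      · intro γ
        rw [one_div, ENNReal.le_rpow_inv_iff hqp, periodize_mk]
        exact ENNReal.le_tsum (f := fun γ : S.Γ => ‖f (g * γ)‖ₑ ^ q.toReal) γ
    calc (∫⁻ y, ‖periodize S.Γ f y‖ₑ ^ q.toReal ∂S.μ) ^ (1 / q.toReal)
        ≤ ((M : ℝ≥0∞) ^ q.toReal * ∫⁻ y, periodize S.Γ (fun g => ‖f g‖ₑ ^ q.toReal) y ∂S.μ) ^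
            (1 / q.toReal) := by
          refine ENNReal.rpow_le_rpow ?_ (by positivity)
          rw [← lintegral_const_mul' _ _ (ENNReal.rpow_ne_top_of_nonneg hqp.le (by simp))]
          exact lintegral_mono h2
      _ = _ := by
          rw [ENNReal.mul_rpow_of_nonneg _ _ (by positivity), ← ENNReal.rpow_mul,
            mul_one_div_cancel hqp.ne', ENNReal.rpow_one]
          simp

/-- Norm bound for `g ↦ W(g) φ(Hg)` with `W` bounded and supported in a compact set. -/
lemma exists_eLpNorm_weighted_le {D : Set S.X} (hD : IsCompact D) {Ω : Set G} (hΩ : IsCompact Ω)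
    {q : ℝ≥0∞} (hq : 1 ≤ q) (A : ℝ≥0) :
    ∃ C : ℝ≥0, ∀ W : G → ℝ, (∀ g, |W g| ≤ A) → (∀ g, W g ≠ 0 → g ∈ Ω) →
      ∀ φ : S.X → ℝ, (∀ x, x ∉ D → φ x = 0) → AEStronglyMeasurable φ S.ξ →
      eLpNorm (S.weighted W φ) q S.m ≤ C * eLpNorm φ q S.ξ := by
  obtain ⟨C, hC⟩ := S.exists_map_pX_restrict_le hD hΩ
  refine ⟨A * (1 + C), fun W hWA hWΩ φ hφD hφ => ?_⟩
  have hm : MeasurableSet (Ω ∩ S.pX ⁻¹' D) :=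
    hΩ.measurableSet.inter (S.measurable_pX (S.measurableSet_of_isClosed_X hD.isClosed))
  calc eLpNorm (S.weighted W φ) q S.m
      ≤ eLpNorm ((A : ℝ) • (Ω ∩ S.pX ⁻¹' D).indicator fun g => φ (S.pX g)) q S.m := by
        refine eLpNorm_mono fun g => ?_
        by_cases hg : g ∈ Ω ∩ S.pX ⁻¹' D
        · rw [Pi.smul_apply, indicator_of_mem hg, weighted, smul_eq_mul, norm_mul, norm_mul]
          gcongr
          simpa using hWA g
        · have : S.weighted W φ g = 0 := by
            by_contra h
            refine hg ⟨hWΩ g (left_ne_zero_of_mul h), ?_⟩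
            by_contra h'
            exact right_ne_zero_of_mul h (hφD _ h')
          rw [this, norm_zero]
          exact norm_nonneg _
    _ = A * eLpNorm (fun g => φ (S.pX g)) q (S.m.restrict (Ω ∩ S.pX ⁻¹' D)) := by
        rw [eLpNorm_const_smul, eLpNorm_indicator_eq_eLpNorm_restrict hm]
        simp
    _ ≤ A * ((1 + C) * eLpNorm φ q S.ξ) := by
        gcongr
        exact eLpNorm_comp_le_of_map_le S.measurable_pX.aemeasurable hC hq hφ
    _ = _ := by
        push_cast
        ring

lemma exists_isCutoff_indicator {D : Set S.X} (hD : IsCompact D) :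
    ∃ Ω : Set G, IsCompact Ω ∧ ∃ Θ : G → ℝ, (∀ g, |Θ g| ≤ (1 : ℝ≥0)) ∧ ∃ lam, ∀ Ω', Ω ⊆ Ω' →
      IsCutoff D Ω' Θ lam := by
  obtain ⟨K₀, hK₀, hK₀n⟩ := exists_compact_mem_nhds (1 : S.H)
  obtain ⟨K, hK, hKs⟩ := S.bounded_s D hD
  have hDm := S.measurableSet_of_isClosed_X hD.isClosed
  have hfib : Measurable S.fiberPart :=
    Measurable.subtype_mk (measurable_id.mul (S.measurable_s.comp S.measurable_pX).inv)
  set T : Set G := S.fiberPart ⁻¹' K₀ ∩ S.pX ⁻¹' D with hT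
  have hTm : MeasurableSet T := (hfib hK₀.measurableSet).inter (S.measurable_pX hDm)
  refine ⟨Subtype.val '' K₀ * K, (hK₀.image continuous_subtype_val).mul hK, T.indicator 1, ?_,
    (S.ρ K₀⁻¹).toReal, fun Ω' hΩ' => ⟨measurable_one.indicator hTm, ?_, ⟨1, ?_⟩, ?_, ?_, ?_⟩⟩
  · intro g
    by_cases hg : g ∈ T <;> simp [hg]
  · exact fun g => indicator_nonneg (fun _ _ => zero_le_one) g
  · exact fun g => indicator_le_self' (fun _ _ => zero_le_one) g
  · intro g hg
    have hgT : g ∈ T := by_contra fun h => hg (indicator_of_notMem h _)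
    exact hΩ' ⟨_, ⟨_, hgT.1, rfl⟩, _, hKs ⟨_, hgT.2, rfl⟩, S.fiberPart_mul g⟩
  · refine ENNReal.toReal_pos ?_ hK₀.inv.measure_lt_top.ne
    exact (Measure.measure_pos_of_mem_nhds S.ρ (inv_mem_nhds_one S.H hK₀n)).ne'
  · intro g hg
    rw [ENNReal.ofReal_toReal hK₀.inv.measure_lt_top.ne]
    have h1 : ∀ h : S.H, ENNReal.ofReal (T.indicator (1 : G → ℝ) ((h : G)⁻¹ * g)) =
        ((fun h => (S.fiberPart g)⁻¹ * h) ⁻¹' K₀⁻¹).indicator 1 h := by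
      intro h
      have h2 : (h : G)⁻¹ * g ∈ T ↔ h ∈ (fun h => (S.fiberPart g)⁻¹ * h) ⁻¹' K₀⁻¹ := by
        have h3 : S.fiberPart ((h : G)⁻¹ * g) = h⁻¹ * S.fiberPart g := by
          ext
          simp [fiberPart, mul_assoc]
        simp [hT, h3, hg]
      by_cases hh : (h : G)⁻¹ * g ∈ T
      · rw [indicator_of_mem hh, indicator_of_mem (h2.1 hh)]
        simp
      · rw [indicator_of_notMem hh, indicator_of_notMem fun h' => hh (h2.2 h')]
        simp
    simp_rw [h1]
    rw [lintegral_indicator_one (hK₀.inv.measurableSet.preimage (measurable_const_mul _)),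
      measure_preimage_mul]

/-- Splitting a cutoff along a cover of its support by translates of a measurable set. -/
lemma exists_isCellFamily_of_cover {D : Set S.X} {Ω : Set G} {Θ : G → ℝ} {lam : ℝ}
    (hΘ : IsCutoff D Ω Θ lam) {K O : Set G} (hO : MeasurableSet O) {V : Finset G}
    (hVK : ∀ v ∈ V, v ∈ K) (hV : Ω ⊆ ⋃ v ∈ V, v • O) :
    ∃ (W : Fin V.card → G → ℝ) (v : Fin V.card → G), IsCellFamily Θ K O W v := by
  set e := V.equivFin
  set v : Fin V.card → G := fun j => (e.symm j : G)
  set N : G → ℝ := fun g => ∑ j, (v j • O).indicator 1 g with hN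
  have hOm : ∀ j, MeasurableSet (v j • O) := fun j => hO.const_smul (v j)
  have hnn : ∀ j g, (0 : ℝ) ≤ (v j • O).indicator 1 g := fun j g =>
    indicator_nonneg (fun _ _ => zero_le_one) g
  refine ⟨fun j g => Θ g * ((v j • O).indicator 1 g / N g), v, ⟨fun j => ?_, fun j g => ?_,
    fun g => ?_, fun j g hg => ?_, fun j => hVK _ (e.symm j).2⟩⟩
  · exact hΘ.measurable.mul ((measurable_one.indicator (hOm j)).div
      (Finset.measurable_fun_sum _ fun j _ => measurable_one.indicator (hOm j)))
  · exact mul_nonneg (hΘ.nonneg g) (div_nonneg (hnn j g) (Finset.sum_nonneg fun j _ => hnn j g))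
  · rw [← Finset.mul_sum, ← Finset.sum_div]
    rcases eq_or_ne (Θ g) 0 with h | h
    · simp [h]
    · obtain ⟨u, hu, hgu⟩ := mem_iUnion₂.1 (hV (hΘ.support g h))
      have hpos : 0 < N g := by
        refine Finset.sum_pos' (fun j _ => hnn j g) ⟨e ⟨u, hu⟩, Finset.mem_univ _, ?_⟩
        have : g ∈ v (e ⟨u, hu⟩) • O := by simpa [v] using hgu
        rw [indicator_of_mem this]
        exact one_pos
      rw [div_self hpos.ne', mul_one]
  · rw [← smul_eq_mul, ← mem_smul_set_iff_inv_smul_mem]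
    by_contra h
    exact hg (by simp [indicator_of_notMem h])

/-- The bump functions of (HA1) force `κ ≥ 0`, provided that the norm dominates the `L¹`-norm. -/
lemma HA1.bump_exponent_nonneg {O : ℝ → Set G} {CH : (S.H → ℝ) → Prop}
    {NH : Set S.H → Set ((S.H → ℝ) → ℝ≥0∞)} {d κ : ℝ} (h : S.HA1 O CH NH d κ)
    (hNH : ∀ K : Set S.H, IsCompact K → ∀ N ∈ NH K, ∃ C : ℝ≥0, ∀ χ : S.H → ℝ, CH χ →
      tsupport χ ⊆ K → ∫⁻ h, ‖χ h‖ₑ ∂S.ρ ≤ C * N χ) : 0 ≤ κ := by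
  obtain ⟨K, hK, N, hN, C, hb⟩ := h.bump
  obtain ⟨C', hC'⟩ := hNH K hK N hN
  refine nonneg_of_eventually_le_rpow (C := C' * C) one_pos (Eventually.frequently ?_)
  filter_upwards [hb, self_mem_nhdsWithin] with ε hε hε0
  obtain ⟨χ, hχ, hnn, hsupp, -, hint, hNχ⟩ := hε
  have h1 : (1 : ℝ≥0∞) ≤ ENNReal.ofReal (C' * (C * ε ^ (-κ))) := by
    calc (1 : ℝ≥0∞) = ‖∫ h, χ h ∂S.ρ‖ₑ := by simp [hint]
      _ ≤ ∫⁻ h, ‖χ h‖ₑ ∂S.ρ := enorm_integral_le_lintegral_enorm _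
      _ ≤ C' * N χ := hC' χ hχ hsupp
      _ ≤ C' * ENNReal.ofReal (C * ε ^ (-κ)) := by gcongr
      _ = _ := by
        rw [ENNReal.ofReal_mul (p := (C' : ℝ)) (by positivity)]
        simp
  rw [← ENNReal.ofReal_one] at h1
  by_contra hlt
  push Not at hlt
  rw [mul_assoc] at hlt
  exact absurd h1 (not_le.2 ((ENNReal.ofReal_lt_ofReal_iff one_pos).2 hlt))

lemma lintegral_enorm_le_of_forall_notMem {α : Type*} [MeasurableSpace α] {ν : Measure α} {K : Set α}
    {f : α → ℝ} (hf : AEStronglyMeasurable f ν) (hfK : ∀ x, x ∉ K → f x = 0)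
    {q : ℝ≥0∞} (hq : 1 ≤ q) :
    ∫⁻ x, ‖f x‖ₑ ∂ν ≤ (1 + ν K) * eLpNorm f q ν := by
  calc ∫⁻ x, ‖f x‖ₑ ∂ν ≤ ∫⁻ x in K, ‖f x‖ₑ ∂ν := by
        rw [setLIntegral_eq_of_support_subset]
        intro x hx
        by_contra h
        simp [hfK x h] at hx
    _ = eLpNorm f 1 (ν.restrict K) := by rw [eLpNorm_one_eq_lintegral_enorm]
    _ ≤ eLpNorm f q (ν.restrict K) * (ν.restrict K) univ ^
          (1 / (1 : ℝ≥0∞).toReal - 1 / q.toReal) :=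
        eLpNorm_le_eLpNorm_mul_rpow_measure_univ hq hf.restrict
    _ ≤ eLpNorm f q ν * (1 + ν K) := by
        refine mul_le_mul' (eLpNorm_restrict_le f q ν K) ?_
        rw [Measure.restrict_apply_univ]
        have h0 : 1 / q.toReal ≤ 1 := by
          rcases eq_or_ne q ⊤ with rfl | hqt
          · simp
          · have : 1 ≤ q.toReal := by
              rw [← ENNReal.toReal_one]
              exact ENNReal.toReal_mono hqt hq
            rw [div_le_one (by linarith)]
            exact this
        calc ν K ^ (1 / (1 : ℝ≥0∞).toReal - 1 / q.toReal)
            ≤ (1 + ν K) ^ (1 / (1 : ℝ≥0∞).toReal - 1 / q.toReal) := by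
              refine ENNReal.rpow_le_rpow le_add_self ?_
              rw [ENNReal.toReal_one]
              linarith
          _ ≤ (1 + ν K) ^ (1 : ℝ) := by
              refine ENNReal.rpow_le_rpow_of_exponent_le (by simp) ?_
              have : 0 ≤ 1 / q.toReal := by positivity
              rw [ENNReal.toReal_one]
              linarith
          _ = _ := ENNReal.rpow_one _
    _ = _ := mul_comm _ _

theorem exists_dualityBound_lebesgue {p q : ℝ≥0∞} (hp : 1 ≤ p) (hpq : p < q) {E : ℝ → ℝ≥0}
    (hE : Tendsto E atTop (𝓝 0)) (hEadm : CoarselyAdmissible S.t₀ E) (hCA1 : S.CA1) (hCA2 : S.CA2)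
    {O : ℝ → Set G} {d κ : ℝ} (hHA1 : S.HA1 O Continuous (lebesgueNorms q S.ρ) d κ)
    (hMET : S.MeanErgodic p (lebesgueNorms q S.μ) E) {D : Set S.X} (hD : IsCompact D) :
    ∃ Ω : Set G, IsCompact Ω ∧ ∀ θ, 0 < θ → S.HA2' (dualityExponent p q) θ Ω →
      ∀ δ, 0 < δ → δ ≤ θ / (θ + (2 * d + 0)) →
        S.DualityBound p (lebesgueNorms q S.ξ) E δ D := by
  have hq : 1 ≤ q := hp.trans hpq.le
  obtain ⟨Ω₁, hΩ₁, Cξ, hξ⟩ := S.exists_restrict_le_map_pX hD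
  obtain ⟨Ω₀, hΩ₀, Θ, hΘ1, lam, hΘ⟩ := exists_isCutoff_indicator hD
  set Ω := Ω₀ ∪ Ω₁
  have hΩ : IsCompact Ω := hΩ₀.union hΩ₁
  have hΘ := hΘ Ω subset_union_left
  have hd := covering_exponent_nonneg hHA1.cover
  refine ⟨Ω, hΩ, fun θ hθ hHA2 δ hδ0 hδ => ?_⟩
  obtain ⟨K, hK, -, hcov⟩ := hasCovers_of_cover (O' := fun ε => closure (O ε)) hHA1.basis hHA1.cover
    (fun ε => subset_closure) hΩ
  obtain ⟨N, hN, hMET⟩ := hMET _ (hΩ.image S.continuous_mk) K hK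
  obtain rfl : N = lebesgueENorm q S.μ := hN
  rintro N rfl
  obtain ⟨Cw, hCw⟩ := exists_eLpNorm_weighted_le (S := S) hD hΩ hq 1
  obtain ⟨M, hM⟩ := eLpNorm_periodize_le (S := S) hΩ hq
  have hNX : ∀ φ : S.X → ℝ, lebesgueENorm q S.ξ φ < ⊤ →
      AEStronglyMeasurable φ S.ξ ∧ lebesgueENorm q S.ξ φ = eLpNorm φ q S.ξ := by
    intro φ hφ
    unfold lebesgueENorm at hφ ⊢
    split_ifs at hφ ⊢ with h
    · exact ⟨h, rfl⟩
    · simp at hφ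
  have hΘm : ∀ φ : S.X → ℝ, AEStronglyMeasurable φ S.ξ →
      AEStronglyMeasurable (S.weighted Θ φ) S.m := fun φ hφ =>
    hΘ.measurable.aestronglyMeasurable.mul
      (hφ.comp_quasiMeasurePreserving S.quasiMeasurePreserving_pX)
  refine dualityBound_of_cells hp hpq hE hEadm hCA1 hCA2 (O := fun ε => closure (O ε)) ?_
    (closure_perturb hHA1.perturb) hΩ hK hcov ⟨Cξ, hξ.trans ?_⟩ hΘ ⟨Cw, ?_⟩ ?_ hMET hHA2 hθ
    (by linarith) hδ0 hδ
  · intro ε hε hε1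
    rw [inv_closure, (hHA1.basis.1 ε hε hε1.le).2]
  · refine Measure.le_iff.2 fun s hs => ?_
    rw [Measure.smul_apply, Measure.smul_apply, Measure.map_apply S.measurable_pX hs,
      Measure.map_apply S.measurable_pX hs]
    gcongr
    exact subset_union_right
  · intro φ hφ hφD hφN
    obtain ⟨h1, h2⟩ := hNX φ hφN
    refine ⟨hΘm φ h1, ?_⟩
    rw [h2]
    exact hCw Θ hΘ1 hΘ.support φ hφD h1
  · obtain ⟨C, ε₁, hε₁, hcov⟩ := hcov
    refine ⟨max C (M * Cw), ε₁, hε₁, fun ε hε hεε => ?_⟩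
    obtain ⟨V, hVK, hV, hVc⟩ := hcov ε hε hεε
    obtain ⟨W, v, hW⟩ := exists_isCellFamily_of_cover hΘ isClosed_closure.measurableSet hVK hV
    refine ⟨_, W, v, hW, hVc.trans ?_, fun φ hφ hφD hφN j => ?_⟩
    · gcongr
      exact le_max_left _ _
    obtain ⟨h1, h2⟩ := hNX φ hφN
    have hWm := hW.aestronglyMeasurable_weighted (hΘm φ h1) hΘ.measurable j
    have hWs := hW.weighted_support hΘ j φ
    have hWn : ∀ g, 0 ≤ S.weighted (W j) φ g := fun g => weighted_nonneg (hW.nonneg j) hφ g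
    have h3 : AEStronglyMeasurable (periodize S.Γ (S.weighted (W j) φ)) S.μ :=
      (S.aemeasurable_of_comp_mk
        (aestronglyMeasurable_periodize_comp_mk hWn hΩ hWs hWm).aemeasurable).aestronglyMeasurable
    rw [lebesgueENorm, if_pos h3, h2]
    refine (hM _ hWn hWs hWm).trans ?_
    have hW1 : ∀ g, |W j g| ≤ (1 : ℝ≥0) := fun g => by
      rw [abs_of_nonneg (hW.nonneg j g)]
      exact (hW.le j g).trans ((le_abs_self _).trans (hΘ1 g))
    refine (mul_le_mul_right (hCw (W j) hW1 (fun g h => hW.mem_of_ne_zero hΘ h) φ hφD h1) _).trans ?_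
    rw [← mul_assoc]
    gcongr
    rw [neg_zero, Real.rpow_zero, mul_one]
    refine le_trans (le_of_eq ?_) (ENNReal.ofReal_le_ofReal (le_max_right _ _))
    rw [ENNReal.ofReal_mul (by positivity)]
    simp

/-- From the estimate with exponents `δ ≤ θ / (θ + b₀)` to the final form with `b ≥ b₀`. -/
lemma dualityBound_conclusion {p q : ℝ≥0∞} {E : ℝ → ℝ≥0} {b₀ b : ℝ}
    {NX : Set S.X → Set ((S.X → ℝ) → ℝ≥0∞)} (hb₀ : 0 ≤ b₀) (hb : b₀ ≤ b)
    (h : ∀ D : Set S.X, IsCompact D → ∃ Ω : Set G, IsCompact Ω ∧ ∀ θ, 0 < θ →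
      S.HA2' (dualityExponent p q) θ Ω → ∀ δ, 0 < δ → δ ≤ θ / (θ + b₀) →
        S.DualityBound p NX E δ D) :
    (∀ θ : ℝ, 0 < θ →
      (∀ Ω : Set G, IsCompact Ω → S.HA2' (dualityExponent p q) θ Ω) →
      0 < θ / (θ + b) ∧
      ∀ D : Set S.X, IsCompact D → S.DualityBound p NX E (θ / (θ + b)) D) ∧
    ((∀ Ω : Set G, IsCompact Ω → ∃ θ : ℝ, 0 < θ ∧ S.HA2' (dualityExponent p q) θ Ω) →
      ∀ D : Set S.X, IsCompact D → ∃ δ : ℝ, 0 < δ ∧ S.DualityBound p NX E δ D) := by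
  have hb1 : 0 ≤ b := hb₀.trans hb
  refine ⟨fun θ hθ hHA2 => ?_, fun hHA2 D hD => ?_⟩
  · have hpos : 0 < θ / (θ + b) := by positivity
    refine ⟨hpos, fun D hD => ?_⟩
    obtain ⟨Ω, hΩ, h⟩ := h D hD
    exact h θ hθ (hHA2 Ω hΩ) _ hpos (by gcongr)
  · obtain ⟨Ω, hΩ, h⟩ := h D hD
    obtain ⟨θ, hθ, hHA2⟩ := hHA2 Ω hΩ
    exact ⟨θ / (θ + b₀), by positivity, h θ hθ hHA2 _ (by positivity) le_rfl⟩

lemma HA1.bump_exponent_nonneg_lebesgue {O : ℝ → Set G} {q : ℝ≥0∞} (hq : 1 ≤ q) {d κ : ℝ}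
    (h : S.HA1 O Continuous (lebesgueNorms q S.ρ) d κ) : 0 ≤ κ := by
  refine h.bump_exponent_nonneg fun K hK N hN => ?_
  obtain rfl : N = lebesgueENorm q S.ρ := hN
  have hKt := (hK.measure_lt_top (μ := S.ρ)).ne
  refine ⟨1 + (S.ρ K).toNNReal, fun χ hχ hχK => ?_⟩
  rw [lebesgueENorm, if_pos hχ.aestronglyMeasurable]
  refine (lintegral_enorm_le_of_forall_notMem (K := K) hχ.aestronglyMeasurable (fun x hx => ?_) hq).trans ?_
  · exact image_eq_zero_of_notMem_tsupport fun h => hx (hχK h)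
  · rw [ENNReal.coe_add, ENNReal.coe_toNNReal hKt, ENNReal.coe_one]

end DualitySetting

section MultiDeriv

variable {k : ℕ}

lemma ContDiff.partialDeriv {ψ : EuclideanSpace ℝ (Fin k) → ℝ} (h : ContDiff ℝ ∞ ψ) (i : Fin k) :
    ContDiff ℝ ∞ (partialDeriv i ψ) :=
  (h.fderiv_right (m := ∞) (by simp)).clm_apply contDiff_const

lemma HasCompactSupport.partialDeriv {ψ : EuclideanSpace ℝ (Fin k) → ℝ} (h : HasCompactSupport ψ)
    (i : Fin k) : HasCompactSupport (partialDeriv i ψ) :=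
  h.fderiv_apply ℝ _

lemma tsupport_partialDeriv_subset (ψ : EuclideanSpace ℝ (Fin k) → ℝ) (i : Fin k) :
    tsupport (partialDeriv i ψ) ⊆ tsupport ψ :=
  tsupport_fderiv_apply_subset ℝ _

lemma partialDeriv_comm {ψ : EuclideanSpace ℝ (Fin k) → ℝ} (h : ContDiff ℝ ∞ ψ) (i j : Fin k) :
    partialDeriv i (partialDeriv j ψ) = partialDeriv j (partialDeriv i ψ) := by
  ext x
  have hd : ∀ y, DifferentiableAt ℝ (fderiv ℝ ψ) y := fun y =>
    ((h.fderiv_right (m := 1) (by norm_cast)).differentiable one_ne_zero) y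
  have h1 : ∀ a b : Fin k, _root_.partialDeriv a (_root_.partialDeriv b ψ) x =
      fderiv ℝ (fderiv ℝ ψ) x (EuclideanSpace.single a 1) (EuclideanSpace.single b 1) := by
    intro a b
    unfold _root_.partialDeriv
    rw [fderiv_clm_apply (hd x) (by fun_prop)]
    simp
  rw [h1, h1]
  have h2 : IsSymmSndFDerivAt ℝ ψ x := h.contDiffAt.isSymmSndFDerivAt (by
    rw [minSmoothness_of_isRCLikeNormedField]
    norm_cast)
  exact h2 _ _

lemma contDiff_partialDeriv_iterate {ψ : EuclideanSpace ℝ (Fin k) → ℝ} (h : ContDiff ℝ ∞ ψ)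
    (i : Fin k) (a : ℕ) : ContDiff ℝ ∞ ((partialDeriv i)^[a] ψ) := by
  induction a with
  | zero => exact h
  | succ a ih =>
    rw [Function.iterate_succ_apply']
    exact ih.partialDeriv i

lemma partialDeriv_iterate_comm {ψ : EuclideanSpace ℝ (Fin k) → ℝ} (h : ContDiff ℝ ∞ ψ)
    (i b : Fin k) (a : ℕ) :
    (partialDeriv i)^[a] (partialDeriv b ψ) = partialDeriv b ((partialDeriv i)^[a] ψ) := by
  induction a with
  | zero => rfl
  | succ a ih =>
    rw [Function.iterate_succ_apply', ih, Function.iterate_succ_apply',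
      partialDeriv_comm (contDiff_partialDeriv_iterate h i a)]

lemma contDiff_foldr_partialDeriv {ψ : EuclideanSpace ℝ (Fin k) → ℝ} (h : ContDiff ℝ ∞ ψ)
    (s : Fin k → ℕ) (L : List (Fin k)) :
    ContDiff ℝ ∞ (L.foldr (fun i g => (partialDeriv i)^[s i] g) ψ) := by
  induction L with
  | nil => exact h
  | cons i L ih => exact contDiff_partialDeriv_iterate ih i _

lemma ContDiff.multiDeriv {ψ : EuclideanSpace ℝ (Fin k) → ℝ} (h : ContDiff ℝ ∞ ψ)
    (s : Fin k → ℕ) : ContDiff ℝ ∞ (multiDeriv s ψ) :=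
  contDiff_foldr_partialDeriv h s _

lemma HasCompactSupport.multiDeriv {ψ : EuclideanSpace ℝ (Fin k) → ℝ} (h : HasCompactSupport ψ)
    (s : Fin k → ℕ) : HasCompactSupport (multiDeriv s ψ) := by
  have h1 : ∀ (i : Fin k) (a : ℕ) (g : EuclideanSpace ℝ (Fin k) → ℝ), HasCompactSupport g →
      HasCompactSupport ((_root_.partialDeriv i)^[a] g) := by
    intro i a g hg
    induction a with
    | zero => exact hg
    | succ a ih =>
      rw [Function.iterate_succ_apply']
      exact ih.partialDeriv i
  unfold _root_.multiDeriv
  induction List.finRange k with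
  | nil => exact h
  | cons i L ih => exact h1 i _ _ ih

lemma foldr_partialDeriv_add_single {ψ : EuclideanSpace ℝ (Fin k) → ℝ} (h : ContDiff ℝ ∞ ψ)
    (s : Fin k → ℕ) (b : Fin k) (L : List (Fin k)) (hL : L.Nodup) :
    L.foldr (fun i g => (partialDeriv i)^[(s + Pi.single b 1 : Fin k → ℕ) i] g) ψ =
      if b ∈ L then partialDeriv b (L.foldr (fun i g => (partialDeriv i)^[s i] g) ψ)
      else L.foldr (fun i g => (partialDeriv i)^[s i] g) ψ := by
  induction L with
  | nil => simp
  | cons i L ih =>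
    obtain ⟨hi, hL⟩ := List.nodup_cons.1 hL
    have hs := contDiff_foldr_partialDeriv h s L
    rw [List.foldr_cons, ih hL, List.foldr_cons]
    by_cases hbi : b = i
    · subst hbi
      rw [if_neg hi, if_pos (by simp), Pi.add_apply, Pi.single_eq_same,
        Function.iterate_succ_apply']
    · have h1 : (s + Pi.single b 1 : Fin k → ℕ) i = s i := by
        rw [Pi.add_apply, Pi.single_eq_of_ne (Ne.symm hbi), add_zero]
      rw [h1]
      by_cases hb : b ∈ L
      · rw [if_pos hb, if_pos (by simp [hb]), partialDeriv_iterate_comm hs]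
      · rw [if_neg hb, if_neg (by simp [hb, hbi])]

lemma multiDeriv_add_single {ψ : EuclideanSpace ℝ (Fin k) → ℝ} (h : ContDiff ℝ ∞ ψ)
    (s : Fin k → ℕ) (b : Fin k) :
    multiDeriv (s + Pi.single b 1) ψ = partialDeriv b (multiDeriv s ψ) := by
  unfold multiDeriv
  rw [foldr_partialDeriv_add_single h s b _ (List.nodup_finRange k), if_pos (List.mem_finRange b)]

@[simp] lemma multiDeriv_zero (ψ : EuclideanSpace ℝ (Fin k) → ℝ) : multiDeriv 0 ψ = ψ := by
  unfold multiDeriv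
  induction List.finRange k with
  | nil => rfl
  | cons i L ih =>
    rw [List.foldr_cons, ih]
    rfl

lemma multiDeriv_single {ψ : EuclideanSpace ℝ (Fin k) → ℝ} (h : ContDiff ℝ ∞ ψ) (b : Fin k) :
    multiDeriv (Pi.single b 1) ψ = partialDeriv b ψ := by
  have := multiDeriv_add_single h 0 b
  rwa [zero_add, multiDeriv_zero] at this

end MultiDeriv

lemma sum_biUnion_le_sum {ι κ : Type*} [DecidableEq κ] (t : Finset ι) (g : ι → Finset κ)
    (f : κ → ℝ≥0∞) : ∑ x ∈ t.biUnion g, f x ≤ ∑ i ∈ t, ∑ x ∈ g i, f x := by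
  classical
  induction t using Finset.induction_on with
  | empty => simp
  | insert i t hi ih =>
    rw [Finset.biUnion_insert, Finset.sum_insert hi]
    exact (le_self_add.trans_eq Finset.sum_union_inter).trans (by gcongr)

section WeakDeriv

variable {k : ℕ} {u v w : EuclideanSpace ℝ (Fin k) → ℝ} {s : Fin k → ℕ} {b : Fin k}

lemma sum_add_single (s : Fin k → ℕ) (b : Fin k) : ∑ i, (s + Pi.single b 1 : Fin k → ℕ) i = ∑ i, s i + 1 := by
  simp [Finset.sum_add_distrib]

lemma hasWeakDeriv_zero (hu : LocallyIntegrable u) : HasWeakDeriv 0 u u :=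
  ⟨hu, hu, fun ψ _ _ => by simp⟩

lemma hasWeakDeriv_single_iff : HasWeakDeriv (Pi.single b 1) u v ↔
    LocallyIntegrable u ∧ LocallyIntegrable v ∧
    ∀ ψ : EuclideanSpace ℝ (Fin k) → ℝ, ContDiff ℝ ∞ ψ → HasCompactSupport ψ →
      ∫ x, u x * partialDeriv b ψ x = - ∫ x, v x * ψ x := by
  unfold HasWeakDeriv
  refine and_congr Iff.rfl (and_congr Iff.rfl (forall_congr' fun ψ => forall_congr' fun hψ =>
    forall_congr' fun _ => ?_))
  rw [multiDeriv_single hψ]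
  simp

lemma HasWeakDeriv.unique (hv : HasWeakDeriv s u v) (hw : HasWeakDeriv s u w) : v =ᵐ[volume] w := by
  refine ae_eq_of_integral_contDiff_smul_eq hv.2.1 hw.2.1 fun ψ hψ hψc => ?_
  have h1 := hv.2.2 ψ hψ hψc
  rw [hw.2.2 ψ hψ hψc] at h1
  have h2 := mul_left_cancel₀ (pow_ne_zero _ (by norm_num : (-1 : ℝ) ≠ 0)) h1
  simp only [smul_eq_mul, mul_comm (ψ _)]
  exact h2.symm

lemma HasWeakDeriv.weakDerivENorm_eq (hv : HasWeakDeriv s u v) (q : ℝ≥0∞) :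
    weakDerivENorm q s u = eLpNorm v q volume := by
  refine le_antisymm (iInf₂_le v hv) (le_iInf₂ fun w hw => ?_)
  rw [eLpNorm_congr_ae (hv.unique hw)]

lemma exists_hasWeakDeriv_of_lt_top {q : ℝ≥0∞} (h : weakDerivENorm q s u < ⊤) :
    ∃ v, HasWeakDeriv s u v := by
  by_contra! hno
  rw [weakDerivENorm, iInf₂_eq_top.2 fun v hv => absurd hv (hno v)] at h
  exact lt_irrefl _ h

lemma HasWeakDeriv.succ (hv : HasWeakDeriv (Pi.single b 1) u v) (hw : HasWeakDeriv s v w) :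
    HasWeakDeriv (s + Pi.single b 1) u w := by
  refine ⟨hv.1, hw.2.1, fun ψ hψ hψc => ?_⟩
  rw [multiDeriv_add_single hψ,
    (hasWeakDeriv_single_iff.1 hv).2.2 _ (hψ.multiDeriv s) (hψc.multiDeriv s),
    hw.2.2 ψ hψ hψc, sum_add_single, pow_succ]
  ring

lemma HasWeakDeriv.of_succ (hv : HasWeakDeriv (Pi.single b 1) u v)
    (hw : HasWeakDeriv (s + Pi.single b 1) u w) : HasWeakDeriv s v w := by
  refine ⟨hv.2.1, hw.2.1, fun ψ hψ hψc => ?_⟩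
  have h1 := hw.2.2 ψ hψ hψc
  rw [multiDeriv_add_single hψ,
    (hasWeakDeriv_single_iff.1 hv).2.2 _ (hψ.multiDeriv s) (hψc.multiDeriv s),
    sum_add_single, pow_succ] at h1
  linarith

lemma HasWeakDeriv.weakDerivENorm_succ (hv : HasWeakDeriv (Pi.single b 1) u v) (q : ℝ≥0∞)
    (s : Fin k → ℕ) : weakDerivENorm q (s + Pi.single b 1) u = weakDerivENorm q s v := by
  unfold weakDerivENorm
  have : ∀ w, HasWeakDeriv (s + Pi.single b 1) u w ↔ HasWeakDeriv s v w := fun w =>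
    ⟨fun hw => hv.of_succ hw, fun hw => hv.succ hw⟩
  simp_rw [this]

lemma HasWeakDeriv.add {u' v' : EuclideanSpace ℝ (Fin k) → ℝ} (h : HasWeakDeriv s u v)
    (h' : HasWeakDeriv s u' v') : HasWeakDeriv s (u + u') (v + v') := by
  refine ⟨h.1.add h'.1, h.2.1.add h'.2.1, fun ψ hψ hψc => ?_⟩
  have hD := (hψ.multiDeriv s).continuous
  have hDc := hψc.multiDeriv s
  have i1 : ∀ {f g : EuclideanSpace ℝ (Fin k) → ℝ}, LocallyIntegrable f → Continuous g →
      HasCompactSupport g → Integrable fun x => f x * g x := by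
    intro f g hf hg hgc
    have := hf.integrable_smul_right_of_hasCompactSupport hg hgc
    simpa [mul_comm] using this
  simp only [Pi.add_apply, add_mul]
  rw [integral_add (i1 h.1 hD hDc) (i1 h'.1 hD hDc), h.2.2 ψ hψ hψc, h'.2.2 ψ hψ hψc,
    integral_add (i1 h.2.1 hψ.continuous hψc) (i1 h'.2.1 hψ.continuous hψc)]
  ring

lemma weakDerivENorm_add_le {q : ℝ≥0∞} (hq : 1 ≤ q) (s : Fin k → ℕ)
    (u u' : EuclideanSpace ℝ (Fin k) → ℝ) :
    weakDerivENorm q s (u + u') ≤ weakDerivENorm q s u + weakDerivENorm q s u' := by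
  rcases lt_or_eq_of_le (le_top : weakDerivENorm q s u ≤ ⊤) with h | h
  · rcases lt_or_eq_of_le (le_top : weakDerivENorm q s u' ≤ ⊤) with h' | h'
    · obtain ⟨v, hv⟩ := exists_hasWeakDeriv_of_lt_top h
      obtain ⟨v', hv'⟩ := exists_hasWeakDeriv_of_lt_top h'
      rw [(hv.add hv').weakDerivENorm_eq, hv.weakDerivENorm_eq, hv'.weakDerivENorm_eq]
      exact eLpNorm_add_le hv.2.1.aestronglyMeasurable hv'.2.1.aestronglyMeasurable hq
    · simp [h']
  · simp [h]

/-- The multi-indices of order at most `l`. -/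
def multiIndices (k l : ℕ) : Finset (Fin k → ℕ) :=
  (Fintype.piFinset fun _ : Fin k => Finset.range (l + 1)).filter (fun s => ∑ i, s i ≤ l)

lemma mem_multiIndices {l : ℕ} {s : Fin k → ℕ} : s ∈ multiIndices k l ↔ ∑ i, s i ≤ l := by
  unfold multiIndices
  rw [Finset.mem_filter, and_iff_right_iff_imp]
  intro h
  rw [Fintype.mem_piFinset]
  intro i
  rw [Finset.mem_range, Nat.lt_succ_iff]
  exact (Finset.single_le_sum (f := s) (fun _ _ => Nat.zero_le _) (Finset.mem_univ i)).trans h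

lemma sobolevENorm_eq (q : ℝ≥0∞) (l : ℕ) (u : EuclideanSpace ℝ (Fin k) → ℝ) :
    sobolevENorm q l u = ∑ s ∈ multiIndices k l, weakDerivENorm q s u := rfl

lemma weakDerivENorm_le_sobolevENorm {q : ℝ≥0∞} {l : ℕ} (hs : ∑ i, s i ≤ l)
    (u : EuclideanSpace ℝ (Fin k) → ℝ) : weakDerivENorm q s u ≤ sobolevENorm q l u := by
  rw [sobolevENorm_eq]
  exact Finset.single_le_sum (f := fun s => weakDerivENorm q s u) (fun _ _ => zero_le)
    (mem_multiIndices.2 hs)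

lemma sobolevENorm_add_le {q : ℝ≥0∞} (hq : 1 ≤ q) (l : ℕ)
    (u u' : EuclideanSpace ℝ (Fin k) → ℝ) :
    sobolevENorm q l (u + u') ≤ sobolevENorm q l u + sobolevENorm q l u' := by
  simp only [sobolevENorm_eq, ← Finset.sum_add_distrib]
  exact Finset.sum_le_sum fun s _ => weakDerivENorm_add_le hq s u u'

lemma locallyIntegrable_of_sobolevENorm_lt_top {q : ℝ≥0∞} {l : ℕ}
    (h : sobolevENorm q l u < ⊤) : LocallyIntegrable u := by
  obtain ⟨v, hv⟩ := exists_hasWeakDeriv_of_lt_top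
    ((weakDerivENorm_le_sobolevENorm (s := 0) (by simp) u).trans_lt h)
  exact hv.1

lemma eLpNorm_le_sobolevENorm {q : ℝ≥0∞} {l : ℕ} (hu : LocallyIntegrable u) :
    eLpNorm u q volume ≤ sobolevENorm q l u := by
  rw [← (hasWeakDeriv_zero hu).weakDerivENorm_eq]
  exact weakDerivENorm_le_sobolevENorm (by simp) u

lemma sobolevENorm_zero_le {q : ℝ≥0∞} (hu : LocallyIntegrable u) :
    sobolevENorm q 0 u ≤ eLpNorm u q volume := by
  rw [sobolevENorm_eq, ← (hasWeakDeriv_zero hu).weakDerivENorm_eq]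
  refine (Finset.sum_le_sum_of_subset (t := {0}) fun s hs => ?_).trans (by simp)
  rw [mem_multiIndices, Nat.le_zero, Finset.sum_eq_zero_iff] at hs
  rw [Finset.mem_singleton]
  ext i
  exact hs i (Finset.mem_univ i)

lemma sobolevENorm_le_succ (q : ℝ≥0∞) (l : ℕ) (u : EuclideanSpace ℝ (Fin k) → ℝ) :
    sobolevENorm q l u ≤ sobolevENorm q (l + 1) u := by
  rw [sobolevENorm_eq, sobolevENorm_eq]
  refine Finset.sum_le_sum_of_subset fun s hs => ?_
  rw [mem_multiIndices] at hs ⊢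
  omega

lemma sobolevENorm_zero_fun {q : ℝ≥0∞} (l : ℕ) :
    sobolevENorm q l (0 : EuclideanSpace ℝ (Fin k) → ℝ) = 0 := by
  rw [sobolevENorm_eq]
  refine Finset.sum_eq_zero fun s _ => ?_
  have : HasWeakDeriv s (0 : EuclideanSpace ℝ (Fin k) → ℝ) 0 :=
    ⟨locallyIntegrable_zero, locallyIntegrable_zero, fun ψ _ _ => by simp⟩
  rw [this.weakDerivENorm_eq]
  simp

lemma sobolevENorm_sum_le {q : ℝ≥0∞} (hq : 1 ≤ q) (l : ℕ) {ι : Type*} (t : Finset ι)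
    (f : ι → EuclideanSpace ℝ (Fin k) → ℝ) :
    sobolevENorm q l (∑ i ∈ t, f i) ≤ ∑ i ∈ t, sobolevENorm q l (f i) := by
  classical
  induction t using Finset.induction_on with
  | empty => simp [sobolevENorm_zero_fun]
  | insert i t hi ih =>
    rw [Finset.sum_insert hi, Finset.sum_insert hi]
    exact (sobolevENorm_add_le hq l _ _).trans (by gcongr)

lemma exists_weak_partial {q : ℝ≥0∞} {l : ℕ} (h : sobolevENorm q (l + 1) u < ⊤) :
    ∃ v : Fin k → EuclideanSpace ℝ (Fin k) → ℝ, ∀ b, HasWeakDeriv (Pi.single b 1) u (v b) ∧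
      sobolevENorm q l (v b) ≤ sobolevENorm q (l + 1) u := by
  have h1 : ∀ b : Fin k, ∃ v, HasWeakDeriv (Pi.single b 1) u v := fun b =>
    exists_hasWeakDeriv_of_lt_top ((weakDerivENorm_le_sobolevENorm (by simp) u).trans_lt h)
  choose v hv using h1
  refine ⟨v, fun b => ⟨hv b, ?_⟩⟩
  rw [sobolevENorm_eq, sobolevENorm_eq]
  simp_rw [← fun s => (hv b).weakDerivENorm_succ q s]
  rw [← Finset.sum_image (f := fun s => weakDerivENorm q s u) (g := fun s => s + Pi.single b 1)
    (fun s _ s' _ h => add_right_cancel h)]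
  refine Finset.sum_le_sum_of_subset fun s hs => ?_
  obtain ⟨s', hs', rfl⟩ := Finset.mem_image.1 hs
  rw [mem_multiIndices] at hs' ⊢
  rw [sum_add_single]
  omega

lemma sobolevENorm_succ_le {q : ℝ≥0∞} {l : ℕ} (hu : LocallyIntegrable u)
    {v : Fin k → EuclideanSpace ℝ (Fin k) → ℝ} (hv : ∀ b, HasWeakDeriv (Pi.single b 1) u (v b)) :
    sobolevENorm q (l + 1) u ≤ eLpNorm u q volume + ∑ b, sobolevENorm q l (v b) := by
  have hsub : multiIndices k (l + 1) ⊆ {0} ∪ Finset.univ.biUnion fun b =>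
      (multiIndices k l).image fun s => s + Pi.single b 1 := by
    intro s hs
    rw [mem_multiIndices] at hs
    rw [Finset.mem_union, Finset.mem_singleton]
    rcases eq_or_ne s 0 with h | h
    · exact Or.inl h
    · right
      obtain ⟨b, hb⟩ := Function.ne_iff.1 h
      have hsb : (s - Pi.single b 1) + Pi.single b 1 = s := by
        refine tsub_add_cancel_of_le fun i => ?_
        rcases eq_or_ne i b with rfl | hib
        · simpa using Nat.one_le_iff_ne_zero.2 hb
        · simp [Pi.single_eq_of_ne hib]
      refine Finset.mem_biUnion.2 ⟨b, Finset.mem_univ b, Finset.mem_image.2 ⟨_, ?_, hsb⟩⟩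
      rw [mem_multiIndices]
      rw [← hsb, sum_add_single] at hs
      omega
  rw [sobolevENorm_eq]
  refine (Finset.sum_le_sum_of_subset hsub).trans ?_
  refine (le_self_add.trans_eq Finset.sum_union_inter).trans ?_
  refine add_le_add ?_ ?_
  · rw [Finset.sum_singleton, (hasWeakDeriv_zero hu).weakDerivENorm_eq]
  · refine (sum_biUnion_le_sum _ _ _).trans (Finset.sum_le_sum fun b _ => ?_)
    rw [Finset.sum_image fun s _ s' _ h => add_right_cancel h, sobolevENorm_eq]
    exact Finset.sum_le_sum fun s _ => ((hv b).weakDerivENorm_succ q s).le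

end WeakDeriv

section Mollification

variable {V : Type*} [NormedAddCommGroup V] [NormedSpace ℝ V] [FiniteDimensional ℝ V]
  [MeasurableSpace V] [BorelSpace V] {μ : Measure V} [μ.IsAddHaarMeasure]

/-- Convolution with a normed bump function. -/
def mollify (μ : Measure V) (φ : ContDiffBump (0 : V)) (f : V → ℝ) : V → ℝ :=
  convolution (φ.normed μ) f (ContinuousLinearMap.lsmul ℝ ℝ) μ

lemma mollify_apply (φ : ContDiffBump (0 : V)) (f : V → ℝ) (x : V) :
    mollify μ φ f x = ∫ t, φ.normed μ t * f (x - t) ∂μ := rfl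

lemma contDiff_mollify (φ : ContDiffBump (0 : V)) {f : V → ℝ} (hf : LocallyIntegrable f μ) :
    ContDiff ℝ ∞ (mollify μ φ f) := by
  have : ContDiff ℝ ∞ (φ.normed μ) := φ.contDiff_normed
  exact φ.hasCompactSupport_normed.contDiff_convolution_left _ this hf

lemma integrable_normed_mul_sub (φ : ContDiffBump (0 : V)) {f : V → ℝ} (hf : LocallyIntegrable f μ)
    (x : V) : Integrable (fun t => φ.normed μ t * f (x - t)) μ :=
  φ.hasCompactSupport_normed.convolutionExists_left (ContinuousLinearMap.lsmul ℝ ℝ)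
    φ.continuous_normed hf x

lemma lintegral_enorm_mollify_le (φ : ContDiffBump (0 : V)) {f : V → ℝ}
    (hf : AEStronglyMeasurable f μ) :
    ∫⁻ x, ‖mollify μ φ f x‖ₑ ∂μ ≤ ∫⁻ x, ‖f x‖ₑ ∂μ := by
  have hφ : AEStronglyMeasurable (φ.normed μ) μ := φ.continuous_normed.aestronglyMeasurable
  have hm := (hφ.convolution_integrand (ContinuousLinearMap.lsmul ℝ ℝ) hf).enorm
  calc ∫⁻ x, ‖mollify μ φ f x‖ₑ ∂μ
      ≤ ∫⁻ x, ∫⁻ t, ‖φ.normed μ t * f (x - t)‖ₑ ∂μ ∂μ :=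
        lintegral_mono fun x => enorm_integral_le_lintegral_enorm _
    _ = ∫⁻ t, ∫⁻ x, ‖φ.normed μ t * f (x - t)‖ₑ ∂μ ∂μ := lintegral_lintegral_swap hm
    _ = ∫⁻ t, ‖φ.normed μ t‖ₑ * ∫⁻ x, ‖f x‖ₑ ∂μ ∂μ := by
        refine lintegral_congr fun t => ?_
        simp_rw [enorm_mul]
        rw [lintegral_const_mul' _ _ (by simp),
          lintegral_sub_right_eq_self (fun x => ‖f x‖ₑ) t]
    _ = ∫⁻ x, ‖f x‖ₑ ∂μ := by
        rw [lintegral_mul_const'' _ hφ.enorm]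
        have : ∫⁻ t, ‖φ.normed μ t‖ₑ ∂μ = 1 := by
          have h1 := φ.integral_normed (μ := μ)
          have h2 := ofReal_integral_eq_lintegral_ofReal φ.integrable_normed
            (Eventually.of_forall (φ.nonneg_normed (μ := μ)))
          rw [h1, ENNReal.ofReal_one] at h2
          rw [h2]
          exact lintegral_congr fun t => Real.enorm_of_nonneg (φ.nonneg_normed t)
        rw [this, one_mul]

lemma mollify_sub (φ : ContDiffBump (0 : V)) {f g : V → ℝ} (hf : LocallyIntegrable f μ)
    (hg : LocallyIntegrable g μ) : mollify μ φ (f - g) = mollify μ φ f - mollify μ φ g := by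
  ext x
  simp only [mollify_apply, Pi.sub_apply, mul_sub]
  exact integral_sub (integrable_normed_mul_sub φ hf x) (integrable_normed_mul_sub φ hg x)

lemma mollify_congr (φ : ContDiffBump (0 : V)) {f g : V → ℝ} {x : V}
    (h : ∀ y ∈ Metric.ball x φ.rOut, f y = g y) : mollify μ φ f x = mollify μ φ g x := by
  rw [mollify_apply, mollify_apply]
  refine integral_congr_ae (Eventually.of_forall fun t => ?_)
  by_cases ht : t ∈ Metric.ball (0 : V) φ.rOut
  · simp only
    rw [h (x - t) (by simpa using ht)]
  · have : φ.normed μ t = 0 := by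
      rw [← Function.notMem_support, φ.support_normed_eq]
      exact ht
    simp [this]

lemma tendsto_lintegral_mollify_sub_of_continuous {φ : ℕ → ContDiffBump (0 : V)}
    (hφ : Tendsto (fun n => (φ n).rOut) atTop (𝓝 0)) {g : V → ℝ} (hg : Continuous g)
    (hgc : HasCompactSupport g) :
    Tendsto (fun n => ∫⁻ x, ‖mollify μ (φ n) g x - g x‖ₑ ∂μ) atTop (𝓝 0) := by
  set K := Metric.cthickening 1 (tsupport g)
  have hK : IsCompact K := hgc.isCompact.cthickening
  have hKt := hK.measure_lt_top (μ := μ)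
  rw [ENNReal.tendsto_nhds_zero]
  intro ε hε
  obtain ⟨δ, hδ, hδε⟩ : ∃ δ : ℝ, 0 < δ ∧ ENNReal.ofReal δ * μ K ≤ ε := by
    rcases eq_or_ne ε ⊤ with rfl | hε'
    · exact ⟨1, one_pos, le_top⟩
    refine ⟨ε.toReal / ((μ K).toReal + 1), by
      have := ENNReal.toReal_pos hε.ne' hε'; positivity, ?_⟩
    rw [← ENNReal.ofReal_toReal hKt.ne, ← ENNReal.ofReal_mul (by positivity)]
    refine ENNReal.ofReal_le_of_le_toReal ?_
    rw [div_mul_eq_mul_div, div_le_iff₀ (by positivity),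
      ENNReal.toReal_ofReal ENNReal.toReal_nonneg]
    nlinarith [ENNReal.toReal_nonneg (a := ε), ENNReal.toReal_nonneg (a := μ K)]
  obtain ⟨r, hr, hgr⟩ := Metric.uniformContinuous_iff.1 (hgc.uniformContinuous_of_continuous hg) δ hδ
  filter_upwards [hφ.eventually (gt_mem_nhds (lt_min hr one_pos))] with n hn
  have h1 : ∀ x, ‖mollify μ (φ n) g x - g x‖ₑ ≤ K.indicator (fun _ => ENNReal.ofReal δ) x := by
    intro x
    by_cases hx : x ∈ K
    · rw [indicator_of_mem hx, ← edist_eq_enorm_sub, edist_dist]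
      refine ENNReal.ofReal_le_ofReal (ContDiffBump.dist_normed_convolution_le
        hg.aestronglyMeasurable fun y hy => (hgr ?_).le)
      exact (Metric.mem_ball.1 hy).trans (hn.trans_le (min_le_left _ _))
    · rw [indicator_of_notMem hx]
      have h0 : ∀ y ∈ Metric.ball x (φ n).rOut, g y = 0 := by
        intro y hy
        by_contra hgy
        refine hx (Metric.mem_cthickening_of_dist_le x y 1 _ (subset_tsupport g hgy) ?_)
        rw [dist_comm]
        exact ((Metric.mem_ball.1 hy).trans (hn.trans_le (min_le_right _ _))).le
      have h2 : mollify μ (φ n) g x = 0 := by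
        rw [mollify_congr (g := 0) (φ n) h0, mollify_apply]
        simp
      rw [h2, h0 x (Metric.mem_ball_self (φ n).rOut_pos)]
      simp
  calc ∫⁻ x, ‖mollify μ (φ n) g x - g x‖ₑ ∂μ
      ≤ ∫⁻ x, K.indicator (fun _ => ENNReal.ofReal δ) x ∂μ := lintegral_mono h1
    _ = ENNReal.ofReal δ * μ K := by
        rw [lintegral_indicator hK.measurableSet, setLIntegral_const]
    _ ≤ ε := hδε

lemma tendsto_lintegral_mollify_sub_of_integrable {φ : ℕ → ContDiffBump (0 : V)}
    (hφ : Tendsto (fun n => (φ n).rOut) atTop (𝓝 0)) {f : V → ℝ} (hf : Integrable f μ) :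
    Tendsto (fun n => ∫⁻ x, ‖mollify μ (φ n) f x - f x‖ₑ ∂μ) atTop (𝓝 0) := by
  rw [ENNReal.tendsto_nhds_zero]
  intro ε hε
  obtain ⟨δ, hδ, hδε⟩ : ∃ δ : ℝ, 0 < δ ∧ ENNReal.ofReal δ + ENNReal.ofReal δ ≤ ε / 2 := by
    rcases eq_or_ne ε ⊤ with rfl | hε'
    · exact ⟨1, one_pos, by simp [ENNReal.top_div_of_ne_top]⟩
    refine ⟨(ε / 2 / 2).toReal, ENNReal.toReal_pos (by simp [hε.ne']) (by finiteness), ?_⟩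
    rw [ENNReal.ofReal_toReal (by finiteness), ENNReal.add_halves]
  obtain ⟨g, hgc, hfg, hg, hgi⟩ := hf.exists_hasCompactSupport_integral_sub_le hδ
  have hfg' : ∫⁻ x, ‖(f - g) x‖ₑ ∂μ ≤ ENNReal.ofReal δ := by
    rw [← ofReal_integral_norm_eq_lintegral_enorm (hf.sub hgi)]
    exact ENNReal.ofReal_le_ofReal hfg
  filter_upwards [ENNReal.tendsto_nhds_zero.1 (tendsto_lintegral_mollify_sub_of_continuous (μ := μ)
    hφ hg hgc) (ε / 2) (by simpa using hε.ne')] with n hn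
  have hsub := mollify_sub (φ n) hf.locallyIntegrable hgi.locallyIntegrable
  have h1 : ∀ x, ‖mollify μ (φ n) f x - f x‖ₑ ≤
      ‖mollify μ (φ n) (f - g) x‖ₑ + (‖mollify μ (φ n) g x - g x‖ₑ + ‖(f - g) x‖ₑ) := by
    intro x
    have e : mollify μ (φ n) f x - f x =
        mollify μ (φ n) (f - g) x + ((mollify μ (φ n) g x - g x) - (f - g) x) := by
      rw [hsub]
      simp only [Pi.sub_apply]
      ring
    rw [e]
    refine (enorm_add_le _ _).trans (add_le_add le_rfl ?_)
    exact enorm_sub_le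
  have hmg : Continuous (mollify μ (φ n) g) :=
    (contDiff_mollify (φ n) hgi.locallyIntegrable).continuous
  have hmfg : Continuous (mollify μ (φ n) (f - g)) :=
    (contDiff_mollify (φ n) (hf.sub hgi).locallyIntegrable).continuous
  calc ∫⁻ x, ‖mollify μ (φ n) f x - f x‖ₑ ∂μ
      ≤ ∫⁻ x, (‖mollify μ (φ n) (f - g) x‖ₑ +
          (‖mollify μ (φ n) g x - g x‖ₑ + ‖(f - g) x‖ₑ)) ∂μ := lintegral_mono h1
    _ = ∫⁻ x, ‖mollify μ (φ n) (f - g) x‖ₑ ∂μ +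
          (∫⁻ x, ‖mollify μ (φ n) g x - g x‖ₑ ∂μ + ∫⁻ x, ‖(f - g) x‖ₑ ∂μ) := by
        have hm := (hmg.sub hg).enorm.measurable
        simp only [Pi.sub_apply] at hm
        rw [lintegral_add_left hmfg.enorm.measurable, lintegral_add_left
          (f := fun x => ‖mollify μ (φ n) g x - g x‖ₑ) hm]
    _ ≤ ENNReal.ofReal δ + (ε / 2 + ENNReal.ofReal δ) := by
        gcongr
        exact (lintegral_enorm_mollify_le (φ n) (hf.sub hgi).aestronglyMeasurable).trans hfg'
    _ = (ENNReal.ofReal δ + ENNReal.ofReal δ) + ε / 2 := by ring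
    _ ≤ ε := by
        exact (add_le_add_left hδε _).trans_eq (ENNReal.add_halves ε)

lemma tendsto_setLIntegral_mollify_sub {φ : ℕ → ContDiffBump (0 : V)}
    (hφ : Tendsto (fun n => (φ n).rOut) atTop (𝓝 0)) {f : V → ℝ} (hf : LocallyIntegrable f μ)
    {K : Set V} (hK : IsCompact K) :
    Tendsto (fun n => ∫⁻ x in K, ‖mollify μ (φ n) f x - f x‖ₑ ∂μ) atTop (𝓝 0) := by
  set K' := Metric.cthickening 1 K
  have hK' : IsCompact K' := hK.cthickening
  have hi : Integrable (K'.indicator f) μ :=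
    (integrable_indicator_iff hK'.measurableSet).2 (hf.integrableOn_isCompact hK')
  refine tendsto_of_tendsto_of_tendsto_of_le_of_le' tendsto_const_nhds
    (tendsto_lintegral_mollify_sub_of_integrable hφ hi) (Eventually.of_forall fun _ => zero_le) ?_
  filter_upwards [hφ.eventually (gt_mem_nhds one_pos)] with n hn
  refine le_trans (le_of_eq ?_) (setLIntegral_le_lintegral K _)
  refine setLIntegral_congr_fun hK.measurableSet fun x hx => ?_
  have h1 : ∀ y ∈ Metric.ball x (φ n).rOut, f y = K'.indicator f y := fun y hy => by
    rw [indicator_of_mem (Metric.mem_cthickening_of_dist_le y x 1 _ hx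
      ((Metric.mem_ball.1 hy).trans hn).le)]
  rw [mollify_congr (φ n) h1, h1 x (Metric.mem_ball_self (φ n).rOut_pos)]

variable (V) in
/-- A sequence of bump functions with radii tending to zero. -/
def bumpSeq (n : ℕ) : ContDiffBump (0 : V) :=
  ⟨1 / (n + 1) / 2, 1 / (n + 1), by positivity, half_lt_self (by positivity)⟩

lemma tendsto_bumpSeq_rOut : Tendsto (fun n => (bumpSeq V n).rOut) atTop (𝓝 0) :=
  tendsto_one_div_add_atTop_nhds_zero_nat

end Mollification

lemma partialDeriv_mollify {k : ℕ} {u v : EuclideanSpace ℝ (Fin k) → ℝ} {b : Fin k}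
    (h : HasWeakDeriv (Pi.single b 1) u v) (φ : ContDiffBump (0 : EuclideanSpace ℝ (Fin k))) :
    partialDeriv b (mollify volume φ u) = mollify volume φ v := by
  obtain ⟨hu, hv, hweak⟩ := hasWeakDeriv_single_iff.1 h
  ext x
  have hφ : ContDiff ℝ ∞ (φ.normed (volume : Measure (EuclideanSpace ℝ (Fin k)))) :=
    φ.contDiff_normed
  have hφ1 : ContDiff ℝ 1 (φ.normed (volume : Measure (EuclideanSpace ℝ (Fin k)))) :=
    φ.contDiff_normed
  have h1 : HasFDerivAt (mollify volume φ u) _ x :=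
    φ.hasCompactSupport_normed.hasFDerivAt_convolution_left
      (ContinuousLinearMap.lsmul ℝ ℝ) hφ1 hu x
  set φ' := φ.normed (volume : Measure (EuclideanSpace ℝ (Fin k))) with hφ'
  have hex := (φ.hasCompactSupport_normed (μ := volume)).fderiv (𝕜 := ℝ) |>.convolutionExists_left
    (ContinuousLinearMap.precompL (EuclideanSpace ℝ (Fin k)) (ContinuousLinearMap.lsmul ℝ ℝ))
    (hφ1.continuous_fderiv one_ne_zero) hu x
  have h2 : partialDeriv b (mollify volume φ u) x =
      ∫ t, partialDeriv b φ' t * u (x - t) := by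
    rw [partialDeriv, h1.fderiv, convolution_def, ContinuousLinearMap.integral_apply hex]
    rfl
  have h3 : ∀ y, partialDeriv b (fun y => φ' (x - y)) y = - partialDeriv b φ' (x - y) := by
    intro y
    have hd : HasFDerivAt φ' (fderiv ℝ φ' (x - y)) (x - y) :=
      (hφ1.differentiable one_ne_zero (x - y)).hasFDerivAt
    have : HasFDerivAt (fun y => φ' (x - y)) _ y := hd.comp y ((hasFDerivAt_id y).const_sub x)
    rw [partialDeriv, this.fderiv, partialDeriv]
    simp
  have h4 := hweak (fun y => φ' (x - y)) (hφ.comp (contDiff_const.sub contDiff_id)) (by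
    have := (φ.hasCompactSupport_normed (μ := volume)).comp_homeomorph (Homeomorph.subLeft x)
    exact this)
  have h5 : ∫ t, partialDeriv b φ' t * u (x - t) = ∫ y, partialDeriv b φ' (x - y) * u y := by
    rw [← integral_sub_left_eq_self (fun t => partialDeriv b φ' t * u (x - t)) volume x]
    simp only [sub_sub_cancel]
  have h6 : ∫ t, φ' t * v (x - t) = ∫ y, φ' (x - y) * v y := by
    rw [← integral_sub_left_eq_self (fun t => φ' t * v (x - t)) volume x]
    simp only [sub_sub_cancel]
  rw [h2, mollify_apply, h5, h6]
  simp only [h3, mul_neg, integral_neg, neg_inj] at h4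
  simpa only [mul_comm] using h4

section CompBounds

variable {α β : Type*} [MeasurableSpace α] [MeasurableSpace β] {μ : Measure α} {ν : Measure β}

lemma map_restrict_le_restrict {P : α → β} (hP : Measurable P) {K : Set α}
    {L : Set β} (hL : MeasurableSet L) (hKL : MapsTo P K L) {c : ℝ≥0}
    (h : (μ.restrict K).map P ≤ c • ν) : (μ.restrict K).map P ≤ c • ν.restrict L := by
  refine Measure.le_iff.2 fun A hA => ?_
  have h1 : (μ.restrict K).map P A = (μ.restrict K).map P (A ∩ L) := by
    rw [Measure.map_apply hP hA, Measure.map_apply hP (hA.inter hL),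
      Measure.restrict_apply (hP hA), Measure.restrict_apply (hP (hA.inter hL))]
    congr 1
    ext x
    constructor
    · exact fun hx => ⟨⟨hx.1, hKL hx.2⟩, hx.2⟩
    · exact fun hx => ⟨hx.1.1, hx.2⟩
  rw [h1, Measure.smul_apply, Measure.restrict_apply hA]
  exact h _

end CompBounds

section ChainRule

variable {n j : ℕ} {P : EuclideanSpace ℝ (Fin n) → EuclideanSpace ℝ (Fin j)}
  {K : Set (EuclideanSpace ℝ (Fin n))} {c : ℝ≥0}

lemma integrableOn_comp_of_map_le (hP : Continuous P) (hK : IsCompact K)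
    (hmap : (volume.restrict K).map P ≤ c • volume) {u : EuclideanSpace ℝ (Fin j) → ℝ}
    (hu : LocallyIntegrable u) : IntegrableOn (fun x => u (P x)) K := by
  have h1 := map_restrict_le_restrict hP.measurable
    (hK.image hP).measurableSet (mapsTo_image P K) hmap
  have h2 : Integrable u (volume.restrict (P '' K)) := hu.integrableOn_isCompact (hK.image hP)
  have h3 : Integrable u ((volume.restrict K).map P) :=
    (h2.smul_measure_nnreal (c := c)).mono_measure h1
  exact (integrable_map_measure h3.aestronglyMeasurable hP.measurable.aemeasurable).1 h3

lemma integrable_mul_comp (hP : Continuous P) (hK : IsCompact K)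
    (hmap : (volume.restrict K).map P ≤ c • volume) {u : EuclideanSpace ℝ (Fin j) → ℝ}
    (hu : LocallyIntegrable u) {α : EuclideanSpace ℝ (Fin n) → ℝ} (hα : Continuous α)
    (hαK : ∀ x, x ∉ K → α x = 0) : Integrable fun x => α x * u (P x) := by
  refine (integrableOn_iff_integrable_of_support_subset (s := K) fun x hx => ?_).1
    ((integrableOn_comp_of_map_le hP hK hmap hu).continuousOn_mul hα.continuousOn hK)
  by_contra h
  exact hx (by simp [hαK x h])

lemma setLIntegral_comp_le (hP : Continuous P) (hK : IsCompact K)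
    (hmap : (volume.restrict K).map P ≤ c • volume) {f : EuclideanSpace ℝ (Fin j) → ℝ≥0∞}
    (hf : AEMeasurable f) : ∫⁻ x in K, f (P x) ≤ c * ∫⁻ y in P '' K, f y := by
  have h1 := map_restrict_le_restrict hP.measurable
    (hK.image hP).measurableSet (mapsTo_image P K) hmap
  have h2 : (volume.restrict K).map P ≪ volume :=
    (Measure.absolutelyContinuous_of_le hmap).trans Measure.smul_absolutelyContinuous
  rw [← lintegral_map' (hf.mono_ac h2) hP.measurable.aemeasurable]
  refine (lintegral_mono' h1 le_rfl).trans_eq ?_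
  rw [lintegral_smul_measure]
  rfl

lemma tendsto_integral_mul_comp_mollify (hP : Continuous P) (hK : IsCompact K)
    (hmap : (volume.restrict K).map P ≤ c • volume) {u : EuclideanSpace ℝ (Fin j) → ℝ}
    (hu : LocallyIntegrable u) {α : EuclideanSpace ℝ (Fin n) → ℝ} (hα : Continuous α)
    (hαK : ∀ x, x ∉ K → α x = 0) :
    Tendsto (fun i => ∫ x, α x * mollify volume (bumpSeq _ i) u (P x)) atTop
      (𝓝 (∫ x, α x * u (P x))) := by
  have hmu : ∀ i, Continuous (mollify volume (bumpSeq (EuclideanSpace ℝ (Fin j)) i) u) := fun i =>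
    (contDiff_mollify _ hu).continuous
  obtain ⟨A, hA⟩ := hK.exists_bound_of_continuousOn hα.continuousOn
  have hA' : ∀ x, ‖α x‖ₑ ≤ K.indicator (fun _ => ENNReal.ofReal A) x := by
    intro x
    by_cases hx : x ∈ K
    · rw [indicator_of_mem hx, ← ofReal_norm]
      exact ENNReal.ofReal_le_ofReal (hA x hx)
    · rw [indicator_of_notMem hx, hαK x hx]
      simp
  have hlim := tendsto_setLIntegral_mollify_sub (μ := volume)
    (tendsto_bumpSeq_rOut (V := EuclideanSpace ℝ (Fin j))) hu (hK.image hP)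
  refine tendsto_integral_of_L1 _ (integrable_mul_comp hP hK hmap hu hα hαK).aestronglyMeasurable
    (Eventually.of_forall fun i =>
      integrable_mul_comp hP hK hmap (hmu i).locallyIntegrable hα hαK) ?_
  have hlim2 : Tendsto (fun i => ENNReal.ofReal A * (c * ∫⁻ y in P '' K,
      ‖mollify volume (bumpSeq _ i) u y - u y‖ₑ)) atTop (𝓝 0) := by
    have := ENNReal.Tendsto.const_mul (a := ENNReal.ofReal A * c) hlim (Or.inr (by finiteness))
    simpa [mul_assoc] using this
  refine tendsto_of_tendsto_of_tendsto_of_le_of_le tendsto_const_nhds hlim2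
    (fun _ => zero_le) fun i => ?_
  calc ∫⁻ x, ‖α x * mollify volume (bumpSeq _ i) u (P x) - α x * u (P x)‖ₑ
      ≤ ∫⁻ x, K.indicator (fun x => ENNReal.ofReal A *
          ‖mollify volume (bumpSeq _ i) u (P x) - u (P x)‖ₑ) x := by
        refine lintegral_mono fun x => ?_
        simp only
        rw [← mul_sub, enorm_mul]
        have := hA' x
        by_cases hx : x ∈ K
        · rw [indicator_of_mem hx] at this ⊢
          gcongr
        · rw [indicator_of_notMem hx] at this ⊢
          simp [le_antisymm this zero_le]
    _ = ENNReal.ofReal A * ∫⁻ x in K, ‖mollify volume (bumpSeq _ i) u (P x) - u (P x)‖ₑ := by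
        rw [lintegral_indicator hK.measurableSet, lintegral_const_mul' _ _ (by finiteness)]
    _ ≤ _ := by
        gcongr
        exact setLIntegral_comp_le hP hK hmap
          (f := fun y => ‖mollify volume (bumpSeq _ i) u y - u y‖ₑ)
          (((hmu i).aestronglyMeasurable.sub hu.aestronglyMeasurable).enorm)

lemma partialDeriv_comp {f : EuclideanSpace ℝ (Fin j) → ℝ} (hf : ContDiff ℝ ∞ f)
    (hP : ContDiff ℝ ∞ P) (a : Fin n) (x : EuclideanSpace ℝ (Fin n)) :
    partialDeriv a (fun x => f (P x)) x =
      ∑ b, partialDeriv a (fun x => P x b) x * partialDeriv b f (P x) := by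
  have hfd : DifferentiableAt ℝ f (P x) := hf.differentiable (by simp) _
  have hPd : DifferentiableAt ℝ P x := hP.differentiable (by simp) _
  have h1 : fderiv ℝ (fun x => f (P x)) x = (fderiv ℝ f (P x)).comp (fderiv ℝ P x) :=
    fderiv_comp x hfd hPd
  have h2 : ∀ b, partialDeriv a (fun x => P x b) x =
      (fderiv ℝ P x (EuclideanSpace.single a 1)) b := by
    intro b
    have h3 : HasFDerivAt (fun x => P x b)
        ((EuclideanSpace.proj b : EuclideanSpace ℝ (Fin j) →L[ℝ] ℝ).comp (fderiv ℝ P x)) x :=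
      (EuclideanSpace.proj b : EuclideanSpace ℝ (Fin j) →L[ℝ] ℝ).hasFDerivAt.comp x
        hPd.hasFDerivAt
    rw [partialDeriv, h3.fderiv]
    rfl
  rw [partialDeriv, h1, ContinuousLinearMap.comp_apply]
  set w := fderiv ℝ P x (EuclideanSpace.single a 1) with hw
  have h4 : w = ∑ b, w b • EuclideanSpace.single b (1 : ℝ) := by
    ext i
    simp [Finset.sum_apply, Pi.single_apply]
  conv_lhs => rw [h4]
  rw [map_sum]
  refine Finset.sum_congr rfl fun b _ => ?_
  rw [map_smul, smul_eq_mul, h2 b]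
  rfl

lemma partialDeriv_mul {f g : EuclideanSpace ℝ (Fin n) → ℝ} (hf : ContDiff ℝ ∞ f)
    (hg : ContDiff ℝ ∞ g) (a : Fin n) (x : EuclideanSpace ℝ (Fin n)) :
    partialDeriv a (fun x => f x * g x) x = partialDeriv a f x * g x + f x * partialDeriv a g x := by
  rw [partialDeriv, fderiv_fun_mul (hf.differentiable (by simp) _) (hg.differentiable (by simp) _)]
  simp only [add_apply, smul_apply, smul_eq_mul,
    partialDeriv]
  ring

lemma contDiff_coord (hP : ContDiff ℝ ∞ P) (b : Fin j) : ContDiff ℝ ∞ fun x => P x b :=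
  (EuclideanSpace.proj b : EuclideanSpace ℝ (Fin j) →L[ℝ] ℝ).contDiff.comp hP

theorem HasWeakDeriv.mul_comp (hP : ContDiff ℝ ∞ P) (hK : IsCompact K)
    (hmap : (volume.restrict K).map P ≤ c • volume) {W : EuclideanSpace ℝ (Fin n) → ℝ}
    (hW : ContDiff ℝ ∞ W) (hWK : tsupport W ⊆ K) {u : EuclideanSpace ℝ (Fin j) → ℝ}
    (hu : LocallyIntegrable u) {v : Fin j → EuclideanSpace ℝ (Fin j) → ℝ}
    (hv : ∀ b, HasWeakDeriv (Pi.single b 1) u (v b)) (a : Fin n) :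
    HasWeakDeriv (Pi.single a 1) (fun x => W x * u (P x)) (fun x =>
      partialDeriv a W x * u (P x) +
        ∑ b, W x * partialDeriv a (fun x => P x b) x * v b (P x)) := by
  have hPc := hP.continuous
  have hPb : ∀ b, ContDiff ℝ ∞ (partialDeriv a fun x => P x b) := fun b =>
    (contDiff_coord hP b).partialDeriv a
  have hW0 : ∀ x, x ∉ K → W x = 0 := fun x hx =>
    image_eq_zero_of_notMem_tsupport fun h => hx (hWK h)
  have hW0' : ∀ x, x ∉ K → partialDeriv a W x = 0 := fun x hx =>
    image_eq_zero_of_notMem_tsupport fun h => hx (hWK (tsupport_partialDeriv_subset W a h))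
  have i1 := integrable_mul_comp hPc hK hmap hu hW.continuous hW0
  have i2 := integrable_mul_comp hPc hK hmap hu (hW.partialDeriv a).continuous hW0'
  have i3 : ∀ b, Integrable fun x => W x * partialDeriv a (fun x => P x b) x * v b (P x) :=
    fun b => integrable_mul_comp hPc hK hmap (hv b).2.1
      (hW.continuous.mul (hPb b).continuous) (fun x hx => by simp [hW0 x hx])
  refine hasWeakDeriv_single_iff.2 ⟨i1.locallyIntegrable,
    (i2.add (integrable_finsetSum _ fun b _ => i3 b)).locallyIntegrable, fun ψ hψ hψc => ?_⟩
  set α₀ : EuclideanSpace ℝ (Fin n) → ℝ := fun x => W x * partialDeriv a ψ x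
  set α₁ : EuclideanSpace ℝ (Fin n) → ℝ := fun x => partialDeriv a W x * ψ x
  set β : Fin j → EuclideanSpace ℝ (Fin n) → ℝ := fun b x =>
    W x * partialDeriv a (fun x => P x b) x * ψ x
  have c0 : Continuous α₀ := hW.continuous.mul (hψ.partialDeriv a).continuous
  have c1 : Continuous α₁ := (hW.partialDeriv a).continuous.mul hψ.continuous
  have cβ : ∀ b, Continuous (β b) := fun b =>
    (hW.continuous.mul (hPb b).continuous).mul hψ.continuous
  have z0 : ∀ x, x ∉ K → α₀ x = 0 := fun x hx => by simp [α₀, hW0 x hx]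
  have z1 : ∀ x, x ∉ K → α₁ x = 0 := fun x hx => by simp [α₁, hW0' x hx]
  have zβ : ∀ b x, x ∉ K → β b x = 0 := fun b x hx => by simp [β, hW0 x hx]
  have key : ∀ i, ∫ x, α₀ x * mollify volume (bumpSeq _ i) u (P x) =
      - ((∫ x, α₁ x * mollify volume (bumpSeq _ i) u (P x)) +
        ∑ b, ∫ x, β b x * mollify volume (bumpSeq _ i) (v b) (P x)) := by
    intro i
    set ui := mollify volume (bumpSeq (EuclideanSpace ℝ (Fin j)) i) u with hui
    have hus : ContDiff ℝ ∞ ui := contDiff_mollify _ hu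
    set g : EuclideanSpace ℝ (Fin n) → ℝ := fun x => W x * ui (P x) with hg
    have huP : ContDiff ℝ ∞ fun x => ui (P x) := hus.comp hP
    have hgs : ContDiff ℝ ∞ g := hW.mul huP
    have hgc : HasCompactSupport g :=
      HasCompactSupport.intro hK fun x hx => by simp [hg, hW0 x hx]
    have hgd : ∀ x, partialDeriv a g x = partialDeriv a W x * ui (P x) +
        ∑ b, W x * partialDeriv a (fun x => P x b) x *
          mollify volume (bumpSeq _ i) (v b) (P x) := by
      intro x
      rw [hg, partialDeriv_mul hW huP, partialDeriv_comp hus hP, Finset.mul_sum]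
      congr 1
      refine Finset.sum_congr rfl fun b _ => ?_
      rw [hui, partialDeriv_mollify (hv b)]
      ring
    have hibp := integral_mul_fderiv_eq_neg_fderiv_mul_of_integrable (μ := volume)
      (v := EuclideanSpace.single a (1 : ℝ)) (f := g) (g := ψ)
      (((hgs.partialDeriv a).continuous.mul hψ.continuous).integrable_of_hasCompactSupport
        hψc.mul_left)
      ((hgs.continuous.mul (hψ.partialDeriv a).continuous).integrable_of_hasCompactSupport
        hgc.mul_right)
      ((hgs.continuous.mul hψ.continuous).integrable_of_hasCompactSupport hgc.mul_right)
      (fun x _ => hgs.differentiable (by simp) x) (fun x _ => hψ.differentiable (by simp) x)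
    have e0 : ∫ x, α₀ x * ui (P x) = ∫ x, g x * fderiv ℝ ψ x (EuclideanSpace.single a 1) := by
      congr 1
      ext x
      simp only [α₀, g, partialDeriv]
      ring
    rw [e0, hibp]
    congr 1
    have i4 : ∀ b, Integrable fun x => β b x * mollify volume (bumpSeq _ i) (v b) (P x) := fun b =>
      integrable_mul_comp hPc hK hmap
        (contDiff_mollify _ (hv b).2.1).continuous.locallyIntegrable (cβ b) (zβ b)
    rw [← integral_finsetSum _ fun b _ => i4 b, ← integral_add
      (integrable_mul_comp hPc hK hmap hus.continuous.locallyIntegrable c1 z1)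
      (integrable_finsetSum _ fun b _ => i4 b)]
    congr 1
    ext x
    change partialDeriv a g x * ψ x = _
    rw [hgd, add_mul, Finset.sum_mul]
    simp only [α₁, β]
    congr 1
    · ring
    · exact Finset.sum_congr rfl fun b _ => by ring
  have t0 := tendsto_integral_mul_comp_mollify hPc hK hmap hu c0 z0
  have t1 := ((tendsto_integral_mul_comp_mollify hPc hK hmap hu c1 z1).add
    (tendsto_finsetSum Finset.univ fun b _ =>
      tendsto_integral_mul_comp_mollify hPc hK hmap (hv b).2.1 (cβ b) (zβ b))).neg
  have hfin := tendsto_nhds_unique t0 (t1.congr fun i => (key i).symm)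
  have e1 : ∫ x, W x * u (P x) * partialDeriv a ψ x = ∫ x, α₀ x * u (P x) := by
    congr 1
    ext x
    simp only [α₀]
    ring
  rw [e1, hfin]
  congr 1
  have i5 : ∀ b, Integrable fun x => β b x * v b (P x) := fun b =>
    integrable_mul_comp hPc hK hmap (hv b).2.1 (cβ b) (zβ b)
  rw [← integral_finsetSum _ fun b _ => i5 b, ← integral_add
    (integrable_mul_comp hPc hK hmap hu c1 z1) (integrable_finsetSum _ fun b _ => i5 b)]
  congr 1
  ext x
  rw [add_mul, Finset.sum_mul]
  simp only [α₁, β]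
  congr 1
  · ring
  · exact Finset.sum_congr rfl fun b _ => by ring

end ChainRule

/-- All derivatives of `W` of order at most `l` are bounded by `M`. -/
def DerivBound {n : ℕ} (l : ℕ) (M : ℝ≥0) (W : EuclideanSpace ℝ (Fin n) → ℝ) : Prop :=
  ∀ i ≤ l, ∀ x, ‖iteratedFDeriv ℝ i W x‖ ≤ M

section DerivBound

variable {n l : ℕ} {M : ℝ≥0} {W : EuclideanSpace ℝ (Fin n) → ℝ}

lemma DerivBound.mono {l' : ℕ} (h : DerivBound l M W) (hl : l' ≤ l) : DerivBound l' M W :=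
  fun i hi x => h i (hi.trans hl) x

lemma DerivBound.norm_le (h : DerivBound l M W) (x : EuclideanSpace ℝ (Fin n)) : ‖W x‖ ≤ M := by
  have := h 0 (Nat.zero_le _) x
  rwa [norm_iteratedFDeriv_zero] at this

lemma DerivBound.partialDeriv (hW : ContDiff ℝ ∞ W) (h : DerivBound (l + 1) M W) (a : Fin n) :
    DerivBound l M (partialDeriv a W) := by
  intro i hi x
  set L : (EuclideanSpace ℝ (Fin n) →L[ℝ] ℝ) →L[ℝ] ℝ :=
    ContinuousLinearMap.apply ℝ ℝ (EuclideanSpace.single a (1 : ℝ))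
  have hL : ‖L‖ ≤ 1 := by
    refine ContinuousLinearMap.opNorm_le_bound _ zero_le_one fun f => ?_
    rw [one_mul]
    change ‖f (EuclideanSpace.single a (1 : ℝ))‖ ≤ ‖f‖
    refine (f.le_opNorm _).trans ?_
    simp
  have hfd : ContDiff ℝ ∞ (fderiv ℝ W) := hW.fderiv_right (m := ∞) (by simp)
  have h1 : iteratedFDeriv ℝ i (_root_.partialDeriv a W) x =
      L.compContinuousMultilinearMap (iteratedFDeriv ℝ i (fderiv ℝ W) x) :=
    L.iteratedFDeriv_comp_left (hfd.contDiffAt (x := x)) (by exact_mod_cast le_top)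
  rw [h1]
  refine (L.norm_compContinuousMultilinearMap_le _).trans ?_
  rw [norm_iteratedFDeriv_fderiv]
  calc ‖L‖ * ‖iteratedFDeriv ℝ (i + 1) W x‖ ≤ 1 * M :=
        mul_le_mul hL (h (i + 1) (by omega) x) (norm_nonneg _) zero_le_one
    _ = M := one_mul _

lemma iteratedFDeriv_eq_zero_of_notMem_tsupport {i : ℕ} {x : EuclideanSpace ℝ (Fin n)}
    (hx : x ∉ tsupport W) : iteratedFDeriv ℝ i W x = 0 := by
  by_contra h
  exact hx (support_iteratedFDeriv_subset i h)

/-- Multiplication by a fixed smooth function, on functions supported in a compact set. -/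
lemma exists_derivBound_mul {K : Set (EuclideanSpace ℝ (Fin n))} (hK : IsCompact K)
    {Q : EuclideanSpace ℝ (Fin n) → ℝ} (hQ : ContDiff ℝ ∞ Q) (l : ℕ) :
    ∃ C : ℝ≥0, ∀ (M : ℝ≥0) (W : EuclideanSpace ℝ (Fin n) → ℝ), ContDiff ℝ ∞ W → tsupport W ⊆ K →
      DerivBound l M W → DerivBound l (C * M) fun x => W x * Q x := by
  have h1 : ∀ i : ℕ, ∃ B : ℝ, ∀ x ∈ K, ‖iteratedFDeriv ℝ i Q x‖ ≤ B := fun i =>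
    hK.exists_bound_of_continuousOn
      (hQ.continuous_iteratedFDeriv (m := i) (by exact_mod_cast le_top)).continuousOn
  choose B hB using h1
  set B' : ℝ≥0 := ∑ i ∈ Finset.range (l + 1), (B i).toNNReal with hB'
  have hBB : ∀ i ≤ l, ∀ x ∈ K, ‖iteratedFDeriv ℝ i Q x‖ ≤ B' := by
    intro i hi x hx
    refine (hB i x hx).trans ((Real.le_coe_toNNReal _).trans ?_)
    exact_mod_cast Finset.single_le_sum (f := fun i => (B i).toNNReal) (fun _ _ => zero_le)
      (Finset.mem_range.2 (Nat.lt_succ_of_le hi))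
  refine ⟨2 ^ l * B', fun M W hW hWK hM i hi x => ?_⟩
  by_cases hx : x ∈ K
  · refine (norm_iteratedFDeriv_mul_le (N := ∞) hW hQ x (by exact_mod_cast le_top)).trans ?_
    calc ∑ a ∈ Finset.range (i + 1), (i.choose a : ℝ) * ‖iteratedFDeriv ℝ a W x‖ *
          ‖iteratedFDeriv ℝ (i - a) Q x‖
        ≤ ∑ a ∈ Finset.range (i + 1), (i.choose a : ℝ) * M * B' := by
          refine Finset.sum_le_sum fun a ha => ?_
          rw [Finset.mem_range] at ha
          gcongr
          · exact hM a (by omega) x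
          · exact hBB (i - a) (by omega) x hx
      _ = 2 ^ i * M * B' := by
          rw [← Finset.sum_mul, ← Finset.sum_mul]
          congr 2
          exact_mod_cast Nat.sum_range_choose i
      _ ≤ 2 ^ l * M * B' := by
          gcongr
          norm_num
      _ = _ := by
          push_cast
          ring
  · rw [iteratedFDeriv_eq_zero_of_notMem_tsupport, norm_zero]
    · exact NNReal.coe_nonneg _
    · intro h
      exact hx (hWK (tsupport_mul_subset_left h))

end DerivBound

section SobolevComp

variable {n j : ℕ} {P : EuclideanSpace ℝ (Fin n) → EuclideanSpace ℝ (Fin j)}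
  {K : Set (EuclideanSpace ℝ (Fin n))} {c : ℝ≥0}

lemma eLpNorm_mul_comp_le (hP : Continuous P) (hK : IsCompact K)
    (hmap : (volume.restrict K).map P ≤ c • volume) {q : ℝ≥0∞} (hq : 1 ≤ q)
    {W : EuclideanSpace ℝ (Fin n) → ℝ} (hWK : tsupport W ⊆ K) {M : ℝ≥0} (hM : ∀ x, ‖W x‖ ≤ M)
    {u : EuclideanSpace ℝ (Fin j) → ℝ} (hu : LocallyIntegrable u) :
    eLpNorm (fun x => W x * u (P x)) q volume ≤ (1 + c) * M * eLpNorm u q volume := by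
  calc eLpNorm (fun x => W x * u (P x)) q volume
      ≤ eLpNorm ((M : ℝ) • K.indicator fun x => u (P x)) q volume := by
        refine eLpNorm_mono fun x => ?_
        rw [Pi.smul_apply, smul_eq_mul, norm_mul, norm_mul]
        by_cases hx : x ∈ K
        · rw [indicator_of_mem hx]
          gcongr
          simpa using hM x
        · rw [image_eq_zero_of_notMem_tsupport fun h => hx (hWK h)]
          simp only [norm_zero, zero_mul]
          positivity
    _ = M * eLpNorm (fun x => u (P x)) q (volume.restrict K) := by
        rw [eLpNorm_const_smul, eLpNorm_indicator_eq_eLpNorm_restrict hK.measurableSet]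
        simp
    _ ≤ M * ((1 + c) * eLpNorm u q volume) := by
        gcongr
        exact eLpNorm_comp_le_of_map_le hP.measurable.aemeasurable hmap hq hu.aestronglyMeasurable
    _ = _ := by ring

/-- Sobolev norms of `W · (u ∘ P)`, for `P` smooth, pushing Lebesgue measure on `K` to a measure
with bounded density, and `W` smooth and supported in `K`. -/
theorem exists_sobolevENorm_mul_comp_le (hP : ContDiff ℝ ∞ P) (hK : IsCompact K)
    (hmap : (volume.restrict K).map P ≤ c • volume) {q : ℝ≥0∞} (hq : 1 ≤ q) (l : ℕ) :
    ∃ C : ℝ≥0, ∀ (M : ℝ≥0) (W : EuclideanSpace ℝ (Fin n) → ℝ), ContDiff ℝ ∞ W → tsupport W ⊆ K →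
      DerivBound l M W → ∀ u : EuclideanSpace ℝ (Fin j) → ℝ, sobolevENorm q l u < ⊤ →
      sobolevENorm q l (fun x => W x * u (P x)) ≤ C * M * sobolevENorm q l u := by
  induction l with
  | zero =>
    refine ⟨1 + c, fun M W hW hWK hM u hu => ?_⟩
    have hul := locallyIntegrable_of_sobolevENorm_lt_top hu
    have hi := integrable_mul_comp hP.continuous hK hmap hul hW.continuous
      fun x hx => image_eq_zero_of_notMem_tsupport fun h => hx (hWK h)
    refine (sobolevENorm_zero_le hi.locallyIntegrable).trans
      ((eLpNorm_mul_comp_le hP.continuous hK hmap hq hWK hM.norm_le hul).trans ?_)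
    push_cast
    gcongr
    exact eLpNorm_le_sobolevENorm hul
  | succ l ih =>
    obtain ⟨C, hC⟩ := ih
    have hPb : ∀ a b, ContDiff ℝ ∞ (partialDeriv a fun x => P x b) := fun a b =>
      (contDiff_coord hP b).partialDeriv a
    have hmul : ∀ a b, ∃ B : ℝ≥0, ∀ (M : ℝ≥0) (W : EuclideanSpace ℝ (Fin n) → ℝ),
        ContDiff ℝ ∞ W → tsupport W ⊆ K → DerivBound l M W →
        DerivBound l (B * M) fun x => W x * partialDeriv a (fun x => P x b) x := fun a b =>
      exists_derivBound_mul hK (hPb a b) l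
    choose B hB using hmul
    refine ⟨(1 + c) + ∑ a : Fin n, (C + ∑ b : Fin j, C * B a b), fun M W hW hWK hM u hu => ?_⟩
    obtain ⟨v, hv⟩ := exists_weak_partial hu
    have hul := locallyIntegrable_of_sobolevENorm_lt_top hu
    have hi := integrable_mul_comp hP.continuous hK hmap hul hW.continuous
      fun x hx => image_eq_zero_of_notMem_tsupport fun h => hx (hWK h)
    have hu' := (sobolevENorm_le_succ q l u).trans_lt hu
    have hMl := hM.mono (Nat.le_succ l)
    refine (sobolevENorm_succ_le hi.locallyIntegrable fun a =>
      HasWeakDeriv.mul_comp hP hK hmap hW hWK hul (fun b => (hv b).1) a).trans ?_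
    have h0 : eLpNorm (fun x => W x * u (P x)) q volume ≤
        (1 + c) * M * sobolevENorm q (l + 1) u := by
      refine (eLpNorm_mul_comp_le hP.continuous hK hmap hq hWK hM.norm_le hul).trans ?_
      gcongr
      exact eLpNorm_le_sobolevENorm hul
    have h1 : ∀ a, sobolevENorm q l (fun x => partialDeriv a W x * u (P x) +
        ∑ b, W x * partialDeriv a (fun x => P x b) x * v b (P x)) ≤
        (C + ∑ b, C * B a b : ℝ≥0) * M * sobolevENorm q (l + 1) u := by
      intro a
      have e : (fun x => partialDeriv a W x * u (P x) +
          ∑ b, W x * partialDeriv a (fun x => P x b) x * v b (P x)) =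
          (fun x => partialDeriv a W x * u (P x)) +
          ∑ b, fun x => W x * partialDeriv a (fun x => P x b) x * v b (P x) := by
        ext x
        simp [Finset.sum_apply]
      rw [e]
      refine (sobolevENorm_add_le hq l _ _).trans ?_
      have h2 : sobolevENorm q l (fun x => partialDeriv a W x * u (P x)) ≤
          C * M * sobolevENorm q (l + 1) u := by
        refine (hC M _ (hW.partialDeriv a) ((tsupport_partialDeriv_subset W a).trans hWK)
          (hM.partialDeriv hW a) u hu').trans ?_
        gcongr
        exact sobolevENorm_le_succ q l u
      have h3 : ∀ b, sobolevENorm q l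
          (fun x => W x * partialDeriv a (fun x => P x b) x * v b (P x)) ≤
          C * (B a b * M : ℝ≥0) * sobolevENorm q (l + 1) u := by
        intro b
        refine (hC _ _ (hW.mul (hPb a b)) (tsupport_mul_subset_left.trans hWK)
          (hB a b M W hW hWK hMl) (v b) ((hv b).2.trans_lt hu)).trans ?_
        gcongr
        exact (hv b).2
      refine (add_le_add h2 ((sobolevENorm_sum_le hq l _ _).trans
        (Finset.sum_le_sum fun b _ => h3 b))).trans (le_of_eq ?_)
      push_cast
      rw [add_mul, add_mul, Finset.sum_mul, Finset.sum_mul]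
      congr 1
      exact Finset.sum_congr rfl fun b _ => by ring
    refine (add_le_add h0 (Finset.sum_le_sum fun a _ => h1 a)).trans (le_of_eq ?_)
    rw [← Finset.sum_mul, ← Finset.sum_mul]
    push_cast
    ring

end SobolevComp

lemma volume_le_of_antilipschitz {j : ℕ} {f : EuclideanSpace ℝ (Fin j) → EuclideanSpace ℝ (Fin j)}
    {s : Set (EuclideanSpace ℝ (Fin j))} {K : ℝ≥0}
    (hf : ∀ b ∈ s, ∀ b' ∈ s, dist b b' ≤ K * dist (f b) (f b'))
    (A : Set (EuclideanSpace ℝ (Fin j))) :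
    volume (s ∩ f ⁻¹' A) ≤ (K ^ j : ℝ≥0) * volume A := by
  set μH : Measure (EuclideanSpace ℝ (Fin j)) :=
    μH[Module.finrank ℝ (EuclideanSpace ℝ (Fin j))] with hμH
  have hvol : (volume : Measure (EuclideanSpace ℝ (Fin j))) =
      (Measure.addHaarScalarFactor volume μH) • μH := Measure.isAddLeftInvariant_eq_smul _ _
  have hanti : AntilipschitzWith K (s.domRestrict f) :=
    AntilipschitzWith.of_le_mul_dist fun x y => hf x x.2 y y.2
  have h1 := hanti.hausdorffMeasure_preimage_le
    (d := (Module.finrank ℝ (EuclideanSpace ℝ (Fin j)) : ℝ)) (by positivity) A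
  have h2 : μH (s ∩ f ⁻¹' A) ≤ (K ^ j : ℝ≥0) * μH A := by
    have h3 : s ∩ f ⁻¹' A = Subtype.val '' (s.domRestrict f ⁻¹' A) := by
      ext x
      simp [Set.domRestrict, and_comm]
    rw [h3, hμH, (isometry_subtype_coe (s := s)).hausdorffMeasure_image (Or.inl (by positivity))]
    refine h1.trans (le_of_eq ?_)
    congr 1
    rw [finrank_euclideanSpace_fin]
    simp
  rw [hvol]
  simp only [Measure.smul_apply, ENNReal.smul_def, smul_eq_mul]
  calc _ ≤ (Measure.addHaarScalarFactor volume μH : ℝ≥0∞) * ((K ^ j : ℝ≥0) * μH A) := by gcongr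
    _ = _ := by ring

/-- The part of the image of `ν` under `Q` that comes from `V` is bounded by a multiple of Lebesgue
measure. -/
def DominatedOn {M : Type*} [MeasurableSpace M] {j : ℕ} (ν : Measure M)
    (Q : M → EuclideanSpace ℝ (Fin j)) (V : Set M) : Prop :=
  ∃ C : ℝ≥0, ∀ A, MeasurableSet A → ν (V ∩ Q ⁻¹' A) ≤ C * volume A

namespace DominatedOn

variable {M : Type*} [MeasurableSpace M] {j : ℕ} {ν : Measure M}
  {Q : M → EuclideanSpace ℝ (Fin j)} {V V' : Set M}

lemma mono (h : DominatedOn ν Q V) (hV : V' ⊆ V) : DominatedOn ν Q V' := by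
  obtain ⟨C, hC⟩ := h
  exact ⟨C, fun A hA => (measure_mono (inter_subset_inter_left _ hV)).trans (hC A hA)⟩

lemma congr {Q' : M → EuclideanSpace ℝ (Fin j)} (h : DominatedOn ν Q V) (hQ : EqOn Q Q' V) :
    DominatedOn ν Q' V := by
  obtain ⟨C, hC⟩ := h
  refine ⟨C, fun A hA => ?_⟩
  rw [← hQ.inter_preimage_eq]
  exact hC A hA

lemma union (h : DominatedOn ν Q V) (h' : DominatedOn ν Q V') : DominatedOn ν Q (V ∪ V') := by
  obtain ⟨C, hC⟩ := h
  obtain ⟨C', hC'⟩ := h'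
  refine ⟨C + C', fun A hA => ?_⟩
  rw [union_inter_distrib_right, ENNReal.coe_add, add_mul]
  exact (measure_union_le _ _).trans (add_le_add (hC A hA) (hC' A hA))

lemma of_isCompact [TopologicalSpace M] {K : Set M} (hK : IsCompact K)
    (h : ∀ x ∈ K, ∃ V ∈ 𝓝 x, DominatedOn ν Q V) : DominatedOn ν Q K := by
  refine hK.induction_on ⟨0, fun A _ => by simp⟩ (fun s t hst ht => ht.mono hst)
    (fun s t hs ht => hs.union ht) fun x hx => ?_
  obtain ⟨V, hV, h⟩ := h x hx
  exact ⟨V, mem_nhdsWithin_of_mem_nhds hV, h⟩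

lemma map_le (h : DominatedOn ν Q V) : ∃ C : ℝ≥0, (ν.restrict V).map Q ≤ C • volume := by
  obtain ⟨C, hC⟩ := h
  refine ⟨C, ?_⟩
  by_cases hQ : AEMeasurable Q (ν.restrict V)
  · refine Measure.le_iff.2 fun A hA => ?_
    rw [Measure.map_apply_of_aemeasurable hQ hA,
      Measure.restrict_apply₀ (hQ.nullMeasurableSet_preimage hA), inter_comm]
    exact hC A hA
  · rw [Measure.map_of_not_aemeasurable hQ]
    exact Measure.zero_le _

end DominatedOn

/-- If `Q` moves with unit speed along a family of measure preserving maps, then the image of the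
measure under `Q` is locally bounded by Lebesgue measure. -/
theorem exists_dominatedOn_nhds {n j : ℕ} {M : Type*} [TopologicalSpace M]
    [ChartedSpace (EuclideanSpace ℝ (Fin n)) M] [IsManifold (𝓡 n) ∞ M]
    [MeasurableSpace M] [BorelSpace M] {ν : Measure M} [SFinite ν]
    [IsLocallyFiniteMeasure ν]
    {T : EuclideanSpace ℝ (Fin j) → M → M} {Q : M → EuclideanSpace ℝ (Fin j)} {x₀ : M}
    (hTm : Measurable (Function.uncurry T)) (hTν : ∀ b, MeasurePreserving (T b) ν ν)
    (hT : ContMDiffAt (𝓘(ℝ, EuclideanSpace ℝ (Fin j)).prod (𝓡 n)) (𝓡 n) ∞ (Function.uncurry T)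
      (0, x₀))
    (hT₀ : T 0 x₀ = x₀) (hQ : ContMDiffAt (𝓡 n) (𝓡 j) ∞ Q x₀)
    (hQT : ∀ᶠ b in 𝓝 0, Q (T b x₀) = Q x₀ + b)
    (hTi : ∀ U ∈ 𝓝 x₀, ∃ V ∈ 𝓝 x₀, ∀ᶠ b in 𝓝 0, ∀ y, T b y ∈ V → y ∈ U) :
    ∃ V ∈ 𝓝 x₀, DominatedOn ν Q V := by
  set e := extChartAt (𝓡 n) x₀ with he
  set F : EuclideanSpace ℝ (Fin j) × EuclideanSpace ℝ (Fin n) → EuclideanSpace ℝ (Fin j) :=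
    fun w => Q (T w.1 (e.symm w.2)) with hF
  have hsymm : ContMDiffAt (𝓡 n) (𝓡 n) ∞ e.symm (e x₀) :=
    (contMDiffOn_extChartAt_symm x₀).contMDiffAt
      (extChartAt_target_mem_nhds x₀)
  have hex : e.symm (e x₀) = x₀ := extChartAt_to_inv x₀
  have hFs : ContDiffAt ℝ ∞ F (0, e x₀) := by
    rw [← contMDiffAt_iff_contDiffAt]
    have h1 : ContMDiffAt (𝓘(ℝ, EuclideanSpace ℝ (Fin j) × EuclideanSpace ℝ (Fin n)))
        (𝓘(ℝ, EuclideanSpace ℝ (Fin j)).prod (𝓡 n)) ∞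
        (fun w : EuclideanSpace ℝ (Fin j) × EuclideanSpace ℝ (Fin n) => (w.1, e.symm w.2))
        (0, e x₀) :=
      (contDiff_fst.contMDiff.contMDiffAt).prodMk
        (ContMDiffAt.comp (0, e x₀) (g := e.symm) hsymm contDiff_snd.contMDiff.contMDiffAt)
    have h2 := ContMDiffAt.comp (0, e x₀) (g := Function.uncurry T)
      (f := fun w : EuclideanSpace ℝ (Fin j) × EuclideanSpace ℝ (Fin n) => (w.1, e.symm w.2))
      (by simpa [hex] using hT) h1
    exact ContMDiffAt.comp (0, e x₀) (g := Q)
      (f := fun w : EuclideanSpace ℝ (Fin j) × EuclideanSpace ℝ (Fin n) => T w.1 (e.symm w.2))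
      (by simpa [hex, hT₀] using hQ) h2
  have hstr := hFs.hasStrictFDerivAt (by simp)
  set F' := fderiv ℝ F (0, e x₀)
  have hF' : ∀ b, F' (b, 0) = b := by
    have h1 : HasFDerivAt (fun b => F (b, e x₀))
        (F'.comp (ContinuousLinearMap.inl ℝ _ _)) 0 :=
      HasFDerivAt.comp (g := F) 0 hstr.hasFDerivAt
        (hasFDerivAt_prodMk_left (0 : EuclideanSpace ℝ (Fin j)) (e x₀))
    have h2 : HasFDerivAt (fun b : EuclideanSpace ℝ (Fin j) => Q x₀ + b)
        (ContinuousLinearMap.id ℝ _) 0 := (hasFDerivAt_id 0).const_add _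
    have h3 : HasFDerivAt (fun b => F (b, e x₀)) (ContinuousLinearMap.id ℝ _) 0 :=
      h2.congr_of_eventuallyEq (by filter_upwards [hQT] with b hb; simp [hF, hex, hb])
    intro b
    have := congrArg (fun L => L b) (h1.unique h3)
    simpa using this
  have hlip : ∀ᶠ w in 𝓝 (((0, e x₀), (0, e x₀)) : (EuclideanSpace ℝ (Fin j) ×
      EuclideanSpace ℝ (Fin n)) × (EuclideanSpace ℝ (Fin j) × EuclideanSpace ℝ (Fin n))),
      ‖F w.1 - F w.2 - F' (w.1 - w.2)‖ ≤ 1 / 2 * ‖w.1 - w.2‖ :=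
    hstr.isLittleO.def (by norm_num)
  obtain ⟨U, hU, hUU⟩ : ∃ U ∈ 𝓝 ((0, e x₀) : EuclideanSpace ℝ (Fin j) ×
      EuclideanSpace ℝ (Fin n)), ∀ w ∈ U, ∀ w' ∈ U,
      ‖F w - F w' - F' (w - w')‖ ≤ 1 / 2 * ‖w - w'‖ := by
    rw [nhds_prod_eq] at hlip
    obtain ⟨U, hU, h⟩ := (Filter.eventually_prod_self_iff
      (r := fun w w' => ‖F w - F w' - F' (w - w')‖ ≤ 1 / 2 * ‖w - w'‖)).1 hlip
    exact ⟨U, hU, fun w hw w' hw' => h w hw w' hw'⟩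
  rw [nhds_prod_eq] at hU
  obtain ⟨B, hB, Z, hZ, hBZ⟩ := Filter.mem_prod_iff.1 hU
  obtain ⟨U₁, hU₁, hνU₁⟩ := ν.finiteAt_nhds x₀
  set U₀ : Set M := e.source ∩ e ⁻¹' Z ∩ U₁ with hU₀
  obtain ⟨V₁, hV₁, hTV⟩ := hTi U₀ (inter_mem (inter_mem (extChartAt_source_mem_nhds x₀)
      ((continuousAt_extChartAt x₀).preimage_mem_nhds hZ)) hU₁)
  have hνU₀ : ν U₀ < ⊤ := (measure_mono inter_subset_right).trans_lt hνU₁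
  have hQc : ∀ᶠ x in 𝓝 x₀, ContinuousAt Q x :=
    (contMDiffAt_iff_contMDiffAt_nhds (by simp)).1
      (hQ.of_le (m := 1) (by simp)) |>.mono fun x hx => hx.continuousAt
  obtain ⟨V, hVV, hVo, hxV⟩ := mem_nhds_iff.1 (inter_mem hV₁ hQc)
  obtain ⟨r, hr, hrB⟩ := Metric.mem_nhds_iff.1 (inter_mem hB hTV)
  have hball0 : volume (Metric.ball (0 : EuclideanSpace ℝ (Fin j)) r) ≠ 0 :=
    (Metric.measure_ball_pos _ _ hr).ne'
  have hballt : volume (Metric.ball (0 : EuclideanSpace ℝ (Fin j)) r) ≠ ⊤ := measure_ball_lt_top.ne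
  set B₀ := Metric.ball (0 : EuclideanSpace ℝ (Fin j)) r with hB₀
  refine ⟨V, hVo.mem_nhds hxV,
    ((volume B₀)⁻¹ * (((2 ^ j : ℝ≥0) : ℝ≥0∞) * ν U₀)).toNNReal, fun A hA => ?_⟩
  rw [ENNReal.coe_toNNReal (ENNReal.mul_ne_top (ENNReal.inv_ne_top.2 hball0)
    (ENNReal.mul_ne_top ENNReal.coe_ne_top hνU₀.ne))]
  have hQV : ContinuousOn Q V := fun x hx => (hVV hx).2.continuousWithinAt
  have hS : MeasurableSet (V ∩ Q ⁻¹' A) := by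
    rw [← Subtype.image_preimage_coe]
    exact hVo.measurableSet.subtype_image
      ((continuousOn_iff_continuous_domRestrict.1 hQV).measurable hA)
  set s := V ∩ Q ⁻¹' A with hs
  have hkey : ∀ y, volume.restrict B₀ {b | T b y ∈ s} ≤
      (toMeasurable ν U₀).indicator (fun _ => ((2 ^ j : ℝ≥0) : ℝ≥0∞) * volume A) y := by
    intro y
    have hm : MeasurableSet {b | T b y ∈ s} := (hTm.comp (measurable_id.prodMk measurable_const)) hS
    rw [Measure.restrict_apply hm]
    by_cases hy : y ∈ U₀
    · rw [indicator_of_mem (subset_toMeasurable _ _ hy)]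
      refine le_trans (measure_mono ?_) (volume_le_of_antilipschitz (s := B₀) (K := 2)
        (f := fun b => Q (T b y)) ?_ A)
      · rintro b ⟨hb, hb'⟩
        exact ⟨hb', hb.2⟩
      · intro b hb b' hb'
        have h1 := hUU (b, e y) (hBZ ⟨(hrB hb).1, hy.1.2⟩) (b', e y) (hBZ ⟨(hrB hb').1, hy.1.2⟩)
        have h2 : e.symm (e y) = y := e.left_inv hy.1.1
        simp only [hF, h2, Prod.mk_sub_mk, sub_self, hF', Prod.norm_mk, norm_zero] at h1
        rw [max_eq_left (norm_nonneg _)] at h1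
        rw [dist_eq_norm, dist_eq_norm]
        have h3 := norm_sub_norm_le (b - b') (Q (T b y) - Q (T b' y))
        rw [norm_sub_rev (b - b')] at h3
        push_cast
        linarith
    · have : {b | T b y ∈ s} ∩ B₀ = ∅ := by
        refine eq_empty_of_forall_notMem fun b hb => hy ?_
        exact (hrB hb.2).2 y (hVV hb.1.1).1
      rw [this, measure_empty]
      exact zero_le
  have h1 : volume B₀ * ν s ≤ ((2 ^ j : ℝ≥0) : ℝ≥0∞) * ν U₀ * volume A := by
    calc volume B₀ * ν s = ∫⁻ b in B₀, ν (T b ⁻¹' s) := by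
          rw [lintegral_congr fun b => (hTν b).measure_preimage hS.nullMeasurableSet,
            lintegral_const, Measure.restrict_apply_univ, mul_comm]
      _ = ((volume.restrict B₀).prod ν) (Function.uncurry T ⁻¹' s) :=
          (Measure.prod_apply (hTm hS)).symm
      _ = ∫⁻ y, volume.restrict B₀ {b | T b y ∈ s} ∂ν := Measure.prod_apply_symm (hTm hS)
      _ ≤ ∫⁻ y, (toMeasurable ν U₀).indicator
            (fun _ => ((2 ^ j : ℝ≥0) : ℝ≥0∞) * volume A) y ∂ν := lintegral_mono hkey
      _ = _ := by
          rw [lintegral_indicator_const (measurableSet_toMeasurable _ _), measure_toMeasurable]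
          ring
  calc ν s = (volume B₀)⁻¹ * (volume B₀ * ν s) := by
        rw [← mul_assoc, ENNReal.inv_mul_cancel hball0 hballt, one_mul]
    _ ≤ (volume B₀)⁻¹ * (((2 ^ j : ℝ≥0) : ℝ≥0∞) * ν U₀ * volume A) := by gcongr
    _ = _ := by ring

/-- The image of a left invariant measure on a Lie group under a map with a smooth local right
inverse is locally bounded by Lebesgue measure. -/
@[to_additive]
theorem exists_dominatedOn_nhds_of_isMulLeftInvariant {n j : ℕ} {G : Type*} [Group G] [TopologicalSpace G]
    [ChartedSpace (EuclideanSpace ℝ (Fin n)) G] [LieGroup (𝓡 n) ∞ G]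
    [IsTopologicalGroup G] [SecondCountableTopology G]
    [MeasurableSpace G] [BorelSpace G] {ν : Measure G} [SFinite ν] [IsLocallyFiniteMeasure ν]
    [ν.IsMulLeftInvariant] {Q : G → EuclideanSpace ℝ (Fin j)} {σ : EuclideanSpace ℝ (Fin j) → G}
    {g₀ : G} (hQ : ContMDiffAt (𝓡 n) (𝓡 j) ∞ Q g₀) (hσ : ContMDiffAt (𝓡 j) (𝓡 n) ∞ σ (Q g₀))
    (hσ₀ : σ (Q g₀) = g₀) (hQσ : ∀ᶠ b in 𝓝 (Q g₀), Q (σ b) = b) :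
    ∃ V ∈ 𝓝 g₀, DominatedOn ν Q V := by
  have hI : IsManifold (𝓡 n) ∞ G := inferInstance
  have hσc : ∀ᶠ b in 𝓝 (Q g₀), ContinuousAt σ b :=
    (contMDiffAt_iff_contMDiffAt_nhds (by simp)).1
      (hσ.of_le (m := 1) (by simp)) |>.mono fun x hx => hx.continuousAt
  obtain ⟨W, hWW, hWo, hgW⟩ := mem_nhds_iff.1 hσc
  classical
  set τ : EuclideanSpace ℝ (Fin j) → G := W.piecewise σ (fun _ => g₀) with hτ
  have hτm : Measurable τ := by
    refine measurable_of_restrict_of_restrict_compl hWo.measurableSet ?_ ?_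
    · rw [hτ, domRestrict_piecewise]
      exact (continuousOn_iff_continuous_domRestrict.1
        fun b hb => (hWW hb).continuousWithinAt).measurable
    · rw [hτ, domRestrict_piecewise_compl]
      exact measurable_const
  have hτσ : τ =ᶠ[𝓝 (Q g₀)] σ := by
    filter_upwards [hWo.mem_nhds hgW] with b hb
    exact piecewise_eq_of_mem _ _ _ hb
  have hadd : Tendsto (fun b => Q g₀ + b) (𝓝 0) (𝓝 (Q g₀)) := by
    have : Continuous fun b => Q g₀ + b := by fun_prop
    simpa using this.tendsto 0
  have hτ' : ContMDiffAt (𝓡 j) (𝓡 n) ∞ τ (Q g₀) := hσ.congr_of_eventuallyEq hτσ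
  have hτ₀ : τ (Q g₀) = g₀ := by rw [hτσ.self_of_nhds, hσ₀]
  have hs : ContMDiffAt (𝓡 j) (𝓡 n) ∞ (fun b => τ (Q g₀ + b) * g₀⁻¹) 0 := by
    refine ContMDiffAt.mul ?_ contMDiffAt_const
    exact ContMDiffAt.comp 0 (g := τ) (f := fun b => Q g₀ + b) (by simpa using hτ')
      (by rw [contMDiffAt_iff_contDiffAt]; fun_prop)
  refine exists_dominatedOn_nhds (T := fun b y => τ (Q g₀ + b) * g₀⁻¹ * y) ?_
    (fun b => measurePreserving_mul_left ν _) ?_ (by simp [hτ₀]) hQ ?_ ?_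
  · have h1 : Measurable fun b => τ (Q g₀ + b) * g₀⁻¹ :=
      (measurable_mul_const _).comp (hτm.comp (measurable_const_add _))
    exact (h1.comp measurable_fst).mul measurable_snd
  · refine ContMDiffAt.mul (f := fun w : EuclideanSpace ℝ (Fin j) × G => τ (Q g₀ + w.1) * g₀⁻¹)
      (g := fun w => w.2) ?_ contMDiffAt_snd
    exact ContMDiffAt.comp (0, g₀) (g := fun b => τ (Q g₀ + b) * g₀⁻¹)
      (f := fun w : EuclideanSpace ℝ (Fin j) × G => w.1) hs contMDiffAt_fst
  · filter_upwards [hadd.eventually hQσ, hadd.eventually hτσ] with b hb hb'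
    rw [inv_mul_cancel_right, hb', hb]
  · intro U hU
    have h1 : ContinuousAt (fun w : EuclideanSpace ℝ (Fin j) × G =>
        (τ (Q g₀ + w.1) * g₀⁻¹)⁻¹ * w.2) (0, g₀) :=
      (((hs.continuousAt).comp_of_eq continuousAt_fst rfl).inv).mul continuousAt_snd
    have h2 := h1.preimage_mem_nhds (t := U) (by simpa [hτ₀] using hU)
    rw [nhds_prod_eq] at h2
    obtain ⟨B, hB, V, hV, h⟩ := Filter.mem_prod_iff.1 h2
    refine ⟨V, hV, ?_⟩
    filter_upwards [hB] with b hb y hy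
    have := h (show (b, τ (Q g₀ + b) * g₀⁻¹ * y) ∈ B ×ˢ V from ⟨hb, hy⟩)
    rwa [mem_preimage, inv_mul_cancel_left] at this

section Submersion

variable {n j : ℕ} {M : Type*} [TopologicalSpace M] [ChartedSpace (EuclideanSpace ℝ (Fin n)) M]
  {N : Type*} [TopologicalSpace N] [ChartedSpace (EuclideanSpace ℝ (Fin j)) N]

lemma contMDiffAt_chart [IsManifold (𝓡 n) ∞ M] {e : OpenPartialHomeomorph M (EuclideanSpace ℝ (Fin n))}
    (he : e ∈ IsManifold.maximalAtlas (𝓡 n) ∞ M) {x : M} (hx : x ∈ e.source) :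
    ContMDiffAt (𝓡 n) (𝓡 n) ∞ e x :=
  (contMDiffOn_of_mem_maximalAtlas he).contMDiffAt (e.open_source.mem_nhds hx)

lemma contMDiffAt_chart_symm [IsManifold (𝓡 n) ∞ M]
    {e : OpenPartialHomeomorph M (EuclideanSpace ℝ (Fin n))}
    (he : e ∈ IsManifold.maximalAtlas (𝓡 n) ∞ M) {z : EuclideanSpace ℝ (Fin n)} (hz : z ∈ e.target) :
    ContMDiffAt (𝓡 n) (𝓡 n) ∞ e.symm z :=
  (contMDiffOn_symm_of_mem_maximalAtlas he).contMDiffAt (e.open_target.mem_nhds hz)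

/-- A submersion has a smooth local section through every point. -/
lemma exists_section_of_isSubmersionAt [IsManifold (𝓡 n) ∞ M] [IsManifold (𝓡 j) ∞ N]
    {f : M → N} {x : M} (hf : Manifold.IsSubmersionAt (𝓡 n) (𝓡 j) ∞ f x) :
    ∃ (σ : N → M) (U : Set N), IsOpen U ∧ f x ∈ U ∧ ContMDiffOn (𝓡 j) (𝓡 n) ∞ σ U ∧
      σ (f x) = x ∧ ∀ y ∈ U, f (σ y) = y := by
  set e := hf.domChart
  set e' := hf.codChart
  set L := hf.equiv
  have hx : x ∈ e.source := hf.mem_domChart_source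
  have hfx : f x ∈ e'.source := hf.mem_codChart_source
  have hw : ∀ z ∈ e.target, e' (f (e.symm z)) = (L z).1 := by
    intro z hz
    have h0 : z ∈ (e.extend (𝓡 n)).target := by simpa using hz
    have := hf.writtenInCharts h0
    simpa [e, e', L] using this
  set s : N → EuclideanSpace ℝ (Fin n) := fun y => L.symm (e' y, (L (e x)).2) with hs
  have hsx : s (f x) = e x := by
    have h1 := hw (e x) (e.map_source hx)
    rw [e.left_inv hx] at h1
    simp only [hs, h1]
    exact L.symm_apply_apply _
  have hss : ContMDiffOn (𝓡 j) (𝓡 n) ∞ s e'.source := by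
    have h1 : ContDiff ℝ ∞ fun b : EuclideanSpace ℝ (Fin j) => L.symm (b, (L (e x)).2) :=
      L.symm.contDiff.comp (contDiff_id.prodMk contDiff_const)
    exact h1.contMDiff.comp_contMDiffOn
      (contMDiffOn_of_mem_maximalAtlas hf.codChart_mem_maximalAtlas)
  refine ⟨fun y => e.symm (s y), e'.source ∩ s ⁻¹' e.target,
    hss.continuousOn.isOpen_inter_preimage e'.open_source e.open_target, ⟨hfx, ?_⟩, ?_, ?_, ?_⟩
  · rw [mem_preimage, hsx]
    exact e.map_source hx
  · exact (contMDiffOn_symm_of_mem_maximalAtlas hf.domChart_mem_maximalAtlas).comp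
      (hss.mono inter_subset_left) inter_subset_right
  · simp only [hsx]
    exact e.left_inv hx
  · intro y hy
    have h1 := hw (s y) hy.2
    have h2 : (L (s y)).1 = e' y := by simp [hs]
    rw [h2] at h1
    refine e'.injOn ?_ hy.1 h1
    exact hf.source_subset_preimage_source (e.map_target hy.2)

/-- A submersion read in a chart of the target has smooth local right inverses. -/
lemma exists_rightInverse_of_isSubmersionAt [IsManifold (𝓡 n) ∞ M] [IsManifold (𝓡 j) ∞ N]
    {f : M → N} {x : M} (hf : Manifold.IsSubmersionAt (𝓡 n) (𝓡 j) ∞ f x)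
    {e : OpenPartialHomeomorph N (EuclideanSpace ℝ (Fin j))}
    (he : e ∈ IsManifold.maximalAtlas (𝓡 j) ∞ N) (hx : f x ∈ e.source) :
    ContMDiffAt (𝓡 n) (𝓡 j) ∞ (fun y => e (f y)) x ∧
    ∃ σ : EuclideanSpace ℝ (Fin j) → M, ContMDiffAt (𝓡 j) (𝓡 n) ∞ σ (e (f x)) ∧
      σ (e (f x)) = x ∧ ∀ᶠ b in 𝓝 (e (f x)), e (f (σ b)) = b := by
  refine ⟨ContMDiffAt.comp x (contMDiffAt_chart he hx) hf.contMDiffAt, ?_⟩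
  obtain ⟨σ, U, hU, hxU, hσ, hσx, hfσ⟩ := exists_section_of_isSubmersionAt hf
  have h1 := contMDiffAt_chart_symm he (e.map_source hx)
  have h2 : e.symm (e (f x)) = f x := e.left_inv hx
  refine ⟨fun b => σ (e.symm b), ?_, by simp only [h2, hσx], ?_⟩
  · refine ContMDiffAt.comp _ (g := σ) ?_ h1
    rw [h2]
    exact hσ.contMDiffAt (hU.mem_nhds hxU)
  · have h3 : ∀ᶠ b in 𝓝 (e (f x)), e.symm b ∈ U :=
      h1.continuousAt.preimage_mem_nhds (by rw [h2]; exact hU.mem_nhds hxU)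
    filter_upwards [h3, e.open_target.mem_nhds (e.map_source hx)] with b hb hb'
    rw [hfσ _ hb, e.right_inv hb']

end Submersion

section Dominated

variable {n j : ℕ} {G : Type*} [Group G] [TopologicalSpace G]
  [ChartedSpace (EuclideanSpace ℝ (Fin n)) G] [LieGroup (𝓡 n) ∞ G]
  [IsTopologicalGroup G] [SecondCountableTopology G]
  [MeasurableSpace G] [BorelSpace G] {ν : Measure G} [SFinite ν] [IsLocallyFiniteMeasure ν]
  [ν.IsMulLeftInvariant]
  {N : Type*} [TopologicalSpace N] [ChartedSpace (EuclideanSpace ℝ (Fin j)) N]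
  [IsManifold (𝓡 j) ∞ N]

/-- Left invariant measures are locally bounded by Lebesgue measure in charts. -/
lemma exists_dominatedOn_chart {e : OpenPartialHomeomorph G (EuclideanSpace ℝ (Fin n))}
    (he : e ∈ IsManifold.maximalAtlas (𝓡 n) ∞ G) {g : G} (hg : g ∈ e.source) :
    ∃ V ∈ 𝓝 g, DominatedOn ν e V := by
  refine exists_dominatedOn_nhds_of_isMulLeftInvariant (σ := e.symm) (contMDiffAt_chart he hg)
    (contMDiffAt_chart_symm he (e.map_source hg)) (e.left_inv hg) ?_
  filter_upwards [e.open_target.mem_nhds (e.map_source hg)] with b hb using e.right_inv hb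

lemma exists_dominatedOn_submersion {f : G → N} {g : G}
    (hf : Manifold.IsSubmersionAt (𝓡 n) (𝓡 j) ∞ f g)
    {e : OpenPartialHomeomorph N (EuclideanSpace ℝ (Fin j))}
    (he : e ∈ IsManifold.maximalAtlas (𝓡 j) ∞ N) (hg : f g ∈ e.source) :
    ∃ V ∈ 𝓝 g, DominatedOn ν (fun y => e (f y)) V := by
  obtain ⟨h1, σ, h2, h3, h4⟩ := exists_rightInverse_of_isSubmersionAt hf he hg
  exact exists_dominatedOn_nhds_of_isMulLeftInvariant h1 h2 h3 h4

end Dominated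

/-- A submersion, read in a chart of the target and in a local parametrisation of the source, maps
Lebesgue measure locally to measures bounded by Lebesgue measure. -/
lemma exists_dominatedOn_volume {n j : ℕ} {M : Type*} [TopologicalSpace M]
    [ChartedSpace (EuclideanSpace ℝ (Fin n)) M] [IsManifold (𝓡 n) ∞ M]
    {N : Type*} [TopologicalSpace N] [ChartedSpace (EuclideanSpace ℝ (Fin j)) N]
    [IsManifold (𝓡 j) ∞ N] {Φ : EuclideanSpace ℝ (Fin n) → M} {Ψ : M → EuclideanSpace ℝ (Fin n)}
    {z : EuclideanSpace ℝ (Fin n)} (hΦ : ContMDiffAt (𝓡 n) (𝓡 n) ∞ Φ z)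
    (hΨ : ContMDiffAt (𝓡 n) (𝓡 n) ∞ Ψ (Φ z)) (hΨΦ : Ψ (Φ z) = z)
    (hΦΨ : ∀ᶠ x in 𝓝 (Φ z), Φ (Ψ x) = x)
    {f : M → N} (hf : Manifold.IsSubmersionAt (𝓡 n) (𝓡 j) ∞ f (Φ z))
    {e : OpenPartialHomeomorph N (EuclideanSpace ℝ (Fin j))}
    (he : e ∈ IsManifold.maximalAtlas (𝓡 j) ∞ N) (hz : f (Φ z) ∈ e.source) :
    ∃ V ∈ 𝓝 z, DominatedOn volume (fun y => e (f (Φ y))) V := by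
  obtain ⟨h1, σ, h2, h3, h4⟩ := exists_rightInverse_of_isSubmersionAt hf he hz
  refine exists_dominatedOn_nhds_of_isAddLeftInvariant (σ := fun b => Ψ (σ b))
    (ContMDiffAt.comp z (g := fun y => e (f y)) h1 hΦ)
    (ContMDiffAt.comp (e (f (Φ z))) (g := Ψ) (by rwa [h3]) h2) (by rw [h3, hΨΦ]) ?_
  have h5 : Tendsto σ (𝓝 (e (f (Φ z)))) (𝓝 (Φ z)) := by simpa [h3] using h2.continuousAt.tendsto
  filter_upwards [h4, h5.eventually hΦΨ] with b hb hb'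
  rw [hb', hb]

section Riemannian

open Manifold

variable {n : ℕ} {M : Type*} [TopologicalSpace M] [ChartedSpace (EuclideanSpace ℝ (Fin n)) M]
  [IsManifold (𝓡 n) ∞ M] [Bundle.RiemannianBundle (fun x : M => TangentSpace (𝓡 n) x)]
  [IsContMDiffRiemannianBundle (𝓡 n) ∞ (EuclideanSpace ℝ (Fin n))
    (fun x : M => TangentSpace (𝓡 n) x)]

lemma isContinuousRiemannianBundle_tangent :
    IsContinuousRiemannianBundle (EuclideanSpace ℝ (Fin n))
      (fun x : M => TangentSpace (𝓡 n) x) := by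
  obtain ⟨g, hg, hg'⟩ := ‹IsContMDiffRiemannianBundle (𝓡 n) ∞ (EuclideanSpace ℝ (Fin n))
    (fun x : M => TangentSpace (𝓡 n) x)›.exists_contMDiff
  exact ⟨g, hg.continuous, hg'⟩

attribute [local instance] isContinuousRiemannianBundle_tangent

attribute [local instance] normedAddCommGroupTangentSpaceVectorSpace
attribute [local instance] normedSpaceTangentSpaceVectorSpace

/-- The chart at `x` is Lipschitz at `x` for the Riemannian distance. -/
lemma exists_edist_extChartAt_le_riemannianEDist [RegularSpace M] (x : M) :
    ∃ C : ℝ≥0, ∃ c > (0 : ℝ≥0), ∀ y, riemannianEDist (𝓡 n) x y < c →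
      edist (extChartAt (𝓡 n) x x) (extChartAt (𝓡 n) x y) ≤ C * riemannianEDist (𝓡 n) x y := by
  obtain ⟨C, C_pos, hC⟩ := eventually_enorm_mfderiv_extChartAt_lt (𝓡 n) x
  have hC' : ∀ᶠ y in 𝓝 x, ∀ v : TangentSpace (𝓡 n) y,
      ‖(mfderiv (𝓡 n) 𝓘(ℝ, EuclideanSpace ℝ (Fin n)) (extChartAt (𝓡 n) x) y v :
        EuclideanSpace ℝ (Fin n))‖ₑ ≤ C * ‖v‖ₑ := by
    filter_upwards [hC] with y hy v
    refine (ContinuousLinearMap.le_opENorm _ _).trans ?_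
    gcongr
    exact hy.le
  obtain ⟨c, hc, hcu⟩ := setOfPred_riemannianEDist_lt_subset_nhds (𝓡 n)
    (inter_mem hC' (chart_source_mem_nhds (EuclideanSpace ℝ (Fin n)) x))
  refine ⟨C, c, hc, fun y hy => ?_⟩
  have key : ∀ r : ℝ≥0∞, riemannianEDist (𝓡 n) x y < r → r ≤ c →
      edist (extChartAt (𝓡 n) x x) (extChartAt (𝓡 n) x y) ≤ C * r := by
    intro r hr hrc
    obtain ⟨γ, hγx, hγy, γ_smooth, hγ, -⟩ :=
      exists_lt_locally_constant_of_riemannianEDist_lt hr zero_lt_one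
    have hmem : ∀ t ∈ Icc (0 : ℝ) 1, γ t ∈ {y : M | ∀ v : TangentSpace (𝓡 n) y,
        ‖(mfderiv (𝓡 n) 𝓘(ℝ, EuclideanSpace ℝ (Fin n)) (extChartAt (𝓡 n) x) y v :
        EuclideanSpace ℝ (Fin n))‖ₑ ≤ C * ‖v‖ₑ} ∩
        (chartAt (EuclideanSpace ℝ (Fin n)) x).source := by
      intro t ht
      refine hcu ?_
      calc riemannianEDist (𝓡 n) x (γ t) ≤ pathELength (𝓡 n) γ 0 t :=
            riemannianEDist_le_pathELength γ_smooth.contMDiffOn hγx rfl ht.1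
        _ ≤ pathELength (𝓡 n) γ 0 1 := pathELength_mono le_rfl ht.2
        _ < c := hγ.trans_le hrc
    set γ' : ℝ → EuclideanSpace ℝ (Fin n) := extChartAt (𝓡 n) x ∘ γ with hγ'
    have hγ's : ContMDiffOn 𝓘(ℝ, ℝ) 𝓘(ℝ, EuclideanSpace ℝ (Fin n)) 1 γ' (Icc 0 1) :=
      contMDiffOn_extChartAt.comp (t := (chartAt (EuclideanSpace ℝ (Fin n)) x).source)
        γ_smooth.contMDiffOn (fun t ht => (hmem t ht).2)
    have hd : ∀ t ∈ Icc (0 : ℝ) 1, ‖derivWithin γ' (Icc 0 1) t‖ₑ ≤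
        C * ‖(mfderivWithin 𝓘(ℝ, ℝ) (𝓡 n) γ (Icc 0 1) t 1 : TangentSpace (𝓡 n) (γ t))‖ₑ := by
      intro t ht
      have h1 : mfderivWithin 𝓘(ℝ, ℝ) 𝓘(ℝ, EuclideanSpace ℝ (Fin n)) γ' (Icc 0 1) t =
          (mfderiv (𝓡 n) 𝓘(ℝ, EuclideanSpace ℝ (Fin n)) (extChartAt (𝓡 n) x) (γ t)).comp
            (mfderivWithin 𝓘(ℝ, ℝ) (𝓡 n) γ (Icc 0 1) t) := by
        apply mfderiv_comp_mfderivWithin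
        · exact mdifferentiableAt_extChartAt (hmem t ht).2
        · exact (γ_smooth.mdifferentiable one_ne_zero).mdifferentiableOn _ ht
        · rw [uniqueMDiffWithinAt_iff_uniqueDiffWithinAt]
          exact uniqueDiffOn_Icc zero_lt_one _ ht
      have h2 : derivWithin γ' (Icc 0 1) t =
          mfderiv (𝓡 n) 𝓘(ℝ, EuclideanSpace ℝ (Fin n)) (extChartAt (𝓡 n) x) (γ t)
            (mfderivWithin 𝓘(ℝ, ℝ) (𝓡 n) γ (Icc 0 1) t 1) := by
        rw [← fderivWithin_derivWithin, ← mfderivWithin_eq_fderivWithin, h1]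
        rfl
      rw [h2]
      exact (hmem t ht).1 _
    calc edist (extChartAt (𝓡 n) x x) (extChartAt (𝓡 n) x y)
        = ‖γ' 1 - γ' 0‖ₑ := by
          rw [edist_comm, edist_eq_enorm_sub, hγ', Function.comp_apply, Function.comp_apply, hγx,
            hγy]
      _ ≤ ∫⁻ t in Icc (0 : ℝ) 1, ‖derivWithin γ' (Icc 0 1) t‖ₑ := by
          apply enorm_sub_le_lintegral_derivWithin_Icc_of_contDiffOn_Icc _ zero_le_one
          rwa [← contMDiffOn_iff_contDiffOn]
      _ ≤ ∫⁻ t in Icc (0 : ℝ) 1, C * ‖(mfderivWithin 𝓘(ℝ, ℝ) (𝓡 n) γ (Icc 0 1) t 1 :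
            TangentSpace (𝓡 n) (γ t))‖ₑ := setLIntegral_mono' measurableSet_Icc hd
      _ = C * pathELength (𝓡 n) γ 0 1 := by
          rw [lintegral_const_mul' _ _ ENNReal.coe_ne_top,
            pathELength_eq_lintegral_mfderivWithin_Icc]
      _ ≤ C * r := by gcongr
  by_contra! hlt
  have hC0 : (C : ℝ≥0∞) ≠ 0 := by exact_mod_cast C_pos.ne'
  have h1 : riemannianEDist (𝓡 n) x y <
      min (edist (extChartAt (𝓡 n) x x) (extChartAt (𝓡 n) x y) / C) c := by
    refine lt_min ?_ hy
    rwa [ENNReal.lt_div_iff_mul_lt (Or.inl hC0) (Or.inl ENNReal.coe_ne_top), mul_comm]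
  obtain ⟨r, hr1, hr2⟩ := exists_between h1
  have h2 := key r hr1 (hr2.le.trans (min_le_right _ _))
  have h3 := ENNReal.mul_lt_of_lt_div (hr2.trans_le (min_le_left _ _))
  rw [mul_comm] at h3
  exact absurd h2 (not_le.2 h3)

end Riemannian

section LocalPiece

variable {j : ℕ} {N : Type*} [TopologicalSpace N] [ChartedSpace (EuclideanSpace ℝ (Fin j)) N]
  {D : Set N}

lemma ChartSystem.localPiece_chart (A : ChartSystem j D) (φ : N → ℝ) {i : Fin A.N} {x : N}
    (hx : x ∈ (A.chart i).source) : A.localPiece φ i (A.chart i x) = φ x * A.ψ i x := by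
  rw [ChartSystem.localPiece, indicator_of_mem ((A.chart i).map_source hx),
    (A.chart i).left_inv hx]

lemma ChartSystem.eq_sum_localPiece (A : ChartSystem j D) {φ : N → ℝ} (hφ : ∀ x, x ∉ D → φ x = 0)
    (x : N) : φ x = ∑ i, (tsupport (A.ψ i)).indicator
      (fun x => A.localPiece φ i (A.chart i x)) x := by
  have h1 : ∀ i, (tsupport (A.ψ i)).indicator (fun x => A.localPiece φ i (A.chart i x)) x =
      φ x * A.ψ i x := by
    intro i
    by_cases hx : x ∈ tsupport (A.ψ i)
    · rw [indicator_of_mem hx, A.localPiece_chart φ (A.support_subset i hx)]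
    · rw [indicator_of_notMem hx, image_eq_zero_of_notMem_tsupport hx, mul_zero]
  simp_rw [h1, ← Finset.mul_sum]
  by_cases hx : x ∈ D
  · rw [A.sum_eq_one x hx, mul_one]
  · rw [hφ x hx, zero_mul]

lemma ChartSystem.sobolevENorm_localPiece_le (A : ChartSystem j D) (q : ℝ≥0∞) (l : ℕ) (φ : N → ℝ)
    (i : Fin A.N) : sobolevENorm q l (A.localPiece φ i) ≤ A.sobolevNorm q l φ :=
  Finset.single_le_sum (f := fun i => sobolevENorm q l (A.localPiece φ i)) (fun _ _ => zero_le)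
    (Finset.mem_univ i)

/-- The `L^q`-norm of the pullback of `φ` is bounded by the Sobolev norm of `φ`, if the measure is
mapped to measures bounded by Lebesgue measure in the charts. -/
lemma ChartSystem.exists_eLpNorm_comp_le [T2Space N] (A : ChartSystem j D) {M : Type*}
    [TopologicalSpace M] [T2Space M] [MeasurableSpace M] [BorelSpace M] {ν : Measure M} {f : M → N}
    (hf : Continuous f) {K : Set M} (hK : IsCompact K)
    (hdom : ∀ x ∈ K, ∀ i, f x ∈ (A.chart i).source →
      ∃ V ∈ 𝓝 x, DominatedOn ν (fun y => A.chart i (f y)) V)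
    {q : ℝ≥0∞} (hq : 1 ≤ q) (l : ℕ) :
    ∃ C : ℝ≥0, ∀ φ : N → ℝ, (∀ x, x ∉ D → φ x = 0) → A.sobolevNorm q l φ < ⊤ →
      AEStronglyMeasurable (fun x => φ (f x)) (ν.restrict K) ∧
        eLpNorm (fun x => φ (f x)) q (ν.restrict K) ≤ C * A.sobolevNorm q l φ := by
  set Ki : Fin A.N → Set M := fun i => K ∩ f ⁻¹' tsupport (A.ψ i) with hKi
  have hKic : ∀ i, IsCompact (Ki i) := fun i =>
    hK.inter_right ((isClosed_tsupport _).preimage hf)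
  have hmap : ∀ i, ∃ C : ℝ≥0, (ν.restrict (Ki i)).map (fun y => A.chart i (f y)) ≤ C • volume :=
    fun i => DominatedOn.map_le (DominatedOn.of_isCompact (hKic i)
      fun x hx => hdom x hx.1 i (A.support_subset i hx.2))
  have hme : ∀ i, AEMeasurable (fun y => A.chart i (f y)) (ν.restrict (Ki i)) := fun i =>
    ((A.chart i).continuousOn.comp hf.continuousOn
      fun x hx => A.support_subset i hx.2).aemeasurable (hKic i).measurableSet
  choose C hC using hmap
  refine ⟨∑ i, (1 + C i), fun φ hφ hfin => ?_⟩
  have hfi : ∀ i, LocallyIntegrable (A.localPiece φ i) := fun i =>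
    locallyIntegrable_of_sobolevENorm_lt_top
      ((A.sobolevENorm_localPiece_le q l φ i).trans_lt hfin)
  have hm : ∀ i, AEStronglyMeasurable (fun x => A.localPiece φ i (A.chart i (f x)))
      (ν.restrict (Ki i)) := fun i => by
    have hac : (ν.restrict (Ki i)).map (fun y => A.chart i (f y)) ≪ volume :=
      (Measure.absolutelyContinuous_of_le (hC i)).trans Measure.smul_absolutelyContinuous
    exact ((hfi i).aestronglyMeasurable.mono_ac hac).comp_aemeasurable (hme i)
  have hme' : ∀ i, MeasurableSet (f ⁻¹' tsupport (A.ψ i)) := fun i =>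
    ((isClosed_tsupport _).preimage hf).measurableSet
  have hrest : ∀ i, (ν.restrict K).restrict (f ⁻¹' tsupport (A.ψ i)) = ν.restrict (Ki i) :=
    fun i => by rw [Measure.restrict_restrict (hme' i), inter_comm]
  have hsum : (fun x => φ (f x)) = ∑ i, (f ⁻¹' tsupport (A.ψ i)).indicator
      (fun x => A.localPiece φ i (A.chart i (f x))) := by
    ext x
    rw [Finset.sum_apply, A.eq_sum_localPiece hφ (f x)]
    rfl
  have hm' : ∀ i, AEStronglyMeasurable ((f ⁻¹' tsupport (A.ψ i)).indicator
      (fun x => A.localPiece φ i (A.chart i (f x)))) (ν.restrict K) := fun i => by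
    rw [aestronglyMeasurable_indicator_iff (hme' i), hrest]
    exact hm i
  rw [hsum]
  refine ⟨Finset.aestronglyMeasurable_sum _ fun i _ => hm' i, ?_⟩
  refine (eLpNorm_sum_le (fun i _ => hm' i) hq).trans ?_
  rw [ENNReal.ofNNReal_finsetSum, Finset.sum_mul]
  refine Finset.sum_le_sum fun i _ => ?_
  rw [eLpNorm_indicator_eq_eLpNorm_restrict (hme' i), hrest]
  refine (eLpNorm_comp_le_of_map_le (hme i) (hC i) hq (hfi i).aestronglyMeasurable).trans ?_
  push_cast
  gcongr
  exact (eLpNorm_le_sobolevENorm (hfi i)).trans (A.sobolevENorm_localPiece_le q l φ i)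

end LocalPiece

lemma DualitySetting.HA1.bump_exponent_nonneg_sobolev {G : Type*} [Group G] [TopologicalSpace G]
    [IsTopologicalGroup G] [LocallyCompactSpace G] [SecondCountableTopology G] [T2Space G]
    [MeasurableSpace G] [BorelSpace G] {S : DualitySetting G} {k l : ℕ}
    [ChartedSpace (EuclideanSpace ℝ (Fin k)) S.H] [LieGroup (𝓡 k) ∞ S.H]
    {O : ℝ → Set G} {q : ℝ≥0∞} (hq : 1 ≤ q) {d κ : ℝ} {CH : (S.H → ℝ) → Prop}
    (h : S.HA1 O CH (sobolevNorms k q l) d κ) : 0 ≤ κ := by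
  refine h.bump_exponent_nonneg fun K hK N hN => ?_
  obtain ⟨A, rfl⟩ := hN
  have hHI : IsManifold (𝓡 k) ∞ S.H := inferInstance
  have : SecondCountableTopology S.H := TopologicalSpace.Subtype.secondCountableTopology _
  obtain ⟨C, hC⟩ := A.exists_eLpNorm_comp_le (ν := S.ρ) continuous_id hK
    (fun x _ i hx => exists_dominatedOn_chart (A.chart_mem i) hx) hq l
  refine ⟨(1 + (S.ρ K).toNNReal) * (C + 1), fun χ _ hχ => ?_⟩
  have hχK : ∀ x, x ∉ K → χ x = 0 := fun x hx => image_eq_zero_of_notMem_tsupport fun h => hx (hχ h)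
  rcases eq_or_ne (A.sobolevNorm q l χ) ⊤ with htop | htop
  · simp only [htop]
    rw [ENNReal.mul_top (by simp)]
    exact le_top
  obtain ⟨h1, h2⟩ := hC χ hχK (lt_top_iff_ne_top.2 htop)
  have hKt : S.ρ K ≠ ⊤ := hK.measure_lt_top.ne
  have h3 : ∫⁻ h, ‖χ h‖ₑ ∂S.ρ = ∫⁻ h, ‖χ h‖ₑ ∂(S.ρ.restrict K) := by
    rw [setLIntegral_eq_of_support_subset]
    intro x hx
    by_contra h
    simp [hχK x h] at hx
  rw [h3]
  refine (DualitySetting.lintegral_enorm_le_of_forall_notMem (ν := S.ρ.restrict K) (K := K) h1 hχK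
    hq).trans ?_
  · rw [Measure.restrict_apply_self]
    calc (1 + S.ρ K) * eLpNorm χ q (S.ρ.restrict K) ≤ (1 + S.ρ K) * (C * A.sobolevNorm q l χ) := by
          gcongr
          exact h2
      _ ≤ (1 + S.ρ K) * ((C + 1) * A.sobolevNorm q l χ) := by gcongr; exact le_self_add
      _ = _ := by
          push_cast
          rw [ENNReal.coe_toNNReal hKt, mul_assoc]

section RiemannianGroup

open Manifold

variable {n : ℕ} {G : Type*} [Group G] [TopologicalSpace G] [IsTopologicalGroup G]
  [ChartedSpace (EuclideanSpace ℝ (Fin n)) G] [LieGroup (𝓡 n) ∞ G]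
  [Bundle.RiemannianBundle (fun x : G => TangentSpace (𝓡 n) x)]
  [IsContMDiffRiemannianBundle (𝓡 n) ∞ (EuclideanSpace ℝ (Fin n))
    (fun x : G => TangentSpace (𝓡 n) x)]

lemma exists_measure_riemannianNhds_le [SecondCountableTopology G] [MeasurableSpace G]
    [BorelSpace G] (ν : Measure G) [SFinite ν] [IsLocallyFiniteMeasure ν] [ν.IsMulLeftInvariant] :
    ∃ C : ℝ≥0, ∀ᶠ ε in 𝓝[>] (0 : ℝ),
      ν (riemannianNhds n G ε) ≤ C * ENNReal.ofReal (ε ^ n) := by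
  have hI : IsManifold (𝓡 n) ∞ G := inferInstance
  obtain ⟨C, c, hc, hCc⟩ := exists_edist_extChartAt_le_riemannianEDist (n := n) (1 : G)
  have := isContinuousRiemannianBundle_tangent (n := n) (M := G)
  obtain ⟨V, hV, C', hC'⟩ := exists_dominatedOn_chart (ν := ν)
    (IsManifold.chart_mem_maximalAtlas (I := 𝓡 n) (n := ∞) (1 : G))
    (mem_chart_source (EuclideanSpace ℝ (Fin n)) (1 : G))
  obtain ⟨c', hc', hcV⟩ := setOfPred_riemannianEDist_lt_subset_nhds (𝓡 n) hV
  refine ⟨C' * (volume (Metric.closedBall (0 : EuclideanSpace ℝ (Fin n)) C)).toNNReal, ?_⟩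
  filter_upwards [Ioo_mem_nhdsGT (show (0 : ℝ) < min c c' by
    have := lt_min hc hc'
    exact_mod_cast this)] with ε hε
  have hεc : ENNReal.ofReal ε ≤ (c : ℝ≥0∞) := by
    rw [← ENNReal.ofReal_coe_nnreal]
    exact ENNReal.ofReal_le_ofReal (hε.2.le.trans (min_le_left _ _))
  have hεc' : ENNReal.ofReal ε ≤ (c' : ℝ≥0∞) := by
    rw [← ENNReal.ofReal_coe_nnreal]
    exact ENNReal.ofReal_le_ofReal (hε.2.le.trans (min_le_right _ _))
  set e := chartAt (EuclideanSpace ℝ (Fin n)) (1 : G)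
  have hsub : riemannianNhds n G ε ⊆ V ∩ e ⁻¹' Metric.closedBall (e 1) (C * ε) := by
    intro g hg
    refine ⟨hcV (hg.1.trans_le hεc'), ?_⟩
    have h1 := (hCc g (hg.1.trans_le hεc)).trans
      (mul_le_mul_of_nonneg_left hg.1.le (zero_le (a := (C : ℝ≥0∞))))
    rw [← ENNReal.ofReal_coe_nnreal, ← ENNReal.ofReal_mul (by positivity), edist_dist] at h1
    have h2 := (ENNReal.ofReal_le_ofReal_iff (mul_nonneg C.2 hε.1.le)).1 h1
    rw [dist_comm] at h2
    simpa [e] using h2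
  refine (measure_mono hsub).trans ((hC' _ Metric.isClosed_closedBall.measurableSet).trans ?_)
  rw [Measure.addHaar_closedBall_center, mul_comm (C : ℝ) ε,
    Measure.addHaar_closedBall_mul_of_pos volume (0 : EuclideanSpace ℝ (Fin n)) hε.1 (C : ℝ), ENNReal.coe_mul, ENNReal.coe_toNNReal
      measure_closedBall_lt_top.ne, finrank_euclideanSpace_fin]
  rw [mul_assoc, mul_comm (ENNReal.ofReal _)]

/-- The covering exponent of the Riemannian neighbourhoods is at least the dimension. -/
lemma le_covering_exponent [SecondCountableTopology G] [LocallyCompactSpace G] [T2Space G]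
    [MeasurableSpace G] [BorelSpace G] (ν : Measure G) [ν.IsHaarMeasure] {d : ℝ}
    (hcov : ∀ Ω : Set G, IsCompact Ω → ∃ C : ℝ, ∀ ε, 0 < ε → ε < 1 →
      ∃ V : Finset G, Ω ⊆ ⋃ v ∈ V, v • riemannianNhds n G ε ∧ (V.card : ℝ) ≤ C * ε ^ (-d)) :
    (n : ℝ) ≤ d := by
  obtain ⟨K, hK, hK1⟩ := exists_compact_mem_nhds (1 : G)
  obtain ⟨C, hC⟩ := hcov K hK
  obtain ⟨C', hC'⟩ := exists_measure_riemannianNhds_le (n := n) ν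
  have hpos : 0 < ν K := Measure.measure_pos_of_mem_nhds ν hK1
  have hlt : ν K < ⊤ := hK.measure_lt_top
  suffices 0 ≤ d - n by linarith
  refine nonneg_of_eventually_le_rpow (c := (ν K).toReal) (C := C * C')
    (ENNReal.toReal_pos hpos.ne' hlt.ne) (Eventually.frequently ?_)
  filter_upwards [hC', Ioo_mem_nhdsGT one_pos] with ε h1 hε
  obtain ⟨V, hV, hVc⟩ := hC ε hε.1 hε.2
  have h2 : ν K ≤ ENNReal.ofReal ((C * ε ^ (-d)) * (C' * ε ^ n)) := by
    calc ν K ≤ ∑ v ∈ V, ν (v • riemannianNhds n G ε) :=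
          (measure_mono hV).trans (measure_biUnion_finset_le _ _)
      _ = V.card * ν (riemannianNhds n G ε) := by simp [measure_smul]
      _ ≤ ENNReal.ofReal (C * ε ^ (-d)) * (C' * ENNReal.ofReal (ε ^ n)) := by
          gcongr
          rw [← ENNReal.ofReal_natCast]
          exact ENNReal.ofReal_le_ofReal hVc
      _ = _ := by
          rw [ENNReal.ofReal_mul (le_trans (by positivity) hVc), ENNReal.ofReal_mul (p := (C' : ℝ)) C'.2,
            ENNReal.ofReal_coe_nnreal]
  have h3 := ENNReal.toReal_mono ENNReal.ofReal_ne_top h2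
  have hε0 := hε.1
  rw [ENNReal.toReal_ofReal (mul_nonneg (le_trans (by positivity) hVc) (by positivity))] at h3
  refine h3.trans (le_of_eq ?_)
  rw [show -(d - n) = -d + (n : ℝ) by ring, Real.rpow_add hε.1, Real.rpow_natCast]
  ring

/-- In a chart, `v⁻¹ g` is in the `ε`-neighbourhood of the identity as soon as `g` and `v` are
within `ε / C`. -/
lemma exists_inv_mul_mem_riemannianNhds {e : OpenPartialHomeomorph G (EuclideanSpace ℝ (Fin n))}
    (he : e ∈ IsManifold.maximalAtlas (𝓡 n) ∞ G) {g₀ : G} (hg₀ : g₀ ∈ e.source) :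
    ∃ V ∈ 𝓝 g₀, ∃ C : ℝ, 0 < C ∧ ∀ v ∈ V, ∀ g ∈ V, ∀ ε, C * ‖e g - e v‖ < ε →
      v⁻¹ * g ∈ riemannianNhds n G ε := by
  have hI : IsManifold (𝓡 n) ∞ G := inferInstance
  have := isContinuousRiemannianBundle_tangent (n := n) (M := G)
  obtain ⟨C, C_pos, hC⟩ := eventually_riemannianEDist_le_edist_extChartAt (𝓡 n) (1 : G)
  set e₁ := extChartAt (𝓡 n) (1 : G) with he₁
  set F : EuclideanSpace ℝ (Fin n) × EuclideanSpace ℝ (Fin n) → EuclideanSpace ℝ (Fin n) :=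
    fun w => e₁ ((e.symm w.1)⁻¹ * e.symm w.2) with hF
  have hsymm := contMDiffAt_chart_symm he (e.map_source hg₀)
  have hinv : e.symm (e g₀) = g₀ := e.left_inv hg₀
  have hFs : ContDiffAt ℝ ∞ F (e g₀, e g₀) := by
    rw [← contMDiffAt_iff_contDiffAt]
    have h1 : ContMDiffAt 𝓘(ℝ, EuclideanSpace ℝ (Fin n) × EuclideanSpace ℝ (Fin n)) (𝓡 n) ∞
        (fun w : EuclideanSpace ℝ (Fin n) × EuclideanSpace ℝ (Fin n) => e.symm w.1)
        (e g₀, e g₀) :=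
      ContMDiffAt.comp (e g₀, e g₀) (g := e.symm) hsymm contDiff_fst.contMDiff.contMDiffAt
    have h2 : ContMDiffAt 𝓘(ℝ, EuclideanSpace ℝ (Fin n) × EuclideanSpace ℝ (Fin n)) (𝓡 n) ∞
        (fun w : EuclideanSpace ℝ (Fin n) × EuclideanSpace ℝ (Fin n) => e.symm w.2)
        (e g₀, e g₀) :=
      ContMDiffAt.comp (e g₀, e g₀) (g := e.symm) hsymm contDiff_snd.contMDiff.contMDiffAt
    refine ContMDiffAt.comp (e g₀, e g₀) (g := e₁)
      (f := fun w : EuclideanSpace ℝ (Fin n) × EuclideanSpace ℝ (Fin n) =>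
        (e.symm w.1)⁻¹ * e.symm w.2) ?_ (h1.inv.mul h2)
    simp only [hinv, inv_mul_cancel]
    exact contMDiffAt_extChartAt
  obtain ⟨L, t, ht, hL⟩ := (hFs.of_le (m := 1) (by simp)).exists_lipschitzOnWith
  rw [nhds_prod_eq] at ht
  obtain ⟨U, hU, U', hU', hUt⟩ := Filter.mem_prod_iff.1 ht
  have hcont : ContinuousAt e g₀ := e.continuousAt hg₀
  have hdiv : ∀ᶠ w in 𝓝 ((g₀, g₀) : G × G), riemannianEDist (𝓡 n) 1 (w.1⁻¹ * w.2) ≤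
      C * edist (e₁ 1) (e₁ (w.1⁻¹ * w.2)) := by
    have h1 : Tendsto (fun w : G × G => w.1⁻¹ * w.2) (𝓝 (g₀, g₀)) (𝓝 1) := by
      have : Continuous fun w : G × G => w.1⁻¹ * w.2 := by fun_prop
      simpa using this.tendsto (g₀, g₀)
    exact h1.eventually hC
  rw [nhds_prod_eq] at hdiv
  obtain ⟨U'', hU'', hdiv⟩ := (Filter.eventually_prod_self_iff (r := fun v g : G =>
    riemannianEDist (𝓡 n) 1 (v⁻¹ * g) ≤ C * edist (e₁ 1) (e₁ (v⁻¹ * g)))).1 hdiv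
  refine ⟨U'' ∩ e ⁻¹' (U ∩ U') ∩ e.source, inter_mem (inter_mem hU''
    (hcont.preimage_mem_nhds (inter_mem hU hU'))) (e.open_source.mem_nhds hg₀), C * L + 1,
    by positivity, ?_⟩
  have key : ∀ v ∈ U'' ∩ e ⁻¹' (U ∩ U') ∩ e.source, ∀ g ∈ U'' ∩ e ⁻¹' (U ∩ U') ∩ e.source,
      ∀ ε, (C * L + 1) * ‖e g - e v‖ < ε → riemannianEDist (𝓡 n) 1 (v⁻¹ * g) < ENNReal.ofReal ε := by
    intro v hv g hg ε hε
    have h1 := hL (hUt (show (e v, e g) ∈ U ×ˢ U' from ⟨hv.1.2.1, hg.1.2.2⟩))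
      (hUt (show (e v, e v) ∈ U ×ˢ U' from ⟨hv.1.2.1, hv.1.2.2⟩))
    simp only [hF, e.left_inv hv.2, e.left_inv hg.2, inv_mul_cancel, Prod.edist_eq, edist_self,
      zero_le, sup_of_le_right] at h1
    rcases (norm_nonneg (e g - e v)).eq_or_lt with h0 | h0
    · have h2 : e g = e v := sub_eq_zero.1 (norm_eq_zero.1 h0.symm)
      have h3 : g = v := e.injOn hg.2 hv.2 h2
      rw [h3, inv_mul_cancel, riemannianEDist_self]
      rw [← h0, mul_zero] at hε
      exact ENNReal.ofReal_pos.2 hε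
    · calc riemannianEDist (𝓡 n) 1 (v⁻¹ * g) ≤ C * edist (e₁ 1) (e₁ (v⁻¹ * g)) :=
            hdiv v hv.1.1 g hg.1.1
        _ ≤ C * (L * edist (e g) (e v)) := by
            gcongr
            rw [edist_comm]
            exact h1
        _ = ENNReal.ofReal (C * L * ‖e g - e v‖) := by
            rw [edist_dist, dist_eq_norm, ENNReal.ofReal_mul (by positivity),
              ENNReal.ofReal_mul (by positivity), ENNReal.ofReal_coe_nnreal,
              ENNReal.ofReal_coe_nnreal, mul_assoc]
        _ < ENNReal.ofReal ε := by
            rw [ENNReal.ofReal_lt_ofReal_iff_of_nonneg (by positivity)]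
            nlinarith
  intro v hv g hg ε hε
  refine ⟨key v hv g hg ε hε, ?_⟩
  rw [mul_inv_rev, inv_inv]
  exact key g hg v hv ε (by rwa [norm_sub_rev])

end RiemannianGroup

section Grid

variable {n : ℕ}

lemma EuclideanSpace.norm_le_of_abs_le {x : EuclideanSpace ℝ (Fin n)} {c : ℝ} (hc : 0 ≤ c)
    (h : ∀ i, |x i| ≤ c) : ‖x‖ ≤ n * c := by
  rw [EuclideanSpace.norm_eq]
  refine Real.sqrt_le_iff.2 ⟨by positivity, ?_⟩
  calc ∑ i, ‖x i‖ ^ 2 ≤ ∑ _i : Fin n, c ^ 2 := by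
        refine Finset.sum_le_sum fun i _ => ?_
        rw [Real.norm_eq_abs]
        gcongr
        exact h i
    _ = (n : ℝ) * c ^ 2 := by simp
    _ ≤ ((n : ℝ) * n) * c ^ 2 := by
        gcongr
        exact_mod_cast Nat.le_mul_self n
    _ = _ := by ring

/-- A smooth bump function on `ℝⁿ` whose integer translates form a partition of unity. -/
def gridBump (x : EuclideanSpace ℝ (Fin n)) : ℝ :=
  ∏ i, (Real.smoothTransition (x i + 1) - Real.smoothTransition (x i))

/-- The point of `ℝⁿ` with integer coordinates `k`. -/
def gridPoint (k : Fin n → ℤ) : EuclideanSpace ℝ (Fin n) := WithLp.toLp 2 fun i => (k i : ℝ)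

lemma contDiff_gridBump : ContDiff ℝ ∞ (gridBump (n := n)) := by
  unfold gridBump
  refine contDiff_prod fun i _ => ?_
  have h : ContDiff ℝ ∞ fun x : EuclideanSpace ℝ (Fin n) => x i :=
    contDiff_coord contDiff_id i
  exact (Real.smoothTransition.contDiff.comp (h.add contDiff_const)).sub
    (Real.smoothTransition.contDiff.comp h)

lemma gridBump_nonneg (x : EuclideanSpace ℝ (Fin n)) : 0 ≤ gridBump x :=
  Finset.prod_nonneg fun i _ => sub_nonneg.2 (Real.smoothTransition.monotone (by linarith))

lemma abs_le_of_gridBump_ne_zero {x : EuclideanSpace ℝ (Fin n)} (hx : gridBump x ≠ 0) (i : Fin n) :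
    |x i| ≤ 1 := by
  have h := Finset.prod_ne_zero_iff.1 hx i (Finset.mem_univ i)
  by_contra hlt
  push Not at hlt
  rcases lt_abs.1 hlt with h1 | h1
  · rw [Real.smoothTransition.one_of_one_le h1.le,
      Real.smoothTransition.one_of_one_le (by linarith), sub_self] at h
    exact h rfl
  · rw [Real.smoothTransition.zero_of_nonpos (by linarith),
      Real.smoothTransition.zero_of_nonpos (by linarith), sub_self] at h
    exact h rfl

lemma hasCompactSupport_gridBump : HasCompactSupport (gridBump (n := n)) := by
  refine HasCompactSupport.intro (isCompact_closedBall 0 (n * 1 : ℝ)) fun x hx => ?_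
  by_contra h
  refine hx (mem_closedBall_zero_iff.2 ?_)
  exact EuclideanSpace.norm_le_of_abs_le zero_le_one fun i => abs_le_of_gridBump_ne_zero h i

lemma norm_sub_le_of_gridBump_ne_zero {x y : EuclideanSpace ℝ (Fin n)} (hx : gridBump x ≠ 0)
    (hy : gridBump y ≠ 0) : ‖x - y‖ ≤ 2 * n := by
  have h1 := EuclideanSpace.norm_le_of_abs_le zero_le_one fun i => abs_le_of_gridBump_ne_zero hx i
  have h2 := EuclideanSpace.norm_le_of_abs_le zero_le_one fun i => abs_le_of_gridBump_ne_zero hy i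
  have := norm_sub_le x y
  linarith

lemma sum_smoothTransition (M : ℕ) {t : ℝ} (ht : |t| ≤ M) :
    ∑ k ∈ Finset.Icc (-(M : ℤ)) M,
      (Real.smoothTransition (t - k + 1) - Real.smoothTransition (t - k)) = 1 := by
  have key : ∀ m : ℕ, ∑ k ∈ Finset.Ico (-(M : ℤ)) (-(M : ℤ) + m),
      (Real.smoothTransition (t - k + 1) - Real.smoothTransition (t - k)) =
      Real.smoothTransition (t + M + 1) - Real.smoothTransition (t + M + 1 - m) := by
    intro m
    induction m with
    | zero => simp
    | succ m ih =>
      have h1 : Finset.Ico (-(M : ℤ)) (-(M : ℤ) + (m + 1 : ℕ)) =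
          insert (-(M : ℤ) + m) (Finset.Ico (-(M : ℤ)) (-(M : ℤ) + m)) := by
        ext k
        simp only [Finset.mem_Ico, Finset.mem_insert]
        omega
      rw [h1, Finset.sum_insert (by simp), ih]
      push_cast
      rw [show t - (-(M : ℝ) + m) + 1 = t + M + 1 - m by ring,
        show t - (-(M : ℝ) + m) = t + M + 1 - (m + 1) by ring]
      ring
  have h2 : Finset.Icc (-(M : ℤ)) M = Finset.Ico (-(M : ℤ)) (-(M : ℤ) + (2 * M + 1 : ℕ)) := by
    ext k
    simp only [Finset.mem_Ico, Finset.mem_Icc]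
    omega
  obtain ⟨h3, h4⟩ := abs_le.1 ht
  rw [h2, key, Real.smoothTransition.one_of_one_le (by linarith),
    Real.smoothTransition.zero_of_nonpos (by push_cast; linarith), sub_zero]

lemma sum_gridBump (M : ℕ) {x : EuclideanSpace ℝ (Fin n)} (hx : ∀ i, |x i| ≤ M) :
    ∑ k ∈ Fintype.piFinset (fun _ : Fin n => Finset.Icc (-(M : ℤ)) M),
      gridBump (x - gridPoint k) = 1 := by
  have h := Finset.prod_univ_sum (fun _ : Fin n => Finset.Icc (-(M : ℤ)) M)
    (fun i k => Real.smoothTransition (x i - k + 1) - Real.smoothTransition (x i - k))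
  rw [Finset.prod_eq_one fun i _ => sum_smoothTransition M (hx i)] at h
  rw [h]
  rfl

lemma card_grid (M : ℕ) :
    (Fintype.piFinset (fun _ : Fin n => Finset.Icc (-(M : ℤ)) M)).card = (2 * M + 1) ^ n := by
  rw [Fintype.card_piFinset]
  simp only [Int.card_Icc, Finset.prod_const, Finset.card_univ, Fintype.card_fin]
  congr 1
  omega

end Grid

section Rescale

variable {n : ℕ} {F : Type*} [NormedAddCommGroup F] [NormedSpace ℝ F]

lemma ContDiff.exists_norm_iteratedFDeriv_le {f : EuclideanSpace ℝ (Fin n) → F}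
    (hf : ContDiff ℝ ∞ f) {K : Set (EuclideanSpace ℝ (Fin n))} (hK : IsCompact K) (l : ℕ) :
    ∃ B : ℝ≥0, ∀ i ≤ l, ∀ x ∈ K, ‖iteratedFDeriv ℝ i f x‖ ≤ B := by
  have h1 : ∀ i : ℕ, ∃ B : ℝ, ∀ x ∈ K, ‖iteratedFDeriv ℝ i f x‖ ≤ B := fun i =>
    hK.exists_bound_of_continuousOn
      (hf.continuous_iteratedFDeriv (m := i) (by exact_mod_cast le_top)).continuousOn
  choose B hB using h1
  refine ⟨∑ i ∈ Finset.range (l + 1), (B i).toNNReal, fun i hi x hx => ?_⟩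
  refine (hB i x hx).trans ((Real.le_coe_toNNReal _).trans ?_)
  exact_mod_cast Finset.single_le_sum (f := fun i => (B i).toNNReal) (fun _ _ => zero_le)
    (Finset.mem_range.2 (Nat.lt_succ_of_le hi))

lemma exists_derivBound_of_hasCompactSupport {f : EuclideanSpace ℝ (Fin n) → ℝ}
    (hf : ContDiff ℝ ∞ f) (hfc : HasCompactSupport f) (l : ℕ) : ∃ B : ℝ≥0, DerivBound l B f := by
  obtain ⟨B, hB⟩ := hf.exists_norm_iteratedFDeriv_le hfc l
  refine ⟨B, fun i hi x => ?_⟩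
  by_cases hx : x ∈ tsupport f
  · exact hB i hi x hx
  · rw [iteratedFDeriv_eq_zero_of_notMem_tsupport hx, norm_zero]
    exact B.2

/-- The functions `A(z) h(ε⁻¹ Q(z) - k)` have derivatives of order at most `l` of size `ε^{-l}`. -/
lemma exists_derivBound_rescale {n' : ℕ} {A : EuclideanSpace ℝ (Fin n) → ℝ} (hA : ContDiff ℝ ∞ A)
    (hAc : HasCompactSupport A) {Q : EuclideanSpace ℝ (Fin n) → EuclideanSpace ℝ (Fin n')}
    (hQ : ContDiff ℝ ∞ Q) {h : EuclideanSpace ℝ (Fin n') → ℝ} (hh : ContDiff ℝ ∞ h)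
    (hhc : HasCompactSupport h) (l : ℕ) :
    ∃ C : ℝ≥0, ∀ ε : ℝ, 0 < ε → ε ≤ 1 → ∀ k,
      DerivBound l (C * (ε⁻¹).toNNReal ^ l) fun z => A z * h (ε⁻¹ • Q z - k) := by
  obtain ⟨BA, hBA⟩ := exists_derivBound_of_hasCompactSupport hA hAc l
  obtain ⟨Bh, hBh⟩ := exists_derivBound_of_hasCompactSupport hh hhc l
  obtain ⟨BQ, hBQ⟩ := hQ.exists_norm_iteratedFDeriv_le hAc l
  set D : ℝ≥0 := BQ + 1 with hD
  refine ⟨2 ^ l * BA * (l.factorial * Bh * D ^ l), fun ε hε hε1 k i hi z => ?_⟩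
  have hε1' : 1 ≤ ε⁻¹ := (one_le_inv₀ hε).2 hε1
  have hεD : 1 ≤ ε⁻¹ * D := by
    have : (1 : ℝ) ≤ D := by simp [hD]
    nlinarith
  have hQs : ContDiff ℝ ∞ fun z => ε⁻¹ • Q z := hQ.const_smul ε⁻¹
  have hhs : ContDiff ℝ ∞ fun z => h (z - k) := hh.comp (contDiff_id.sub contDiff_const)
  have hcomp : ContDiff ℝ ∞ fun z => h (ε⁻¹ • Q z - k) := hhs.comp hQs
  by_cases hz : z ∈ tsupport A
  · have h1 : ∀ i ≤ l, ‖iteratedFDeriv ℝ i (fun z => h (ε⁻¹ • Q z - k)) z‖ ≤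
        l.factorial * Bh * (ε⁻¹ * D) ^ l := by
      intro i hi
      have h2 := norm_iteratedFDeriv_comp_le (g := fun z => h (z - k)) (f := fun z => ε⁻¹ • Q z)
        (n := i) (N := ∞) hhs hQs (by exact_mod_cast le_top) z (C := Bh) (D := ε⁻¹ * D) ?_ ?_
      · refine h2.trans ?_
        have := Nat.factorial_le hi
        gcongr
      · intro i' hi'
        rw [iteratedFDeriv_comp_sub]
        exact hBh i' (hi'.trans hi) _
      · intro i' h1i hi'
        have e : iteratedFDeriv ℝ i' (fun z => ε⁻¹ • Q z) z = ε⁻¹ • iteratedFDeriv ℝ i' Q z := by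
          change iteratedFDeriv ℝ i' (ε⁻¹ • Q) z = _
          exact iteratedFDeriv_const_smul_apply (hQ.contDiffAt.of_le (by exact_mod_cast le_top))
        rw [e, norm_smul, Real.norm_of_nonneg (by positivity)]
        calc ε⁻¹ * ‖iteratedFDeriv ℝ i' Q z‖ ≤ ε⁻¹ * D := by
              gcongr
              refine (hBQ i' (hi'.trans hi) z hz).trans ?_
              simp [hD]
          _ = (ε⁻¹ * D) ^ 1 := (pow_one _).symm
          _ ≤ (ε⁻¹ * D) ^ i' := pow_le_pow_right₀ hεD h1i
    refine (norm_iteratedFDeriv_mul_le (N := ∞) hA hcomp z (by exact_mod_cast le_top)).trans ?_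
    calc ∑ a ∈ Finset.range (i + 1), (i.choose a : ℝ) * ‖iteratedFDeriv ℝ a A z‖ *
          ‖iteratedFDeriv ℝ (i - a) (fun z => h (ε⁻¹ • Q z - k)) z‖
        ≤ ∑ a ∈ Finset.range (i + 1), (i.choose a : ℝ) * BA *
            (l.factorial * Bh * (ε⁻¹ * D) ^ l) := by
          refine Finset.sum_le_sum fun a ha => ?_
          rw [Finset.mem_range] at ha
          gcongr
          · exact hBA a (by omega) z
          · exact h1 (i - a) (by omega)
      _ = 2 ^ i * BA * (l.factorial * Bh * (ε⁻¹ * D) ^ l) := by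
          rw [← Finset.sum_mul, ← Finset.sum_mul]
          congr 2
          exact_mod_cast Nat.sum_range_choose i
      _ ≤ 2 ^ l * BA * (l.factorial * Bh * (ε⁻¹ * D) ^ l) := by
          gcongr
          norm_num
      _ = _ := by
          push_cast
          rw [Real.coe_toNNReal _ (by positivity)]
          ring
  · rw [iteratedFDeriv_eq_zero_of_notMem_tsupport, norm_zero]
    · positivity
    · intro h
      exact hz (tsupport_mul_subset_left h)

end Rescale

section Transport

variable {n : ℕ} {M : Type*} [TopologicalSpace M] [ChartedSpace (EuclideanSpace ℝ (Fin n)) M]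
  [T2Space M] {E : OpenPartialHomeomorph M (EuclideanSpace ℝ (Fin n))} {β : M → ℝ}

/-- A compactly supported function on the source of a chart, read in the chart and extended by
zero, is supported in the image of its support. -/
lemma tsupport_indicator_target_subset (hβc : HasCompactSupport β) (hβE : tsupport β ⊆ E.source) :
    tsupport (E.target.indicator fun z => β (E.symm z)) ⊆ E '' tsupport β := by
  refine closure_minimal ?_ (hβc.image_of_continuousOn (E.continuousOn.mono hβE)).isClosed
  intro z hz
  have hzt : z ∈ E.target := by
    by_contra h
    exact hz (indicator_of_notMem h _)
  rw [Function.mem_support, indicator_of_mem hzt] at hz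
  exact ⟨E.symm z, subset_tsupport _ hz, E.right_inv hzt⟩

lemma contDiff_indicator_target (hE : ContMDiffOn (𝓡 n) (𝓡 n) ∞ E.symm E.target)
    (hβ : ContMDiff (𝓡 n) 𝓘(ℝ, ℝ) ∞ β) (hβc : HasCompactSupport β) (hβE : tsupport β ⊆ E.source) :
    ContDiff ℝ ∞ (E.target.indicator fun z => β (E.symm z)) := by
  rw [← contMDiff_iff_contDiff]
  refine contMDiff_of_tsupport fun z hz => ?_
  obtain ⟨x, hx, rfl⟩ := tsupport_indicator_target_subset hβc hβE hz
  have hxt : E x ∈ E.target := E.map_source (hβE hx)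
  have h1 : ContMDiffAt (𝓡 n) 𝓘(ℝ, ℝ) ∞ (fun z => β (E.symm z)) (E x) :=
    (hβ _).comp (E x) (hE.contMDiffAt (E.open_target.mem_nhds hxt))
  refine h1.congr_of_eventuallyEq ?_
  filter_upwards [E.open_target.mem_nhds hxt] with z hz
  exact indicator_of_mem hz _

/-- A smooth function on a neighbourhood of a compact set agrees near the compact set with a smooth
function on the whole space. -/
lemma exists_contDiff_eqOn {F : Type*} [NormedAddCommGroup F] [NormedSpace ℝ F]
    {f : EuclideanSpace ℝ (Fin n) → F} {K U : Set (EuclideanSpace ℝ (Fin n))} (hK : IsCompact K)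
    (hU : IsOpen U) (hKU : K ⊆ U) (hf : ContDiffOn ℝ ∞ f U) :
    ∃ Q : EuclideanSpace ℝ (Fin n) → F, ContDiff ℝ ∞ Q ∧ EqOn Q f K := by
  obtain ⟨V, hVo, hKV, hVU⟩ := normal_exists_closure_subset hK.isClosed hU hKU
  obtain ⟨χ, hχ1, hχ0, -⟩ := exists_contMDiffMap_one_nhds_of_subset_interior (n := ⊤)
    (𝓘(ℝ, EuclideanSpace ℝ (Fin n))) hK.isClosed (t := V) (by rwa [hVo.interior_eq])
  have hχs : ContDiff ℝ ∞ χ := contMDiff_iff_contDiff.1 χ.contMDiff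
  refine ⟨fun z => χ z • f z, ?_, fun z hz => ?_⟩
  · rw [contDiff_iff_contDiffAt]
    intro z
    by_cases hz : z ∈ closure V
    · exact hχs.contDiffAt.smul (hf.contDiffAt (hU.mem_nhds (hVU hz)))
    · refine (contDiffAt_const (c := (0 : F))).congr_of_eventuallyEq ?_
      filter_upwards [isClosed_closure.isOpen_compl.mem_nhds hz] with w hw
      rw [hχ0 w fun h => hw (subset_closure h), zero_smul]
  · have : χ z = 1 := hχ1.self_of_nhdsSet z hz
    simp [this]

end Transport

/-- The Sobolev norm, in a chart `E`, of the pullback of `u` by a submersion, multiplied by a smooth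
function and a rescaled bump function. -/
theorem exists_sobolevENorm_pullback_le {n j : ℕ} {M : Type*} [TopologicalSpace M]
    [ChartedSpace (EuclideanSpace ℝ (Fin n)) M] [IsManifold (𝓡 n) ∞ M] [T2Space M]
    {N : Type*} [TopologicalSpace N] [ChartedSpace (EuclideanSpace ℝ (Fin j)) N]
    [IsManifold (𝓡 j) ∞ N] {E : OpenPartialHomeomorph M (EuclideanSpace ℝ (Fin n))}
    (hE : ContMDiffOn (𝓡 n) (𝓡 n) ∞ E E.source) (hE' : ContMDiffOn (𝓡 n) (𝓡 n) ∞ E.symm E.target)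
    {f : M → N} (hf : Manifold.IsSubmersion (𝓡 n) (𝓡 j) ∞ f)
    {κ : OpenPartialHomeomorph N (EuclideanSpace ℝ (Fin j))}
    (hκ : κ ∈ IsManifold.maximalAtlas (𝓡 j) ∞ N) {β : M → ℝ}
    (hβ : ContMDiff (𝓡 n) 𝓘(ℝ, ℝ) ∞ β) (hβc : HasCompactSupport β) (hβE : tsupport β ⊆ E.source)
    (hβκ : tsupport β ⊆ f ⁻¹' κ.source) {e : M → EuclideanSpace ℝ (Fin n)} {V : Set M}
    (hV : IsOpen V) (he : ContMDiffOn (𝓡 n) (𝓡 n) ∞ e V) (hβV : tsupport β ⊆ V)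
    {h : EuclideanSpace ℝ (Fin n) → ℝ} (hh : ContDiff ℝ ∞ h) (hhc : HasCompactSupport h)
    {q : ℝ≥0∞} (hq : 1 ≤ q) (l : ℕ) :
    ∃ C : ℝ≥0, ∀ ε : ℝ, 0 < ε → ε ≤ 1 → ∀ k, ∀ u : EuclideanSpace ℝ (Fin j) → ℝ,
      sobolevENorm q l u < ⊤ →
      sobolevENorm q l (E.target.indicator fun z =>
        β (E.symm z) * h (ε⁻¹ • e (E.symm z) - k) * u (κ (f (E.symm z)))) ≤
        (C * (ε⁻¹).toNNReal ^ l : ℝ≥0) * sobolevENorm q l u := by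
  set K := E '' tsupport β with hK
  have hKc : IsCompact K := hβc.image_of_continuousOn (E.continuousOn.mono hβE)
  have hfc : Continuous f := hf.contMDiff.continuous
  set U := E.target ∩ E.symm ⁻¹' (V ∩ f ⁻¹' κ.source) with hU
  have hUo : IsOpen U := E.isOpen_inter_preimage_symm (hV.inter (κ.open_source.preimage hfc))
  have hKU : K ⊆ U := by
    rintro _ ⟨x, hx, rfl⟩
    refine ⟨E.map_source (hβE hx), ?_⟩
    rw [mem_preimage, E.left_inv (hβE hx)]
    exact ⟨hβV hx, hβκ hx⟩
  have hEs : ∀ z ∈ U, ContMDiffAt (𝓡 n) (𝓡 n) ∞ E.symm z := fun z hz =>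
    hE'.contMDiffAt (E.open_target.mem_nhds hz.1)
  obtain ⟨Q, hQ, hQK⟩ := exists_contDiff_eqOn (f := fun z => e (E.symm z)) hKc hUo hKU
    fun z hz => (contMDiffAt_iff_contDiffAt.1 (ContMDiffAt.comp z (g := e)
      (he.contMDiffAt (hV.mem_nhds hz.2.1)) (hEs z hz))).contDiffWithinAt
  obtain ⟨P, hP, hPK⟩ := exists_contDiff_eqOn (f := fun z => κ (f (E.symm z))) hKc hUo hKU
    fun z hz => (contMDiffAt_iff_contDiffAt.1 (ContMDiffAt.comp z (g := fun x => κ (f x))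
      (ContMDiffAt.comp (E.symm z) (g := κ) (contMDiffAt_chart hκ hz.2.2) (hf.contMDiff _))
      (hEs z hz))).contDiffWithinAt
  have hdom : DominatedOn volume P K := by
    refine DominatedOn.congr (DominatedOn.of_isCompact hKc fun z hz => ?_) fun z hz => (hPK hz).symm
    have hz' := hKU hz
    have hinv : E (E.symm z) = z := E.right_inv hz'.1
    have hsrc : E.symm z ∈ E.source := E.map_target hz'.1
    refine exists_dominatedOn_volume (Ψ := E) (hEs z hz')
      (hE.contMDiffAt (E.open_source.mem_nhds hsrc)) hinv ?_ (hf.isSubmersionAt _) hκ hz'.2.2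
    filter_upwards [E.open_source.mem_nhds hsrc] with x hx using E.left_inv hx
  obtain ⟨c, hc⟩ := hdom.map_le
  set A := E.target.indicator fun z => β (E.symm z) with hA
  have hAs : ContDiff ℝ ∞ A := contDiff_indicator_target hE' hβ hβc hβE
  have hAK : tsupport A ⊆ K := tsupport_indicator_target_subset hβc hβE
  have hAc : HasCompactSupport A := hKc.of_isClosed_subset (isClosed_tsupport _) hAK
  obtain ⟨C₁, hC₁⟩ := exists_derivBound_rescale hAs hAc hQ hh hhc l
  obtain ⟨C₂, hC₂⟩ := exists_sobolevENorm_mul_comp_le hP hKc hc hq l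
  refine ⟨C₂ * C₁, fun ε hε hε1 k u hu => ?_⟩
  have heq : (E.target.indicator fun z =>
      β (E.symm z) * h (ε⁻¹ • e (E.symm z) - k) * u (κ (f (E.symm z)))) =
      fun z => (A z * h (ε⁻¹ • Q z - k)) * u (P z) := by
    ext z
    by_cases hz : z ∈ K
    · rw [indicator_of_mem (hKU hz).1, hA, indicator_of_mem (hKU hz).1, hQK hz, hPK hz]
    · have hAz : A z = 0 := image_eq_zero_of_notMem_tsupport fun h => hz (hAK h)
      rw [hAz, zero_mul, zero_mul]
      by_cases hzt : z ∈ E.target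
      · rw [hA, indicator_of_mem hzt] at hAz
        rw [indicator_of_mem hzt, hAz, zero_mul, zero_mul]
      · exact indicator_of_notMem hzt _
  rw [heq]
  refine (hC₂ _ _ (hAs.mul (hh.comp ((hQ.const_smul ε⁻¹).sub contDiff_const)))
    (tsupport_mul_subset_left.trans hAK) (hC₁ ε hε hε1 k) u hu).trans (le_of_eq ?_)
  push_cast
  ring

/-- A finite smooth partition of unity on a compact set, subordinate to given neighbourhoods. -/
lemma exists_smooth_partition {n : ℕ} {M : Type*} [TopologicalSpace M]
    [ChartedSpace (EuclideanSpace ℝ (Fin n)) M] [IsManifold (𝓡 n) ∞ M] [T2Space M]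
    [SigmaCompactSpace M] [LocallyCompactSpace M] {D : Set M} (hD : IsCompact D) {U : M → Set M}
    (hU : ∀ x ∈ D, U x ∈ 𝓝 x) :
    ∃ (N : ℕ) (c : Fin N → M) (ψ : Fin N → M → ℝ), (∀ i, c i ∈ D) ∧
      (∀ i, ContMDiff (𝓡 n) 𝓘(ℝ, ℝ) ∞ (ψ i)) ∧ (∀ i x, 0 ≤ ψ i x) ∧
      (∀ i, HasCompactSupport (ψ i)) ∧ (∀ i, tsupport (ψ i) ⊆ U (c i)) ∧
      ∀ x ∈ D, ∑ i, ψ i x = 1 := by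
  have h1 : ∀ x ∈ D, ∃ K, IsCompact K ∧ K ⊆ U x ∧ K ∈ 𝓝 x := fun x hx => by
    obtain ⟨K, hK, hKU, hKc⟩ := local_compact_nhds (hU x hx)
    exact ⟨K, hKc, hKU, hK⟩
  choose! K hKc hKU hKn using h1
  obtain ⟨t, htD, hDt⟩ := hD.elim_nhds_subcover (fun x => interior (K x))
    fun x hx => interior_mem_nhds.2 (hKn x hx)
  obtain ⟨f, hf⟩ := SmoothPartitionOfUnity.exists_isSubordinate (𝓡 n) hD.isClosed
    (fun i : Fin t.card => interior (K (t.equivFin.symm i))) (fun i => isOpen_interior)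
    (fun x hx => by
      obtain ⟨y, hy, hxy⟩ := mem_iUnion₂.1 (hDt hx)
      exact mem_iUnion.2 ⟨t.equivFin ⟨y, hy⟩, by simpa using hxy⟩)
  have hc : ∀ i, ((t.equivFin.symm i : t) : M) ∈ D := fun i => htD _ (t.equivFin.symm i).2
  refine ⟨t.card, fun i => t.equivFin.symm i, fun i => f i, hc, fun i => (f i).contMDiff,
    fun i x => f.nonneg i x, fun i => ?_, fun i => ?_, fun x hx => ?_⟩
  · exact (hKc _ (hc i)).of_isClosed_subset (isClosed_tsupport _) ((hf i).trans interior_subset)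
  · exact ((hf i).trans interior_subset).trans (hKU _ (hc i))
  · have := f.sum_eq_one hx
    rwa [finsum_eq_sum_of_fintype] at this

/-- A smooth cutoff function for a compact subset of an open set. -/
lemma exists_smooth_cutoff {n : ℕ} {M : Type*} [TopologicalSpace M]
    [ChartedSpace (EuclideanSpace ℝ (Fin n)) M] [IsManifold (𝓡 n) ∞ M] [T2Space M]
    [SigmaCompactSpace M] [LocallyCompactSpace M] {D U : Set M} (hD : IsCompact D) (hU : IsOpen U)
    (hDU : D ⊆ U) :
    ∃ ζ : M → ℝ, ContMDiff (𝓡 n) 𝓘(ℝ, ℝ) ∞ ζ ∧ (∀ x, 0 ≤ ζ x) ∧ HasCompactSupport ζ ∧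
      tsupport ζ ⊆ U ∧ ∀ x ∈ D, ζ x = 1 := by
  obtain ⟨N, c, ψ, -, h1, h2, h3, h4, h5⟩ := exists_smooth_partition (n := n) hD (U := fun _ => U)
    fun x hx => hU.mem_nhds (hDU hx)
  have hsub : ∀ x, x ∉ ⋃ i, tsupport (ψ i) → ∑ i, ψ i x = 0 := fun x hx =>
    Finset.sum_eq_zero fun i _ => image_eq_zero_of_notMem_tsupport fun h => hx (mem_iUnion.2 ⟨i, h⟩)
  have hc : IsCompact (⋃ i, tsupport (ψ i)) := isCompact_iUnion h3
  refine ⟨fun x => ∑ i, ψ i x, contMDiff_finsetSum fun i _ => h1 i,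
    fun x => Finset.sum_nonneg fun i _ => h2 i x, HasCompactSupport.intro hc hsub, ?_, h5⟩
  refine (closure_minimal (fun x hx => ?_) hc.isClosed).trans (iUnion_subset h4)
  by_contra h
  exact hx (hsub x h)

namespace DualitySetting

variable {G : Type*} [Group G] [TopologicalSpace G] [IsTopologicalGroup G]
  [LocallyCompactSpace G] [SecondCountableTopology G] [T2Space G]
  [MeasurableSpace G] [BorelSpace G] {S : DualitySetting G}
  {n j : ℕ} [ChartedSpace (EuclideanSpace ℝ (Fin n)) G] [LieGroup (𝓡 n) ∞ G]
  [ChartedSpace (EuclideanSpace ℝ (Fin j)) S.X] [IsManifold (𝓡 j) ∞ S.X]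

/-- Smooth cutoff functions whose integrals over the fibres above `D` are constant. -/
lemma exists_isCutoff_smooth (hsub : Manifold.IsSubmersion (𝓡 n) (𝓡 j) ∞ S.pX) {D : Set S.X}
    (hD : IsCompact D) :
    ∃ Ω : Set G, IsCompact Ω ∧ ∃ Θ : G → ℝ, ContMDiff (𝓡 n) 𝓘(ℝ, ℝ) ∞ Θ ∧
      ∃ lam, ∀ Ω', Ω ⊆ Ω' → IsCutoff D Ω' Θ lam := by
  have hI : IsManifold (𝓡 n) ∞ G := inferInstance
  obtain ⟨Ξ, hΞs, hΞ0, hΞc, -, hΞ1⟩ := exists_smooth_cutoff (n := n) (isCompact_singleton (x := (1 : G)))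
    isOpen_univ (subset_univ _)
  have hsec : ∀ x : S.X, ∃ (σ : S.X → G) (U : Set S.X), IsOpen U ∧ x ∈ U ∧
      ContMDiffOn (𝓡 j) (𝓡 n) ∞ σ U ∧ ∀ y ∈ U, S.pX (σ y) = y := fun x => by
    obtain ⟨g, rfl⟩ := S.pX_surjective x
    obtain ⟨σ, U, hU, hxU, hσ, -, hfσ⟩ := exists_section_of_isSubmersionAt (hsub.isSubmersionAt g)
    exact ⟨σ, U, hU, hxU, hσ, hfσ⟩
  choose σ U hUo hxU hσ hpσ using hsec
  obtain ⟨N, c, ψ, -, hψs, hψ0, hψc, hψU, hψ1⟩ := exists_smooth_partition (n := j) hD (U := U)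
    fun x _ => (hUo x).mem_nhds (hxU x)
  set T : Fin N → G → ℝ := fun b g => Ξ (g * (σ (c b) (S.pX g))⁻¹) * ψ b (S.pX g) with hT
  have hTs : ∀ b, ContMDiff (𝓡 n) 𝓘(ℝ, ℝ) ∞ (T b) := by
    intro b g
    by_cases hg : S.pX g ∈ tsupport (ψ b)
    · have h1 : ContMDiffAt (𝓡 n) (𝓡 n) ∞ (fun g => σ (c b) (S.pX g)) g :=
        ContMDiffAt.comp g (g := σ (c b))
          ((hσ (c b)).contMDiffAt ((hUo _).mem_nhds (hψU b hg))) (hsub.contMDiff g)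
      have h2 : ContMDiffAt (𝓡 n) (𝓡 n) ∞ (fun g => g * (σ (c b) (S.pX g))⁻¹) g :=
        contMDiffAt_id.mul h1.inv
      have h3 : ContMDiffAt (𝓡 n) 𝓘(ℝ, ℝ) ∞ (fun g => Ξ (g * (σ (c b) (S.pX g))⁻¹)) g :=
        ContMDiffAt.comp g (hΞs _) h2
      exact h3.mul (ContMDiffAt.comp g (hψs b _) (hsub.contMDiff g))
    · refine (contMDiffAt_const (c := (0 : ℝ))).congr_of_eventuallyEq ?_
      filter_upwards [S.continuous_pX.continuousAt.preimage_mem_nhds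
        ((isClosed_tsupport (ψ b)).isOpen_compl.mem_nhds hg)] with g' hg'
      simp only [hT]
      rw [image_eq_zero_of_notMem_tsupport hg', mul_zero]
  set Ω : Set G := ⋃ b, tsupport Ξ * σ (c b) '' tsupport (ψ b) with hΩ
  have hΩc : IsCompact Ω := isCompact_iUnion fun b => IsCompact.mul hΞc
    ((hψc b).image_of_continuousOn ((hσ (c b)).continuousOn.mono (hψU b)))
  have hΩ0 : ∀ g, g ∉ Ω → ∑ b, T b g = 0 := by
    refine fun g hg => Finset.sum_eq_zero fun b _ => ?_
    by_contra h
    refine hg (mem_iUnion.2 ⟨b, _, subset_tsupport _ (left_ne_zero_of_mul h), _,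
      ⟨_, subset_tsupport _ (right_ne_zero_of_mul h), rfl⟩, ?_⟩)
    simp
  have hinvc : Continuous fun h : S.H => Ξ (h : G)⁻¹ :=
    hΞs.continuous.comp (continuous_inv.comp continuous_subtype_val)
  set I : ℝ≥0∞ := ∫⁻ h : S.H, ENNReal.ofReal (Ξ (h : G)⁻¹) ∂S.ρ with hI
  have hIpos : I ≠ 0 := by
    rw [hI, ← pos_iff_ne_zero, lintegral_pos_iff_support
      (f := fun h : S.H => ENNReal.ofReal (Ξ (h : G)⁻¹)) (ENNReal.measurable_ofReal.comp hinvc.measurable)]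
    refine (IsOpen.measure_pos S.ρ ?_ ⟨1, ?_⟩)
    · exact (ENNReal.continuous_ofReal.comp hinvc).isOpen_support
    · simp [hΞ1]
  have hIfin : I ≠ ⊤ := by
    have hcs : HasCompactSupport fun h : S.H => Ξ (h : G)⁻¹ := by
      refine HasCompactSupport.intro (S.isCompact_preimage_coe_H (K := (tsupport Ξ)⁻¹)
        (IsCompact.inv hΞc)) fun h hh => ?_
      exact image_eq_zero_of_notMem_tsupport fun h' => hh h'
    have h1 := (hinvc.integrable_of_hasCompactSupport (μ := S.ρ) hcs).lintegral_lt_top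
    exact h1.ne
  refine ⟨Ω, hΩc, fun g => ∑ b, T b g, contMDiff_finsetSum fun b _ => hTs b, I.toReal,
    fun Ω' hΩ' => ⟨?_, ?_, ?_, ?_, ENNReal.toReal_pos hIpos hIfin, ?_⟩⟩
  · exact (continuous_finsetSum _ fun b _ => (hTs b).continuous).measurable
  · exact fun g => Finset.sum_nonneg fun b _ => mul_nonneg (hΞ0 _) (hψ0 _ _)
  · have hcs : HasCompactSupport fun g => ∑ b, T b g := HasCompactSupport.intro hΩc hΩ0
    obtain ⟨C, hC⟩ := (continuous_finsetSum _ fun b _ => 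
      (hTs b).continuous).bounded_above_of_compact_support hcs
    exact ⟨C, fun g => (le_abs_self _).trans (hC g)⟩
  · exact fun g hg => hΩ' (by_contra fun h => hg (hΩ0 g h))
  · intro g hg
    rw [ENNReal.ofReal_toReal hIfin]
    have h1 : ∀ h : S.H, ENNReal.ofReal (∑ b, T b ((h : G)⁻¹ * g)) =
        ∑ b, ENNReal.ofReal (Ξ ((h : G)⁻¹ * (g * (σ (c b) (S.pX g))⁻¹))) *
          ENNReal.ofReal (ψ b (S.pX g)) := by
      intro h
      rw [ENNReal.ofReal_sum_of_nonneg fun b _ => mul_nonneg (hΞ0 _) (hψ0 _ _)]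
      refine Finset.sum_congr rfl fun b _ => ?_
      simp only [S.pX_inv_mul, mul_assoc]
      rw [ENNReal.ofReal_mul (hΞ0 _)]
    simp_rw [h1]
    rw [lintegral_finsetSum _ fun b _ => ?_]
    · have h2 : ∀ b, ∫⁻ h : S.H, ENNReal.ofReal (Ξ ((h : G)⁻¹ * (g * (σ (c b) (S.pX g))⁻¹))) *
          ENNReal.ofReal (ψ b (S.pX g)) ∂S.ρ = I * ENNReal.ofReal (ψ b (S.pX g)) := by
        intro b
        by_cases hb : S.pX g ∈ tsupport (ψ b)
        · rw [lintegral_mul_const' _ _ ENNReal.ofReal_ne_top]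
          congr 1
          have hmem : g * (σ (c b) (S.pX g))⁻¹ ∈ S.H :=
            S.pX_eq_iff.1 (hpσ (c b) _ (hψU b hb))
          rw [hI, ← lintegral_mul_left_eq_self _ (⟨_, hmem⟩ : S.H)]
          refine lintegral_congr fun h => ?_
          simp [mul_assoc]
        · rw [image_eq_zero_of_notMem_tsupport hb]
          simp
      simp_rw [h2]
      rw [← Finset.mul_sum, ← ENNReal.ofReal_sum_of_nonneg fun b _ => hψ0 b _, hψ1 _ hg,
        ENNReal.ofReal_one, mul_one]
    · refine Measurable.mul_const ?_ _
      refine ENNReal.measurable_ofReal.comp (Continuous.measurable ?_)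
      exact hΞs.continuous.comp ((continuous_inv.comp continuous_subtype_val).mul continuous_const)

end DualitySetting

/-- Local diffeomorphisms as open partial homeomorphisms. -/
lemma IsLocalDiffeomorph.exists_openPartialHomeomorph {n : ℕ} {M N : Type*} [TopologicalSpace M]
    [ChartedSpace (EuclideanSpace ℝ (Fin n)) M] [TopologicalSpace N]
    [ChartedSpace (EuclideanSpace ℝ (Fin n)) N] {f : M → N}
    (hf : IsLocalDiffeomorph (𝓡 n) (𝓡 n) ∞ f) (x : M) :
    ∃ Φ : OpenPartialHomeomorph M N, x ∈ Φ.source ∧ ContMDiffOn (𝓡 n) (𝓡 n) ∞ Φ Φ.source ∧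
      ContMDiffOn (𝓡 n) (𝓡 n) ∞ Φ.symm Φ.target ∧ ∀ y ∈ Φ.source, Φ y = f y := by
  obtain ⟨Φ, hx, h⟩ := hf x
  exact ⟨Φ.toOpenPartialHomeomorph, hx, Φ.contMDiffOn_toFun, Φ.contMDiffOn_invFun,
    fun y hy => (h hy).symm⟩

lemma periodize_mk_of_injOn {G : Type*} [Group G] {Γ : Subgroup G} {w : G → ℝ} {V : Set G}
    (hV : InjOn (QuotientGroup.mk : G → G ⧸ Γ) V) (hw : ∀ g, w g ≠ 0 → g ∈ V) {g : G} (hg : g ∈ V) :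
    periodize Γ w (g : G ⧸ Γ) = w g := by
  rw [periodize_mk, tsum_eq_single 1, Subgroup.coe_one, mul_one]
  intro γ hγ
  by_contra h
  have h1 : g * γ = g := hV (hw _ h) hg (by simp)
  exact hγ (by simpa using h1)

lemma periodize_eq_zero_of_notMem {G : Type*} [Group G] {Γ : Subgroup G} {w : G → ℝ} {V : Set G}
    (hw : ∀ g, w g ≠ 0 → g ∈ V) {y : G ⧸ Γ} (hy : y ∉ (QuotientGroup.mk : G → G ⧸ Γ) '' V) :
    periodize Γ w y = 0 := by
  obtain ⟨g, rfl⟩ := QuotientGroup.mk_surjective y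
  rw [periodize_mk, ← tsum_zero (L := SummationFilter.unconditional Γ)]
  refine tsum_congr fun γ => ?_
  by_contra h
  exact hy ⟨_, hw _ h, by simp⟩

namespace DualitySetting

variable {G : Type*} [Group G] [TopologicalSpace G] [IsTopologicalGroup G]
  [LocallyCompactSpace G] [SecondCountableTopology G] [T2Space G]
  [MeasurableSpace G] [BorelSpace G] {S : DualitySetting G}
  {n j : ℕ} [ChartedSpace (EuclideanSpace ℝ (Fin n)) G] [LieGroup (𝓡 n) ∞ G]
  [ChartedSpace (EuclideanSpace ℝ (Fin j)) S.X] [IsManifold (𝓡 j) ∞ S.X]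
  [ChartedSpace (EuclideanSpace ℝ (Fin n)) S.Y] [IsManifold (𝓡 n) ∞ S.Y]

/-- The pieces, in the charts of `Y`, of the periodization of `w · (φ ∘ p)`, when `w` is supported in
a small set. -/
lemma localPiece_periodize_eq {D : Set S.X} (AX : ChartSystem j D) {B : Set S.Y}
    (AY : ChartSystem n B) {Φ : OpenPartialHomeomorph G S.Y}
    (hΦ : ∀ g ∈ Φ.source, Φ g = (g : S.Y)) {w : G → ℝ} (hw : ∀ g, w g ≠ 0 → g ∈ Φ.source)
    {ζ : Fin AX.N → S.X → ℝ} (hζ : ∀ b, tsupport (ζ b) ⊆ (AX.chart b).source)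
    (hζ1 : ∀ b, ∀ x ∈ tsupport (AX.ψ b), ζ b x = 1) {φ : S.X → ℝ} (hφ : ∀ x, x ∉ D → φ x = 0)
    (i : Fin AY.N) :
    AY.localPiece (periodize S.Γ (S.weighted w φ)) i =
      ∑ b, (Φ.trans (AY.chart i)).target.indicator fun z =>
        w ((Φ.trans (AY.chart i)).symm z) * ζ b (S.pX ((Φ.trans (AY.chart i)).symm z)) *
          AY.ψ i ((Φ.trans (AY.chart i)).symm z : G) *
          AX.localPiece φ b (AX.chart b (S.pX ((Φ.trans (AY.chart i)).symm z))) := by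
  have hinj : InjOn (QuotientGroup.mk : G → S.Y) Φ.source := fun g hg g' hg' h =>
    Φ.injOn hg hg' (by rw [hΦ g hg, hΦ g' hg']; exact h)
  have hw' : ∀ g, S.weighted w φ g ≠ 0 → g ∈ Φ.source := fun g hg => hw g (left_ne_zero_of_mul hg)
  have hφ' : ∀ x, φ x = ∑ b, ζ b x * AX.localPiece φ b (AX.chart b x) := by
    intro x
    rw [AX.eq_sum_localPiece hφ x]
    refine Finset.sum_congr rfl fun b _ => ?_
    by_cases hx : x ∈ tsupport (AX.ψ b)
    · rw [indicator_of_mem hx, hζ1 b x hx, one_mul]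
    · rw [indicator_of_notMem hx]
      by_cases hx' : x ∈ tsupport (ζ b)
      · rw [AX.localPiece_chart φ (hζ b hx'), image_eq_zero_of_notMem_tsupport hx, mul_zero, mul_zero]
      · rw [image_eq_zero_of_notMem_tsupport hx', zero_mul]
  ext z
  rw [Finset.sum_apply]
  by_cases hz : z ∈ (Φ.trans (AY.chart i)).target
  · simp_rw [indicator_of_mem hz]
    have hz1 : z ∈ (AY.chart i).target := by
      rw [OpenPartialHomeomorph.trans_target] at hz
      exact hz.1
    have hz2 : (AY.chart i).symm z ∈ Φ.target := by
      rw [OpenPartialHomeomorph.trans_target] at hz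
      exact hz.2
    have hg : (Φ.trans (AY.chart i)).symm z = Φ.symm ((AY.chart i).symm z) := rfl
    rw [hg]
    set g := Φ.symm ((AY.chart i).symm z)
    have hgs : g ∈ Φ.source := Φ.map_target hz2
    have hgy : (g : S.Y) = (AY.chart i).symm z := by
      rw [← hΦ g hgs]
      exact Φ.right_inv hz2
    rw [ChartSystem.localPiece, indicator_of_mem hz1, ← hgy, periodize_mk_of_injOn hinj hw' hgs,
      weighted, hφ' (S.pX g), Finset.mul_sum, Finset.sum_mul]
    exact Finset.sum_congr rfl fun b _ => by ring
  · rw [Finset.sum_eq_zero fun b _ => indicator_of_notMem hz _]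
    by_cases hz1 : z ∈ (AY.chart i).target
    · rw [ChartSystem.localPiece, indicator_of_mem hz1, periodize_eq_zero_of_notMem hw', zero_mul]
      rintro ⟨g, hg, hgz⟩
      refine hz ?_
      rw [OpenPartialHomeomorph.trans_target]
      refine ⟨hz1, ?_⟩
      rw [mem_preimage, ← hgz]
      exact hΦ g hg ▸ Φ.map_source hg
    · exact indicator_of_notMem hz1 _

/-- The Sobolev norms of the periodizations of rescaled bump functions times `φ ∘ p`. -/
lemma exists_sobolevNorm_periodize_le (hsub : Manifold.IsSubmersion (𝓡 n) (𝓡 j) ∞ S.pX)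
    {D : Set S.X} (AX : ChartSystem j D) {B : Set S.Y} (AY : ChartSystem n B)
    {Φ : OpenPartialHomeomorph G S.Y} (hΦs : ContMDiffOn (𝓡 n) (𝓡 n) ∞ Φ Φ.source)
    (hΦs' : ContMDiffOn (𝓡 n) (𝓡 n) ∞ Φ.symm Φ.target) (hmk : ContMDiff (𝓡 n) (𝓡 n) ∞
      (QuotientGroup.mk : G → S.Y)) (hΦ : ∀ g ∈ Φ.source, Φ g = (g : S.Y))
    {η : G → ℝ} (hη : ContMDiff (𝓡 n) 𝓘(ℝ, ℝ) ∞ η) (hηc : HasCompactSupport η)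
    (hηΦ : tsupport η ⊆ Φ.source) {e : G → EuclideanSpace ℝ (Fin n)} {V : Set G} (hV : IsOpen V)
    (he : ContMDiffOn (𝓡 n) (𝓡 n) ∞ e V) (hηV : tsupport η ⊆ V)
    {h : EuclideanSpace ℝ (Fin n) → ℝ} (hh : ContDiff ℝ ∞ h) (hhc : HasCompactSupport h)
    {q : ℝ≥0∞} (hq : 1 ≤ q) (l : ℕ) :
    ∃ C : ℝ≥0, ∀ ε : ℝ, 0 < ε → ε ≤ 1 → ∀ k, ∀ φ : S.X → ℝ, (∀ x, x ∉ D → φ x = 0) →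
      AX.sobolevNorm q l φ < ⊤ →
      AY.sobolevNorm q l
        (periodize S.Γ (S.weighted (fun g => η g * h (ε⁻¹ • e g - k)) φ)) ≤
        (C * (ε⁻¹).toNNReal ^ l : ℝ≥0) * AX.sobolevNorm q l φ := by
  have hI : IsManifold (𝓡 n) ∞ G := inferInstance
  have hζ : ∀ b, ∃ ζ : S.X → ℝ, ContMDiff (𝓡 j) 𝓘(ℝ, ℝ) ∞ ζ ∧ (∀ x, 0 ≤ ζ x) ∧
      HasCompactSupport ζ ∧ tsupport ζ ⊆ (AX.chart b).source ∧
      ∀ x ∈ tsupport (AX.ψ b), ζ x = 1 := fun b =>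
    exists_smooth_cutoff (AX.compact_support b) (AX.chart b).open_source (AX.support_subset b)
  choose ζ hζs _ _ hζc hζ1 using hζ
  have hE : ∀ i, ContMDiffOn (𝓡 n) (𝓡 n) ∞ (Φ.trans (AY.chart i))
      (Φ.trans (AY.chart i)).source := fun i =>
    (contMDiffOn_of_mem_maximalAtlas (AY.chart_mem i)).comp (hΦs.mono inter_subset_left)
      inter_subset_right
  have hE' : ∀ i, ContMDiffOn (𝓡 n) (𝓡 n) ∞ (Φ.trans (AY.chart i)).symm
      (Φ.trans (AY.chart i)).target := fun i =>
    hΦs'.comp ((contMDiffOn_symm_of_mem_maximalAtlas (AY.chart_mem i)).mono inter_subset_left)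
      inter_subset_right
  set β : Fin AY.N → Fin AX.N → G → ℝ := fun i b g =>
    η g * (ζ b (S.pX g) * AY.ψ i (g : S.Y)) with hβ
  have hβs : ∀ i b, ContMDiff (𝓡 n) 𝓘(ℝ, ℝ) ∞ (β i b) := fun i b =>
    hη.mul (((hζs b).comp hsub.contMDiff).mul ((AY.smooth i).comp hmk))
  have hβη : ∀ i b, tsupport (β i b) ⊆ tsupport η := fun i b => tsupport_mul_subset_left
  have hβX : ∀ i b, tsupport (β i b) ⊆ S.pX ⁻¹' (AX.chart b).source := fun i b =>
    tsupport_mul_subset_right.trans (tsupport_mul_subset_left.trans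
      ((tsupport_comp_subset_preimage _ S.continuous_pX).trans (preimage_mono (hζc b))))
  have hβY : ∀ i b, tsupport (β i b) ⊆ (QuotientGroup.mk : G → S.Y) ⁻¹' (AY.chart i).source :=
    fun i b => tsupport_mul_subset_right.trans (tsupport_mul_subset_right.trans
      ((tsupport_comp_subset_preimage _ S.continuous_mk).trans
        (preimage_mono (AY.support_subset i))))
  have hC : ∀ i b, _ := fun i b => exists_sobolevENorm_pullback_le (hE i) (hE' i) hsub
    (AX.chart_mem b) (hβs i b) (hηc.of_isClosed_subset (isClosed_tsupport _) (hβη i b))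
    (fun g hg => by
      rw [OpenPartialHomeomorph.trans_source]
      refine ⟨hηΦ (hβη i b hg), ?_⟩
      rw [mem_preimage, hΦ g (hηΦ (hβη i b hg))]
      exact hβY i b hg)
    (hβX i b) hV he ((hβη i b).trans hηV) hh hhc hq l
  choose C hC using hC
  refine ⟨∑ i, ∑ b, C i b, fun ε hε hε1 k φ hφ hfin => ?_⟩
  rw [ChartSystem.sobolevNorm, Finset.sum_mul, ENNReal.ofNNReal_finsetSum, Finset.sum_mul]
  refine Finset.sum_le_sum fun i _ => ?_
  rw [localPiece_periodize_eq AX AY hΦ (fun g hg => hηΦ (subset_tsupport _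
    (left_ne_zero_of_mul hg))) hζc hζ1 hφ i, Finset.sum_mul, ENNReal.ofNNReal_finsetSum, Finset.sum_mul]
  refine (sobolevENorm_sum_le hq l _ _).trans (Finset.sum_le_sum fun b _ => ?_)
  have hu := AX.sobolevENorm_localPiece_le q l φ b
  refine le_trans (le_of_eq ?_) ((hC i b ε hε hε1 k _ (hu.trans_lt hfin)).trans ?_)
  · congr 1
    refine congrArg _ (funext fun z => ?_)
    simp only [hβ]
    ring
  · gcongr

end DualitySetting

namespace DualitySetting

variable {G : Type*} [Group G] [TopologicalSpace G] [IsTopologicalGroup G]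
  [LocallyCompactSpace G] [SecondCountableTopology G] [T2Space G]
  [MeasurableSpace G] [BorelSpace G] {S : DualitySetting G}
  {n j : ℕ} [ChartedSpace (EuclideanSpace ℝ (Fin n)) G] [LieGroup (𝓡 n) ∞ G]
  [Bundle.RiemannianBundle (fun x : G => TangentSpace (𝓡 n) x)]
  [IsContMDiffRiemannianBundle (𝓡 n) ∞ (EuclideanSpace ℝ (Fin n))
    (fun x : G => TangentSpace (𝓡 n) x)]
  [ChartedSpace (EuclideanSpace ℝ (Fin j)) S.X] [IsManifold (𝓡 j) ∞ S.X]
  [ChartedSpace (EuclideanSpace ℝ (Fin n)) S.Y] [IsManifold (𝓡 n) ∞ S.Y]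

/-- A smooth cutoff function decomposes into `O(ε^{-d})` cells of size `ε` which multiply Sobolev
norms of order `l` by `O(ε^{-l})`. -/
lemma hasCells_smooth (hsub : Manifold.IsSubmersion (𝓡 n) (𝓡 j) ∞ S.pX)
    (hloc : IsLocalDiffeomorph (𝓡 n) (𝓡 n) ∞ (QuotientGroup.mk : G → S.Y)) {D : Set S.X}
    {Ω K : Set G} (hΩ : IsCompact Ω) (hΩK : Ω ⊆ K) (hK : K.Nonempty) {Θ : G → ℝ}
    (hΘs : ContMDiff (𝓡 n) 𝓘(ℝ, ℝ) ∞ Θ) {lam : ℝ} (hΘ : IsCutoff D Ω Θ lam) {d : ℝ}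
    (hd : (n : ℝ) ≤ d) (AX : ChartSystem j D) {B : Set S.Y} (AY : ChartSystem n B) {q : ℝ≥0∞}
    (hq : 1 ≤ q) (l : ℕ) :
    S.HasCells D Θ K (riemannianNhds n G) (AX.sobolevNorm q l) (AY.sobolevNorm q l) d l := by
  classical
  have hI : IsManifold (𝓡 n) ∞ G := inferInstance
  have hmk : ContMDiff (𝓡 n) (𝓡 n) ∞ (QuotientGroup.mk : G → S.Y) := hloc.contMDiff
  choose Φ hxΦ hΦs hΦs' hΦ using hloc.exists_openPartialHomeomorph
  have hV : ∀ g₀ : G, ∃ V ∈ 𝓝 g₀, ∃ C : ℝ, 0 < C ∧ ∀ v ∈ V, ∀ g ∈ V, ∀ ε,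
      C * ‖chartAt (EuclideanSpace ℝ (Fin n)) g₀ g - chartAt (EuclideanSpace ℝ (Fin n)) g₀ v‖ < ε →
      v⁻¹ * g ∈ riemannianNhds n G ε := fun g₀ =>
    exists_inv_mul_mem_riemannianNhds (IsManifold.chart_mem_maximalAtlas g₀)
      (mem_chart_source _ g₀)
  choose V hVn Cv hCv hV using hV
  obtain ⟨N, c, η, -, hηs, hη0, hηc, hηU, hη1⟩ := exists_smooth_partition (n := n) hΩ
    (U := fun g₀ => (Φ g₀).source ∩ (chartAt (EuclideanSpace ℝ (Fin n)) g₀).source ∩ V g₀)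
    (fun g₀ _ => inter_mem (inter_mem ((Φ g₀).open_source.mem_nhds (hxΦ g₀))
      (chart_source_mem_nhds _ g₀)) (hVn g₀))
  set e : Fin N → OpenPartialHomeomorph G (EuclideanSpace ℝ (Fin n)) := fun a => chartAt _ (c a)
    with he
  have hηΦ : ∀ a, tsupport (η a) ⊆ (Φ (c a)).source := fun a g hg => (hηU a hg).1.1
  have hηe : ∀ a, tsupport (η a) ⊆ (e a).source := fun a g hg => (hηU a hg).1.2
  have hηV : ∀ a, tsupport (η a) ⊆ V (c a) := fun a g hg => (hηU a hg).2
  have hC := fun a => exists_sobolevNorm_periodize_le hsub AX AY (hΦs (c a)) (hΦs' (c a)) hmk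
    (hΦ (c a)) (hΘs.mul (hηs a)) ((hηc a).of_isClosed_subset (isClosed_tsupport _)
      tsupport_mul_subset_right) (tsupport_mul_subset_right.trans (hηΦ a)) (e a).open_source
    (contMDiffOn_of_mem_maximalAtlas (IsManifold.chart_mem_maximalAtlas (c a)))
    (tsupport_mul_subset_right.trans (hηe a)) contDiff_gridBump hasCompactSupport_gridBump hq l
  choose C hC using hC
  have hR : ∀ a, ∃ R : ℝ, ∀ g ∈ tsupport (η a), ‖e a g‖ ≤ R := fun a =>
    (hηc a).isCompact.exists_bound_of_continuousOn ((e a).continuousOn.mono (hηe a))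
  choose R' hR' using hR
  obtain ⟨R, hR0, hR⟩ : ∃ R : ℝ, 0 ≤ R ∧ ∀ a, ∀ g ∈ tsupport (η a), ‖e a g‖ ≤ R :=
    ⟨∑ a, |R' a|, Finset.sum_nonneg fun a _ => abs_nonneg _, fun a g hg =>
      (hR' a g hg).trans ((le_abs_self _).trans
        (Finset.single_le_sum (f := fun a => |R' a|) (fun a _ => abs_nonneg _) (Finset.mem_univ a)))⟩
  obtain ⟨C₀, hC₀, hC₀a⟩ : ∃ C₀ : ℝ, 1 ≤ C₀ ∧ ∀ a, Cv (c a) * (2 * n) < C₀ := by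
    have h0 : ∀ a, 0 ≤ Cv (c a) * (2 * n) := fun a => mul_nonneg (hCv _).le (by positivity)
    refine ⟨1 + ∑ a, Cv (c a) * (2 * n), ?_, fun a => ?_⟩
    · linarith [Finset.sum_nonneg fun a (_ : a ∈ Finset.univ) => h0 a]
    · linarith [Finset.single_le_sum (f := fun a => Cv (c a) * (2 * n)) (fun a _ => h0 a)
        (Finset.mem_univ a)]
  have hC₀0 : 0 < C₀ := zero_lt_one.trans_le hC₀
  refine ⟨max (N * ((2 * R + 3) * C₀) ^ n) ((∑ a, C a : ℝ≥0) * C₀ ^ l), 1, one_pos,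
    fun ε hε hε1 => ?_⟩
  set τ : ℝ := ε / C₀ with hτ
  have hτ0 : 0 < τ := by positivity
  have hτ1 : τ ≤ 1 := (div_le_one hC₀0).2 (hε1.le.trans hC₀)
  set M : ℕ := ⌈R / τ⌉₊ with hM
  set P := Fintype.piFinset (fun _ : Fin n => Finset.Icc (-(M : ℤ)) M) with hP
  set w : Fin N × P → G → ℝ := fun b g =>
    Θ g * η b.1 g * gridBump (τ⁻¹ • e b.1 g - gridPoint b.2) with hw
  have hw0 : ∀ b g, w b g ≠ 0 → g ∈ tsupport (η b.1) ∧ Θ g ≠ 0 ∧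
      gridBump (τ⁻¹ • e b.1 g - gridPoint b.2) ≠ 0 := fun b g h =>
    ⟨subset_tsupport _ (right_ne_zero_of_mul (left_ne_zero_of_mul h)),
      left_ne_zero_of_mul (left_ne_zero_of_mul h), right_ne_zero_of_mul h⟩
  have hwm : ∀ b, Measurable (w b) := fun b => by
    refine Continuous.measurable (continuous_of_tsupport fun g hg => ?_)
    have hge : g ∈ (e b.1).source := hηe b.1
      (tsupport_mul_subset_right (tsupport_mul_subset_left hg))
    exact (hΘs.continuous.continuousAt.mul (hηs b.1).continuous.continuousAt).mul
      (contDiff_gridBump.continuous.continuousAt.comp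
        ((((e b.1).continuousAt hge).const_smul τ⁻¹).sub continuousAt_const))
  have hv : ∀ b, ∃ v ∈ K, ∀ g, w b g ≠ 0 → v⁻¹ * g ∈ riemannianNhds n G ε := by
    intro b
    by_cases h : ∃ v, w b v ≠ 0
    · obtain ⟨v, hvb⟩ := h
      obtain ⟨hv1, hv2, hv3⟩ := hw0 b v hvb
      refine ⟨v, hΩK (hΘ.support v hv2), fun g hg => ?_⟩
      obtain ⟨hg1, -, hg3⟩ := hw0 b g hg
      refine hV (c b.1) v (hηV _ hv1) g (hηV _ hg1) ε ?_
      have h1 := norm_sub_le_of_gridBump_ne_zero hg3 hv3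
      rw [sub_sub_sub_cancel_right, ← smul_sub, norm_smul, norm_inv, Real.norm_of_nonneg hτ0.le,
        inv_mul_le_iff₀ hτ0] at h1
      calc Cv (c b.1) * ‖e b.1 g - e b.1 v‖ ≤ Cv (c b.1) * (τ * (2 * n)) := by
            gcongr
            exact (hCv _).le
        _ = τ * (Cv (c b.1) * (2 * n)) := by ring
        _ < τ * C₀ := by
            gcongr
            exact hC₀a _
        _ = ε := div_mul_cancel₀ _ hC₀0.ne'
    · push Not at h
      obtain ⟨v, hvK⟩ := hK
      exact ⟨v, hvK, fun g hg => absurd (h g) hg⟩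
  choose v hvK hv using hv
  set E := Fintype.equivFin (Fin N × P)
  refine ⟨Fintype.card (Fin N × P), fun i => w (E.symm i), fun i => v (E.symm i),
    ⟨fun i => hwm _, fun i g => ?_, fun g => ?_, fun i g hg => hv _ g hg, fun i => hvK _⟩, ?_,
    fun φ hφ hφD hfin i => ?_⟩
  · exact mul_nonneg (mul_nonneg (hΘ.nonneg g) (hη0 _ g)) (gridBump_nonneg _)
  · rw [E.symm.sum_comp (fun b => w b g), Fintype.sum_prod_type]
    have h1 : ∀ a, ∑ k : P, w (a, k) g = Θ g * η a g := fun a => by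
      by_cases hg : g ∈ tsupport (η a)
      · simp only [hw]
        rw [← Finset.mul_sum, Finset.sum_coe_sort P
          (fun k => gridBump (τ⁻¹ • e a g - gridPoint k)), sum_gridBump, mul_one]
        intro i
        refine (PiLp.norm_apply_le (τ⁻¹ • e a g) i).trans (le_trans ?_ (Nat.le_ceil _))
        rw [norm_smul, norm_inv, Real.norm_of_nonneg hτ0.le, inv_mul_eq_div]
        gcongr
        exact hR a g hg
      · simp [hw, image_eq_zero_of_notMem_tsupport hg]
    simp_rw [h1]
    rw [← Finset.mul_sum]
    by_cases hg : Θ g = 0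
    · rw [hg, zero_mul]
    · rw [hη1 g (hΘ.support g hg), mul_one]
  · rw [Fintype.card_prod, Fintype.card_fin, Fintype.card_coe, hP, card_grid]
    push_cast
    have h1 : 2 * (M : ℝ) + 1 ≤ (2 * R + 3) * C₀ * ε⁻¹ := by
      have h2 := (Nat.ceil_lt_add_one (div_nonneg hR0 hτ0.le)).le
      have h3 : 1 ≤ τ⁻¹ := (one_le_inv₀ hτ0).2 hτ1
      have h4 : τ⁻¹ = C₀ * ε⁻¹ := by rw [hτ, inv_div, div_eq_mul_inv]
      rw [mul_assoc, ← h4]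
      rw [← hM, div_eq_mul_inv] at h2
      linarith
    calc (N : ℝ) * (2 * (M : ℝ) + 1) ^ n ≤ N * ((2 * R + 3) * C₀ * ε⁻¹) ^ n := by gcongr
      _ = N * ((2 * R + 3) * C₀) ^ n * ε ^ (-(n : ℝ)) := by
          rw [mul_pow, Real.rpow_neg hε.le, Real.rpow_natCast, inv_pow, mul_assoc]
      _ ≤ _ := by
          gcongr ?_ * ?_
          · exact le_max_left _ _
          · exact Real.rpow_le_rpow_of_exponent_ge hε hε1.le (neg_le_neg hd)
  · refine (hC (E.symm i).1 τ hτ0 hτ1 (gridPoint (E.symm i).2) φ hφD hfin).trans ?_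
    gcongr
    rw [← ENNReal.ofReal_coe_nnreal]
    refine ENNReal.ofReal_le_ofReal ?_
    rw [NNReal.coe_mul, NNReal.coe_pow, Real.coe_toNNReal _ (by positivity), Real.rpow_neg hε.le,
      Real.rpow_natCast, hτ, inv_div, div_pow, ← mul_div_assoc, div_eq_mul_inv]
    gcongr
    refine le_trans ?_ (le_max_right _ _)
    gcongr
    exact Finset.single_le_sum (f := C) (fun a _ => zero_le) (Finset.mem_univ _)

end DualitySetting

namespace DualitySetting

variable {G : Type*} [Group G] [TopologicalSpace G] [IsTopologicalGroup G]
  [LocallyCompactSpace G] [SecondCountableTopology G] [T2Space G]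
  [MeasurableSpace G] [BorelSpace G] {S : DualitySetting G}
  {n j : ℕ} [ChartedSpace (EuclideanSpace ℝ (Fin n)) G] [LieGroup (𝓡 n) ∞ G]
  [ChartedSpace (EuclideanSpace ℝ (Fin j)) S.X] [IsManifold (𝓡 j) ∞ S.X]

/-- Weighted pullbacks of functions in a Sobolev space are in `L^q`. -/
lemma exists_eLpNorm_weighted_le_sobolev (hsub : Manifold.IsSubmersion (𝓡 n) (𝓡 j) ∞ S.pX)
    {D : Set S.X} (A : ChartSystem j D) {Ω : Set G} (hΩ : IsCompact Ω) {Θ : G → ℝ} {lam : ℝ}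
    (hΘ : IsCutoff D Ω Θ lam) {q : ℝ≥0∞} (hq : 1 ≤ q) (l : ℕ) :
    ∃ C : ℝ≥0, ∀ φ : S.X → ℝ, (∀ x, x ∉ D → φ x = 0) → A.sobolevNorm q l φ < ⊤ →
      AEStronglyMeasurable (S.weighted Θ φ) S.m ∧
        eLpNorm (S.weighted Θ φ) q S.m ≤ C * A.sobolevNorm q l φ := by
  obtain ⟨C, hC⟩ := A.exists_eLpNorm_comp_le (ν := S.m) S.continuous_pX hΩ
    (fun g _ i hg => exists_dominatedOn_submersion (hsub.isSubmersionAt g) (A.chart_mem i) hg) hq l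
  obtain ⟨M, hM⟩ := hΘ.bdd
  have hMn : ∀ g, ‖Θ g‖ ≤ M.toNNReal := fun g => by
    rw [Real.norm_of_nonneg (hΘ.nonneg g)]
    exact (hM g).trans (Real.le_coe_toNNReal M)
  refine ⟨M.toNNReal * C, fun φ hφD hfin => ?_⟩
  obtain ⟨h1, h2⟩ := hC φ hφD hfin
  have hind : S.weighted Θ φ = Ω.indicator (S.weighted Θ φ) := by
    refine (indicator_eq_self.2 fun g hg => hΘ.support g (left_ne_zero_of_mul hg)).symm
  rw [hind, aestronglyMeasurable_indicator_iff hΩ.measurableSet,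
    eLpNorm_indicator_eq_eLpNorm_restrict hΩ.measurableSet]
  refine ⟨hΘ.measurable.aestronglyMeasurable.mul h1, ?_⟩
  refine (eLpNorm_le_nnreal_smul_eLpNorm_of_ae_le_mul (g := fun g => φ (S.pX g)) (c := M.toNNReal)
    (Eventually.of_forall fun g => ?_) q).trans ?_
  · rw [weighted, nnnorm_mul]
    gcongr
    exact hMn g
  · rw [ENNReal.smul_def, smul_eq_mul, ENNReal.coe_mul, mul_assoc]
    gcongr

variable [Bundle.RiemannianBundle (fun x : G => TangentSpace (𝓡 n) x)]
  [IsContMDiffRiemannianBundle (𝓡 n) ∞ (EuclideanSpace ℝ (Fin n))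
    (fun x : G => TangentSpace (𝓡 n) x)]
  [ChartedSpace (EuclideanSpace ℝ (Fin n)) S.Y] [IsManifold (𝓡 n) ∞ S.Y]

theorem exists_dualityBound_sobolev {p q : ℝ≥0∞} (hp : 1 ≤ p) (hpq : p < q) {E : ℝ → ℝ≥0}
    (hE : Tendsto E atTop (𝓝 0)) (hEadm : CoarselyAdmissible S.t₀ E) (hCA1 : S.CA1) (hCA2 : S.CA2)
    (hsub : Manifold.IsSubmersion (𝓡 n) (𝓡 j) ∞ S.pX)
    (hloc : IsLocalDiffeomorph (𝓡 n) (𝓡 n) ∞ (QuotientGroup.mk : G → S.Y)) {d κ : ℝ} {l : ℕ}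
    {CH : (S.H → ℝ) → Prop} {NH : Set S.H → Set ((S.H → ℝ) → ℝ≥0∞)}
    (hHA1 : S.HA1 (riemannianNhds n G) CH NH d κ)
    (hMET : S.MeanErgodic p (sobolevNorms n q l) E) {D : Set S.X} (hD : IsCompact D) :
    ∃ Ω : Set G, IsCompact Ω ∧ ∀ θ, 0 < θ → S.HA2' (dualityExponent p q) θ Ω →
      ∀ δ, 0 < δ → δ ≤ θ / (θ + (2 * d + l)) →
        S.DualityBound p (sobolevNorms j q l) E δ D := by
  have := S.isHaar_m
  have hq : 1 ≤ q := hp.trans hpq.le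
  obtain ⟨Ω₁, hΩ₁, Cξ, hξ⟩ := S.exists_restrict_le_map_pX hD
  obtain ⟨Ω₀, hΩ₀, Θ, hΘs, lam, hΘ⟩ := exists_isCutoff_smooth hsub hD
  set Ω := Ω₀ ∪ Ω₁
  have hΩ : IsCompact Ω := hΩ₀.union hΩ₁
  have hΘ := hΘ Ω subset_union_left
  have hd := covering_exponent_nonneg hHA1.cover
  have hdn : (n : ℝ) ≤ d := le_covering_exponent S.m hHA1.cover
  refine ⟨Ω, hΩ, fun θ hθ hHA2 δ hδ0 hδ => ?_⟩
  obtain ⟨K₀, hK₀, hΩK, C, ε₁, hε₁, hcov⟩ :=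
    hasCovers_of_cover hHA1.basis hHA1.cover (fun ε => subset_rfl) hΩ
  have hcov : HasCovers Ω (insert 1 K₀) (riemannianNhds n G) d := ⟨C, ε₁, hε₁, fun ε hε hεε => by
    obtain ⟨V, hVK, hV⟩ := hcov ε hε hεε
    exact ⟨V, fun v hv => mem_insert_of_mem _ (hVK v hv), hV⟩⟩
  have hK := hK₀.insert 1
  obtain ⟨N, ⟨AY, rfl⟩, hMET⟩ := hMET _ (hΩ.image S.continuous_mk) _ hK
  rintro N ⟨AX, rfl⟩
  obtain ⟨Cw, hCw⟩ := exists_eLpNorm_weighted_le_sobolev hsub AX hΩ hΘ hq l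
  refine dualityBound_of_cells hp hpq hE hEadm hCA1 hCA2
    (fun ε hε hε1 => (hHA1.basis.1 ε hε hε1.le).2) hHA1.perturb hΩ hK hcov ⟨Cξ, hξ.trans ?_⟩ hΘ
    ⟨Cw, fun φ _ hφD hfin => hCw φ hφD hfin⟩
    (hasCells_smooth hsub hloc hΩ (hΩK.trans (subset_insert _ _)) (insert_nonempty _ _) hΘs hΘ hdn
      AX AY hq l) hMET hHA2 hθ (by positivity) hδ0 hδ
  refine Measure.le_iff.2 fun s hs => ?_
  rw [Measure.smul_apply, Measure.smul_apply, Measure.map_apply S.measurable_pX hs,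
    Measure.map_apply S.measurable_pX hs]
  gcongr
  exact subset_union_right

end DualitySetting

end

theorem theorem6p1 {G : Type*} [Group G] [TopologicalSpace G] [IsTopologicalGroup G]
    [LocallyCompactSpace G] [SecondCountableTopology G] [T2Space G]
    [MeasurableSpace G] [BorelSpace G] (S : DualitySetting G)
    (p q : ℝ≥0∞) (hp : 1 ≤ p) (hpq : p < q) (d κ : ℝ)
    (E : ℝ → ℝ≥0) (hE : Tendsto E atTop (𝓝 0)) (hEadm : CoarselyAdmissible S.t₀ E)
    (hCA1 : S.CA1) (hCA2 : S.CA2) :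
    -- the case `l = 0`
    (∀ O : ℝ → Set G,
      S.HA1 O Continuous (lebesgueNorms q S.ρ) d κ →
      S.HS O →
      S.MeanErgodic p (lebesgueNorms q S.μ) E →
        (∀ θ : ℝ, 0 < θ →
          (∀ Ω : Set G, IsCompact Ω → S.HA2' (dualityExponent p q) θ Ω) →
          0 < θ / (θ + 2 * d + κ) ∧
          ∀ D : Set S.X, IsCompact D →
            S.DualityBound p (lebesgueNorms q S.ξ) E (θ / (θ + 2 * d + κ)) D) ∧
        ((∀ Ω : Set G, IsCompact Ω → ∃ θ : ℝ, 0 < θ ∧ S.HA2' (dualityExponent p q) θ Ω) →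
          ∀ D : Set S.X, IsCompact D → ∃ δ : ℝ, 0 < δ ∧
            S.DualityBound p (lebesgueNorms q S.ξ) E δ D)) ∧
    -- the case `l > 0`
    (∀ (l n k j : ℕ), 0 < l →
      -- `G` is a connected Lie group with a Riemannian metric
      ∀ [ChartedSpace (EuclideanSpace ℝ (Fin n)) G] [LieGroup (𝓡 n) ∞ G] [ConnectedSpace G]
        [Bundle.RiemannianBundle (fun x : G => TangentSpace (𝓡 n) x)]
        [IsContMDiffRiemannianBundle (𝓡 n) ∞ (EuclideanSpace ℝ (Fin n))
          (fun x : G => TangentSpace (𝓡 n) x)]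
        -- the smooth structures of the Lie subgroup `H` and of the quotients `X` and `Y`
        [ChartedSpace (EuclideanSpace ℝ (Fin k)) S.H] [LieGroup (𝓡 k) ∞ S.H]
        [ChartedSpace (EuclideanSpace ℝ (Fin j)) S.X] [IsManifold (𝓡 j) ∞ S.X]
        [ChartedSpace (EuclideanSpace ℝ (Fin n)) S.Y] [IsManifold (𝓡 n) ∞ S.Y],
      ContMDiff (𝓡 k) (𝓡 n) ∞ (Subtype.val : S.H → G) →
      Manifold.IsSubmersion (𝓡 n) (𝓡 j) ∞ (toRightCosets S.H) →
      IsLocalDiffeomorph (𝓡 n) (𝓡 n) ∞ (QuotientGroup.mk : G → S.Y) →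
      S.HA1 (riemannianNhds n G) (fun χ => ContMDiff (𝓡 k) 𝓘(ℝ, ℝ) l χ)
        (sobolevNorms k q l) d κ →
      S.HS (riemannianNhds n G) →
      S.MeanErgodic p (sobolevNorms n q l) E →
        (∀ θ : ℝ, 0 < θ →
          (∀ Ω : Set G, IsCompact Ω → S.HA2' (dualityExponent p q) θ Ω) →
          0 < θ / (θ + 2 * d + l + κ) ∧
          ∀ D : Set S.X, IsCompact D →
            S.DualityBound p (sobolevNorms j q l) E (θ / (θ + 2 * d + l + κ)) D) ∧
        ((∀ Ω : Set G, IsCompact Ω → ∃ θ : ℝ, 0 < θ ∧ S.HA2' (dualityExponent p q) θ Ω) →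
          ∀ D : Set S.X, IsCompact D → ∃ δ : ℝ, 0 < δ ∧
            S.DualityBound p (sobolevNorms j q l) E δ D)) := by
  refine ⟨fun O hHA1 _ hMET => ?_, ?_⟩
  · have hκ := hHA1.bump_exponent_nonneg_lebesgue (hp.trans hpq.le)
    have hd := DualitySetting.covering_exponent_nonneg hHA1.cover
    have h := DualitySetting.dualityBound_conclusion (S := S) (b₀ := 2 * d + 0) (b := 2 * d + κ)
      (by linarith) (by linarith) (fun D hD => DualitySetting.exists_dualityBound_lebesgue hp hpq
        hE hEadm hCA1 hCA2 hHA1 hMET hD)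
    simpa only [add_assoc] using h
  · intro l n k j _ _ _ _ _ _ _ _ _ _ _ _ _ hsub hloc hHA1 _ hMET
    have hκ := hHA1.bump_exponent_nonneg_sobolev (hp.trans hpq.le)
    have hd := DualitySetting.covering_exponent_nonneg hHA1.cover
    have h := DualitySetting.dualityBound_conclusion (S := S) (b₀ := 2 * d + l)
      (b := 2 * d + (l + κ)) (by positivity) (by linarith)
      (fun D hD => DualitySetting.exists_dualityBound_sobolev hp hpq hE hEadm hCA1 hCA2 hsub hloc
        hHA1 hMET hD)
    simpa only [add_assoc] using h
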